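/- Let $G\rightrightarrows M$ be a Lie groupoid (smooth finite-dimensional manifolds without boundary) with source $s$, target $t$, multiplication $m_G:G_{(2)}\to G$, $G_{(2)}=\{(g,h):s(g)=t(h)\}$, and let $AG=\ker Ts|_M$. Let $\mathbb{T}G=TG\oplus T^*G\rightrightarrows TM\oplus A^*G$ be the direct sum of the tangent groupoid (whose structure maps are the differentials of those of $G$, with product $X\bullet Y=Tm_G(X,Y)$) and the cotangent groupoid (with $\tilde s(\alpha_g)u=\alpha_g(Tl_g(u-Tt\,u))$, $\tilde t(\alpha_g)v=\alpha_g(Tr_g v)$ and $(\alpha_g\circ\beta_h)(X_g\bullet Y_h)=\alpha_g(X_g)+\beta_h(Y_h)$), and let $m_{\mathbb{T}}$ be its multiplication. Equip $\mathbb{T}G\to G$ with the anchor $\rho(X,\alpha)=X$, the pairing $\langle(X,\alpha),(Y,\beta)\rangle=\alpha(Y)+\beta(X)$ and the Courant bracket $[\![(X,\alpha),(Y,\beta)]\!]=([X,Y],\mathcal{L}_X\beta-i_Yd\alpha)$. Then $\mathbb{T}G$ is a $\mathcal{CA}$-groupoid. More precisely: 1. $\mathbb{T}G\rightrightarrows TM\oplus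 A^*G$ is a well-defined Lie groupoid, whose structure maps are linear on the fibres over the structure maps of $G$ (a $\mathcal{VB}$-groupoid), and $\mathbb{T}G\to G$ is a Courant algebroid. 2. The pairing $\mathbb{T}G\oplus\mathbb{T}G\to\mathbb{R}$ is a morphism of Lie groupoids to the additive group $\mathbb{R}$, i.e. a smooth functor. 3. For composable $a\in\mathbb{T}_gG$, $b\in\mathbb{T}_hG$ one has $(\rho(a),\rho(b))\in T_{(g,h)}G_{(2)}$ and $\rho(m_{\mathbb{T}}(a,b))=Tm_G(\rho(a),\rho(b))$. If $a,b,a_1,a_2,b_1,b_2$ are smooth sections of $\mathbb{T}G$ with $m_{\mathbb{T}}\circ(a_1,a_2)=a\circ m_G$ and $m_{\mathbb{T}}\circ(b_1,b_2)=b\circ m_G$ on $G_{(2)}$ (in particular the pairs on the left are composable), then $([\![a_1,b_1]\!],[\![a_2,b_2]\!])$ is composable and $m_{\mathbb{T}}\circ([\![a_1,b_1]\!],[\![a_2,b_2]\!])=[\![a,b]\!]\circ m_G$ on $G_{(2)}$. 4. Let $\mathbb{E}=\mathbb{T}G\times\overline{\mathbb{T}G\times\mathbb{T}G}$ be the product Courant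 algebroid over $G\times G\times G$, with pairing $\langle\cdot,\cdot\rangle-\langle\cdot,\cdot\rangle-\langle\cdot,\cdot\rangle$. Then $K=\mathrm{graph}(m_{\mathbb{T}})=\{(m_{\mathbb{T}}(a,b),a,b)\}$ is a Dirac structure in $\mathbb{E}$ supported on $Q=\mathrm{graph}(m_G)=\{(gh,g,h)\}$: $Q$ is an embedded submanifold, $K$ is a smooth vector subbundle of $\mathbb{E}|_Q$, $K_q$ is Lagrangian ($K_q=K_q^\perp$) and $\rho(K_q)\subseteq T_qQ$ for all $q\in Q$, and if $c_1,c_2$ are smooth sections of $\mathbb{E}$ whose restrictions to $Q$ take values in $K$, then so does the restriction of $[\![c_1,c_2]\!]$. -/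

import Mathlib

open Set Bundle Filter Topology
set_option linter.unusedSectionVars false

open scoped Manifold ContDiff Bundle

noncomputable section

/-! ### Lie groupoids -/

/-- The structure maps of a groupoid `G ⇉ M`; the multiplication `mul g h = gh` is a total function
whose values matter only when `src g = tgt h`. -/
structure GroupoidData (G M : Type*) where
  src : G → M
  tgt : G → M
  unit : M → G
  inv : G → G
  mul : G → G → G

/-- The set `G_(2) = {(g, h) | s(g) = t(h)}` of composable pairs. -/
def GroupoidData.composable {G M : Type*} (D : GroupoidData G M) : Set (G × G) :=
  {p | D.src p.1 = D.tgt p.2}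

section
variable {E H E' H' : Type*} [NormedAddCommGroup E] [NormedSpace ℝ E] [TopologicalSpace H]
  [NormedAddCommGroup E'] [NormedSpace ℝ E'] [TopologicalSpace H']

/-- Smoothness of a map on a subset `S` of a manifold: local existence of smooth extensions. When `S`
is an embedded submanifold, this is smoothness of the restriction to the manifold `S`. -/
def SmoothOnSubset (I : ModelWithCorners ℝ E H) (I' : ModelWithCorners ℝ E' H')
    {N N' : Type*} [TopologicalSpace N] [ChartedSpace H N] [TopologicalSpace N']
    [ChartedSpace H' N'] (f : N → N') (S : Set N) : Prop :=
  ∀ p ∈ S, ∃ (U : Set N) (f' : N → N'), IsOpen U ∧ p ∈ U ∧ ContMDiffOn I I' ∞ f' U ∧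
    EqOn f' f (S ∩ U)

/-- `G ⇉ M` is a Lie groupoid. -/
structure IsLieGroupoid (I : ModelWithCorners ℝ E H) (I' : ModelWithCorners ℝ E' H')
    {G M : Type*} [TopologicalSpace G] [ChartedSpace H G] [TopologicalSpace M]
    [ChartedSpace H' M] (D : GroupoidData G M) : Prop where
  src_unit : ∀ x, D.src (D.unit x) = x
  tgt_unit : ∀ x, D.tgt (D.unit x) = x
  src_mul : ∀ g h, D.src g = D.tgt h → D.src (D.mul g h) = D.src h
  tgt_mul : ∀ g h, D.src g = D.tgt h → D.tgt (D.mul g h) = D.tgt g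
  mul_assoc : ∀ g h k, D.src g = D.tgt h → D.src h = D.tgt k →
    D.mul (D.mul g h) k = D.mul g (D.mul h k)
  unit_mul : ∀ g, D.mul (D.unit (D.tgt g)) g = g
  mul_unit : ∀ g, D.mul g (D.unit (D.src g)) = g
  src_inv : ∀ g, D.src (D.inv g) = D.tgt g
  tgt_inv : ∀ g, D.tgt (D.inv g) = D.src g
  inv_mul : ∀ g, D.mul (D.inv g) g = D.unit (D.src g)
  mul_inv : ∀ g, D.mul g (D.inv g) = D.unit (D.tgt g)
  smooth_src : ContMDiff I I' ∞ D.src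
  smooth_tgt : ContMDiff I I' ∞ D.tgt
  smooth_unit : ContMDiff I' I ∞ D.unit
  smooth_inv : ContMDiff I I ∞ D.inv
  smooth_mul : SmoothOnSubset (I.prod I) I (fun p : G × G => D.mul p.1 p.2) D.composable
  submersion_src : ∀ g, Function.Surjective (mfderiv I I' D.src g)
  submersion_tgt : ∀ g, Function.Surjective (mfderiv I I' D.tgt g)

/-- A Lie groupoid `G ⇉ M`. -/
structure LieGroupoid (I : ModelWithCorners ℝ E H) (G : Type*) [TopologicalSpace G]
    [ChartedSpace H G] (I' : ModelWithCorners ℝ E' H') (M : Type*) [TopologicalSpace M]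
    [ChartedSpace H' M] extends GroupoidData G M where
  isLieGroupoid : IsLieGroupoid I I' toGroupoidData

end

/-! ### The Lie algebroid of a Lie groupoid as a smooth vector bundle -/

namespace LieGroupoid

variable {E H E' H' : Type*} [NormedAddCommGroup E] [NormedSpace ℝ E]
  [TopologicalSpace H] [NormedAddCommGroup E'] [NormedSpace ℝ E']
  [TopologicalSpace H'] {I : ModelWithCorners ℝ E H} {I' : ModelWithCorners ℝ E' H'}
  {G M : Type*} [TopologicalSpace G] [ChartedSpace H G]
  [TopologicalSpace M] [ChartedSpace H' M]
  (𝒢 : LieGroupoid I G I' M)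

/-- The fibre `A_x G = ker T_{1_x} s` of the Lie algebroid. -/
abbrev Algebroid (x : M) : Type _ :=
  (LinearMap.ker (mfderiv I I' 𝒢.src (𝒢.unit x)).toLinearMap :
    Submodule ℝ (TangentSpace I (𝒢.unit x)))

variable (E E') in
/-- The model fibre of `AG`, of dimension `dim G - dim M`. -/
abbrev AModel : Type := Fin (Module.finrank ℝ E - Module.finrank ℝ E') → ℝ

/-- The derivative at `1_x` of the chart of `G` around `1_{x₀}`. -/
def dchart (x₀ x : M) : TangentSpace I (𝒢.unit x) →L[ℝ] E :=
  mfderiv I 𝓘(ℝ, E) (extChartAt I (𝒢.unit x₀)) (𝒢.unit x)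

/-- The derivative at `1_x` of the source map, read in the charts around `1_{x₀}` and `x₀`. -/
def dsrc (x₀ x : M) : E →L[ℝ] E' :=
  fderiv ℝ (extChartAt I' x₀ ∘ 𝒢.src ∘ (extChartAt I (𝒢.unit x₀)).symm)
    (extChartAt I (𝒢.unit x₀) (𝒢.unit x))

/-- The map `(ds, ϖ) : E → E' × ℝ^k` attached to a chart around `x₀` and `ϖ : E → ℝ^k`. -/
def frameMap (i : M × (E →L[ℝ] AModel E E')) (x : M) : E →L[ℝ] E' × AModel E E' :=
  (𝒢.dsrc i.1 x).prod i.2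

/-- The points of `M` where the charts around `x₀` and `1_{x₀}` are defined. -/
def chartDom (x₀ : M) : Set M :=
  𝒢.unit ⁻¹' (extChartAt I (𝒢.unit x₀)).source ∩ (extChartAt I' x₀).source

/-- The points of `M` where `ϖ` restricts to an isomorphism `ker ds → ℝ^k`. -/
def trivDom (i : M × (E →L[ℝ] AModel E E')) : Set M :=
  {x ∈ 𝒢.chartDom i.1 | (𝒢.frameMap i x).IsInvertible}

variable [IsManifold I ∞ G] [IsManifold I' ∞ M] [I.Boundaryless] [I'.Boundaryless]


lemma dchart_inv {x₀ x : M} (hx : x ∈ 𝒢.chartDom x₀) : (𝒢.dchart x₀ x).IsInvertible :=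
  isInvertible_mfderiv_extChartAt hx.1

lemma isOpen_chartDom (x₀ : M) : IsOpen (𝒢.chartDom x₀) :=
  ((isOpen_extChartAt_source _).preimage 𝒢.isLieGroupoid.smooth_unit.continuous).inter
    (isOpen_extChartAt_source _)

/-- The source map read in the charts around `1_{x₀}` and `x₀`. -/
abbrev srcInChart (x₀ : M) : E → E' :=
  extChartAt I' x₀ ∘ 𝒢.src ∘ (extChartAt I (𝒢.unit x₀)).symm

lemma contDiffAt_srcInChart {x₀ x : M} (hx : x ∈ 𝒢.chartDom x₀) :
    ContDiffAt ℝ ∞ (𝒢.srcInChart x₀) (extChartAt I (𝒢.unit x₀) (𝒢.unit x)) := by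
  have hs := 𝒢.isLieGroupoid.src_unit x
  have hl : (extChartAt I (𝒢.unit x₀)).symm (extChartAt I (𝒢.unit x₀) (𝒢.unit x)) = 𝒢.unit x :=
    (extChartAt I (𝒢.unit x₀)).left_inv hx.1
  have h4 : ContMDiffAt 𝓘(ℝ, E) I ∞ (extChartAt I (𝒢.unit x₀)).symm
      (extChartAt I (𝒢.unit x₀) (𝒢.unit x)) :=
    (contMDiffOn_extChartAt_symm (n := ∞) (𝒢.unit x₀)).contMDiffAt
      ((isOpen_extChartAt_target _).mem_nhds ((extChartAt I (𝒢.unit x₀)).map_source hx.1))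
  have h3 : ContMDiffAt 𝓘(ℝ, E) I' ∞ (𝒢.src ∘ (extChartAt I (𝒢.unit x₀)).symm)
      (extChartAt I (𝒢.unit x₀) (𝒢.unit x)) :=
    (𝒢.isLieGroupoid.smooth_src _).comp _ h4
  have h2 : ContMDiffAt I' 𝓘(ℝ, E') ∞ (extChartAt I' x₀) x :=
    contMDiffAt_extChartAt' (by simpa using hx.2)
  exact (ContMDiffAt.comp_of_eq h2 h3 (by simp only [Function.comp_apply]; rw [hl, hs])).contDiffAt

lemma dsrc_dchart {x₀ x : M} (hx : x ∈ 𝒢.chartDom x₀) (v : TangentSpace I (𝒢.unit x)) :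
    𝒢.dsrc x₀ x (𝒢.dchart x₀ x v) = mfderiv I' 𝓘(ℝ, E') (extChartAt I' x₀) (𝒢.src (𝒢.unit x))
      (mfderiv I I' 𝒢.src (𝒢.unit x) v) := by
  have hs := 𝒢.isLieGroupoid.src_unit x
  have h1 : HasMFDerivAt I 𝓘(ℝ, E) (extChartAt I (𝒢.unit x₀)) (𝒢.unit x) (𝒢.dchart x₀ x) :=
    (mdifferentiableAt_extChartAt (by simpa using hx.1)).hasMFDerivAt
  have h2 : MDifferentiableAt I' 𝓘(ℝ, E') (extChartAt I' x₀) (𝒢.src (𝒢.unit x)) :=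
    mdifferentiableAt_extChartAt (by rw [hs]; simpa using hx.2)
  have h3 : MDifferentiableAt I I' 𝒢.src (𝒢.unit x) :=
    (𝒢.isLieGroupoid.smooth_src _).mdifferentiableAt (by simp)
  have h5 : HasFDerivAt (𝒢.srcInChart x₀) (𝒢.dsrc x₀ x)
      (extChartAt I (𝒢.unit x₀) (𝒢.unit x)) :=
    ((𝒢.contDiffAt_srcInChart hx).differentiableAt (by simp)).hasFDerivAt
  have hA := h2.hasMFDerivAt.comp (𝒢.unit x) h3.hasMFDerivAt
  have hB := h5.hasMFDerivAt.comp (𝒢.unit x) h1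
  have heq : extChartAt I' x₀ ∘ 𝒢.src =ᶠ[𝓝 (𝒢.unit x)]
      𝒢.srcInChart x₀ ∘ extChartAt I (𝒢.unit x₀) := by
    filter_upwards [(isOpen_extChartAt_source (I := I) (𝒢.unit x₀)).mem_nhds hx.1] with y hy
    simp only [Function.comp_apply, (extChartAt I (𝒢.unit x₀)).left_inv hy]
  exact congrArg (fun L => L v) (hasMFDerivAt_unique (hB.congr_of_eventuallyEq heq) hA)

lemma mem_algebroid_iff {x₀ x : M} (hx : x ∈ 𝒢.chartDom x₀) (v : TangentSpace I (𝒢.unit x)) :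
    mfderiv I I' 𝒢.src (𝒢.unit x) v = 0 ↔ 𝒢.dsrc x₀ x (𝒢.dchart x₀ x v) = 0 := by
  have key := 𝒢.dsrc_dchart hx v
  obtain ⟨L, hL⟩ := isInvertible_mfderiv_extChartAt (I := I') (x := x₀)
    (y := 𝒢.src (𝒢.unit x)) (by rw [𝒢.isLieGroupoid.src_unit x]; exact hx.2)
  rw [← hL] at key
  constructor
  · intro h
    exact key.trans ((congrArg L h).trans (map_zero L))
  · intro h
    exact L.map_eq_zero_iff.1 (key.symm.trans h)

/-- Transition of the coordinates of `G` along the units. -/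
lemma contDiffAt_transition {x₀ x₁ x : M} (h₀ : x ∈ 𝒢.chartDom x₀) (h₁ : x ∈ 𝒢.chartDom x₁) :
    ContDiffAt ℝ ∞ (extChartAt I (𝒢.unit x₁) ∘ (extChartAt I (𝒢.unit x₀)).symm)
      (extChartAt I (𝒢.unit x₀) (𝒢.unit x)) := by
  have h4 : ContMDiffAt 𝓘(ℝ, E) I ∞ (extChartAt I (𝒢.unit x₀)).symm
      (extChartAt I (𝒢.unit x₀) (𝒢.unit x)) :=
    (contMDiffOn_extChartAt_symm (n := ∞) (𝒢.unit x₀)).contMDiffAt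
      ((isOpen_extChartAt_target _).mem_nhds ((extChartAt I (𝒢.unit x₀)).map_source h₀.1))
  have h2 : ContMDiffAt I 𝓘(ℝ, E) ∞ (extChartAt I (𝒢.unit x₁)) (𝒢.unit x) :=
    contMDiffAt_extChartAt' (by simpa using h₁.1)
  exact (h2.comp_of_eq h4 ((extChartAt I (𝒢.unit x₀)).left_inv h₀.1)).contDiffAt

/-- The derivative of the transition of charts. -/
def dtrans (x₀ x₁ x : M) : E →L[ℝ] E :=
  fderiv ℝ (extChartAt I (𝒢.unit x₁) ∘ (extChartAt I (𝒢.unit x₀)).symm)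
    (extChartAt I (𝒢.unit x₀) (𝒢.unit x))

lemma dtrans_dchart {x₀ x₁ x : M} (h₀ : x ∈ 𝒢.chartDom x₀) (h₁ : x ∈ 𝒢.chartDom x₁)
    (v : TangentSpace I (𝒢.unit x)) :
    𝒢.dtrans x₀ x₁ x (𝒢.dchart x₀ x v) = 𝒢.dchart x₁ x v := by
  have h1 : HasMFDerivAt I 𝓘(ℝ, E) (extChartAt I (𝒢.unit x₀)) (𝒢.unit x) (𝒢.dchart x₀ x) :=
    (mdifferentiableAt_extChartAt (by simpa using h₀.1)).hasMFDerivAt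
  have h1' : HasMFDerivAt I 𝓘(ℝ, E) (extChartAt I (𝒢.unit x₁)) (𝒢.unit x) (𝒢.dchart x₁ x) :=
    (mdifferentiableAt_extChartAt (by simpa using h₁.1)).hasMFDerivAt
  have h5 : HasFDerivAt (extChartAt I (𝒢.unit x₁) ∘ (extChartAt I (𝒢.unit x₀)).symm)
      (𝒢.dtrans x₀ x₁ x) (extChartAt I (𝒢.unit x₀) (𝒢.unit x)) :=
    ((𝒢.contDiffAt_transition h₀ h₁).differentiableAt (by simp)).hasFDerivAt
  have hB := h5.hasMFDerivAt.comp (𝒢.unit x) h1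
  have heq : extChartAt I (𝒢.unit x₁) =ᶠ[𝓝 (𝒢.unit x)]
      (extChartAt I (𝒢.unit x₁) ∘ (extChartAt I (𝒢.unit x₀)).symm) ∘
        extChartAt I (𝒢.unit x₀) := by
    filter_upwards [(isOpen_extChartAt_source (I := I) (𝒢.unit x₀)).mem_nhds h₀.1] with y hy
    simp only [Function.comp_apply, (extChartAt I (𝒢.unit x₀)).left_inv hy]
  exact congrArg (fun L => L v) (hasMFDerivAt_unique (hB.congr_of_eventuallyEq heq) h1')

lemma contMDiffAt_chart_unit {x₀ x : M} (h₀ : x ∈ 𝒢.chartDom x₀) :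
    ContMDiffAt I' 𝓘(ℝ, E) ∞ (fun y => extChartAt I (𝒢.unit x₀) (𝒢.unit y)) x := by
  have h2 : ContMDiffAt I 𝓘(ℝ, E) ∞ (extChartAt I (𝒢.unit x₀)) (𝒢.unit x) :=
    contMDiffAt_extChartAt' (by simpa using h₀.1)
  exact h2.comp x (𝒢.isLieGroupoid.smooth_unit x)

lemma contMDiffAt_dsrc {x₀ x : M} (hx : x ∈ 𝒢.chartDom x₀) :
    ContMDiffAt I' 𝓘(ℝ, E →L[ℝ] E') ∞ (𝒢.dsrc x₀) x := by
  have : ContDiffAt ℝ ∞ (fderiv ℝ (𝒢.srcInChart x₀))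
      (extChartAt I (𝒢.unit x₀) (𝒢.unit x)) :=
    (𝒢.contDiffAt_srcInChart hx).fderiv_right (by simp)
  exact this.contMDiffAt.comp x (𝒢.contMDiffAt_chart_unit hx)

lemma contMDiffAt_dtrans {x₀ x₁ x : M} (h₀ : x ∈ 𝒢.chartDom x₀) (h₁ : x ∈ 𝒢.chartDom x₁) :
    ContMDiffAt I' 𝓘(ℝ, E →L[ℝ] E) ∞ (𝒢.dtrans x₀ x₁) x := by
  have : ContDiffAt ℝ ∞
      (fderiv ℝ (extChartAt I (𝒢.unit x₁) ∘ (extChartAt I (𝒢.unit x₀)).symm))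
      (extChartAt I (𝒢.unit x₀) (𝒢.unit x)) :=
    (𝒢.contDiffAt_transition h₀ h₁).fderiv_right (by simp)
  exact this.contMDiffAt.comp x (𝒢.contMDiffAt_chart_unit h₀)

lemma contMDiffAt_frameMap {i : M × (E →L[ℝ] AModel E E')} {x : M} (hx : x ∈ 𝒢.chartDom i.1) :
    ContMDiffAt I' 𝓘(ℝ, E →L[ℝ] E' × AModel E E') ∞ (𝒢.frameMap i) x := by
  have h := (ContinuousLinearMap.prodL ℝ (E := E) (F := E') (G := AModel E E') (𝕜 := ℝ))
  have h2 : ContMDiffAt I' 𝓘(ℝ, (E →L[ℝ] E') × (E →L[ℝ] AModel E E')) ∞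
      (fun y => (𝒢.dsrc i.1 y, i.2)) x :=
    (𝒢.contMDiffAt_dsrc hx).prodMk_space contMDiffAt_const
  exact ((ContinuousLinearMap.prodL ℝ (E := E) (F := E') (G := AModel E E')
    (𝕜 := ℝ)).contDiff.contMDiff.contMDiffAt).comp x h2

variable [FiniteDimensional ℝ E] [FiniteDimensional ℝ E']

lemma isOpen_trivDom (i : M × (E →L[ℝ] AModel E E')) : IsOpen (𝒢.trivDom i) := by
  have hc : ContinuousOn (𝒢.frameMap i) (𝒢.chartDom i.1) := fun x hx =>
    (𝒢.contMDiffAt_frameMap hx).continuousAt.continuousWithinAt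
  have : CompleteSpace E := FiniteDimensional.complete ℝ E
  exact hc.isOpen_inter_preimage (𝒢.isOpen_chartDom i.1)
    (ContinuousLinearEquiv.isOpen (𝕜 := ℝ) (E := E) (F := E' × AModel E E'))

lemma exists_prod_isInvertible (L : E →L[ℝ] E') (hL : Function.Surjective L) :
    ∃ ϖ : E →L[ℝ] AModel E E', (L.prod ϖ).IsInvertible := by
  have hrk := LinearMap.finrank_range_add_finrank_ker (L : E →ₗ[ℝ] E')
  rw [LinearMap.range_eq_top.2 hL, finrank_top] at hrk
  obtain ⟨p, hp⟩ := LinearMap.exists_leftInverse_of_injective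
    (LinearMap.ker (L : E →ₗ[ℝ] E')).subtype (Submodule.ker_subtype _)
  let e : LinearMap.ker (L : E →ₗ[ℝ] E') ≃ₗ[ℝ] AModel E E' := LinearEquiv.ofFinrankEq _ _ (by
    rw [Module.finrank_fin_fun]; omega)
  let q : E →ₗ[ℝ] E' × AModel E E' := (L : E →ₗ[ℝ] E').prod (e.toLinearMap ∘ₗ p)
  have hq : Function.Injective q := by
    rw [injective_iff_map_eq_zero]
    intro v hv
    have h1 : L v = 0 := congrArg Prod.fst hv
    have h2 : e (p v) = 0 := congrArg Prod.snd hv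
    have h3 : p v = 0 := e.map_eq_zero_iff.1 h2
    have h4 : p v = ⟨v, h1⟩ := congrArg (fun l => l ⟨v, h1⟩) hp
    exact congrArg Subtype.val (h4.symm.trans h3)
  let Q := (LinearEquiv.ofInjectiveOfFinrankEq q hq (by
    rw [Module.finrank_prod, Module.finrank_fin_fun]; omega)).toContinuousLinearEquiv
  refine ⟨LinearMap.toContinuousLinearMap (e.toLinearMap ∘ₗ p), ⟨Q, ?_⟩⟩
  ext v <;> rfl

lemma exists_complement (x : M) : ∃ ϖ : E →L[ℝ] AModel E E', x ∈ 𝒢.trivDom (x, ϖ) := by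
  have hx : x ∈ 𝒢.chartDom x := ⟨mem_extChartAt_source _, mem_extChartAt_source _⟩
  have hsurj : Function.Surjective (𝒢.dsrc x x) := by
    intro w
    have hi := isInvertible_mfderiv_extChartAt (I := I') (x := x)
      (y := 𝒢.src (𝒢.unit x)) (by rw [𝒢.isLieGroupoid.src_unit x]; exact hx.2)
    obtain ⟨u, hu⟩ := hi.surjective w
    obtain ⟨v, rfl⟩ := 𝒢.isLieGroupoid.submersion_src (𝒢.unit x) u
    exact ⟨_, (𝒢.dsrc_dchart hx v).trans hu⟩
  obtain ⟨ϖ, hϖ⟩ := exists_prod_isInvertible (𝒢.dsrc x x) hsurj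
  exact ⟨ϖ, hx, hϖ⟩

open Classical in
/-- Local trivialization of the algebroid attached to `x₀` and a linear map `E → ℝ^k` which is a
complement of the differential of the source map: `v ↦ ϖ (dφ v)`. -/
def pretriv (i : M × (E →L[ℝ] AModel E E')) :
    Pretrivialization (AModel E E') (TotalSpace.proj (F := AModel E E') (E := 𝒢.Algebroid)) where
  toFun p := (p.1, i.2 (𝒢.dchart i.1 p.1 p.2.1))
  invFun q := ⟨q.1, if h : q.1 ∈ 𝒢.trivDom i then
    ⟨(𝒢.dchart i.1 q.1).inverse ((𝒢.frameMap i q.1).inverse (0, q.2)), by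
      rw [LinearMap.mem_ker]
      refine (𝒢.mem_algebroid_iff h.1 _).2 ?_
      rw [(𝒢.dchart_inv h.1).self_apply_inverse]
      exact congrArg Prod.fst (h.2.self_apply_inverse (0, q.2))⟩ else 0⟩
  source := TotalSpace.proj ⁻¹' 𝒢.trivDom i
  target := 𝒢.trivDom i ×ˢ univ
  baseSet := 𝒢.trivDom i
  open_baseSet := 𝒢.isOpen_trivDom i
  open_target := (𝒢.isOpen_trivDom i).prod isOpen_univ
  source_eq := rfl
  target_eq := rfl
  proj_toFun _ _ := rfl
  map_source' p hp := ⟨hp, mem_univ _⟩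
  map_target' q hq := hq.1
  left_inv' := by
    rintro ⟨x, v⟩ (hx : x ∈ 𝒢.trivDom i)
    simp only [dif_pos hx]
    congr 1
    apply Subtype.ext
    have hv : 𝒢.dsrc i.1 x (𝒢.dchart i.1 x v.1) = 0 := (𝒢.mem_algebroid_iff hx.1 v.1).1 v.2
    have h2 : 𝒢.frameMap i x (𝒢.dchart i.1 x v.1) = (0, i.2 (𝒢.dchart i.1 x v.1)) :=
      Prod.ext hv rfl
    change (𝒢.dchart i.1 x).inverse ((𝒢.frameMap i x).inverse (0, i.2 (𝒢.dchart i.1 x v.1))) = v.1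
    rw [← h2, hx.2.inverse_apply_self, (𝒢.dchart_inv hx.1).inverse_apply_self]
  right_inv' := by
    rintro ⟨x, w⟩ ⟨hx, -⟩
    have hx : x ∈ 𝒢.trivDom i := hx
    simp only [dif_pos hx]
    refine Prod.ext rfl ?_
    change i.2 (𝒢.dchart i.1 x ((𝒢.dchart i.1 x).inverse ((𝒢.frameMap i x).inverse (0, w)))) = w
    rw [(𝒢.dchart_inv hx.1).self_apply_inverse]
    exact congrArg Prod.snd (hx.2.self_apply_inverse (0, w))

/-- Coordinate changes of the algebroid. -/
def coordChange (i j : M × (E →L[ℝ] AModel E E')) (x : M) : AModel E E' →L[ℝ] AModel E E' :=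
  j.2 ∘L 𝒢.dtrans i.1 j.1 x ∘L (𝒢.frameMap i x).inverse ∘L ContinuousLinearMap.inr ℝ E' _

lemma contMDiffOn_coordChange (i j : M × (E →L[ℝ] AModel E E')) :
    ContMDiffOn I' 𝓘(ℝ, AModel E E' →L[ℝ] AModel E E') ∞ (𝒢.coordChange i j)
      (𝒢.trivDom i ∩ 𝒢.trivDom j) := by
  intro x hx
  apply ContMDiffAt.contMDiffWithinAt
  have : CompleteSpace E := FiniteDimensional.complete ℝ E
  have h1 : ContMDiffAt I' 𝓘(ℝ, E' × AModel E E' →L[ℝ] E) ∞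
      (fun y => (𝒢.frameMap i y).inverse) x :=
    (hx.1.2.contDiffAt_map_inverse (n := ∞)).contMDiffAt.comp x (𝒢.contMDiffAt_frameMap hx.1.1)
  exact contMDiffAt_const.clm_comp ((𝒢.contMDiffAt_dtrans hx.1.1 hx.2.1).clm_comp
    (h1.clm_comp contMDiffAt_const))

lemma coordChange_apply (i j : M × (E →L[ℝ] AModel E E')) (x : M)
    (hx : x ∈ 𝒢.trivDom i ∩ 𝒢.trivDom j) (w : AModel E E') :
    𝒢.coordChange i j x w = (𝒢.pretriv j ⟨x, (𝒢.pretriv i).symm x w⟩).2 := by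
  rw [Pretrivialization.mk_symm (𝒢.pretriv i) hx.1]
  have : (𝒢.pretriv i).toPartialEquiv.symm (x, w) = (𝒢.pretriv i).invFun (x, w) := rfl
  rw [this]
  simp only [pretriv, dif_pos hx.1]
  change _ = j.2 (𝒢.dchart j.1 x _)
  rw [← 𝒢.dtrans_dchart hx.1.1 hx.2.1, (𝒢.dchart_inv hx.1.1).self_apply_inverse]
  rfl

/-- The Lie algebroid `AG = ker Ts|_M` as a vector bundle. -/
def prebundle : VectorPrebundle ℝ (AModel E E') 𝒢.Algebroid where
  pretrivializationAtlas := range 𝒢.pretriv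
  pretrivialization_linear' := by
    rintro _ ⟨i, rfl⟩
    refine ⟨fun x _ => ⟨fun v w => ?_, fun c v => ?_⟩⟩
    · change i.2 (𝒢.dchart i.1 x (v.1 + w.1)) = i.2 (𝒢.dchart i.1 x v.1) + i.2 (𝒢.dchart i.1 x w.1)
      simp
    · change i.2 (𝒢.dchart i.1 x (c • v.1)) = c • i.2 (𝒢.dchart i.1 x v.1)
      simp
  pretrivializationAt x := 𝒢.pretriv (x, (𝒢.exists_complement x).choose)
  mem_base_pretrivializationAt x := (𝒢.exists_complement x).choose_spec
  pretrivialization_mem_atlas x := ⟨_, rfl⟩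
  exists_coordChange := by
    rintro _ ⟨i, rfl⟩ _ ⟨j, rfl⟩
    exact ⟨𝒢.coordChange i j, (𝒢.contMDiffOn_coordChange i j).continuousOn,
      fun x hx w => 𝒢.coordChange_apply i j x hx w⟩
  totalSpaceMk_isInducing x := by
    obtain ⟨hx, hi⟩ := (𝒢.exists_complement x).choose_spec
    set ϖ := (𝒢.exists_complement x).choose
    refine IsInducing.of_comp
      (g := fun q : M × AModel E E' =>
        (𝒢.dchart x x).inverse ((𝒢.frameMap (x, ϖ) x).inverse (0, q.2))) ?_ ?_ ?_
    · exact continuous_const.prodMk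
        (ϖ.continuous.comp ((𝒢.dchart x x).continuous.comp continuous_subtype_val))
    · exact (𝒢.dchart x x).inverse.continuous.comp
        ((𝒢.frameMap (x, ϖ) x).inverse.continuous.comp (continuous_const.prodMk continuous_snd))
    · convert IsInducing.subtypeVal using 1
      funext v
      have hv : 𝒢.dsrc x x (𝒢.dchart x x v.1) = 0 := (𝒢.mem_algebroid_iff hx v.1).1 v.2
      have h2 : 𝒢.frameMap (x, ϖ) x (𝒢.dchart x x v.1) = (0, ϖ (𝒢.dchart x x v.1)) :=
        Prod.ext hv rfl
      change (𝒢.dchart x x).inverse ((𝒢.frameMap (x, ϖ) x).inverse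
        (0, ϖ (𝒢.dchart x x v.1))) = v.1
      rw [← h2, hi.inverse_apply_self, (𝒢.dchart_inv hx).inverse_apply_self]

instance : 𝒢.prebundle.IsContMDiff I' ∞ where
  exists_contMDiffCoordChange := by
    rintro _ ⟨i, rfl⟩ _ ⟨j, rfl⟩
    exact ⟨𝒢.coordChange i j, 𝒢.contMDiffOn_coordChange i j,
      fun x hx w => 𝒢.coordChange_apply i j x hx w⟩

instance : TopologicalSpace (TotalSpace (AModel E E') 𝒢.Algebroid) :=
  𝒢.prebundle.totalSpaceTopology
instance : FiberBundle (AModel E E') 𝒢.Algebroid := 𝒢.prebundle.toFiberBundle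
instance : VectorBundle ℝ (AModel E E') 𝒢.Algebroid := 𝒢.prebundle.toVectorBundle
instance : ContMDiffVectorBundle ∞ (AModel E E') 𝒢.Algebroid I' :=
  𝒢.prebundle.contMDiffVectorBundle I'

end LieGroupoid

/-! ### Calculus on manifolds -/

section Calculus

variable {E H : Type*} [NormedAddCommGroup E] [NormedSpace ℝ E] [TopologicalSpace H]
  (I : ModelWithCorners ℝ E H) {N : Type*} [TopologicalSpace N] [ChartedSpace H N]

/-- The fibre `T*_x N` of the cotangent bundle. -/
abbrev Cotangent (x : N) : Type _ := TangentSpace I x →L[ℝ] ℝ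

/-- The bundle `𝕋N = TN ⊕ T*N`. -/
abbrev GenTangent : N → Type _ := (fun x : N => TangentSpace I x) ×ᵇ (fun x : N => Cotangent I x)

/-- The model fibre of `𝕋N`. -/
abbrev GenModel (E : Type*) [NormedAddCommGroup E] [NormedSpace ℝ E] : Type _ := E × (E →L[ℝ] ℝ)

/-- The velocities at `q` of smooth curves lying in `Q`; for an embedded submanifold `Q` and
`q ∈ Q` this is the tangent space `T_q Q`. -/
def tangentTo (Q : Set N) (q : N) : Set (TangentSpace I q) :=
  {v | ∃ γ : ℝ → N, ContMDiffAt 𝓘(ℝ, ℝ) I ∞ γ 0 ∧ (∀ᶠ t in 𝓝 0, γ t ∈ Q) ∧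
    tangentMap 𝓘(ℝ, ℝ) I γ ⟨0, (1 : ℝ)⟩ = (⟨q, v⟩ : TangentBundle I N)}

/-- `Q` is an embedded submanifold: locally the zero set of a submersion to some `ℝ^k`. -/
def IsEmbeddedSubmanifold (Q : Set N) : Prop :=
  ∀ q ∈ Q, ∃ (k : ℕ) (U : Set N) (f : N → (Fin k → ℝ)), IsOpen U ∧ q ∈ U ∧
    ContMDiffOn I 𝓘(ℝ, Fin k → ℝ) ∞ f U ∧
    Function.Surjective (mfderiv I 𝓘(ℝ, Fin k → ℝ) f q) ∧ ∀ p ∈ U, p ∈ Q ↔ f p = 0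

/-- The differential of a function. -/
def dFun (f : N → ℝ) (x : N) : Cotangent I x := mfderiv I 𝓘(ℝ, ℝ) f x

/-- A 1-form read in the preferred chart at `x₀`. -/
def oneFormInChart (α : ∀ x : N, Cotangent I x) (x₀ : N) (y : E) : E →L[ℝ] ℝ :=
  α ((extChartAt I x₀).symm y) ∘L
    (mfderivWithin 𝓘(ℝ, E) I (extChartAt I x₀).symm (range I) y :
      E →L[ℝ] TangentSpace I ((extChartAt I x₀).symm y))

/-- The exterior derivative of a 1-form, `(dα)_x (u, v)`; computed in the preferred chart at `x` as
`(D_u α)(v) - (D_v α)(u)`. -/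
def dOneForm (α : ∀ x : N, Cotangent I x) (x : N) : TangentSpace I x →L[ℝ] Cotangent I x :=
  let Φ : TangentSpace I x →L[ℝ] E := mfderiv I 𝓘(ℝ, E) (extChartAt I x) x
  let D : E →L[ℝ] E →L[ℝ] ℝ := fderivWithin ℝ (oneFormInChart I α x) (range I) (extChartAt I x x)
  ContinuousLinearMap.precomp ℝ Φ ∘L (D - D.flip) ∘L Φ

/-- The Lie derivative `L_X β = i_X dβ + d (β X)` of a 1-form. -/
def lieDerivOneForm (X : ∀ x : N, TangentSpace I x) (β : ∀ x : N, Cotangent I x) (x : N) :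
    Cotangent I x :=
  dOneForm I β x (X x) + dFun I (fun y => β y (X y)) x

/-- The Courant bracket `⟦(X, α), (Y, β)⟧ = ([X, Y], L_X β - i_Y dα)`. -/
def courantBracket (a b : ∀ x : N, GenTangent I x) (x : N) : GenTangent I x :=
  (VectorField.mlieBracket I (fun y => (a y).1) (fun y => (b y).1) x,
    lieDerivOneForm I (fun y => (a y).1) (fun y => (b y).2) x
      - dOneForm I (fun y => (a y).2) x (b x).1)

/-- The canonical pairing `⟨(X, α), (Y, β)⟩ = α Y + β X` on `𝕋N`. -/
def canonicalPairing (x : N) : GenTangent I x →ₗ[ℝ] GenTangent I x →ₗ[ℝ] ℝ :=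
  LinearMap.mk₂ ℝ (fun a b => a.2 b.1 + b.2 a.1)
    (by intros; simp; ring) (by intros; simp; ring) (by intros; simp; ring) (by intros; simp; ring)

/-- A section of `𝕋N` is smooth on `U`. -/
def IsSmoothGenSection [IsManifold I 1 N] (a : ∀ x : N, GenTangent I x) (U : Set N) : Prop :=
  ContMDiffOn I (I.prod 𝓘(ℝ, GenModel E)) ∞
    (fun x => (⟨x, a x⟩ : TotalSpace (GenModel E) (GenTangent I : N → Type _))) U

end Calculus

/-! ### Courant algebroids and Dirac structures with support -/

section Courant

variable {E H : Type*} [NormedAddCommGroup E] [NormedSpace ℝ E] [TopologicalSpace H]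
  (I : ModelWithCorners ℝ E H) {N : Type*} [TopologicalSpace N] [ChartedSpace H N]

/-- The data of a Courant algebroid on a family of vector spaces `V` over `N`: the (local) smooth
sections, pairing, anchor and bracket. -/
structure CourantData (V : N → Type*) [∀ x, AddCommGroup (V x)] [∀ x, Module ℝ (V x)] where
  IsSmoothOn : (∀ x, V x) → Set N → Prop
  pairing : ∀ x, V x →ₗ[ℝ] V x →ₗ[ℝ] ℝ
  anchor : ∀ x, V x →ₗ[ℝ] TangentSpace I x
  bracket : (∀ x, V x) → (∀ x, V x) → ∀ x, V x

variable {I} {V : N → Type*} [∀ x, AddCommGroup (V x)] [∀ x, Module ℝ (V x)]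

namespace CourantData

variable (C : CourantData I V)

/-- Global smooth sections. -/
def IsSmooth (a : ∀ x, V x) : Prop := C.IsSmoothOn a univ

/-- The function `⟨a, b⟩`. -/
def pair (a b : ∀ x, V x) (x : N) : ℝ := C.pairing x (a x) (b x)

/-- The axioms of a Courant algebroid (with the non-skew-symmetric bracket). -/
structure IsCourantAlgebroid [IsManifold I 1 N] : Prop where
  pairing_symm : ∀ x (v w : V x), C.pairing x v w = C.pairing x w v
  pairing_nondegenerate : ∀ x (v : V x), (∀ w, C.pairing x v w = 0) → v = 0
  smooth_pairing : ∀ a b, C.IsSmooth a → C.IsSmooth b → ContMDiff I 𝓘(ℝ, ℝ) ∞ (C.pair a b)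
  smooth_anchor : ∀ a, C.IsSmooth a → ContMDiff I (I.prod 𝓘(ℝ, E)) ∞
    (fun x => (⟨x, C.anchor x (a x)⟩ : TangentBundle I N))
  smooth_bracket : ∀ a b, C.IsSmooth a → C.IsSmooth b → C.IsSmooth (C.bracket a b)
  bracket_add_left : ∀ a b c, C.IsSmooth a → C.IsSmooth b → C.IsSmooth c →
    C.bracket (a + b) c = C.bracket a c + C.bracket b c
  bracket_smul_left : ∀ (r : ℝ) a b, C.IsSmooth a → C.IsSmooth b →
    C.bracket (r • a) b = r • C.bracket a b
  bracket_add_right : ∀ a b c, C.IsSmooth a → C.IsSmooth b → C.IsSmooth c →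
    C.bracket a (b + c) = C.bracket a b + C.bracket a c
  leibniz : ∀ (f : N → ℝ) a b, ContMDiff I 𝓘(ℝ, ℝ) ∞ f → C.IsSmooth a → C.IsSmooth b → ∀ x,
    C.bracket a (fun y => f y • b y) x =
      f x • C.bracket a b x + dFun I f x (C.anchor x (a x)) • b x
  jacobi : ∀ a b c, C.IsSmooth a → C.IsSmooth b → C.IsSmooth c →
    C.bracket a (C.bracket b c) = C.bracket (C.bracket a b) c + C.bracket b (C.bracket a c)
  anchor_bracket : ∀ a b, C.IsSmooth a → C.IsSmooth b → ∀ x, C.anchor x (C.bracket a b x) =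
    VectorField.mlieBracket I (fun y => C.anchor y (a y)) (fun y => C.anchor y (b y)) x
  invariance : ∀ a b c, C.IsSmooth a → C.IsSmooth b → C.IsSmooth c → ∀ x,
    dFun I (C.pair b c) x (C.anchor x (a x)) =
      C.pair (C.bracket a b) c x + C.pair b (C.bracket a c) x
  symmetric_part : ∀ a b, C.IsSmooth a → C.IsSmooth b → ∀ x (v : V x),
    C.pairing x (C.bracket a b x + C.bracket b a x) v = dFun I (C.pair a b) x (C.anchor x v)

/-- `K ⊆ V|_Q` is a Dirac structure supported on the embedded submanifold `Q`. -/
structure IsDiracStructureOn (Q : Set N) (K : ∀ x, Set (V x)) : Prop where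
  support : IsEmbeddedSubmanifold I Q
  /-- `K` is a smooth vector subbundle of `V|_Q`: locally spanned by a smooth frame. -/
  subbundle : ∀ q ∈ Q, ∃ (U : Set N) (r : ℕ) (e : Fin r → ∀ x, V x), IsOpen U ∧ q ∈ U ∧
    (∀ i, C.IsSmoothOn (e i) U) ∧ ∀ p ∈ U ∩ Q, LinearIndependent ℝ (fun i => e i p) ∧
      K p = (Submodule.span ℝ (range fun i => e i p) : Set (V p))
  lagrangian : ∀ q ∈ Q, ∀ v : V q, v ∈ K q ↔ ∀ w ∈ K q, C.pairing q v w = 0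
  anchor_mem : ∀ q ∈ Q, ∀ v ∈ K q, C.anchor q v ∈ tangentTo I Q q
  bracket_mem : ∀ a b, C.IsSmooth a → C.IsSmooth b → (∀ q ∈ Q, a q ∈ K q) →
    (∀ q ∈ Q, b q ∈ K q) → ∀ q ∈ Q, C.bracket a b q ∈ K q

end CourantData

variable (I) (N)

/-- The canonical Courant algebroid `𝕋N`. -/
def standardCourant [IsManifold I 1 N] : CourantData I (GenTangent I : N → Type _) where
  IsSmoothOn := IsSmoothGenSection I
  pairing := canonicalPairing I
  anchor _ := LinearMap.fst ℝ _ _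
  bracket := courantBracket I

variable {N}

/-- The fibre at `p = (p₀, p₁, p₂)` of the vector bundle `𝕋N × (𝕋N × 𝕋N)` over `N × (N × N)`. -/
abbrev TripleGen (p : N × (N × N)) : Type _ :=
  GenTangent I p.1 × (GenTangent I p.2.1 × GenTangent I p.2.2)

/-- The identification of `𝕋N × (𝕋N × 𝕋N)` with `𝕋(N × N × N)`, with a sign on the covectors of the
last two factors:
`((X₀, α₀), (X₁, α₁), (X₂, α₂)) ↦ ((X₀, X₁, X₂), pr₀^*α₀ - pr₁^*α₁ - pr₂^*α₂)`. -/
def tripleEquiv (p : N × (N × N)) :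
    TripleGen I p ≃ₗ[ℝ] GenTangent (I.prod (I.prod I)) p where
  toFun v := ((v.1.1, (v.2.1.1, v.2.2.1)),
    (v.1.2.comp (ContinuousLinearMap.fst ℝ E (E × E))
      - v.2.1.2.comp ((ContinuousLinearMap.fst ℝ E E).comp (ContinuousLinearMap.snd ℝ E (E × E)))
      - v.2.2.2.comp ((ContinuousLinearMap.snd ℝ E E).comp (ContinuousLinearMap.snd ℝ E (E × E))) :
      E × (E × E) →L[ℝ] ℝ))
  invFun w :=
    let X : E × (E × E) := w.1
    let θ : E × (E × E) →L[ℝ] ℝ := w.2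
    ((X.1, θ.comp (ContinuousLinearMap.inl ℝ E (E × E))),
      (X.2.1, -θ.comp ((ContinuousLinearMap.inr ℝ E (E × E)).comp (ContinuousLinearMap.inl ℝ E E))),
      (X.2.2, -θ.comp ((ContinuousLinearMap.inr ℝ E (E × E)).comp (ContinuousLinearMap.inr ℝ E E))))
  map_add' v w := by
    refine Prod.ext rfl ?_
    ext1 u
    change (v.1.2 + w.1.2) _ - (v.2.1.2 + w.2.1.2) _ - (v.2.2.2 + w.2.2.2) _ =
      (v.1.2 _ - v.2.1.2 _ - v.2.2.2 _) + (w.1.2 _ - w.2.1.2 _ - w.2.2.2 _)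
    simp only [add_apply]
    abel
  map_smul' r v := by
    refine Prod.ext rfl ?_
    ext1 u
    change (r • v.1.2) _ - (r • v.2.1.2) _ - (r • v.2.2.2) _ =
      r • (v.1.2 _ - v.2.1.2 _ - v.2.2.2 _)
    simp only [smul_apply, smul_sub]
  left_inv v := by
    obtain ⟨⟨X, α⟩, ⟨Y, β⟩, ⟨Z, γ⟩⟩ := v
    refine Prod.ext (Prod.ext rfl ?_) (Prod.ext (Prod.ext rfl ?_) (Prod.ext rfl ?_)) <;> ext u
    · change α u - β (0 : TangentSpace I p.2.1) - γ (0 : TangentSpace I p.2.2) = α u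
      rw [β.map_zero, γ.map_zero, sub_zero, sub_zero]
    · change -(α (0 : TangentSpace I p.1) - β u - γ (0 : TangentSpace I p.2.2)) = β u
      rw [α.map_zero, γ.map_zero]; ring
    · change -(α (0 : TangentSpace I p.1) - β (0 : TangentSpace I p.2.1) - γ u) = γ u
      rw [α.map_zero, β.map_zero]; ring
  right_inv w := by
    refine Prod.ext rfl ?_
    ext1 u
    let θ : E × (E × E) →L[ℝ] ℝ := w.2
    change θ (u.1, (0, 0)) - -θ (0, (u.2.1, 0)) - -θ (0, (0, u.2.2)) = θ u
    rw [sub_neg_eq_add, sub_neg_eq_add, ← map_add, ← map_add]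
    congr 1
    refine Prod.ext ?_ (Prod.ext ?_ ?_)
    · change u.1 + 0 + 0 = u.1; abel
    · change 0 + u.2.1 + 0 = u.2.1; abel
    · change 0 + 0 + u.2.2 = u.2.2; abel

variable (N)

/-- The Courant algebroid `𝕋N × \overline{𝕋N × 𝕋N}` over `N × (N × N)`: the pairing is
`⟨·,·⟩ - ⟨·,·⟩ - ⟨·,·⟩`, the anchor is componentwise, and the bracket is the one of
`𝕋(N × N × N)` under the identification `tripleEquiv`, which is an isometry compatible with the
anchors; on sections that are pulled back from the factors it is the componentwise bracket. -/
def tripleCourant [IsManifold I 1 N] :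
    CourantData (I.prod (I.prod I)) (fun p : N × (N × N) => TripleGen I p) where
  IsSmoothOn a U :=
    ContMDiffOn (I.prod (I.prod I)) (I.prod 𝓘(ℝ, GenModel E)) ∞
      (fun p => (⟨p.1, (a p).1⟩ : TotalSpace (GenModel E) (GenTangent I : N → Type _))) U ∧
    ContMDiffOn (I.prod (I.prod I)) (I.prod 𝓘(ℝ, GenModel E)) ∞
      (fun p => (⟨p.2.1, (a p).2.1⟩ : TotalSpace (GenModel E) (GenTangent I : N → Type _))) U ∧
    ContMDiffOn (I.prod (I.prod I)) (I.prod 𝓘(ℝ, GenModel E)) ∞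
      (fun p => (⟨p.2.2, (a p).2.2⟩ : TotalSpace (GenModel E) (GenTangent I : N → Type _))) U
  pairing p := LinearMap.mk₂ ℝ
    (fun v w => canonicalPairing I p.1 v.1 w.1 - canonicalPairing I p.2.1 v.2.1 w.2.1
      - canonicalPairing I p.2.2 v.2.2 w.2.2)
    (by intros; simp only [Prod.fst_add, Prod.snd_add, map_add, LinearMap.add_apply]; ring)
    (by intros; simp only [Prod.smul_fst, Prod.smul_snd, map_smul, LinearMap.smul_apply,
          smul_eq_mul]; ring)
    (by intros; simp only [Prod.fst_add, Prod.snd_add, map_add]; ring)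
    (by intros; simp only [Prod.smul_fst, Prod.smul_snd, map_smul, smul_eq_mul]; ring)
  anchor p := LinearMap.fst ℝ _ _ ∘ₗ (tripleEquiv I p).toLinearMap
  bracket a b p := (tripleEquiv I p).symm
    (courantBracket (I.prod (I.prod I)) (fun q => tripleEquiv I q (a q))
      (fun q => tripleEquiv I q (b q)) p)

end Courant

/-! ### Morphisms of groupoids -/

section Morphisms

variable {E H E' H' : Type*} [NormedAddCommGroup E] [NormedSpace ℝ E] [TopologicalSpace H]
  [NormedAddCommGroup E'] [NormedSpace ℝ E'] [TopologicalSpace H']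
  {F K F' K' : Type*} [NormedAddCommGroup F] [NormedSpace ℝ F] [TopologicalSpace K]
  [NormedAddCommGroup F'] [NormedSpace ℝ F'] [TopologicalSpace K']

/-- Morphisms of Lie groupoids: smooth functors. -/
structure IsLieGroupoidHom (I : ModelWithCorners ℝ E H) (I' : ModelWithCorners ℝ E' H')
    (J : ModelWithCorners ℝ F K) (J' : ModelWithCorners ℝ F' K')
    {G M G₁ M₁ : Type*} [TopologicalSpace G] [ChartedSpace H G] [TopologicalSpace M]
    [ChartedSpace H' M] [TopologicalSpace G₁] [ChartedSpace K G₁] [TopologicalSpace M₁]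
    [ChartedSpace K' M₁] (D : GroupoidData G M) (D₁ : GroupoidData G₁ M₁)
    (Ψ : G → G₁) (ψ : M → M₁) : Prop where
  smooth : ContMDiff I J ∞ Ψ
  smooth_base : ContMDiff I' J' ∞ ψ
  map_src : ∀ g, D₁.src (Ψ g) = ψ (D.src g)
  map_tgt : ∀ g, D₁.tgt (Ψ g) = ψ (D.tgt g)
  map_unit : ∀ x, Ψ (D.unit x) = D₁.unit (ψ x)
  map_mul : ∀ g h, D.src g = D.tgt h → Ψ (D.mul g h) = D₁.mul (Ψ g) (Ψ h)

/-- The additive group `ℝ` as a groupoid over a point. -/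
def realGroupoid : GroupoidData ℝ PUnit.{1} where
  src _ := PUnit.unit
  tgt _ := PUnit.unit
  unit _ := 0
  inv a := -a
  mul a b := a + b

end Morphisms

/-! ### The groupoids `TG`, `T*G` and `𝕋G` -/

namespace LieGroupoid

variable {E H E' H' : Type*} [NormedAddCommGroup E] [NormedSpace ℝ E]
  [TopologicalSpace H] [NormedAddCommGroup E'] [NormedSpace ℝ E']
  [TopologicalSpace H'] {I : ModelWithCorners ℝ E H} {I' : ModelWithCorners ℝ E' H'}
  {G M : Type*} [TopologicalSpace G] [ChartedSpace H G]
  [TopologicalSpace M] [ChartedSpace H' M]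
  (𝒢 : LieGroupoid I G I' M)

/-- The fibre `A*_x G` of the dual of the Lie algebroid. -/
abbrev DualAlgebroid (x : M) : Type _ := 𝒢.Algebroid x →L[ℝ] ℝ

/-- The derivative `Tm` of the multiplication at `(g, h)`, as a linear map on `T_g G × T_h G`; it is
meaningful on `T_{(g,h)} G_(2) = {(X, Y) | Ts X = Tt Y}` for `(g, h) ∈ G_(2)`. -/
def dMul (g h : G) : E × E →L[ℝ] TangentSpace I (𝒢.mul g h) :=
  mfderivWithin (I.prod I) I (fun p : G × G => 𝒢.mul p.1 p.2) 𝒢.composable (g, h)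

/-- The multiplication `X • Y = Tm (X, Y)` of the tangent groupoid. -/
def tMul (g h : G) (X : TangentSpace I g) (Y : TangentSpace I h) : TangentSpace I (𝒢.mul g h) :=
  𝒢.dMul g h (X, Y)

/-- The tangent groupoid `TG ⇉ TM`. -/
def tangentGroupoid : GroupoidData (TangentBundle I G) (TangentBundle I' M) where
  src := tangentMap I I' 𝒢.src
  tgt := tangentMap I I' 𝒢.tgt
  unit := tangentMap I' I 𝒢.unit
  inv := tangentMap I I 𝒢.inv
  mul X Y := ⟨𝒢.mul X.1 Y.1, 𝒢.tMul X.1 Y.1 X.2 Y.2⟩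

/-- `T(1 ∘ t)` at the point `1_x = 1_{t(1_x)}`. -/
def unitTgt (x : M) : TangentSpace I (𝒢.unit x) →L[ℝ] TangentSpace I (𝒢.unit x) :=
  (mfderiv I I (fun g => 𝒢.unit (𝒢.tgt g)) (𝒢.unit x) : E →L[ℝ] E)

/-- `T(1 ∘ s)` at the point `1_x = 1_{s(1_x)}`. -/
def unitSrc (x : M) : TangentSpace I (𝒢.unit x) →L[ℝ] TangentSpace I (𝒢.unit x) :=
  (mfderiv I I (fun g => 𝒢.unit (𝒢.src g)) (𝒢.unit x) : E →L[ℝ] E)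

/-- Left translation `w ↦ Tl_g w = Tm (0_g, w) ∈ T_g G`, for `w ∈ T_{1_{s(g)}} G` with
`Tt w = 0`. -/
def leftTranslation (g : G) : TangentSpace I (𝒢.unit (𝒢.src g)) →L[ℝ] TangentSpace I g :=
  (𝒢.dMul g (𝒢.unit (𝒢.src g)) : E × E →L[ℝ] E) ∘L ContinuousLinearMap.inr ℝ E E

/-- Right translation `v ↦ Tr_g v = Tm (v, 0_g) ∈ T_g G`, for `v ∈ T_{1_{t(g)}} G` with
`Ts v = 0`. -/
def rightTranslation (g : G) : TangentSpace I (𝒢.unit (𝒢.tgt g)) →L[ℝ] TangentSpace I g :=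
  (𝒢.dMul (𝒢.unit (𝒢.tgt g)) g : E × E →L[ℝ] E) ∘L ContinuousLinearMap.inl ℝ E E

/-- The source `(s̃ α) u = α (Tl_g (u - Tt u))` of the cotangent groupoid. -/
def cSrc (g : G) : Cotangent I g →ₗ[ℝ] 𝒢.DualAlgebroid (𝒢.src g) :=
  (ContinuousLinearMap.precomp ℝ (𝒢.leftTranslation g ∘L
    (ContinuousLinearMap.id ℝ _ - 𝒢.unitTgt (𝒢.src g)) ∘L Submodule.subtypeL _)).toLinearMap

/-- The target `(t̃ α) v = α (Tr_g v)` of the cotangent groupoid. -/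
def cTgt (g : G) : Cotangent I g →ₗ[ℝ] 𝒢.DualAlgebroid (𝒢.tgt g) :=
  (ContinuousLinearMap.precomp ℝ (𝒢.rightTranslation g ∘L Submodule.subtypeL _)).toLinearMap

/-- The projection `v ↦ v - T1 (Ts v)` of `T_{1_x} G` onto `A_x G` along `T_x M`. -/
def algebroidProj (x : M) : TangentSpace I (𝒢.unit x) →L[ℝ] 𝒢.Algebroid x :=
  (ContinuousLinearMap.id ℝ _ - 𝒢.unitSrc x).codRestrict _ (by
    intro v
    have hs := 𝒢.isLieGroupoid.src_unit x
    have h1 : MDifferentiableAt I I (fun g => 𝒢.unit (𝒢.src g)) (𝒢.unit x) :=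
      ((𝒢.isLieGroupoid.smooth_unit.comp 𝒢.isLieGroupoid.smooth_src) _).mdifferentiableAt (by simp)
    have h2 : ∀ g, MDifferentiableAt I I' 𝒢.src g := fun g =>
      (𝒢.isLieGroupoid.smooth_src g).mdifferentiableAt (by simp)
    have h3 := (h2 (𝒢.unit (𝒢.src (𝒢.unit x)))).hasMFDerivAt.comp (𝒢.unit x) h1.hasMFDerivAt
    have h4 : 𝒢.src ∘ (fun g => 𝒢.unit (𝒢.src g)) = 𝒢.src :=
      funext fun g => 𝒢.isLieGroupoid.src_unit _
    rw [h4] at h3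
    have h5 := congrArg (fun L : E →L[ℝ] E' => L v) (hasMFDerivAt_unique (h2 _).hasMFDerivAt h3)
    have h6 : ∀ g, g = 𝒢.unit x → (mfderiv I I' 𝒢.src g : E →L[ℝ] E') =
      (mfderiv I I' 𝒢.src (𝒢.unit x) : E →L[ℝ] E') := by rintro _ rfl; rfl
    have h7 : (mfderiv I I' 𝒢.src (𝒢.unit x) : E →L[ℝ] E') v =
        (mfderiv I I' 𝒢.src (𝒢.unit (𝒢.src (𝒢.unit x))) : E →L[ℝ] E') (𝒢.unitSrc x v) := h5
    rw [h6 (𝒢.unit (𝒢.src (𝒢.unit x))) (congrArg 𝒢.unit hs)] at h7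
    rw [LinearMap.mem_ker]
    exact ((mfderiv I I' 𝒢.src (𝒢.unit x)).map_sub v (𝒢.unitSrc x v)).trans
      (sub_eq_zero.2 h7))

/-- The unit of the cotangent groupoid at `ξ ∈ A*_x G`: the covector on `T_{1_x} G` that extends `ξ`
and vanishes on `T_x M`. -/
def cUnit (x : M) : 𝒢.DualAlgebroid x →ₗ[ℝ] Cotangent I (𝒢.unit x) :=
  (ContinuousLinearMap.precomp ℝ (𝒢.algebroidProj x)).toLinearMap

/-- The inverse of the cotangent groupoid: `α⁻¹ (X⁻¹) = - α X`. -/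
def cInv (g : G) : Cotangent I g →ₗ[ℝ] Cotangent I (𝒢.inv g) :=
  -(ContinuousLinearMap.precomp ℝ (mfderiv I I 𝒢.inv g).inverse).toLinearMap

/-- `γ` is the product of `α ∈ T*_g G` and `β ∈ T*_h G`: `γ (X • Y) = α X + β Y` for all composable
`(X, Y)`. -/
def IsCotangentProduct (g h : G) (α : Cotangent I g) (β : Cotangent I h)
    (γ : Cotangent I (𝒢.mul g h)) : Prop :=
  ∀ (X : TangentSpace I g) (Y : TangentSpace I h),
    𝒢.tangentGroupoid.src ⟨g, X⟩ = 𝒢.tangentGroupoid.tgt ⟨h, Y⟩ →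
      γ (𝒢.tMul g h X Y) = α X + β Y

open Classical in
/-- The multiplication `α ∘ β` of the cotangent groupoid (with value `0` where it is undefined). -/
def cMul (g h : G) (α : Cotangent I g) (β : Cotangent I h) : Cotangent I (𝒢.mul g h) :=
  if hγ : ∃ γ, 𝒢.IsCotangentProduct g h α β γ then hγ.choose else 0

/-- The bundle `TM ⊕ A*G` over `M`. -/
abbrev GenBase : M → Type _ := (fun x : M => TangentSpace I' x) ×ᵇ (fun x : M => 𝒢.DualAlgebroid x)

variable (E E') in
/-- The model fibre of `TM ⊕ A*G`. -/
abbrev BaseModel : Type _ := E' × (AModel E E' →L[ℝ] ℝ)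

/-- The source `(X, α) ↦ (Ts X, s̃ α)` of `𝕋G = TG ⊕ T*G ⇉ TM ⊕ A*G` on the fibres. -/
def genSrc (g : G) : GenTangent I g →ₗ[ℝ] 𝒢.GenBase (𝒢.src g) :=
  (mfderiv I I' 𝒢.src g).toLinearMap.prodMap (𝒢.cSrc g)

/-- The target of `𝕋G` on the fibres. -/
def genTgt (g : G) : GenTangent I g →ₗ[ℝ] 𝒢.GenBase (𝒢.tgt g) :=
  (mfderiv I I' 𝒢.tgt g).toLinearMap.prodMap (𝒢.cTgt g)

/-- The unit of `𝕋G` on the fibres. -/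
def genUnit (x : M) : 𝒢.GenBase x →ₗ[ℝ] GenTangent I (𝒢.unit x) :=
  (mfderiv I' I 𝒢.unit x).toLinearMap.prodMap (𝒢.cUnit x)

/-- The inverse of `𝕋G` on the fibres. -/
def genInv (g : G) : GenTangent I g →ₗ[ℝ] GenTangent I (𝒢.inv g) :=
  (mfderiv I I 𝒢.inv g).toLinearMap.prodMap (𝒢.cInv g)

/-- The multiplication `m_𝕋` of `𝕋G` on the fibres. -/
def genMul (g h : G) (a : GenTangent I g) (b : GenTangent I h) : GenTangent I (𝒢.mul g h) :=
  (𝒢.tMul g h a.1 b.1, 𝒢.cMul g h a.2 b.2)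

/-- The total space of `𝕋G`. -/
abbrev GenTotal (_ : LieGroupoid I G I' M) : Type _ :=
  TotalSpace (GenModel E) (GenTangent I : G → Type _)

/-- The total space of `TM ⊕ A*G`. -/
abbrev GenBaseTotal : Type _ := TotalSpace (BaseModel E E') 𝒢.GenBase

/-- The groupoid `𝕋G ⇉ TM ⊕ A*G`. -/
def genGroupoid : GroupoidData 𝒢.GenTotal 𝒢.GenBaseTotal where
  src v := ⟨𝒢.src v.1, 𝒢.genSrc v.1 v.2⟩
  tgt v := ⟨𝒢.tgt v.1, 𝒢.genTgt v.1 v.2⟩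
  unit ξ := ⟨𝒢.unit ξ.1, 𝒢.genUnit ξ.1 ξ.2⟩
  inv v := ⟨𝒢.inv v.1, 𝒢.genInv v.1 v.2⟩
  mul v w := ⟨𝒢.mul v.1 w.1, 𝒢.genMul v.1 w.1 v.2 w.2⟩

/-- `a ∈ 𝕋_g G` and `b ∈ 𝕋_h G` are composable in `𝕋G`. -/
def GenComposable (g h : G) (a : GenTangent I g) (b : GenTangent I h) : Prop :=
  𝒢.genGroupoid.src ⟨g, a⟩ = 𝒢.genGroupoid.tgt ⟨h, b⟩

/-- The total space of `𝕋G ⊕ 𝕋G`. -/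
abbrev GenSumTotal (_ : LieGroupoid I G I' M) : Type _ :=
  TotalSpace (GenModel E × GenModel E)
    ((GenTangent I : G → Type _) ×ᵇ (GenTangent I : G → Type _))

/-- The total space of `(TM ⊕ A*G) ⊕ (TM ⊕ A*G)`. -/
abbrev GenBaseSumTotal : Type _ :=
  TotalSpace (BaseModel E E' × BaseModel E E') (𝒢.GenBase ×ᵇ 𝒢.GenBase)

/-- The groupoid `𝕋G ⊕ 𝕋G`, with componentwise structure. -/
def genSumGroupoid : GroupoidData 𝒢.GenSumTotal 𝒢.GenBaseSumTotal where
  src v := ⟨𝒢.src v.1, (𝒢.genSrc v.1 v.2.1, 𝒢.genSrc v.1 v.2.2)⟩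
  tgt v := ⟨𝒢.tgt v.1, (𝒢.genTgt v.1 v.2.1, 𝒢.genTgt v.1 v.2.2)⟩
  unit ξ := ⟨𝒢.unit ξ.1, (𝒢.genUnit ξ.1 ξ.2.1, 𝒢.genUnit ξ.1 ξ.2.2)⟩
  inv v := ⟨𝒢.inv v.1, (𝒢.genInv v.1 v.2.1, 𝒢.genInv v.1 v.2.2)⟩
  mul v w := ⟨𝒢.mul v.1 w.1,
    (𝒢.genMul v.1 w.1 v.2.1 w.2.1, 𝒢.genMul v.1 w.1 v.2.2 w.2.2)⟩

/-- The canonical pairing as a function on `𝕋G ⊕ 𝕋G`. -/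
def genPairing (v : 𝒢.GenSumTotal) : ℝ := canonicalPairing I v.1 v.2.1 v.2.2

/-- `graph(m_G) = {(gh, g, h)} ⊆ G × (G × G)`. -/
def graphMul : Set (G × (G × G)) :=
  {p | 𝒢.src p.2.1 = 𝒢.tgt p.2.2 ∧ p.1 = 𝒢.mul p.2.1 p.2.2}

/-- The fibres of `graph(m_𝕋) = {(v * w, v, w)} ⊆ 𝕋G × (𝕋G × 𝕋G)`. -/
def graphGenMul (p : G × (G × G)) : Set (TripleGen I p) :=
  {c | 𝒢.GenComposable p.2.1 p.2.2 c.2.1 c.2.2 ∧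
    (⟨p.1, c.1⟩ : 𝒢.GenTotal) = 𝒢.genGroupoid.mul ⟨p.2.1, c.2.1⟩ ⟨p.2.2, c.2.2⟩}

end LieGroupoid

end

/-! The tangent functor turns `G` into the groupoid `TG`: vectors are represented by curves,
composable vectors by composable curves (`exists_curve_composable`, which corrects a curve by local
sections of the target map), and each law of `TG` is the velocity of the corresponding law of `G`.

The cotangent product is dual to this. The map `(X, Y) ↦ X • Y` from composable pairs to `T_{gh} G`
is onto (`exists_tMul_eq`), and its kernel consists of the pairs `(Tl_g (u - Tt u), -Tr_h u)` with
`u` in the algebroid (`translation_mul_translation`, `exists_of_tMul_eq_zero`). Hence `(X, Y) ↦ α X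
+ β Y` descends to a covector at `gh` exactly when it vanishes on these pairs, that is, when the
source of `α` is the target of `β` (`exists_isCotangentProduct_iff`). The covector is then unique,
so the laws of `𝕋G` are checked by evaluating both sides on products of tangent vectors.
Multiplicativity of the pairing is the sum of two instances of the defining equation. Smoothness of
covector families is tested on local frames. For the product, a smooth family of vectors at `gh` is
factored smoothly as `X • Y` (`contMDiffAt_gen_mul`). The target of `𝕋G` is fibrewise linear and
onto over a submersion, hence a submersion (`surjective_mfderiv_of_fibrewise`), and the source is
the target composed with inversion.

For the Courant algebroid, the bracket in a chart is the explicit expression `flatBracket`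
(`genInChart_courantBracket`). The axioms become product rules, together with the symmetry of second
derivatives for the Jacobi identity.

The compatibility of bracket and product rests on one fact: for every embedded submanifold `Q`, the
bundle `TQ ⊕ Ann TQ` is Lagrangian and closed under the bracket (`tangentDirac_lagrangian`,
`courantBracket_mem_tangentDirac`). Changing the sign of the covectors of the last two factors
identifies the graph of `m_𝕋` with `TQ ⊕ Ann TQ` for `Q` the graph of `m_G`: that `(γ, -α, -β)`
annihilates all `(X • Y, X, Y)` is the equation `γ (X • Y) = α X + β Y` (`mem_graphGenMul_iff`). The
statement on related sections is this closure applied to sections pulled back from the factors,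
whose bracket is componentwise (`courantBracket_tripleSection`). -/

noncomputable section

/-! ### Submersions -/

section Submersion

variable {E H E' H' : Type*} [NormedAddCommGroup E] [NormedSpace ℝ E] [FiniteDimensional ℝ E]
  [TopologicalSpace H] [NormedAddCommGroup E'] [NormedSpace ℝ E'] [FiniteDimensional ℝ E']
  [TopologicalSpace H'] {I : ModelWithCorners ℝ E H} {I' : ModelWithCorners ℝ E' H'}
  [I.Boundaryless] [I'.Boundaryless]
  {N B : Type*} [TopologicalSpace N] [ChartedSpace H N] [IsManifold I ∞ N]
  [TopologicalSpace B] [ChartedSpace H' B] [IsManifold I' ∞ B]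

/-- Near a point where it is submersive, a smooth map between vector spaces has a smooth family of
local sections through every point. -/
lemma exists_flat_sections {f : E → E'} {x₀ : E} {V : Set E} (hV : IsOpen V) (hx₀ : x₀ ∈ V)
    (hf : ContDiffOn ℝ ∞ f V) (hs : Function.Surjective (fderiv ℝ f x₀)) :
    ∃ σ : E' × E → E, ∀ᶠ p in 𝓝 (f x₀, x₀), ContDiffAt ℝ ∞ σ p ∧ σ p ∈ V ∧ f (σ p) = p.1 ∧
      (p.1 = f p.2 → σ p = p.2) := by
  have : CompleteSpace E := FiniteDimensional.complete ℝ E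
  -- A complement `ϖ` of the derivative makes `(f, ϖ)` a local diffeomorphism in which `f` is the
  -- first projection.
  obtain ⟨ϖ, L, hL⟩ := LieGroupoid.exists_prod_isInvertible (fderiv ℝ f x₀) hs
  have hfa : ∀ x ∈ V, ContDiffAt ℝ ∞ f x := fun x hx => hf.contDiffAt (hV.mem_nhds hx)
  let Φ : E → E' × LieGroupoid.AModel E E' := fun x => (f x, ϖ x)
  have hΦ : ∀ x ∈ V, ContDiffAt ℝ ∞ Φ x := fun x hx =>
    (hfa x hx).prodMk ϖ.contDiff.contDiffAt
  have hΦd : ∀ x ∈ V, HasFDerivAt Φ ((fderiv ℝ f x).prod ϖ) x := fun x hx =>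
    ((hfa x hx).differentiableAt (by simp)).hasFDerivAt.prodMk ϖ.hasFDerivAt
  have hΦ0 : HasFDerivAt Φ (L : E →L[ℝ] E' × LieGroupoid.AModel E E') x₀ := by
    rw [hL]; exact hΦd x₀ hx₀
  let Ψ := (hΦ x₀ hx₀).toOpenPartialHomeomorph Φ hΦ0 (by simp)
  have hΨ : ⇑Ψ = Φ := ContDiffAt.toOpenPartialHomeomorph_coe ..
  have hm : x₀ ∈ Ψ.source := ContDiffAt.mem_toOpenPartialHomeomorph_source ..
  -- the open set of good points
  have hcont : ContinuousOn (fun x => (fderiv ℝ f x).prod ϖ) V := by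
    have h1 : ContinuousOn (fderiv ℝ f) V := hf.continuousOn_fderiv_of_isOpen hV (by simp)
    exact ((ContinuousLinearMap.prodL ℝ (E := E) (F := E') (G := LieGroupoid.AModel E E')
      (𝕜 := ℝ)).continuous.comp_continuousOn (h1.prodMk continuousOn_const))
  have hW : IsOpen (V ∩ (fun x => (fderiv ℝ f x).prod ϖ) ⁻¹'
      range ((↑) : (E ≃L[ℝ] E' × LieGroupoid.AModel E E') → _)) :=
    hcont.isOpen_inter_preimage hV (ContinuousLinearEquiv.isOpen)
  let W := V ∩ (fun x => (fderiv ℝ f x).prod ϖ) ⁻¹'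
      range ((↑) : (E ≃L[ℝ] E' × LieGroupoid.AModel E E') → _)
  have hx₀W : x₀ ∈ W := ⟨hx₀, L, hL⟩
  -- The section through `x` over `b` keeps the complementary coordinate `ϖ x` and replaces the
  -- value of `f` by `b`.
  let j : E' × E → E' × LieGroupoid.AModel E E' := fun p => (p.1, ϖ p.2)
  have hj : ContDiff ℝ ∞ j := contDiff_fst.prodMk (ϖ.contDiff.comp contDiff_snd)
  have hj0 : j (f x₀, x₀) = Ψ x₀ := by rw [hΨ]
  refine ⟨fun p => Ψ.symm (j p), ?_⟩
  have e1 : ∀ᶠ p in 𝓝 (f x₀, x₀), j p ∈ Ψ.target := by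
    refine hj.continuous.continuousAt.eventually_mem (Ψ.open_target.mem_nhds ?_)
    rw [hj0]; exact Ψ.map_source hm
  have e2 : ∀ᶠ p in 𝓝 (f x₀, x₀), Ψ.symm (j p) ∈ W := by
    have : ContinuousAt (fun p => Ψ.symm (j p)) (f x₀, x₀) := by
      refine ContinuousAt.comp (g := Ψ.symm) ?_ hj.continuous.continuousAt
      rw [hj0]; exact Ψ.continuousAt_symm (Ψ.map_source hm)
    refine this.eventually_mem (hW.mem_nhds ?_)
    rw [hj0, Ψ.left_inv hm]; exact hx₀W
  have e3 : ∀ᶠ p : E' × E in 𝓝 (f x₀, x₀), p.2 ∈ Ψ.source :=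
    continuous_snd.continuousAt.eventually_mem (Ψ.open_source.mem_nhds hm)
  filter_upwards [e1, e2, e3] with p h1 h2 h3
  have h4 : Φ (Ψ.symm (j p)) = j p := by rw [← hΨ]; exact Ψ.right_inv h1
  refine ⟨?_, h2.1, congrArg Prod.fst h4, fun h5 => ?_⟩
  -- Smoothness of the local inverse at a point other than the centre needs an invertible derivative
  -- there, hence the set `W`.
  · obtain ⟨L', hL'⟩ := h2.2
    refine ContDiffAt.comp p ?_ hj.contDiffAt
    refine Ψ.contDiffAt_symm (f₀' := L') h1 ?_ ?_
    · rw [hΨ, hL']; exact hΦd _ h2.1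
    · rw [hΨ]; exact hΦ _ h2.1
  · have h6 : j p = Ψ p.2 := by rw [hΨ]; exact Prod.ext h5 rfl
    rw [h6, Ψ.left_inv h3]

lemma mfderiv_extChartAt_bijective {x₀ x : N} (hx : x ∈ (extChartAt I x₀).source) :
    Function.Bijective (mfderiv I 𝓘(ℝ, E) (extChartAt I x₀) x) := by
  obtain ⟨L, hL⟩ := isInvertible_mfderiv_extChartAt (I := I) hx
  rw [← hL]
  exact L.bijective

/-- A map between manifolds read in the preferred charts around `x₀` and `f x₀`. -/
lemma fderiv_inCharts {f : N → B} {x₀ x : N} (hf : MDifferentiableAt I I' f x)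
    (hx : x ∈ (extChartAt I x₀).source) {y₀ : B} (hy : f x ∈ (extChartAt I' y₀).source)
    (v : TangentSpace I x) :
    fderiv ℝ (extChartAt I' y₀ ∘ f ∘ (extChartAt I x₀).symm) (extChartAt I x₀ x)
      (mfderiv I 𝓘(ℝ, E) (extChartAt I x₀) x v) =
    mfderiv I' 𝓘(ℝ, E') (extChartAt I' y₀) (f x) (mfderiv I I' f x v) := by
  have h1 : HasMFDerivAt I 𝓘(ℝ, E) (extChartAt I x₀) x _ :=
    (mdifferentiableAt_extChartAt (by simpa using hx)).hasMFDerivAt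
  have h2 : MDifferentiableAt I' 𝓘(ℝ, E') (extChartAt I' y₀) (f x) :=
    mdifferentiableAt_extChartAt (by simpa using hy)
  have hl := (extChartAt I x₀).left_inv hx
  have h4 : MDifferentiableAt 𝓘(ℝ, E) I (extChartAt I x₀).symm (extChartAt I x₀ x) :=
    ((contMDiffOn_extChartAt_symm (n := ∞) x₀).contMDiffAt
      ((isOpen_extChartAt_target _).mem_nhds
        ((extChartAt I x₀).map_source hx))).mdifferentiableAt (by simp)
  have h5 : MDifferentiableAt 𝓘(ℝ, E) 𝓘(ℝ, E') (extChartAt I' y₀ ∘ f ∘ (extChartAt I x₀).symm)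
      (extChartAt I x₀ x) := by
    have hf' : MDifferentiableAt I I' f ((extChartAt I x₀).symm (extChartAt I x₀ x)) := by rwa [hl]
    refine MDifferentiableAt.comp (I' := I') _ ?_ (hf'.comp _ h4)
    rwa [Function.comp_apply, hl]
  have h6 : HasMFDerivAt 𝓘(ℝ, E) 𝓘(ℝ, E') (extChartAt I' y₀ ∘ f ∘ (extChartAt I x₀).symm)
      (extChartAt I x₀ x) (fderiv ℝ (extChartAt I' y₀ ∘ f ∘ (extChartAt I x₀).symm)
        (extChartAt I x₀ x)) :=
    h5.differentiableAt.hasFDerivAt.hasMFDerivAt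
  have hA := h2.hasMFDerivAt.comp x hf.hasMFDerivAt
  have hB := h6.comp x h1
  have heq : extChartAt I' y₀ ∘ f =ᶠ[𝓝 x]
      (extChartAt I' y₀ ∘ f ∘ (extChartAt I x₀).symm) ∘ extChartAt I x₀ := by
    filter_upwards [(isOpen_extChartAt_source (I := I) x₀).mem_nhds hx] with y hy
    simp only [Function.comp_apply, (extChartAt I x₀).left_inv hy]
  exact congrArg (fun L => L v) (hasMFDerivAt_unique (hB.congr_of_eventuallyEq heq) hA)

lemma contDiffOn_inCharts {f : N → B} {U : Set N} (hU : IsOpen U) (hf : ContMDiffOn I I' ∞ f U)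
    (x₀ : N) (y₀ : B) :
    ContDiffOn ℝ ∞ (extChartAt I' y₀ ∘ f ∘ (extChartAt I x₀).symm)
      ((extChartAt I x₀).target ∩
        (extChartAt I x₀).symm ⁻¹' (U ∩ f ⁻¹' (extChartAt I' y₀).source)) := by
  intro y hy
  have h4 : ContMDiffAt 𝓘(ℝ, E) I ∞ (extChartAt I x₀).symm y :=
    (contMDiffOn_extChartAt_symm (n := ∞) x₀).contMDiffAt
      ((isOpen_extChartAt_target _).mem_nhds hy.1)
  have h3 : ContMDiffAt I I' ∞ f ((extChartAt I x₀).symm y) :=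
    hf.contMDiffAt (hU.mem_nhds hy.2.1)
  have h2 : ContMDiffAt I' 𝓘(ℝ, E') ∞ (extChartAt I' y₀) (f ((extChartAt I x₀).symm y)) :=
    contMDiffAt_extChartAt' (by simpa using hy.2.2)
  exact (h2.comp y (h3.comp y h4)).contDiffAt.contDiffWithinAt

/-- Near a point where it is submersive, a smooth map has a smooth family of local sections through
every point. -/
theorem exists_sections_of_submersion {f : N → B} {x₀ : N} {U : Set N} (hU : IsOpen U)
    (hx₀ : x₀ ∈ U) (hf : ContMDiffOn I I' ∞ f U) (hs : Function.Surjective (mfderiv I I' f x₀)) :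
    ∃ σ : B × N → N, ∀ᶠ p in 𝓝 (f x₀, x₀), ContMDiffAt (I'.prod I) I ∞ σ p ∧ f (σ p) = p.1 ∧
      (p.1 = f p.2 → σ p = p.2) := by
  set φ := extChartAt I x₀
  set ψ := extChartAt I' (f x₀)
  have hφ0 : x₀ ∈ φ.source := mem_extChartAt_source _
  have hψ0 : f x₀ ∈ ψ.source := mem_extChartAt_source _
  let V := φ.target ∩ φ.symm ⁻¹' (U ∩ f ⁻¹' ψ.source)
  have hUf : IsOpen (U ∩ f ⁻¹' ψ.source) :=
    hf.continuousOn.isOpen_inter_preimage hU (isOpen_extChartAt_source _)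
  have hV : IsOpen V := (continuousOn_extChartAt_symm (I := I) x₀).isOpen_inter_preimage
    (isOpen_extChartAt_target _) hUf
  have hV0 : φ x₀ ∈ V := ⟨φ.map_source hφ0, by
    rw [mem_preimage, φ.left_inv hφ0]; exact ⟨hx₀, hψ0⟩⟩
  have hfa : ∀ x ∈ U, ContMDiffAt I I' ∞ f x := fun x hx => hf.contMDiffAt (hU.mem_nhds hx)
  have hsurj : Function.Surjective (fderiv ℝ (ψ ∘ f ∘ φ.symm) (φ x₀)) := by
    intro w
    obtain ⟨u, hu⟩ := (mfderiv_extChartAt_bijective (I := I') hψ0).2 w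
    obtain ⟨v, rfl⟩ := hs u
    exact ⟨_, (fderiv_inCharts ((hfa x₀ hx₀).mdifferentiableAt (by simp)) hφ0 hψ0 v).trans hu⟩
  obtain ⟨σ, hσ⟩ := exists_flat_sections hV hV0 (contDiffOn_inCharts hU hf x₀ (f x₀)) hsurj
  have h0 : (ψ ∘ f ∘ φ.symm) (φ x₀) = ψ (f x₀) := by
    simp only [Function.comp_apply, φ.left_inv hφ0]
  rw [h0] at hσ
  refine ⟨fun p => φ.symm (σ (ψ p.1, φ p.2)), ?_⟩
  have hc : ContinuousAt (fun p : B × N => (ψ p.1, φ p.2)) (f x₀, x₀) := by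
    refine ContinuousAt.prodMk ?_ ?_
    · exact ContinuousAt.comp (g := ψ) (continuousAt_extChartAt _) continuousAt_fst
    · exact ContinuousAt.comp (g := φ) (continuousAt_extChartAt _) continuousAt_snd
  have e2 : ∀ᶠ p : B × N in 𝓝 (f x₀, x₀), p.1 ∈ ψ.source ∧ p.2 ∈ φ.source ∩ U ∩ f ⁻¹' ψ.source := by
    refine (continuousAt_fst.eventually_mem ((isOpen_extChartAt_source _).mem_nhds hψ0)).and
      (continuousAt_snd.eventually_mem (IsOpen.mem_nhds ?_ ?_))
    · rw [inter_assoc]; exact (isOpen_extChartAt_source _).inter hUf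
    · exact ⟨⟨hφ0, hx₀⟩, hψ0⟩
  filter_upwards [hc.eventually hσ, e2] with p ⟨h1, h2, h3, h4⟩ ⟨h5, ⟨h6, h7⟩, h8⟩
  have hr : f (φ.symm (σ (ψ p.1, φ p.2))) = p.1 := by
    have := congrArg ψ.symm h3
    simp only [Function.comp_apply] at this
    rwa [ψ.left_inv h2.2.2, ψ.left_inv h5] at this
  refine ⟨?_, hr, fun h9 => ?_⟩
  · have a1 : ContMDiffAt (I'.prod I) 𝓘(ℝ, E' × E) ∞ (fun p : B × N => (ψ p.1, φ p.2)) p := by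
      refine ContMDiffAt.prodMk_space ?_ ?_
      · exact (contMDiffAt_extChartAt' (by simpa [ψ] using h5)).comp p contMDiffAt_fst
      · exact (contMDiffAt_extChartAt' (by simpa [φ] using h6)).comp p contMDiffAt_snd
    have a2 : ContMDiffAt 𝓘(ℝ, E) I ∞ φ.symm (σ (ψ p.1, φ p.2)) :=
      (contMDiffOn_extChartAt_symm (n := ∞) x₀).contMDiffAt
        ((isOpen_extChartAt_target _).mem_nhds h2.1)
    exact a2.comp p (ContMDiffAt.comp p h1.contMDiffAt a1)
  · rw [h4 (by
      change ψ p.1 = ψ (f (φ.symm (φ p.2)))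
      rw [φ.left_inv h6, h9]), φ.left_inv h6]

end Submersion

/-! ### Velocities of curves -/

section Velocity

variable {E H E' H' : Type*} [NormedAddCommGroup E] [NormedSpace ℝ E]
  [TopologicalSpace H] [NormedAddCommGroup E'] [NormedSpace ℝ E']
  [TopologicalSpace H'] {I : ModelWithCorners ℝ E H} {I' : ModelWithCorners ℝ E' H'}
  {N B : Type*} [TopologicalSpace N] [ChartedSpace H N]
  [TopologicalSpace B] [ChartedSpace H' B]

/-- All tangent spaces are the model space `E` by definition. Identities between vectors whose base
points agree only by a groupoid law can therefore be compared in `E`, without transport along the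
equality of points. -/
lemma tangentBundle_mk_eq_iff {x y : N} {v : TangentSpace I x} {w : TangentSpace I y} :
    (⟨x, v⟩ : TangentBundle I N) = ⟨y, w⟩ ↔ x = y ∧ (v : E) = (w : E) := by
  constructor
  · intro h
    have h1 : x = y := congrArg TotalSpace.proj h
    subst h1
    exact ⟨rfl, (TotalSpace.mk_inj.1 h)⟩
  · rintro ⟨rfl, h⟩
    exact congrArg _ h

variable (I) in
/-- The velocity at time `0` of a curve. -/
def velocity (γ : ℝ → N) : TangentBundle I N := tangentMap 𝓘(ℝ, ℝ) I γ ⟨0, (1 : ℝ)⟩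

lemma velocity_congr {γ δ : ℝ → N} (h : γ =ᶠ[𝓝 0] δ) : velocity I γ = velocity I δ := by
  refine tangentBundle_mk_eq_iff.2 ⟨h.self_of_nhds, ?_⟩
  have := h.mfderiv_eq (I := 𝓘(ℝ, ℝ)) (I' := I)
  exact congrArg (fun L : ℝ →L[ℝ] E => L 1) this

lemma velocity_comp {f : N → B} {γ : ℝ → N} (hf : MDifferentiableAt I I' f (γ 0))
    (hγ : MDifferentiableAt 𝓘(ℝ, ℝ) I γ 0) :
    velocity I' (fun τ => f (γ τ)) = tangentMap I I' f (velocity I γ) :=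
  tangentMap_comp_at (p := (⟨0, (1 : ℝ)⟩ : TangentBundle 𝓘(ℝ, ℝ) ℝ)) hf hγ

lemma velocity_prodMk {γ : ℝ → N} {δ : ℝ → B} (hγ : MDifferentiableAt 𝓘(ℝ, ℝ) I γ 0)
    (hδ : MDifferentiableAt 𝓘(ℝ, ℝ) I' δ 0) :
    velocity (I.prod I') (fun τ => (γ τ, δ τ)) =
      ⟨(γ 0, δ 0), ((velocity I γ).2, (velocity I' δ).2)⟩ := by
  refine tangentBundle_mk_eq_iff.2 ⟨rfl, ?_⟩
  exact congrArg (fun L : ℝ →L[ℝ] E × E' => L 1) (hγ.mfderiv_prod hδ)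

lemma velocity_const (x : N) : velocity I (fun _ => x) = ⟨x, 0⟩ := by
  refine tangentBundle_mk_eq_iff.2 ⟨rfl, ?_⟩
  exact congrArg (fun L : ℝ →L[ℝ] E => L 1) (mfderiv_const (I := 𝓘(ℝ, ℝ)) (I' := I) (c := x))

/-- A straight line in a chart works; its velocity is identified after applying the derivative of
the chart, which is injective. -/
lemma exists_velocity_eq [IsManifold I ∞ N] [I.Boundaryless] (v : TangentBundle I N) :
    ∃ γ : ℝ → N, ContMDiffAt 𝓘(ℝ, ℝ) I ∞ γ 0 ∧ velocity I γ = v := by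
  obtain ⟨x, v⟩ := v
  set φ := extChartAt I x
  have hx : x ∈ φ.source := mem_extChartAt_source _
  obtain ⟨L, hL⟩ := isInvertible_mfderiv_extChartAt (I := I) hx
  let w : E := L v
  let c : ℝ → E := fun τ => φ x + τ • w
  have hc : ContDiff ℝ ∞ c := contDiff_const.add (contDiff_id.smul contDiff_const)
  have hc0 : c 0 = φ x := by simp [c]
  have hs : ContMDiffAt 𝓘(ℝ, E) I ∞ φ.symm (c 0) := by
    rw [hc0]
    exact (contMDiffOn_extChartAt_symm (n := ∞) x).contMDiffAt
      ((isOpen_extChartAt_target _).mem_nhds (φ.map_source hx))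
  have hγ : ContMDiffAt 𝓘(ℝ, ℝ) I ∞ (φ.symm ∘ c) 0 := hs.comp 0 hc.contDiffAt.contMDiffAt
  have h0 : (φ.symm ∘ c) 0 = x := by simp only [Function.comp_apply, hc0, φ.left_inv hx]
  refine ⟨φ.symm ∘ c, hγ, tangentBundle_mk_eq_iff.2 ⟨h0, ?_⟩⟩
  have hφ : MDifferentiableAt I 𝓘(ℝ, E) φ ((φ.symm ∘ c) 0) := by
    rw [h0]; exact mdifferentiableAt_extChartAt (mem_chart_source _ _)
  have h1 := hφ.hasMFDerivAt.comp (0 : ℝ) (hγ.mdifferentiableAt (by simp)).hasMFDerivAt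
  have h2 : HasMFDerivAt 𝓘(ℝ, ℝ) 𝓘(ℝ, E) c 0 (ContinuousLinearMap.toSpanSingleton ℝ w) := by
    have : HasDerivAt c ((1 : ℝ) • w) 0 :=
      ((hasDerivAt_id (0 : ℝ)).smul_const w).const_add (φ x)
    rw [one_smul] at this
    exact this.hasFDerivAt.hasMFDerivAt
  have h3 : c =ᶠ[𝓝 0] φ ∘ (φ.symm ∘ c) := by
    have : ∀ᶠ τ in 𝓝 (0 : ℝ), c τ ∈ φ.target :=
      hc.continuous.continuousAt.eventually_mem
        ((isOpen_extChartAt_target _).mem_nhds (by rw [hc0]; exact φ.map_source hx))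
    filter_upwards [this] with τ hτ
    simp only [Function.comp_apply, φ.right_inv hτ]
  have h4 := hasMFDerivAt_unique (h1.congr_of_eventuallyEq h3) h2
  have h5 : ∀ y, y = x → (mfderiv I 𝓘(ℝ, E) φ y : E →L[ℝ] E) = mfderiv I 𝓘(ℝ, E) φ x := by
    rintro _ rfl; rfl
  have h6 := congrArg (fun A : ℝ →L[ℝ] E => A 1) h4
  have h7 : (mfderiv I 𝓘(ℝ, E) φ ((φ.symm ∘ c) 0) : E →L[ℝ] E)
      ((mfderiv 𝓘(ℝ, ℝ) I (φ.symm ∘ c) 0 : ℝ →L[ℝ] E) 1) = w := by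
    exact h6.trans (one_smul ℝ w)
  rw [h5 _ h0, ← hL] at h7
  exact L.injective h7

end Velocity

/-! ### The tangent groupoid -/

namespace LieGroupoid

variable {E H E' H' : Type*} [NormedAddCommGroup E] [NormedSpace ℝ E]
  [TopologicalSpace H] [NormedAddCommGroup E'] [NormedSpace ℝ E']
  [TopologicalSpace H'] {I : ModelWithCorners ℝ E H} {I' : ModelWithCorners ℝ E' H'}
  {G M : Type*} [TopologicalSpace G] [ChartedSpace H G]
  [TopologicalSpace M] [ChartedSpace H' M]
  (𝒢 : LieGroupoid I G I' M)

lemma inv_inv (g : G) : 𝒢.inv (𝒢.inv g) = g := by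
  have h := 𝒢.isLieGroupoid
  have h1 := h.mul_assoc (𝒢.inv (𝒢.inv g)) (𝒢.inv g) g (by rw [h.src_inv]) (by rw [h.src_inv])
  rw [h.inv_mul, h.inv_mul, h.src_inv] at h1
  have h2 := h.mul_unit (𝒢.inv (𝒢.inv g))
  rw [h.src_inv, h.tgt_inv] at h2
  rw [← h2, ← h1, h.unit_mul]

lemma mdifferentiableAt_src (g : G) : MDifferentiableAt I I' 𝒢.src g :=
  (𝒢.isLieGroupoid.smooth_src g).mdifferentiableAt (by simp)

lemma mdifferentiableAt_tgt (g : G) : MDifferentiableAt I I' 𝒢.tgt g :=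
  (𝒢.isLieGroupoid.smooth_tgt g).mdifferentiableAt (by simp)

lemma mdifferentiableAt_inv (g : G) : MDifferentiableAt I I 𝒢.inv g :=
  (𝒢.isLieGroupoid.smooth_inv g).mdifferentiableAt (by simp)

lemma mdifferentiableAt_unit (x : M) : MDifferentiableAt I' I 𝒢.unit x :=
  (𝒢.isLieGroupoid.smooth_unit x).mdifferentiableAt (by simp)

section Families

variable {F K P : Type*} [NormedAddCommGroup F] [NormedSpace ℝ F] [TopologicalSpace K]
  {J : ModelWithCorners ℝ F K} [TopologicalSpace P] [ChartedSpace K P]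

/-- The product of two smooth families of composable elements. -/
lemma contMDiffAt_mul {a b : P → G} {p : P} (ha : ContMDiffAt J I ∞ a p)
    (hb : ContMDiffAt J I ∞ b p) (hab : ∀ᶠ q in 𝓝 p, 𝒢.src (a q) = 𝒢.tgt (b q)) :
    ContMDiffAt J I ∞ (fun q => 𝒢.mul (a q) (b q)) p := by
  obtain ⟨U, m, hU, hpU, hm, he⟩ := 𝒢.isLieGroupoid.smooth_mul (a p, b p) hab.self_of_nhds
  have hc : ContMDiffAt J (I.prod I) ∞ (fun q => (a q, b q)) p := ha.prodMk hb
  -- Only composable pairs carry the smooth structure of the product; near `p` the family agrees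
  -- with the smooth extension `m`.
  refine ContMDiffAt.congr_of_eventuallyEq (f := fun q => m (a q, b q)) ?_ ?_
  · exact (hm.contMDiffAt (hU.mem_nhds hpU)).comp p hc
  · filter_upwards [hab, hc.continuousAt.eventually_mem (hU.mem_nhds hpU)] with q h1 h2
    exact (he ⟨h1, h2⟩).symm

lemma mdifferentiableWithinAt_mul {g h : G} (hgh : 𝒢.src g = 𝒢.tgt h) :
    MDifferentiableWithinAt (I.prod I) I (fun p : G × G => 𝒢.mul p.1 p.2) 𝒢.composable (g, h) := by
  obtain ⟨U, m, hU, hpU, hm, he⟩ := 𝒢.isLieGroupoid.smooth_mul (g, h) hgh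
  have h1 : MDifferentiableWithinAt (I.prod I) I m 𝒢.composable (g, h) :=
    ((hm.contMDiffAt (hU.mem_nhds hpU)).mdifferentiableAt (by simp)).mdifferentiableWithinAt
  refine h1.congr_of_eventuallyEq ?_ (he ⟨hgh, hpU⟩).symm
  filter_upwards [self_mem_nhdsWithin, mem_nhdsWithin_of_mem_nhds (hU.mem_nhds hpU)] with q h1 h2
  exact (he ⟨h1, h2⟩).symm

/-- The derivative of the product of two families of composable elements. -/
lemma hasMFDerivAt_mul {a b : P → G} {p : P} (ha : MDifferentiableAt J I a p)
    (hb : MDifferentiableAt J I b p) (hab : ∀ᶠ q in 𝓝 p, 𝒢.src (a q) = 𝒢.tgt (b q)) :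
    HasMFDerivAt J I (fun q => 𝒢.mul (a q) (b q)) p
      ((𝒢.dMul (a p) (b p)).comp ((mfderiv J I a p).prod (mfderiv J I b p))) := by
  have h1 := (𝒢.mdifferentiableWithinAt_mul hab.self_of_nhds).hasMFDerivWithinAt
  have h2 := (ha.hasMFDerivAt.prodMk hb.hasMFDerivAt).hasMFDerivWithinAt
    (s := (fun q => (a q, b q)) ⁻¹' 𝒢.composable)
  have h3 := h1.comp p h2 subset_rfl
  -- The preimage of the composable pairs is a neighbourhood of `p`, so the derivative within it is
  -- the full derivative.
  exact h3.hasMFDerivAt hab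

lemma velocity_mul {γ δ : ℝ → G} (hγ : MDifferentiableAt 𝓘(ℝ, ℝ) I γ 0)
    (hδ : MDifferentiableAt 𝓘(ℝ, ℝ) I δ 0) (h : ∀ᶠ τ in 𝓝 0, 𝒢.src (γ τ) = 𝒢.tgt (δ τ)) :
    velocity I (fun τ => 𝒢.mul (γ τ) (δ τ)) =
      𝒢.tangentGroupoid.mul (velocity I γ) (velocity I δ) := by
  refine tangentBundle_mk_eq_iff.2 ⟨rfl, ?_⟩
  exact congrArg (fun L : ℝ →L[ℝ] E => L 1) (𝒢.hasMFDerivAt_mul hγ hδ h).mfderiv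

end Families

variable [FiniteDimensional ℝ E] [FiniteDimensional ℝ E'] [IsManifold I ∞ G] [IsManifold I' ∞ M]
  [I.Boundaryless] [I'.Boundaryless]

/-- A curve in `G` can be completed to a curve of composable pairs with prescribed velocity. -/
lemma exists_curve_composable {γ : ℝ → G} (hγ : ContMDiffAt 𝓘(ℝ, ℝ) I ∞ γ 0)
    (Y : TangentBundle I G)
    (h : 𝒢.tangentGroupoid.src (velocity I γ) = 𝒢.tangentGroupoid.tgt Y) :
    ∃ δ : ℝ → G, ContMDiffAt 𝓘(ℝ, ℝ) I ∞ δ 0 ∧ (∀ᶠ τ in 𝓝 0, 𝒢.src (γ τ) = 𝒢.tgt (δ τ)) ∧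
      velocity I δ = Y := by
  obtain ⟨δ, hδ, rfl⟩ := exists_velocity_eq Y
  have hh : 𝒢.src (γ 0) = 𝒢.tgt (δ 0) := congrArg TotalSpace.proj h
  -- `σ (b, k)` moves `k` to an element with target `b`; taking `b = s(γ τ)` makes the pair of
  -- curves composable.
  obtain ⟨σ, hσ⟩ := exists_sections_of_submersion (x₀ := δ 0) isOpen_univ (mem_univ _)
    𝒢.isLieGroupoid.smooth_tgt.contMDiffOn (𝒢.isLieGroupoid.submersion_tgt (δ 0))
  have hs : ContMDiffAt 𝓘(ℝ, ℝ) I' ∞ (fun τ => 𝒢.src (γ τ)) 0 :=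
    (𝒢.isLieGroupoid.smooth_src _).comp 0 hγ
  have ht : ContMDiffAt 𝓘(ℝ, ℝ) I' ∞ (fun τ => 𝒢.tgt (δ τ)) 0 :=
    (𝒢.isLieGroupoid.smooth_tgt _).comp 0 hδ
  have c1 : ContMDiffAt 𝓘(ℝ, ℝ) (I'.prod I) ∞ (fun τ => (𝒢.src (γ τ), δ τ)) 0 := hs.prodMk hδ
  have c2 : ContMDiffAt 𝓘(ℝ, ℝ) (I'.prod I) ∞ (fun τ => (𝒢.tgt (δ τ), δ τ)) 0 := ht.prodMk hδ
  have hσ0 : ContMDiffAt (I'.prod I) I ∞ σ (𝒢.tgt (δ 0), δ 0) := hσ.self_of_nhds.1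
  have h1 : ContinuousAt (fun τ => (𝒢.src (γ τ), δ τ)) 0 := c1.continuousAt
  rw [ContinuousAt, hh] at h1
  refine ⟨fun τ => σ (𝒢.src (γ τ), δ τ), ?_, ?_, ?_⟩
  · exact ContMDiffAt.comp_of_eq hσ0 c1 (by rw [hh])
  · filter_upwards [h1.eventually hσ] with τ hτ using hτ.2.1.symm
  -- The correction does not change the velocity: the curves `(s γ, δ)` and `(t δ, δ)` have the same
  -- velocity at `0`, and `σ` maps the second one to `δ`.
  · have v1 : velocity (I'.prod I) (fun τ => (𝒢.src (γ τ), δ τ)) =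
        velocity (I'.prod I) (fun τ => (𝒢.tgt (δ τ), δ τ)) := by
      rw [velocity_prodMk (hs.mdifferentiableAt (by simp)) (hδ.mdifferentiableAt (by simp)),
        velocity_prodMk (ht.mdifferentiableAt (by simp)) (hδ.mdifferentiableAt (by simp)),
        velocity_comp (𝒢.mdifferentiableAt_src _) (hγ.mdifferentiableAt (by simp)),
        velocity_comp (𝒢.mdifferentiableAt_tgt _) (hδ.mdifferentiableAt (by simp))]
      refine tangentBundle_mk_eq_iff.2 ⟨by rw [hh], Prod.ext ?_ rfl⟩
      exact (tangentBundle_mk_eq_iff.1 h).2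
    rw [velocity_comp (f := σ) (γ := fun τ => (𝒢.src (γ τ), δ τ))
      (by simp only [hh]; exact hσ0.mdifferentiableAt (by simp))
      (c1.mdifferentiableAt (by simp)), v1,
      ← velocity_comp (f := σ) (hσ0.mdifferentiableAt (by simp))
        (c2.mdifferentiableAt (by simp))]
    refine velocity_congr ?_
    have h2 : ContinuousAt (fun τ => (𝒢.tgt (δ τ), δ τ)) 0 := c2.continuousAt
    filter_upwards [h2.eventually hσ] with τ hτ using hτ.2.2 rfl

/-- Source of all laws of `TG`: replace vectors by such curves, use the law of `G` at each time, and
differentiate at `0`. -/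
lemma exists_curves_composable (X Y : TangentBundle I G)
    (h : 𝒢.tangentGroupoid.src X = 𝒢.tangentGroupoid.tgt Y) :
    ∃ γ δ : ℝ → G, ContMDiffAt 𝓘(ℝ, ℝ) I ∞ γ 0 ∧ ContMDiffAt 𝓘(ℝ, ℝ) I ∞ δ 0 ∧
      (∀ᶠ τ in 𝓝 0, 𝒢.src (γ τ) = 𝒢.tgt (δ τ)) ∧ velocity I γ = X ∧ velocity I δ = Y := by
  obtain ⟨γ, hγ, rfl⟩ := exists_velocity_eq X
  obtain ⟨δ, hδ, h1, h2⟩ := 𝒢.exists_curve_composable hγ Y h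
  exact ⟨γ, δ, hγ, hδ, h1, rfl, h2⟩

lemma velocity_src {γ : ℝ → G} (hγ : ContMDiffAt 𝓘(ℝ, ℝ) I ∞ γ 0) :
    velocity I' (fun τ => 𝒢.src (γ τ)) = 𝒢.tangentGroupoid.src (velocity I γ) :=
  velocity_comp (𝒢.mdifferentiableAt_src _) (hγ.mdifferentiableAt (by simp))

lemma velocity_tgt {γ : ℝ → G} (hγ : ContMDiffAt 𝓘(ℝ, ℝ) I ∞ γ 0) :
    velocity I' (fun τ => 𝒢.tgt (γ τ)) = 𝒢.tangentGroupoid.tgt (velocity I γ) :=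
  velocity_comp (𝒢.mdifferentiableAt_tgt _) (hγ.mdifferentiableAt (by simp))

lemma velocity_inv {γ : ℝ → G} (hγ : ContMDiffAt 𝓘(ℝ, ℝ) I ∞ γ 0) :
    velocity I (fun τ => 𝒢.inv (γ τ)) = 𝒢.tangentGroupoid.inv (velocity I γ) :=
  velocity_comp (𝒢.mdifferentiableAt_inv _) (hγ.mdifferentiableAt (by simp))

lemma velocity_unit {γ : ℝ → M} (hγ : ContMDiffAt 𝓘(ℝ, ℝ) I' ∞ γ 0) :
    velocity I (fun τ => 𝒢.unit (γ τ)) = 𝒢.tangentGroupoid.unit (velocity I' γ) :=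
  velocity_comp (𝒢.mdifferentiableAt_unit _) (hγ.mdifferentiableAt (by simp))

lemma velocity_mul' {γ δ : ℝ → G} (hγ : ContMDiffAt 𝓘(ℝ, ℝ) I ∞ γ 0)
    (hδ : ContMDiffAt 𝓘(ℝ, ℝ) I ∞ δ 0) (h : ∀ᶠ τ in 𝓝 0, 𝒢.src (γ τ) = 𝒢.tgt (δ τ)) :
    velocity I (fun τ => 𝒢.mul (γ τ) (δ τ)) =
      𝒢.tangentGroupoid.mul (velocity I γ) (velocity I δ) :=
  𝒢.velocity_mul (hγ.mdifferentiableAt (by simp)) (hδ.mdifferentiableAt (by simp)) h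

lemma contMDiffAt_src {γ : ℝ → G} (hγ : ContMDiffAt 𝓘(ℝ, ℝ) I ∞ γ 0) :
    ContMDiffAt 𝓘(ℝ, ℝ) I' ∞ (fun τ => 𝒢.src (γ τ)) 0 :=
  (𝒢.isLieGroupoid.smooth_src _).comp 0 hγ

lemma contMDiffAt_tgt {γ : ℝ → G} (hγ : ContMDiffAt 𝓘(ℝ, ℝ) I ∞ γ 0) :
    ContMDiffAt 𝓘(ℝ, ℝ) I' ∞ (fun τ => 𝒢.tgt (γ τ)) 0 :=
  (𝒢.isLieGroupoid.smooth_tgt _).comp 0 hγ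

lemma contMDiffAt_inv {γ : ℝ → G} (hγ : ContMDiffAt 𝓘(ℝ, ℝ) I ∞ γ 0) :
    ContMDiffAt 𝓘(ℝ, ℝ) I ∞ (fun τ => 𝒢.inv (γ τ)) 0 :=
  (𝒢.isLieGroupoid.smooth_inv _).comp 0 hγ

lemma contMDiffAt_unit {γ : ℝ → M} (hγ : ContMDiffAt 𝓘(ℝ, ℝ) I' ∞ γ 0) :
    ContMDiffAt 𝓘(ℝ, ℝ) I ∞ (fun τ => 𝒢.unit (γ τ)) 0 :=
  (𝒢.isLieGroupoid.smooth_unit _).comp 0 hγ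

/-- The tangent groupoid satisfies the algebraic axioms of a groupoid. -/
lemma tangent_src_unit (v : TangentBundle I' M) :
    𝒢.tangentGroupoid.src (𝒢.tangentGroupoid.unit v) = v := by
  obtain ⟨γ, hγ, rfl⟩ := exists_velocity_eq v
  rw [← 𝒢.velocity_unit hγ, ← 𝒢.velocity_src (𝒢.contMDiffAt_unit hγ)]
  simp only [𝒢.isLieGroupoid.src_unit]

lemma tangent_tgt_unit (v : TangentBundle I' M) :
    𝒢.tangentGroupoid.tgt (𝒢.tangentGroupoid.unit v) = v := by
  obtain ⟨γ, hγ, rfl⟩ := exists_velocity_eq v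
  rw [← 𝒢.velocity_unit hγ, ← 𝒢.velocity_tgt (𝒢.contMDiffAt_unit hγ)]
  simp only [𝒢.isLieGroupoid.tgt_unit]

lemma tangent_src_mul (X Y : TangentBundle I G)
    (h : 𝒢.tangentGroupoid.src X = 𝒢.tangentGroupoid.tgt Y) :
    𝒢.tangentGroupoid.src (𝒢.tangentGroupoid.mul X Y) = 𝒢.tangentGroupoid.src Y := by
  obtain ⟨γ, δ, hγ, hδ, hc, rfl, rfl⟩ := 𝒢.exists_curves_composable X Y h
  rw [← 𝒢.velocity_mul' hγ hδ hc, ← 𝒢.velocity_src (𝒢.contMDiffAt_mul hγ hδ hc),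
    ← 𝒢.velocity_src hδ]
  exact velocity_congr (hc.mono fun τ hτ => 𝒢.isLieGroupoid.src_mul _ _ hτ)

lemma tangent_tgt_mul (X Y : TangentBundle I G)
    (h : 𝒢.tangentGroupoid.src X = 𝒢.tangentGroupoid.tgt Y) :
    𝒢.tangentGroupoid.tgt (𝒢.tangentGroupoid.mul X Y) = 𝒢.tangentGroupoid.tgt X := by
  obtain ⟨γ, δ, hγ, hδ, hc, rfl, rfl⟩ := 𝒢.exists_curves_composable X Y h
  rw [← 𝒢.velocity_mul' hγ hδ hc, ← 𝒢.velocity_tgt (𝒢.contMDiffAt_mul hγ hδ hc),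
    ← 𝒢.velocity_tgt hγ]
  exact velocity_congr (hc.mono fun τ hτ => 𝒢.isLieGroupoid.tgt_mul _ _ hτ)

/-- The curves are chosen one after the other, the third completing the second, so that both
composability conditions hold for all small times. -/
lemma tangent_mul_assoc (X Y Z : TangentBundle I G)
    (h : 𝒢.tangentGroupoid.src X = 𝒢.tangentGroupoid.tgt Y)
    (h' : 𝒢.tangentGroupoid.src Y = 𝒢.tangentGroupoid.tgt Z) :
    𝒢.tangentGroupoid.mul (𝒢.tangentGroupoid.mul X Y) Z =
      𝒢.tangentGroupoid.mul X (𝒢.tangentGroupoid.mul Y Z) := by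
  obtain ⟨γ, δ, hγ, hδ, hc, rfl, rfl⟩ := 𝒢.exists_curves_composable X Y h
  obtain ⟨ε, hε, hc', rfl⟩ := 𝒢.exists_curve_composable hδ Z h'
  rw [← 𝒢.velocity_mul' hγ hδ hc, ← 𝒢.velocity_mul' hδ hε hc',
    ← 𝒢.velocity_mul' (𝒢.contMDiffAt_mul hγ hδ hc) hε, ← 𝒢.velocity_mul' hγ
    (𝒢.contMDiffAt_mul hδ hε hc')]
  · refine velocity_congr ?_
    filter_upwards [hc, hc'] with τ h1 h2 using 𝒢.isLieGroupoid.mul_assoc _ _ _ h1 h2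
  · filter_upwards [hc, hc'] with τ h1 h2
    rw [h1, 𝒢.isLieGroupoid.tgt_mul _ _ h2]
  · filter_upwards [hc, hc'] with τ h1 h2
    rw [← h2, 𝒢.isLieGroupoid.src_mul _ _ h1]

lemma tangent_unit_mul (X : TangentBundle I G) :
    𝒢.tangentGroupoid.mul (𝒢.tangentGroupoid.unit (𝒢.tangentGroupoid.tgt X)) X = X := by
  obtain ⟨γ, hγ, rfl⟩ := exists_velocity_eq X
  rw [← 𝒢.velocity_tgt hγ, ← 𝒢.velocity_unit (𝒢.contMDiffAt_tgt hγ),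
    ← 𝒢.velocity_mul' (𝒢.contMDiffAt_unit (𝒢.contMDiffAt_tgt hγ)) hγ
      (.of_forall fun τ => 𝒢.isLieGroupoid.src_unit _)]
  simp only [𝒢.isLieGroupoid.unit_mul]

lemma tangent_mul_unit (X : TangentBundle I G) :
    𝒢.tangentGroupoid.mul X (𝒢.tangentGroupoid.unit (𝒢.tangentGroupoid.src X)) = X := by
  obtain ⟨γ, hγ, rfl⟩ := exists_velocity_eq X
  rw [← 𝒢.velocity_src hγ, ← 𝒢.velocity_unit (𝒢.contMDiffAt_src hγ),
    ← 𝒢.velocity_mul' hγ (𝒢.contMDiffAt_unit (𝒢.contMDiffAt_src hγ))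
      (.of_forall fun τ => (𝒢.isLieGroupoid.tgt_unit _).symm)]
  simp only [𝒢.isLieGroupoid.mul_unit]

lemma tangent_src_inv (X : TangentBundle I G) :
    𝒢.tangentGroupoid.src (𝒢.tangentGroupoid.inv X) = 𝒢.tangentGroupoid.tgt X := by
  obtain ⟨γ, hγ, rfl⟩ := exists_velocity_eq X
  rw [← 𝒢.velocity_inv hγ, ← 𝒢.velocity_src (𝒢.contMDiffAt_inv hγ), ← 𝒢.velocity_tgt hγ]
  simp only [𝒢.isLieGroupoid.src_inv]

lemma tangent_tgt_inv (X : TangentBundle I G) :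
    𝒢.tangentGroupoid.tgt (𝒢.tangentGroupoid.inv X) = 𝒢.tangentGroupoid.src X := by
  obtain ⟨γ, hγ, rfl⟩ := exists_velocity_eq X
  rw [← 𝒢.velocity_inv hγ, ← 𝒢.velocity_tgt (𝒢.contMDiffAt_inv hγ), ← 𝒢.velocity_src hγ]
  simp only [𝒢.isLieGroupoid.tgt_inv]

lemma tangent_inv_inv (X : TangentBundle I G) :
    𝒢.tangentGroupoid.inv (𝒢.tangentGroupoid.inv X) = X := by
  obtain ⟨γ, hγ, rfl⟩ := exists_velocity_eq X
  rw [← 𝒢.velocity_inv hγ, ← 𝒢.velocity_inv (𝒢.contMDiffAt_inv hγ)]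
  simp only [𝒢.inv_inv]

lemma tangent_inv_mul (X : TangentBundle I G) :
    𝒢.tangentGroupoid.mul (𝒢.tangentGroupoid.inv X) X =
      𝒢.tangentGroupoid.unit (𝒢.tangentGroupoid.src X) := by
  obtain ⟨γ, hγ, rfl⟩ := exists_velocity_eq X
  rw [← 𝒢.velocity_inv hγ, ← 𝒢.velocity_src hγ, ← 𝒢.velocity_unit (𝒢.contMDiffAt_src hγ),
    ← 𝒢.velocity_mul' (𝒢.contMDiffAt_inv hγ) hγ
      (.of_forall fun τ => 𝒢.isLieGroupoid.src_inv _)]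
  simp only [𝒢.isLieGroupoid.inv_mul]

lemma tangent_mul_inv (X : TangentBundle I G) :
    𝒢.tangentGroupoid.mul X (𝒢.tangentGroupoid.inv X) =
      𝒢.tangentGroupoid.unit (𝒢.tangentGroupoid.tgt X) := by
  obtain ⟨γ, hγ, rfl⟩ := exists_velocity_eq X
  rw [← 𝒢.velocity_inv hγ, ← 𝒢.velocity_tgt hγ, ← 𝒢.velocity_unit (𝒢.contMDiffAt_tgt hγ),
    ← 𝒢.velocity_mul' hγ (𝒢.contMDiffAt_inv hγ)
      (.of_forall fun τ => (𝒢.isLieGroupoid.tgt_inv _).symm)]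
  simp only [𝒢.isLieGroupoid.mul_inv]

end LieGroupoid

/-! ### The cotangent groupoid -/

namespace LieGroupoid

variable {E H E' H' : Type*} [NormedAddCommGroup E] [NormedSpace ℝ E]
  [TopologicalSpace H] [NormedAddCommGroup E'] [NormedSpace ℝ E']
  [TopologicalSpace H'] {I : ModelWithCorners ℝ E H} {I' : ModelWithCorners ℝ E' H'}
  {G M : Type*} [TopologicalSpace G] [ChartedSpace H G]
  [TopologicalSpace M] [ChartedSpace H' M]
  (𝒢 : LieGroupoid I G I' M)

lemma tMul_add (g h : G) (X X' : TangentSpace I g) (Y Y' : TangentSpace I h) :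
    𝒢.tMul g h (X + X') (Y + Y') = 𝒢.tMul g h X Y + 𝒢.tMul g h X' Y' :=
  (𝒢.dMul g h).map_add (X, Y) (X', Y')

lemma tMul_sub (g h : G) (X X' : TangentSpace I g) (Y Y' : TangentSpace I h) :
    𝒢.tMul g h (X - X') (Y - Y') = 𝒢.tMul g h X Y - 𝒢.tMul g h X' Y' :=
  (𝒢.dMul g h).map_sub (X, Y) (X', Y')

lemma tMul_smul (g h : G) (r : ℝ) (X : TangentSpace I g) (Y : TangentSpace I h) :
    𝒢.tMul g h (r • X) (r • Y) = r • 𝒢.tMul g h X Y :=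
  (𝒢.dMul g h).map_smul r (X, Y)

lemma tMul_zero (g h : G) : 𝒢.tMul g h 0 0 = 0 :=
  (𝒢.dMul g h).map_zero

lemma tangent_mul_mk (g h : G) (X : TangentSpace I g) (Y : TangentSpace I h) :
    𝒢.tangentGroupoid.mul ⟨g, X⟩ ⟨h, Y⟩ = ⟨𝒢.mul g h, 𝒢.tMul g h X Y⟩ := rfl

lemma tangent_composable_iff {g h : G} {X : TangentSpace I g} {Y : TangentSpace I h} :
    𝒢.tangentGroupoid.src ⟨g, X⟩ = 𝒢.tangentGroupoid.tgt ⟨h, Y⟩ ↔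
      𝒢.src g = 𝒢.tgt h ∧ (mfderiv I I' 𝒢.src g X : E') = mfderiv I I' 𝒢.tgt h Y :=
  tangentBundle_mk_eq_iff

lemma tangent_src_zero (g : G) : 𝒢.tangentGroupoid.src ⟨g, 0⟩ = ⟨𝒢.src g, 0⟩ :=
  tangentBundle_mk_eq_iff.2 ⟨rfl, (mfderiv I I' 𝒢.src g).map_zero⟩

lemma tangent_tgt_zero (g : G) : 𝒢.tangentGroupoid.tgt ⟨g, 0⟩ = ⟨𝒢.tgt g, 0⟩ :=
  tangentBundle_mk_eq_iff.2 ⟨rfl, (mfderiv I I' 𝒢.tgt g).map_zero⟩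

lemma tangent_unit_zero (x : M) : 𝒢.tangentGroupoid.unit ⟨x, 0⟩ = ⟨𝒢.unit x, 0⟩ :=
  tangentBundle_mk_eq_iff.2 ⟨rfl, (mfderiv I' I 𝒢.unit x).map_zero⟩

lemma tangent_inv_zero (g : G) : 𝒢.tangentGroupoid.inv ⟨g, 0⟩ = ⟨𝒢.inv g, 0⟩ :=
  tangentBundle_mk_eq_iff.2 ⟨rfl, (mfderiv I I 𝒢.inv g).map_zero⟩

lemma tangent_mul_zero (g h : G) :
    𝒢.tangentGroupoid.mul ⟨g, 0⟩ ⟨h, 0⟩ = ⟨𝒢.mul g h, 0⟩ :=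
  tangentBundle_mk_eq_iff.2 ⟨rfl, 𝒢.tMul_zero g h⟩

/-- By the chain rule. The equality is in the total space because `T(1 ∘ t)` takes its values over
`1_{t(1_x)}`, which equals `1_x` only by an axiom. -/
lemma tangent_mk_unitTgt (x : M) (u : TangentSpace I (𝒢.unit x)) :
    (⟨𝒢.unit x, 𝒢.unitTgt x u⟩ : TangentBundle I G) =
      𝒢.tangentGroupoid.unit (𝒢.tangentGroupoid.tgt ⟨𝒢.unit x, u⟩) := by
  have h := mfderiv_comp (𝒢.unit x) (𝒢.mdifferentiableAt_unit (𝒢.tgt (𝒢.unit x)))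
    (𝒢.mdifferentiableAt_tgt (𝒢.unit x))
  refine tangentBundle_mk_eq_iff.2 ⟨congrArg 𝒢.unit (𝒢.isLieGroupoid.tgt_unit x).symm, ?_⟩
  exact congrArg (fun L : E →L[ℝ] E => L u) h

lemma tangent_mk_unitSrc (x : M) (u : TangentSpace I (𝒢.unit x)) :
    (⟨𝒢.unit x, 𝒢.unitSrc x u⟩ : TangentBundle I G) =
      𝒢.tangentGroupoid.unit (𝒢.tangentGroupoid.src ⟨𝒢.unit x, u⟩) := by
  have h := mfderiv_comp (𝒢.unit x) (𝒢.mdifferentiableAt_unit (𝒢.src (𝒢.unit x)))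
    (𝒢.mdifferentiableAt_src (𝒢.unit x))
  refine tangentBundle_mk_eq_iff.2 ⟨congrArg 𝒢.unit (𝒢.isLieGroupoid.src_unit x).symm, ?_⟩
  exact congrArg (fun L : E →L[ℝ] E => L u) h

/-- Translations are products with zero vectors, so that identities between them reduce to the laws
of `TG`. -/
lemma tangent_mk_leftTranslation (g : G) (w : TangentSpace I (𝒢.unit (𝒢.src g))) :
    (⟨g, 𝒢.leftTranslation g w⟩ : TangentBundle I G) =
      𝒢.tangentGroupoid.mul ⟨g, 0⟩ ⟨𝒢.unit (𝒢.src g), w⟩ :=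
  tangentBundle_mk_eq_iff.2 ⟨(𝒢.isLieGroupoid.mul_unit g).symm, rfl⟩

lemma tangent_mk_rightTranslation (g : G) (v : TangentSpace I (𝒢.unit (𝒢.tgt g))) :
    (⟨g, 𝒢.rightTranslation g v⟩ : TangentBundle I G) =
      𝒢.tangentGroupoid.mul ⟨𝒢.unit (𝒢.tgt g), v⟩ ⟨g, 0⟩ :=
  tangentBundle_mk_eq_iff.2 ⟨(𝒢.isLieGroupoid.unit_mul g).symm, rfl⟩

variable [FiniteDimensional ℝ E] [FiniteDimensional ℝ E'] [IsManifold I ∞ G] [IsManifold I' ∞ M]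
  [I.Boundaryless] [I'.Boundaryless]

/-- The vector `Tl_g (u - Tt u) ∈ T_g G` for `u ∈ A_{s(g)} G`. -/
def leftInvariant (g : G) (u : TangentSpace I (𝒢.unit (𝒢.src g))) : TangentSpace I g :=
  𝒢.leftTranslation g (u - 𝒢.unitTgt (𝒢.src g) u)

lemma tangent_mul_inv_mul (Z Y : TangentBundle I G)
    (h : 𝒢.tangentGroupoid.src Z = 𝒢.tangentGroupoid.src Y) :
    𝒢.tangentGroupoid.mul (𝒢.tangentGroupoid.mul Z (𝒢.tangentGroupoid.inv Y)) Y = Z := by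
  rw [𝒢.tangent_mul_assoc _ _ _ (by rw [𝒢.tangent_tgt_inv, h]) (by rw [𝒢.tangent_src_inv]),
    𝒢.tangent_inv_mul, ← h, 𝒢.tangent_mul_unit]

/-- Every tangent vector at `gh` is a product. -/
lemma exists_tMul_eq {g h : G} (hgh : 𝒢.src g = 𝒢.tgt h) (Z : TangentSpace I (𝒢.mul g h)) :
    ∃ (X : TangentSpace I g) (Y : TangentSpace I h),
      𝒢.tangentGroupoid.src ⟨g, X⟩ = 𝒢.tangentGroupoid.tgt ⟨h, Y⟩ ∧ 𝒢.tMul g h X Y = Z := by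
  -- Choose `Y` at `h` with the same image under `Ts` as `Z`, and put `X = Z • Y⁻¹`.
  obtain ⟨Y, hY⟩ := 𝒢.isLieGroupoid.submersion_src h
    (show TangentSpace I' (𝒢.src h) from (mfderiv I I' 𝒢.src (𝒢.mul g h) Z : E'))
  have hs : 𝒢.tangentGroupoid.src ⟨𝒢.mul g h, Z⟩ = 𝒢.tangentGroupoid.src ⟨h, Y⟩ :=
    tangentBundle_mk_eq_iff.2 ⟨𝒢.isLieGroupoid.src_mul _ _ hgh, hY.symm⟩
  set W : TangentBundle I G :=
    𝒢.tangentGroupoid.mul ⟨𝒢.mul g h, Z⟩ (𝒢.tangentGroupoid.inv ⟨h, Y⟩) with hW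
  have hb : 𝒢.mul (𝒢.mul g h) (𝒢.inv h) = g := by
    rw [𝒢.isLieGroupoid.mul_assoc _ _ _ hgh (𝒢.isLieGroupoid.tgt_inv h).symm,
      𝒢.isLieGroupoid.mul_inv, ← hgh, 𝒢.isLieGroupoid.mul_unit]
  have hWg : W = ⟨g, (W.2 : E)⟩ := tangentBundle_mk_eq_iff.2 ⟨hb, rfl⟩
  refine ⟨(W.2 : E), Y, ?_, ?_⟩
  · rw [← hWg, hW, 𝒢.tangent_src_mul _ _ (by rw [hs, 𝒢.tangent_tgt_inv]), 𝒢.tangent_src_inv]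
  · have := 𝒢.tangent_mul_inv_mul _ _ hs
    rw [← hW, hWg] at this
    exact (tangentBundle_mk_eq_iff.1 this).2

/-- The product of the tangent groupoid at a unit. -/
lemma tangent_unit_mul_unit (x : M) (w v : TangentSpace I (𝒢.unit x))
    (h : 𝒢.tangentGroupoid.src ⟨𝒢.unit x, w⟩ = 𝒢.tangentGroupoid.tgt ⟨𝒢.unit x, v⟩) :
    𝒢.tangentGroupoid.mul ⟨𝒢.unit x, w⟩ ⟨𝒢.unit x, v⟩ =
      ⟨𝒢.unit x, w + v - 𝒢.unitSrc x w⟩ := by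
  have e : 𝒢.mul (𝒢.unit x) (𝒢.unit x) = 𝒢.unit x := by
    have := 𝒢.isLieGroupoid.unit_mul (𝒢.unit x)
    rwa [𝒢.isLieGroupoid.tgt_unit] at this
  have h1 := 𝒢.tangent_mul_unit ⟨𝒢.unit x, w⟩
  rw [← 𝒢.tangent_mk_unitSrc] at h1
  have hu : (⟨𝒢.unit x, 𝒢.unitSrc x w⟩ : TangentBundle I G) = ⟨𝒢.unit x, 𝒢.unitTgt x v⟩ := by
    rw [𝒢.tangent_mk_unitSrc, 𝒢.tangent_mk_unitTgt, h]
  have hu' : 𝒢.unitSrc x w = 𝒢.unitTgt x v := (tangentBundle_mk_eq_iff.1 hu).2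
  have ht : 𝒢.tangentGroupoid.tgt ⟨𝒢.unit x, v - 𝒢.unitTgt x v⟩ = ⟨x, 0⟩ := by
    have h2 : 𝒢.tangentGroupoid.tgt ⟨𝒢.unit x, 𝒢.unitTgt x v⟩ =
        𝒢.tangentGroupoid.tgt ⟨𝒢.unit x, v⟩ := by
      rw [𝒢.tangent_mk_unitTgt, 𝒢.tangent_tgt_unit]
    have h3 : mfderiv I I' 𝒢.tgt (𝒢.unit x) (𝒢.unitTgt x v) = mfderiv I I' 𝒢.tgt (𝒢.unit x) v :=
      (tangentBundle_mk_eq_iff.1 h2).2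
    refine tangentBundle_mk_eq_iff.2 ⟨𝒢.isLieGroupoid.tgt_unit x, ?_⟩
    exact ((mfderiv I I' 𝒢.tgt (𝒢.unit x)).map_sub _ _).trans (sub_eq_zero.2 h3.symm)
  have h4 := 𝒢.tangent_unit_mul ⟨𝒢.unit x, v - 𝒢.unitTgt x v⟩
  rw [ht, 𝒢.tangent_unit_zero] at h4
  -- Linearity of `Tm` on `(w, v) = (w, T1 (Ts w)) + (0, v - T1 (Tt v))`: each summand is a product
  -- with a unit of `TG`.
  have h5 : (𝒢.tMul (𝒢.unit x) (𝒢.unit x) w v : E) =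
      𝒢.tMul (𝒢.unit x) (𝒢.unit x) w (𝒢.unitSrc x w) +
        𝒢.tMul (𝒢.unit x) (𝒢.unit x) 0 (v - 𝒢.unitTgt x v) := by
    rw [← 𝒢.tMul_add, hu', add_zero, add_sub_cancel]
  refine tangentBundle_mk_eq_iff.2 ⟨e, h5.trans ?_⟩
  have h6 : (𝒢.tMul (𝒢.unit x) (𝒢.unit x) w (𝒢.unitSrc x w) : E) = w :=
    (tangentBundle_mk_eq_iff.1 h1).2
  have h7 : (𝒢.tMul (𝒢.unit x) (𝒢.unit x) 0 (v - 𝒢.unitTgt x v) : E) = v - 𝒢.unitTgt x v :=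
    (tangentBundle_mk_eq_iff.1 h4).2
  have h8 : (𝒢.tMul (𝒢.unit x) (𝒢.unit x) w (𝒢.unitSrc x w) : E) +
      (𝒢.tMul (𝒢.unit x) (𝒢.unit x) 0 (v - 𝒢.unitTgt x v) : E) = w + (v - 𝒢.unitTgt x v) :=
    congrArg₂ _ h6 h7
  refine h8.trans ?_
  rw [hu']
  exact (add_sub_assoc _ _ _).symm

lemma tangent_tgt_sub_unitTgt (x : M) (u : TangentSpace I (𝒢.unit x)) :
    𝒢.tangentGroupoid.tgt ⟨𝒢.unit x, u - 𝒢.unitTgt x u⟩ = ⟨x, 0⟩ := by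
  have h2 : 𝒢.tangentGroupoid.tgt ⟨𝒢.unit x, 𝒢.unitTgt x u⟩ =
      𝒢.tangentGroupoid.tgt ⟨𝒢.unit x, u⟩ := by
    rw [𝒢.tangent_mk_unitTgt, 𝒢.tangent_tgt_unit]
  have h3 : mfderiv I I' 𝒢.tgt (𝒢.unit x) (𝒢.unitTgt x u) = mfderiv I I' 𝒢.tgt (𝒢.unit x) u :=
    (tangentBundle_mk_eq_iff.1 h2).2
  refine tangentBundle_mk_eq_iff.2 ⟨𝒢.isLieGroupoid.tgt_unit x, ?_⟩
  exact ((mfderiv I I' 𝒢.tgt (𝒢.unit x)).map_sub _ _).trans (sub_eq_zero.2 h3.symm)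

lemma tangent_src_algebroid {x : M} {u : TangentSpace I (𝒢.unit x)}
    (hu : mfderiv I I' 𝒢.src (𝒢.unit x) u = 0) :
    𝒢.tangentGroupoid.src ⟨𝒢.unit x, u⟩ = ⟨x, 0⟩ :=
  tangentBundle_mk_eq_iff.2 ⟨𝒢.isLieGroupoid.src_unit x, hu⟩

lemma unitSrc_algebroid {x : M} {u : TangentSpace I (𝒢.unit x)}
    (hu : mfderiv I I' 𝒢.src (𝒢.unit x) u = 0) : 𝒢.unitSrc x u = 0 := by
  have := 𝒢.tangent_mk_unitSrc x u
  rw [𝒢.tangent_src_algebroid hu, 𝒢.tangent_unit_zero] at this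
  exact (tangentBundle_mk_eq_iff.1 this).2

lemma unitSrc_unitTgt (x : M) (u : TangentSpace I (𝒢.unit x)) :
    𝒢.unitSrc x (𝒢.unitTgt x u) = 𝒢.unitTgt x u := by
  have := 𝒢.tangent_mk_unitSrc x (𝒢.unitTgt x u)
  rw [𝒢.tangent_mk_unitTgt, 𝒢.tangent_src_unit, ← 𝒢.tangent_mk_unitTgt] at this
  exact (tangentBundle_mk_eq_iff.1 this).2

/-- Inversion exchanges left and right translations. With `w = u - T1 (Tt u)` and `v = w⁻¹`, the
product formula at a unit turns `w • v = 0` into `w + v + T1 (Tt u) = 0`. -/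
lemma tangent_inv_sub_unitTgt {x : M} {u : TangentSpace I (𝒢.unit x)}
    (hu : mfderiv I I' 𝒢.src (𝒢.unit x) u = 0) :
    𝒢.tangentGroupoid.inv ⟨𝒢.unit x, u - 𝒢.unitTgt x u⟩ = ⟨𝒢.unit x, -u⟩ := by
  set w := u - 𝒢.unitTgt x u with hw
  have e : 𝒢.inv (𝒢.unit x) = 𝒢.unit x := by
    have h1 := 𝒢.isLieGroupoid.mul_inv (𝒢.unit x)
    have h2 := 𝒢.isLieGroupoid.unit_mul (𝒢.inv (𝒢.unit x))
    rw [𝒢.isLieGroupoid.tgt_inv, 𝒢.isLieGroupoid.src_unit] at h2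
    rw [𝒢.isLieGroupoid.tgt_unit, h2] at h1
    exact h1
  set v : TangentSpace I (𝒢.unit x) := (mfderiv I I 𝒢.inv (𝒢.unit x) w : E) with hv
  have hi : 𝒢.tangentGroupoid.inv ⟨𝒢.unit x, w⟩ = ⟨𝒢.unit x, v⟩ :=
    tangentBundle_mk_eq_iff.2 ⟨e, rfl⟩
  have hsrc : 𝒢.tangentGroupoid.src ⟨𝒢.unit x, w⟩ = 𝒢.tangentGroupoid.tgt ⟨𝒢.unit x, v⟩ := by
    rw [← hi, 𝒢.tangent_tgt_inv]
  have h1 := 𝒢.tangent_mul_inv ⟨𝒢.unit x, w⟩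
  rw [hi, 𝒢.tangent_unit_mul_unit _ _ _ hsrc, hw, 𝒢.tangent_tgt_sub_unitTgt, ← hw,
    𝒢.tangent_unit_zero] at h1
  have h2 : w + v - 𝒢.unitSrc x w = 0 := (tangentBundle_mk_eq_iff.1 h1).2
  have h3 : 𝒢.unitSrc x w = - 𝒢.unitTgt x u := by
    rw [hw]
    refine ((𝒢.unitSrc x).map_sub _ _).trans ?_
    rw [𝒢.unitSrc_algebroid hu, 𝒢.unitSrc_unitTgt, zero_sub]
  have h4 : v = -u := by
    rw [h3, hw] at h2
    have : v = (u - 𝒢.unitTgt x u + v - - 𝒢.unitTgt x u) - u := by abel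
    rw [this, h2, zero_sub]
  rw [hi, h4]

lemma tangent_composable_left {g : G} {w : TangentSpace I (𝒢.unit (𝒢.src g))}
    (hw : 𝒢.tangentGroupoid.tgt ⟨𝒢.unit (𝒢.src g), w⟩ = ⟨𝒢.src g, 0⟩) :
    𝒢.tangentGroupoid.src ⟨g, 0⟩ = 𝒢.tangentGroupoid.tgt ⟨𝒢.unit (𝒢.src g), w⟩ := by
  rw [hw, 𝒢.tangent_src_zero]

lemma tangent_composable_right {g : G} {u : TangentSpace I (𝒢.unit (𝒢.tgt g))}
    (hu : mfderiv I I' 𝒢.src (𝒢.unit (𝒢.tgt g)) u = 0) :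
    𝒢.tangentGroupoid.src ⟨𝒢.unit (𝒢.tgt g), u⟩ = 𝒢.tangentGroupoid.tgt ⟨g, 0⟩ := by
  rw [𝒢.tangent_src_algebroid hu, 𝒢.tangent_tgt_zero]

/-- The pairs `(Tl_g (u - Tt u), -Tr_h u)` are composable with product zero. -/
lemma translation_mul_translation {g h : G} (hgh : 𝒢.src g = 𝒢.tgt h)
    {u : E} (hu : mfderiv I I' 𝒢.src (𝒢.unit (𝒢.src g)) u = 0)
    (hu' : mfderiv I I' 𝒢.src (𝒢.unit (𝒢.tgt h)) u = 0) :
    𝒢.tangentGroupoid.src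
        ⟨g, 𝒢.leftInvariant g u⟩ =
      𝒢.tangentGroupoid.tgt ⟨h, - 𝒢.rightTranslation h u⟩ ∧
    𝒢.tMul g h (𝒢.leftInvariant g u) (- 𝒢.rightTranslation h u) = 0 := by
  set u' : TangentSpace I (𝒢.unit (𝒢.src g)) := u with hu'_def
  have hL : 𝒢.leftInvariant g u = 𝒢.leftTranslation g (u' - 𝒢.unitTgt (𝒢.src g) u') := rfl
  rw [hL]
  set w : TangentSpace I (𝒢.unit (𝒢.src g)) := u' - 𝒢.unitTgt (𝒢.src g) u' with hw
  have hwt := 𝒢.tangent_tgt_sub_unitTgt (𝒢.src g) u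
  have hwi := 𝒢.tangent_inv_sub_unitTgt hu
  rw [← hw] at hwt hwi
  have hneg : mfderiv I I' 𝒢.src (𝒢.unit (𝒢.tgt h)) (-u) = 0 := by
    refine ((mfderiv I I' 𝒢.src (𝒢.unit (𝒢.tgt h))).map_neg u).trans ?_
    rw [hu', neg_zero]
  -- Since `-u = w⁻¹`, the right translate is `w⁻¹ • 0_h`, and the product becomes `(0_g • w) • (w⁻¹
  -- • 0_h) = 0_g • 0_h`.
  have hr : (⟨h, - 𝒢.rightTranslation h u⟩ : TangentBundle I G) =
      𝒢.tangentGroupoid.mul (𝒢.tangentGroupoid.inv ⟨𝒢.unit (𝒢.src g), w⟩) ⟨h, 0⟩ := by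
    have : - 𝒢.rightTranslation h u = 𝒢.rightTranslation h (-u) :=
      ((𝒢.rightTranslation h).map_neg u).symm
    rw [this, hwi]
    refine (𝒢.tangent_mk_rightTranslation h _).trans ?_
    have h3 : (⟨𝒢.unit (𝒢.tgt h), -u⟩ : TangentBundle I G) = ⟨𝒢.unit (𝒢.src g), -u⟩ :=
      tangentBundle_mk_eq_iff.2 ⟨by rw [hgh], rfl⟩
    exact congrArg (fun Z => 𝒢.tangentGroupoid.mul Z ⟨h, 0⟩) h3
  have hc1 := 𝒢.tangent_composable_left hwt
  have hc2 : 𝒢.tangentGroupoid.src (𝒢.tangentGroupoid.inv ⟨𝒢.unit (𝒢.src g), w⟩) =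
      𝒢.tangentGroupoid.tgt ⟨h, 0⟩ := by
    rw [𝒢.tangent_src_inv, hwt, 𝒢.tangent_tgt_zero, hgh]
  have hc3 : 𝒢.tangentGroupoid.src ⟨𝒢.unit (𝒢.src g), w⟩ =
      𝒢.tangentGroupoid.tgt (𝒢.tangentGroupoid.mul
        (𝒢.tangentGroupoid.inv ⟨𝒢.unit (𝒢.src g), w⟩) ⟨h, 0⟩) := by
    rw [𝒢.tangent_tgt_mul _ _ hc2, 𝒢.tangent_tgt_inv]
  constructor
  · rw [𝒢.tangent_mk_leftTranslation, hr, 𝒢.tangent_src_mul _ _ hc1, hc3]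
  · have h1 : 𝒢.tangentGroupoid.mul ⟨g, 𝒢.leftTranslation g w⟩ ⟨h, - 𝒢.rightTranslation h u⟩ =
        ⟨𝒢.mul g h, 0⟩ := by
      rw [𝒢.tangent_mk_leftTranslation, hr, 𝒢.tangent_mul_assoc _ _ _ hc1 hc3,
        ← 𝒢.tangent_mul_assoc ⟨𝒢.unit (𝒢.src g), w⟩ _ _ (by rw [𝒢.tangent_tgt_inv]) hc2,
        𝒢.tangent_mul_inv, hwt]
      have h2 := 𝒢.tangent_unit_mul ⟨h, 0⟩
      rw [𝒢.tangent_tgt_zero, ← hgh] at h2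
      rw [h2, 𝒢.tangent_mul_zero]
    exact (tangentBundle_mk_eq_iff.1 h1).2

/-- Composable pairs of tangent vectors with product zero. -/
lemma exists_of_tMul_eq_zero {g h : G} {X : TangentSpace I g} {Y : TangentSpace I h}
    (hXY : 𝒢.tangentGroupoid.src ⟨g, X⟩ = 𝒢.tangentGroupoid.tgt ⟨h, Y⟩)
    (h0 : 𝒢.tMul g h X Y = 0) :
    ∃ u : E, mfderiv I I' 𝒢.src (𝒢.unit (𝒢.src g)) u = 0 ∧
      mfderiv I I' 𝒢.src (𝒢.unit (𝒢.tgt h)) u = 0 ∧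
      X = 𝒢.leftInvariant g u ∧ Y = - 𝒢.rightTranslation h u := by
  have hgh : 𝒢.src g = 𝒢.tgt h := (tangentBundle_mk_eq_iff.1 hXY).1
  have hm : 𝒢.tangentGroupoid.mul ⟨g, X⟩ ⟨h, Y⟩ = ⟨𝒢.mul g h, 0⟩ := by
    rw [𝒢.tangent_mul_mk, h0]
  have hXt : 𝒢.tangentGroupoid.tgt ⟨g, X⟩ = ⟨𝒢.tgt g, 0⟩ := by
    rw [← 𝒢.tangent_tgt_mul _ _ hXY, hm, 𝒢.tangent_tgt_zero, 𝒢.isLieGroupoid.tgt_mul _ _ hgh]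
  have hYs : 𝒢.tangentGroupoid.src ⟨h, Y⟩ = ⟨𝒢.src h, 0⟩ := by
    rw [← 𝒢.tangent_src_mul _ _ hXY, hm, 𝒢.tangent_src_zero, 𝒢.isLieGroupoid.src_mul _ _ hgh]
  have hgi : 𝒢.tangentGroupoid.src ⟨𝒢.inv g, 0⟩ = 𝒢.tangentGroupoid.tgt ⟨g, X⟩ := by
    rw [hXt, 𝒢.tangent_src_zero, 𝒢.isLieGroupoid.src_inv]
  have hhi : 𝒢.tangentGroupoid.src ⟨h, Y⟩ = 𝒢.tangentGroupoid.tgt ⟨𝒢.inv h, 0⟩ := by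
    rw [hYs, 𝒢.tangent_tgt_zero, 𝒢.isLieGroupoid.tgt_inv]
  -- Both factors are translated to the units: `W = 0 • X` and `V = Y • 0`. Their product is a zero
  -- vector at a unit, so `V = W⁻¹`, and `V` lies in the algebroid.
  set W : TangentBundle I G := 𝒢.tangentGroupoid.mul ⟨𝒢.inv g, 0⟩ ⟨g, X⟩ with hW
  set V : TangentBundle I G := 𝒢.tangentGroupoid.mul ⟨h, Y⟩ ⟨𝒢.inv h, 0⟩ with hV
  have hWb : W.1 = 𝒢.unit (𝒢.src g) := 𝒢.isLieGroupoid.inv_mul g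
  have hVb : V.1 = 𝒢.unit (𝒢.src g) := (𝒢.isLieGroupoid.mul_inv h).trans (by rw [hgh])
  have hVb' : V.1 = 𝒢.unit (𝒢.tgt h) := 𝒢.isLieGroupoid.mul_inv h
  have hWs : 𝒢.tangentGroupoid.src W = 𝒢.tangentGroupoid.src ⟨g, X⟩ := 𝒢.tangent_src_mul _ _ hgi
  have hWt : 𝒢.tangentGroupoid.tgt W = ⟨𝒢.src g, 0⟩ := by
    rw [hW, 𝒢.tangent_tgt_mul _ _ hgi, 𝒢.tangent_tgt_zero, 𝒢.isLieGroupoid.tgt_inv]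
  have hVt : 𝒢.tangentGroupoid.tgt V = 𝒢.tangentGroupoid.tgt ⟨h, Y⟩ := 𝒢.tangent_tgt_mul _ _ hhi
  have hVs : 𝒢.tangentGroupoid.src V = ⟨𝒢.tgt h, 0⟩ := by
    rw [hV, 𝒢.tangent_src_mul _ _ hhi, 𝒢.tangent_src_zero, 𝒢.isLieGroupoid.src_inv]
  have hWV : 𝒢.tangentGroupoid.src W = 𝒢.tangentGroupoid.tgt V := by rw [hWs, hVt, hXY]
  have hX : 𝒢.tangentGroupoid.mul ⟨g, 0⟩ W = ⟨g, X⟩ := by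
    have h1 := 𝒢.tangent_mul_inv ⟨g, 0⟩
    rw [𝒢.tangent_inv_zero] at h1
    rw [hW, ← 𝒢.tangent_mul_assoc _ _ _
      (by rw [𝒢.tangent_src_zero, 𝒢.tangent_tgt_zero, 𝒢.isLieGroupoid.tgt_inv]) hgi, h1,
      𝒢.tangent_tgt_zero, ← hXt, 𝒢.tangent_unit_mul]
  have hY : 𝒢.tangentGroupoid.mul V ⟨h, 0⟩ = ⟨h, Y⟩ := by
    have h1 := 𝒢.tangent_inv_mul ⟨h, 0⟩
    rw [𝒢.tangent_inv_zero] at h1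
    rw [hV, 𝒢.tangent_mul_assoc _ _ _ hhi
      (by rw [𝒢.tangent_src_zero, 𝒢.tangent_tgt_zero, 𝒢.isLieGroupoid.src_inv]), h1,
      𝒢.tangent_src_zero, ← hYs, 𝒢.tangent_mul_unit]
  have hWVm : 𝒢.tangentGroupoid.mul W V = 𝒢.tangentGroupoid.unit ⟨𝒢.src g, 0⟩ := by
    rw [hW, 𝒢.tangent_mul_assoc _ _ _ hgi (by rw [hXY, hVt]), hV,
      ← 𝒢.tangent_mul_assoc _ _ _ hXY hhi, hm, 𝒢.tangent_mul_zero, 𝒢.tangent_mul_zero,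
      𝒢.tangent_unit_zero]
    congr 1
    rw [𝒢.isLieGroupoid.mul_assoc _ _ _ hgh (𝒢.isLieGroupoid.tgt_inv h).symm,
      𝒢.isLieGroupoid.mul_inv, ← hgh, 𝒢.isLieGroupoid.mul_unit, 𝒢.isLieGroupoid.inv_mul]
  have hinv : 𝒢.tangentGroupoid.inv W = V := by
    have h1 := 𝒢.tangent_mul_assoc (𝒢.tangentGroupoid.inv W) W V (by rw [𝒢.tangent_src_inv]) hWV
    rw [hWVm, 𝒢.tangent_inv_mul, hWV, 𝒢.tangent_unit_mul] at h1
    rw [h1, ← hWt, ← 𝒢.tangent_src_inv, 𝒢.tangent_mul_unit]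
  set v : E := V.2 with hv
  have hV1 : V = ⟨𝒢.unit (𝒢.src g), v⟩ := tangentBundle_mk_eq_iff.2 ⟨hVb, rfl⟩
  have hV2 : V = ⟨𝒢.unit (𝒢.tgt h), v⟩ := tangentBundle_mk_eq_iff.2 ⟨hVb', rfl⟩
  have k1 : mfderiv I I' 𝒢.src (𝒢.unit (𝒢.src g)) v = 0 := by
    have h1 := hVs
    rw [hV1] at h1
    exact (tangentBundle_mk_eq_iff.1 h1).2
  have k2 : mfderiv I I' 𝒢.src (𝒢.unit (𝒢.tgt h)) v = 0 := by
    have h1 := hVs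
    rw [hV2] at h1
    exact (tangentBundle_mk_eq_iff.1 h1).2
  have n1 : mfderiv I I' 𝒢.src (𝒢.unit (𝒢.src g)) (-v) = 0 := by
    refine ((mfderiv I I' 𝒢.src (𝒢.unit (𝒢.src g))).map_neg v).trans ?_
    rw [k1, neg_zero]
  have n2 : mfderiv I I' 𝒢.src (𝒢.unit (𝒢.tgt h)) (-v) = 0 := by
    refine ((mfderiv I I' 𝒢.src (𝒢.unit (𝒢.tgt h))).map_neg v).trans ?_
    rw [k2, neg_zero]
  -- For `u = -v` the inverse of `u - T1 (Tt u)` is `-u = v`, so `W = V⁻¹` is the vector whose left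
  -- translate is `X`.
  refine ⟨-v, n1, n2, ?_, ?_⟩
  · have h1 := 𝒢.tangent_inv_sub_unitTgt n1
    have h3 : (⟨𝒢.unit (𝒢.src g), -(-v : E)⟩ : TangentBundle I G) = V := by
      rw [neg_neg]; exact hV1.symm
    replace h1 := h1.trans (h3.trans hinv.symm)
    have h2 := congrArg 𝒢.tangentGroupoid.inv h1
    rw [𝒢.tangent_inv_inv, 𝒢.tangent_inv_inv] at h2
    rw [← h2, ← 𝒢.tangent_mk_leftTranslation] at hX
    exact (tangentBundle_mk_eq_iff.1 hX).2.symm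
  · rw [hV2] at hY
    replace hY := (𝒢.tangent_mk_rightTranslation h v).trans hY
    refine (tangentBundle_mk_eq_iff.1 hY).2.symm.trans ?_
    refine Eq.trans ?_ (congrArg Neg.neg ((𝒢.rightTranslation h).map_neg v).symm)
    exact (neg_neg _).symm

end LieGroupoid

/-! ### Existence and uniqueness of products of covectors. -/

namespace LieGroupoid

variable {E H E' H' : Type*} [NormedAddCommGroup E] [NormedSpace ℝ E]
  [TopologicalSpace H] [NormedAddCommGroup E'] [NormedSpace ℝ E']
  [TopologicalSpace H'] {I : ModelWithCorners ℝ E H} {I' : ModelWithCorners ℝ E' H'}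
  {G M : Type*} [TopologicalSpace G] [ChartedSpace H G]
  [TopologicalSpace M] [ChartedSpace H' M]
  (𝒢 : LieGroupoid I G I' M)
  [FiniteDimensional ℝ E] [FiniteDimensional ℝ E'] [IsManifold I ∞ G] [IsManifold I' ∞ M]
  [I.Boundaryless] [I'.Boundaryless]

variable (I) in
/-- An element of the model space regarded as a tangent vector at `g`. -/
abbrev tangentVec (g : G) (u : E) : TangentSpace I g := u

/-- The value of a covector on an element of the total space of `TG` (meaningful over the same base
point). -/
def covectorEval {g : G} (α : Cotangent I g) (Z : TangentBundle I G) : ℝ :=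
  (show E →L[ℝ] ℝ from α) Z.2

lemma covectorEval_mk {g h : G} (α : Cotangent I g) (Z : TangentSpace I h) :
    covectorEval α (⟨h, Z⟩ : TangentBundle I G) = (show E →L[ℝ] ℝ from α) Z := rfl

lemma covectorEval_zero {g h : G} (α : Cotangent I g) :
    covectorEval α (⟨h, 0⟩ : TangentBundle I G) = 0 := α.map_zero

/-- The equality of base points is carried by the tangent components alone; covectors are compared
as functionals on `E`. -/
lemma genTotal_mk_eq_iff {g h : G} {X : TangentSpace I g} {Y : TangentSpace I h}
    {α : Cotangent I g} {β : Cotangent I h} :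
    ((⟨g, (X, α)⟩ : TotalSpace (GenModel E) (GenTangent I : G → Type _)) = ⟨h, (Y, β)⟩) ↔
      (⟨g, X⟩ : TangentBundle I G) = ⟨h, Y⟩ ∧ ∀ Z : E, (α : E →L[ℝ] ℝ) Z = (β : E →L[ℝ] ℝ) Z := by
  constructor
  · intro h1
    have h2 : g = h := congrArg TotalSpace.proj h1
    subst h2
    have h3 := TotalSpace.mk_inj.1 h1
    exact ⟨congrArg _ (congrArg Prod.fst h3),
      fun Z => congrArg (fun v : GenTangent I g => (v.2 : E →L[ℝ] ℝ) Z) h3⟩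
  · rintro ⟨h1, h2⟩
    have h3 : g = h := congrArg TotalSpace.proj h1
    subst h3
    exact congrArg _ (Prod.ext (TotalSpace.mk_inj.1 h1) (ContinuousLinearMap.ext h2))

/-- Functionals on two algebroid fibres over possibly different points are tested on the same
element `u` of `E`, with a kernel condition for each fibre, so that no transport is needed. -/
lemma genBaseTotal_mk_eq_iff {x y : M} {v : TangentSpace I' x} {w : TangentSpace I' y}
    {ξ : 𝒢.DualAlgebroid x} {η : 𝒢.DualAlgebroid y} :
    ((⟨x, (v, ξ)⟩ : 𝒢.GenBaseTotal) = ⟨y, (w, η)⟩) ↔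
      (⟨x, v⟩ : TangentBundle I' M) = ⟨y, w⟩ ∧
        ∀ (u : E) (hu : mfderiv I I' 𝒢.src (𝒢.unit x) u = 0)
          (hu' : mfderiv I I' 𝒢.src (𝒢.unit y) u = 0), ξ ⟨u, hu⟩ = η ⟨u, hu'⟩ := by
  constructor
  · intro h1
    have h2 : x = y := congrArg TotalSpace.proj h1
    subst h2
    have h3 := TotalSpace.mk_inj.1 h1
    exact ⟨congrArg _ (congrArg Prod.fst h3),
      fun u hu _ => congrArg (fun v : 𝒢.GenBase x => v.2 ⟨u, hu⟩) h3⟩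
  · rintro ⟨h1, h2⟩
    have h3 : x = y := congrArg TotalSpace.proj h1
    subst h3
    exact congrArg _ (Prod.ext (TotalSpace.mk_inj.1 h1)
      (ContinuousLinearMap.ext fun u => h2 u.1 u.2 u.2))

lemma cSrc_apply (g : G) (α : Cotangent I g) (u : E)
    (hu : mfderiv I I' 𝒢.src (𝒢.unit (𝒢.src g)) u = 0) :
    𝒢.cSrc g α ⟨u, hu⟩ = α (𝒢.leftInvariant g u) := rfl

lemma cTgt_apply (g : G) (α : Cotangent I g) (u : E)
    (hu : mfderiv I I' 𝒢.src (𝒢.unit (𝒢.tgt g)) u = 0) :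
    𝒢.cTgt g α ⟨u, hu⟩ = α (𝒢.rightTranslation g u) := rfl

/-- The projected vector is a separate variable `u` with its own membership proof, so that it can be
simplified without rewriting inside the subtype. -/
lemma cUnit_apply {x : M} (ξ : 𝒢.DualAlgebroid x) {Z u : TangentSpace I (𝒢.unit x)}
    (hu : mfderiv I I' 𝒢.src (𝒢.unit x) u = 0) (h : Z - 𝒢.unitSrc x Z = u) :
    𝒢.cUnit x ξ Z = ξ ⟨u, hu⟩ := by
  subst h; rfl

lemma tangent_mk_leftInvariant (g : G) (u : TangentSpace I (𝒢.unit (𝒢.src g))) :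
    (⟨g, 𝒢.leftInvariant g u⟩ : TangentBundle I G) =
      𝒢.tangentGroupoid.mul ⟨g, 0⟩
        ⟨𝒢.unit (𝒢.src g), u - 𝒢.unitTgt (𝒢.src g) u⟩ :=
  𝒢.tangent_mk_leftTranslation g _

lemma genComposable_iff {g h : G} {a : GenTangent I g} {b : GenTangent I h} :
    𝒢.GenComposable g h a b ↔
      𝒢.tangentGroupoid.src ⟨g, a.1⟩ = 𝒢.tangentGroupoid.tgt ⟨h, b.1⟩ ∧
        ∀ (u : E) (_ : mfderiv I I' 𝒢.src (𝒢.unit (𝒢.src g)) u = 0)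
          (_ : mfderiv I I' 𝒢.src (𝒢.unit (𝒢.tgt h)) u = 0),
          a.2 (𝒢.leftInvariant g u) = b.2 (𝒢.rightTranslation h u) :=
  𝒢.genBaseTotal_mk_eq_iff

/-- A product of covectors exists precisely for composable covectors. -/
lemma exists_isCotangentProduct_iff {g h : G} (hgh : 𝒢.src g = 𝒢.tgt h)
    (α : Cotangent I g) (β : Cotangent I h) :
    (∃ γ, 𝒢.IsCotangentProduct g h α β γ) ↔
      ∀ (u : E) (_ : mfderiv I I' 𝒢.src (𝒢.unit (𝒢.src g)) u = 0)
          (_ : mfderiv I I' 𝒢.src (𝒢.unit (𝒢.tgt h)) u = 0),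
          α (𝒢.leftInvariant g u) = β (𝒢.rightTranslation h u) := by
  constructor
  · rintro ⟨γ, hγ⟩ u hu hu'
    obtain ⟨h1, h2⟩ := 𝒢.translation_mul_translation hgh hu hu'
    have h3 := hγ _ _ h1
    rw [h2, γ.map_zero, β.map_neg] at h3
    linarith
  · intro hαβ
    -- `T` is the tangent space of `G_(2)`. The functional `φ = α + β` on `T` has to be factored
    -- through the surjection `m : T → T_{gh} G`.
    let T : Submodule ℝ (E × E) :=
      { carrier := {p | 𝒢.tangentGroupoid.src ⟨g, p.1⟩ = 𝒢.tangentGroupoid.tgt ⟨h, p.2⟩}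
        add_mem' := by
          rintro p q hp hq
          refine 𝒢.tangent_composable_iff.2 ⟨hgh, ?_⟩
          refine ((mfderiv I I' 𝒢.src g).map_add p.1 q.1).trans
            (Eq.trans ?_ ((mfderiv I I' 𝒢.tgt h).map_add p.2 q.2).symm)
          exact congrArg₂ _ (𝒢.tangent_composable_iff.1 hp).2 (𝒢.tangent_composable_iff.1 hq).2
        zero_mem' := by
          change 𝒢.tangentGroupoid.src ⟨g, 0⟩ = 𝒢.tangentGroupoid.tgt ⟨h, 0⟩
          rw [𝒢.tangent_src_zero, 𝒢.tangent_tgt_zero, hgh]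
        smul_mem' := by
          rintro c p hp
          refine 𝒢.tangent_composable_iff.2 ⟨hgh, ?_⟩
          refine ((mfderiv I I' 𝒢.src g).map_smul c p.1).trans
            (Eq.trans ?_ ((mfderiv I I' 𝒢.tgt h).map_smul c p.2).symm)
          exact congrArg (c • ·) (𝒢.tangent_composable_iff.1 hp).2 }
    let m : T →ₗ[ℝ] E := ((show E × E →L[ℝ] E from 𝒢.dMul g h) : E × E →ₗ[ℝ] E).comp T.subtype
    let φ : T →ₗ[ℝ] ℝ := (((show E →L[ℝ] ℝ from α).coprod (show E →L[ℝ] ℝ from β) : E × E →L[ℝ] ℝ) :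
      E × E →ₗ[ℝ] ℝ).comp T.subtype
    have hm : Function.Surjective m := by
      intro Z
      obtain ⟨X, Y, h1, h2⟩ := 𝒢.exists_tMul_eq hgh Z
      exact ⟨⟨(X, Y), h1⟩, h2⟩
    -- On a kernel element `(Tl_g (u - Tt u), -Tr_h u)` the value of `φ` is the difference of the
    -- source of `α` and the target of `β` at `u`.
    have hφ : ∀ p, m p = 0 → φ p = 0 := by
      rintro ⟨⟨X, Y⟩, hp⟩ h0
      obtain ⟨u, hu, hu', h1, h2⟩ := 𝒢.exists_of_tMul_eq_zero hp h0
      have h3 := hαβ u hu hu'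
      have h4 : φ ⟨⟨X, Y⟩, hp⟩ = (α : E →L[ℝ] ℝ) X + (β : E →L[ℝ] ℝ) Y := rfl
      have h5 : (α : E →L[ℝ] ℝ) X = (β : E →L[ℝ] ℝ) (𝒢.rightTranslation h u) :=
        (congrArg α h1).trans h3
      have h6 : (β : E →L[ℝ] ℝ) Y = - (β : E →L[ℝ] ℝ) (𝒢.rightTranslation h u) :=
        (congrArg β h2).trans (β.map_neg _)
      rw [h4, h5, h6, add_neg_cancel]
    -- Any linear right inverse `s` of `m` gives the product `φ ∘ s`, the choice being irrelevant
    -- because `φ` vanishes on the kernel.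
    obtain ⟨s, hs⟩ := LinearMap.exists_rightInverse_of_surjective m (LinearMap.range_eq_top.2 hm)
    refine ⟨(LinearMap.toContinuousLinearMap (φ ∘ₗ s) : E →L[ℝ] ℝ), fun X Y hXY => ?_⟩
    have h1 : m (s (m ⟨(X, Y), hXY⟩) - ⟨(X, Y), hXY⟩) = 0 := by
      rw [map_sub, sub_eq_zero]
      exact congrArg (fun f : E →ₗ[ℝ] E => f (m ⟨(X, Y), hXY⟩)) hs
    have h2 := hφ _ h1
    rw [map_sub, sub_eq_zero] at h2
    exact h2

/-- Every tangent vector at `gh` is a product, so the defining equation leaves no freedom. This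
makes the choice in `cMul` harmless. -/
lemma IsCotangentProduct.unique {g h : G} (hgh : 𝒢.src g = 𝒢.tgt h) {α : Cotangent I g}
    {β : Cotangent I h} {γ γ' : Cotangent I (𝒢.mul g h)} (h1 : 𝒢.IsCotangentProduct g h α β γ)
    (h2 : 𝒢.IsCotangentProduct g h α β γ') : γ = γ' := by
  ext Z
  obtain ⟨X, Y, hXY, rfl⟩ := 𝒢.exists_tMul_eq hgh Z
  rw [h1 X Y hXY, h2 X Y hXY]

lemma cMul_eq {g h : G} (hgh : 𝒢.src g = 𝒢.tgt h) {α : Cotangent I g}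
    {β : Cotangent I h} {γ : Cotangent I (𝒢.mul g h)} (h1 : 𝒢.IsCotangentProduct g h α β γ) :
    𝒢.cMul g h α β = γ := by
  have h : ∃ γ, 𝒢.IsCotangentProduct g h α β γ := ⟨γ, h1⟩
  rw [cMul, dif_pos h]
  exact IsCotangentProduct.unique 𝒢 hgh h.choose_spec h1

lemma GenComposable.src_eq {g h : G} {a : GenTangent I g} {b : GenTangent I h}
    (hab : 𝒢.GenComposable g h a b) : 𝒢.src g = 𝒢.tgt h :=
  congrArg TotalSpace.proj hab

lemma isCotangentProduct_cMul {g h : G} {a : GenTangent I g} {b : GenTangent I h}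
    (hab : 𝒢.GenComposable g h a b) : 𝒢.IsCotangentProduct g h a.2 b.2 (𝒢.cMul g h a.2 b.2) := by
  have h : ∃ γ, 𝒢.IsCotangentProduct g h a.2 b.2 γ :=
    (𝒢.exists_isCotangentProduct_iff (GenComposable.src_eq 𝒢 hab) _ _).2
      (𝒢.genComposable_iff.1 hab).2
  rw [cMul, dif_pos h]
  exact h.choose_spec

/-- Form of the defining equation for vectors that are known to sit over `g` and `h` only up to a
proved equality. -/
lemma IsCotangentProduct.eval {g h : G} {α : Cotangent I g}
    {β : Cotangent I h} {γ : Cotangent I (𝒢.mul g h)} (h1 : 𝒢.IsCotangentProduct g h α β γ)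
    {X Y : TangentBundle I G} (hX : X.1 = g) (hY : Y.1 = h)
    (hXY : 𝒢.tangentGroupoid.src X = 𝒢.tangentGroupoid.tgt Y) :
    covectorEval γ (𝒢.tangentGroupoid.mul X Y) = covectorEval α X + covectorEval β Y := by
  obtain ⟨g', X⟩ := X
  obtain ⟨h', Y⟩ := Y
  obtain rfl : g' = g := hX
  obtain rfl : h' = h := hY
  exact h1 X Y hXY

/-- The covector product is a choice, so its linearity comes from uniqueness: the linear combination
of the two products satisfies the defining equation of the new one. -/
lemma genMul_smul_add (g h : G) (a a' : GenTangent I g) (b b' : GenTangent I h) (r : ℝ)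
    (hab : 𝒢.GenComposable g h a b) (hab' : 𝒢.GenComposable g h a' b') :
    𝒢.genMul g h (a + r • a') (b + r • b') = 𝒢.genMul g h a b + r • 𝒢.genMul g h a' b' := by
  refine Prod.ext ?_ ?_
  · refine (𝒢.tMul_add g h a.1 (r • a'.1) b.1 (r • b'.1)).trans ?_
    rw [𝒢.tMul_smul]
    rfl
  · refine 𝒢.cMul_eq (GenComposable.src_eq 𝒢 hab) fun X Y hXY => ?_
    have h1 := 𝒢.isCotangentProduct_cMul hab X Y hXY
    have h2 := 𝒢.isCotangentProduct_cMul hab' X Y hXY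
    change 𝒢.cMul g h a.2 b.2 _ + r * 𝒢.cMul g h a'.2 b'.2 _ =
      (a.2 X + r * a'.2 X) + (b.2 Y + r * b'.2 Y)
    rw [h1, h2]
    ring

/-! ### The groupoid axioms of `𝕋G`. -/

lemma leftInvariant_unit (x : M) {u : E} (hu : mfderiv I I' 𝒢.src (𝒢.unit x) u = 0) :
    𝒢.leftInvariant (𝒢.unit x) u = tangentVec I (𝒢.unit x) u - 𝒢.unitTgt x u := by
  have h1 := 𝒢.tangent_mk_leftInvariant (𝒢.unit x) u
  have hx : ∀ y, y = x →
      (⟨𝒢.unit y, tangentVec I (𝒢.unit y) u - 𝒢.unitTgt y u⟩ : TangentBundle I G)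
      = ⟨𝒢.unit x, tangentVec I (𝒢.unit x) u - 𝒢.unitTgt x u⟩ := by rintro _ rfl; rfl
  replace h1 := h1.trans (congrArg _ (hx _ (𝒢.isLieGroupoid.src_unit x)))
  have h2 := 𝒢.tangent_unit_mul ⟨𝒢.unit x, tangentVec I (𝒢.unit x) u - 𝒢.unitTgt x u⟩
  have h3 : 𝒢.tangentGroupoid.tgt ⟨𝒢.unit x, tangentVec I (𝒢.unit x) u - 𝒢.unitTgt x u⟩ =
      ⟨x, 0⟩ := 𝒢.tangent_tgt_sub_unitTgt x u
  rw [h3, 𝒢.tangent_unit_zero] at h2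
  exact (tangentBundle_mk_eq_iff.1 (h1.trans h2)).2

lemma rightTranslation_unit (x : M) {u : E} (hu : mfderiv I I' 𝒢.src (𝒢.unit x) u = 0) :
    (𝒢.rightTranslation (𝒢.unit x) u : E) = u := by
  have h1 := 𝒢.tangent_mk_rightTranslation (𝒢.unit x) u
  have hx : ∀ y, y = x → (⟨𝒢.unit y, u⟩ : TangentBundle I G)
    = ⟨𝒢.unit x, u⟩ := by rintro _ rfl; rfl
  replace h1 := h1.trans (congrArg (fun Z => 𝒢.tangentGroupoid.mul Z _)
    (hx _ (𝒢.isLieGroupoid.tgt_unit x)))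
  have h2 := 𝒢.tangent_mul_unit ⟨𝒢.unit x, u⟩
  rw [𝒢.tangent_src_algebroid hu, 𝒢.tangent_unit_zero] at h2
  exact (tangentBundle_mk_eq_iff.1 (h1.trans h2)).2

/-- The vector `u - T1 (Tt u)` projects to `u` along `T_x M`: here `Ts u = 0`, while `T1 (Tt u)` is
tangent to the units and is removed. -/
lemma gen_src_unit (ξ : 𝒢.GenBaseTotal) : 𝒢.genGroupoid.src (𝒢.genGroupoid.unit ξ) = ξ := by
  obtain ⟨x, v, ξ⟩ := ξ
  refine 𝒢.genBaseTotal_mk_eq_iff.2 ⟨𝒢.tangent_src_unit ⟨x, v⟩, fun u hu hu' => ?_⟩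
  refine (𝒢.cSrc_apply _ _ u hu).trans (𝒢.cUnit_apply ξ hu' ?_)
  change 𝒢.leftInvariant (𝒢.unit x) u - 𝒢.unitSrc x (𝒢.leftInvariant (𝒢.unit x) u) = _
  rw [𝒢.leftInvariant_unit x hu']
  refine (congrArg (fun z => tangentVec I (𝒢.unit x) u - 𝒢.unitTgt x u - z)
    ((𝒢.unitSrc x).map_sub _ _)).trans ?_
  rw [𝒢.unitSrc_algebroid hu', show 𝒢.unitSrc x (𝒢.unitTgt x (tangentVec I (𝒢.unit x) u)) = _
    from 𝒢.unitSrc_unitTgt x _, zero_sub, sub_neg_eq_add, sub_add_cancel]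

lemma gen_tgt_unit (ξ : 𝒢.GenBaseTotal) : 𝒢.genGroupoid.tgt (𝒢.genGroupoid.unit ξ) = ξ := by
  obtain ⟨x, v, ξ⟩ := ξ
  refine 𝒢.genBaseTotal_mk_eq_iff.2 ⟨𝒢.tangent_tgt_unit ⟨x, v⟩, fun u hu hu' => ?_⟩
  refine (𝒢.cTgt_apply _ _ u hu).trans (𝒢.cUnit_apply ξ hu' ?_)
  change 𝒢.rightTranslation (𝒢.unit x) u - 𝒢.unitSrc x (𝒢.rightTranslation (𝒢.unit x) u) = _
  have h1 : 𝒢.rightTranslation (𝒢.unit x) u = tangentVec I (𝒢.unit x) u :=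
    𝒢.rightTranslation_unit x hu'
  rw [h1, 𝒢.unitSrc_algebroid hu', sub_zero]

/-- The left-invariant vector of `u` at `gh` is `0_g • Z`, with `Z` the left-invariant vector of `u`
at `h`; the product covector therefore sees only its second factor on it. -/
lemma gen_src_mul (v w : 𝒢.GenTotal) (h : 𝒢.genGroupoid.src v = 𝒢.genGroupoid.tgt w) :
    𝒢.genGroupoid.src (𝒢.genGroupoid.mul v w) = 𝒢.genGroupoid.src w := by
  obtain ⟨g, X, α⟩ := v
  obtain ⟨h', Y, β⟩ := w
  have hc : 𝒢.GenComposable g h' (X, α) (Y, β) := h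
  have hgh := GenComposable.src_eq 𝒢 hc
  have hT := (𝒢.genComposable_iff.1 hc).1
  refine 𝒢.genBaseTotal_mk_eq_iff.2 ⟨𝒢.tangent_src_mul _ _ hT, fun u hu hu' => ?_⟩
  have hs := 𝒢.isLieGroupoid.src_mul _ _ hgh
  refine (𝒢.cSrc_apply _ _ u hu).trans (Eq.trans ?_ (𝒢.cSrc_apply h' β u hu').symm)
  set w := tangentVec I (𝒢.unit (𝒢.src h')) u - 𝒢.unitTgt (𝒢.src h') u
  have hw : 𝒢.tangentGroupoid.tgt ⟨𝒢.unit (𝒢.src h'), w⟩ = ⟨𝒢.src h', 0⟩ :=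
    𝒢.tangent_tgt_sub_unitTgt (𝒢.src h') u
  have hx : ∀ y, y = 𝒢.src h' →
      (⟨𝒢.unit y, tangentVec I (𝒢.unit y) u - 𝒢.unitTgt y u⟩ : TangentBundle I G)
      = ⟨𝒢.unit (𝒢.src h'), w⟩ := by rintro _ rfl; rfl
  have h1 : (⟨𝒢.mul g h', 𝒢.leftInvariant (𝒢.mul g h') u⟩ : TangentBundle I G) =
      𝒢.tangentGroupoid.mul ⟨𝒢.mul g h', 0⟩ ⟨𝒢.unit (𝒢.src h'), w⟩ :=
    (𝒢.tangent_mk_leftInvariant (𝒢.mul g h') u).trans (congrArg _ (hx _ hs))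
  have h2 : (⟨h', 𝒢.leftInvariant h' u⟩ : TangentBundle I G) =
      𝒢.tangentGroupoid.mul ⟨h', 0⟩ ⟨𝒢.unit (𝒢.src h'), w⟩ :=
    𝒢.tangent_mk_leftInvariant h' u
  have c1 : 𝒢.tangentGroupoid.src ⟨g, 0⟩ = 𝒢.tangentGroupoid.tgt ⟨h', 0⟩ := by
    rw [𝒢.tangent_src_zero, 𝒢.tangent_tgt_zero, hgh]
  have c2 : 𝒢.tangentGroupoid.src ⟨h', 0⟩ =
      𝒢.tangentGroupoid.tgt ⟨𝒢.unit (𝒢.src h'), w⟩ := by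
    rw [𝒢.tangent_src_zero, hw]
  have h3 : (⟨𝒢.mul g h', 𝒢.leftInvariant (𝒢.mul g h') u⟩ : TangentBundle I G) =
      𝒢.tangentGroupoid.mul ⟨g, 0⟩ ⟨h', 𝒢.leftInvariant h' u⟩ := by
    rw [h1, h2, ← 𝒢.tangent_mul_zero, 𝒢.tangent_mul_assoc _ _ _ c1 c2]
  have h4 := IsCotangentProduct.eval 𝒢 (𝒢.isCotangentProduct_cMul hc) (X := ⟨g, 0⟩)
    (Y := ⟨h', 𝒢.leftInvariant h' u⟩) rfl rfl (by
      rw [h2, 𝒢.tangent_tgt_mul _ _ c2, c1])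
  rw [← h3, covectorEval_zero, zero_add] at h4
  exact h4

/-- Mirror image: the right translate at `gh` is the right translate at `g` multiplied by `0_h`. -/
lemma gen_tgt_mul (v w : 𝒢.GenTotal) (h : 𝒢.genGroupoid.src v = 𝒢.genGroupoid.tgt w) :
    𝒢.genGroupoid.tgt (𝒢.genGroupoid.mul v w) = 𝒢.genGroupoid.tgt v := by
  obtain ⟨g, X, α⟩ := v
  obtain ⟨h', Y, β⟩ := w
  have hc : 𝒢.GenComposable g h' (X, α) (Y, β) := h
  have hgh := GenComposable.src_eq 𝒢 hc
  have hT := (𝒢.genComposable_iff.1 hc).1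
  refine 𝒢.genBaseTotal_mk_eq_iff.2 ⟨𝒢.tangent_tgt_mul _ _ hT, fun u hu hu' => ?_⟩
  have hs := 𝒢.isLieGroupoid.tgt_mul _ _ hgh
  refine (𝒢.cTgt_apply _ _ u hu).trans (Eq.trans ?_ (𝒢.cTgt_apply g α u hu').symm)
  have hw : 𝒢.tangentGroupoid.src ⟨𝒢.unit (𝒢.tgt g), u⟩ = ⟨𝒢.tgt g, 0⟩ :=
    𝒢.tangent_src_algebroid hu'
  have hx : ∀ y, y = 𝒢.tgt g →
      (⟨𝒢.unit y, u⟩ : TangentBundle I G) = ⟨𝒢.unit (𝒢.tgt g), u⟩ := by rintro _ rfl; rfl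
  have h1 : (⟨𝒢.mul g h', 𝒢.rightTranslation (𝒢.mul g h') u⟩ : TangentBundle I G) =
      𝒢.tangentGroupoid.mul ⟨𝒢.unit (𝒢.tgt g), u⟩ ⟨𝒢.mul g h', 0⟩ :=
    (𝒢.tangent_mk_rightTranslation (𝒢.mul g h') u).trans
      (congrArg (fun Z => 𝒢.tangentGroupoid.mul Z _) (hx _ hs))
  have h2 : (⟨g, 𝒢.rightTranslation g u⟩ : TangentBundle I G) =
      𝒢.tangentGroupoid.mul ⟨𝒢.unit (𝒢.tgt g), u⟩ ⟨g, 0⟩ :=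
    𝒢.tangent_mk_rightTranslation g u
  have c1 : 𝒢.tangentGroupoid.src ⟨g, 0⟩ = 𝒢.tangentGroupoid.tgt ⟨h', 0⟩ := by
    rw [𝒢.tangent_src_zero, 𝒢.tangent_tgt_zero, hgh]
  have c2 : 𝒢.tangentGroupoid.src ⟨𝒢.unit (𝒢.tgt g), u⟩ =
      𝒢.tangentGroupoid.tgt ⟨g, 0⟩ := by
    rw [𝒢.tangent_tgt_zero, hw]
  have h3 : (⟨𝒢.mul g h', 𝒢.rightTranslation (𝒢.mul g h') u⟩ : TangentBundle I G) =
      𝒢.tangentGroupoid.mul ⟨g, 𝒢.rightTranslation g u⟩ ⟨h', 0⟩ := by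
    rw [h1, h2, ← 𝒢.tangent_mul_zero, 𝒢.tangent_mul_assoc _ _ _ c2 c1]
  have h4 := IsCotangentProduct.eval 𝒢 (𝒢.isCotangentProduct_cMul hc) (X := ⟨g, 𝒢.rightTranslation g u⟩)
    (Y := ⟨h', 0⟩) rfl rfl (by
      rw [h2, 𝒢.tangent_src_mul _ _ c2, c1])
  rw [← h3, covectorEval_zero, add_zero] at h4
  exact h4

/-- Every vector at the triple product is `(Y₁ • Y₂) • Y₃`, and on it both covectors take the value
`α₁ Y₁ + α₂ Y₂ + α₃ Y₃`. -/
lemma gen_mul_assoc (v w z : 𝒢.GenTotal) (h : 𝒢.genGroupoid.src v = 𝒢.genGroupoid.tgt w)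
    (h' : 𝒢.genGroupoid.src w = 𝒢.genGroupoid.tgt z) :
    𝒢.genGroupoid.mul (𝒢.genGroupoid.mul v w) z =
      𝒢.genGroupoid.mul v (𝒢.genGroupoid.mul w z) := by
  have hvwz : 𝒢.genGroupoid.src (𝒢.genGroupoid.mul v w) = 𝒢.genGroupoid.tgt z := by
    rw [𝒢.gen_src_mul v w h, h']
  have hvwz' : 𝒢.genGroupoid.src v = 𝒢.genGroupoid.tgt (𝒢.genGroupoid.mul w z) := by
    rw [𝒢.gen_tgt_mul w z h', h]
  obtain ⟨g₁, X₁, α₁⟩ := v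
  obtain ⟨g₂, X₂, α₂⟩ := w
  obtain ⟨g₃, X₃, α₃⟩ := z
  have c12 : 𝒢.GenComposable g₁ g₂ (X₁, α₁) (X₂, α₂) := h
  have c23 : 𝒢.GenComposable g₂ g₃ (X₂, α₂) (X₃, α₃) := h'
  have d12 := GenComposable.src_eq 𝒢 c12
  have d23 := GenComposable.src_eq 𝒢 c23
  have p12 := 𝒢.isCotangentProduct_cMul c12
  have p23 := 𝒢.isCotangentProduct_cMul c23
  have p12_3 := 𝒢.isCotangentProduct_cMul hvwz
  have p1_23 := 𝒢.isCotangentProduct_cMul hvwz'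
  refine genTotal_mk_eq_iff.2 ⟨𝒢.tangent_mul_assoc ⟨g₁, X₁⟩ ⟨g₂, X₂⟩ ⟨g₃, X₃⟩
    (𝒢.genComposable_iff.1 c12).1 (𝒢.genComposable_iff.1 c23).1, fun Z => ?_⟩
  have e123 : 𝒢.src (𝒢.mul g₁ g₂) = 𝒢.tgt g₃ := by rw [𝒢.isLieGroupoid.src_mul _ _ d12, d23]
  obtain ⟨W, Y₃, hW, hZ⟩ := 𝒢.exists_tMul_eq e123 Z
  obtain ⟨Y₁, Y₂, hY, rfl⟩ := 𝒢.exists_tMul_eq d12 W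
  have hY23 : 𝒢.tangentGroupoid.src ⟨g₂, Y₂⟩ = 𝒢.tangentGroupoid.tgt ⟨g₃, Y₃⟩ := by
    rw [← 𝒢.tangent_src_mul _ _ hY, 𝒢.tangent_mul_mk, hW]
  have q1 := IsCotangentProduct.eval 𝒢 p12_3 (X := 𝒢.tangentGroupoid.mul ⟨g₁, Y₁⟩ ⟨g₂, Y₂⟩) (Y := ⟨g₃, Y₃⟩) rfl rfl hW
  have q2 := IsCotangentProduct.eval 𝒢 p12 (X := ⟨g₁, Y₁⟩) (Y := ⟨g₂, Y₂⟩) rfl rfl hY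
  have q3 := IsCotangentProduct.eval 𝒢 p1_23 (X := ⟨g₁, Y₁⟩) (Y := 𝒢.tangentGroupoid.mul ⟨g₂, Y₂⟩ ⟨g₃, Y₃⟩) rfl rfl
    (by rw [𝒢.tangent_tgt_mul _ _ hY23, hY])
  have q4 := IsCotangentProduct.eval 𝒢 p23 (X := ⟨g₂, Y₂⟩) (Y := ⟨g₃, Y₃⟩) rfl rfl hY23
  have hass := 𝒢.tangent_mul_assoc _ _ _ hY hY23
  have hZ' : 𝒢.tangentGroupoid.mul (𝒢.tangentGroupoid.mul ⟨g₁, Y₁⟩ ⟨g₂, Y₂⟩) ⟨g₃, Y₃⟩ =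
    ⟨𝒢.mul (𝒢.mul g₁ g₂) g₃, Z⟩ := tangentBundle_mk_eq_iff.2 ⟨rfl, hZ⟩
  rw [← hass] at q3
  rw [hZ'] at q1 q3
  refine Eq.trans (q1.trans ?_) q3.symm
  erw [q2, q4]
  exact add_assoc _ _ _

/-- Split `W • Y = (W - T1 (Ts W)) • 0 + T1 (Ts W) • Y`. The first term is the right translate on
which the unit covector is evaluated, and the second is `Y`. -/
lemma gen_unit_mul (v : 𝒢.GenTotal) :
    𝒢.genGroupoid.mul (𝒢.genGroupoid.unit (𝒢.genGroupoid.tgt v)) v = v := by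
  obtain ⟨g, X, α⟩ := v
  have e := 𝒢.isLieGroupoid.src_unit (𝒢.tgt g)
  refine genTotal_mk_eq_iff.2 ⟨𝒢.tangent_unit_mul ⟨g, X⟩, fun Z => ?_⟩
  have key : 𝒢.cMul (𝒢.unit (𝒢.tgt g)) g (𝒢.cUnit (𝒢.tgt g) (𝒢.cTgt g α)) α =
      (α : E →L[ℝ] ℝ) := by
    refine 𝒢.cMul_eq e fun W Y hWY => ?_
    have h1 : 𝒢.cUnit (𝒢.tgt g) (𝒢.cTgt g α) W =
        α (𝒢.rightTranslation g (W - 𝒢.unitSrc (𝒢.tgt g) W)) := rfl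
    rw [h1]
    refine Eq.trans (?_ : _ = (α : E →L[ℝ] ℝ) _) ((α : E →L[ℝ] ℝ).map_add _ Y)
    congr 1
    have h2 : 𝒢.tMul (𝒢.unit (𝒢.tgt g)) g W Y =
        𝒢.tMul (𝒢.unit (𝒢.tgt g)) g (W - 𝒢.unitSrc (𝒢.tgt g) W) 0 +
        𝒢.tMul (𝒢.unit (𝒢.tgt g)) g (𝒢.unitSrc (𝒢.tgt g) W) Y := by
      rw [← 𝒢.tMul_add, sub_add_cancel, zero_add]
    refine h2.trans (congrArg₂ (fun a b : E => a + b) rfl ?_)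
    have h3 : 𝒢.tangentGroupoid.mul ⟨𝒢.unit (𝒢.tgt g), 𝒢.unitSrc (𝒢.tgt g) W⟩ ⟨g, Y⟩ = ⟨g, Y⟩ := by
      rw [𝒢.tangent_mk_unitSrc, hWY, 𝒢.tangent_unit_mul]
    exact (tangentBundle_mk_eq_iff.1 h3).2
  exact congrArg (fun L : E →L[ℝ] ℝ => L Z) key

lemma gen_mul_unit (v : 𝒢.GenTotal) :
    𝒢.genGroupoid.mul v (𝒢.genGroupoid.unit (𝒢.genGroupoid.src v)) = v := by
  obtain ⟨g, X, α⟩ := v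
  have e := (𝒢.isLieGroupoid.tgt_unit (𝒢.src g)).symm
  refine genTotal_mk_eq_iff.2 ⟨𝒢.tangent_mul_unit ⟨g, X⟩, fun Z => ?_⟩
  have key : 𝒢.cMul g (𝒢.unit (𝒢.src g)) α (𝒢.cUnit (𝒢.src g) (𝒢.cSrc g α)) =
      (α : E →L[ℝ] ℝ) := by
    refine 𝒢.cMul_eq e fun W Y hWY => ?_
    have h1 : 𝒢.cUnit (𝒢.src g) (𝒢.cSrc g α) Y =
        α (𝒢.leftInvariant g (Y - 𝒢.unitSrc (𝒢.src g) Y)) := rfl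
    rw [h1]
    refine Eq.trans (?_ : _ = (α : E →L[ℝ] ℝ) _) ((α : E →L[ℝ] ℝ).map_add W _)
    congr 1
    -- The splitting is now along `T1 ∘ Tt`: the first product is `W`, the second a left translate.
    have h2 : 𝒢.tMul g (𝒢.unit (𝒢.src g)) W Y =
        𝒢.tMul g (𝒢.unit (𝒢.src g)) W (𝒢.unitTgt (𝒢.src g) Y) +
        𝒢.tMul g (𝒢.unit (𝒢.src g)) 0 (Y - 𝒢.unitTgt (𝒢.src g) Y) := by
      rw [← 𝒢.tMul_add, add_sub_cancel, add_zero]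
    refine h2.trans (congrArg₂ (fun a b : E => a + b) ?_ ?_)
    · have h3 : 𝒢.tangentGroupoid.mul ⟨g, W⟩ ⟨𝒢.unit (𝒢.src g), 𝒢.unitTgt (𝒢.src g) Y⟩ =
          ⟨g, W⟩ := by
        rw [𝒢.tangent_mk_unitTgt, ← hWY, 𝒢.tangent_mul_unit]
      exact (tangentBundle_mk_eq_iff.1 h3).2
    -- The unit covector removes `T1 (Ts Y)`, and the source map then subtracts the image under `T1
    -- ∘ Tt`. As `T1 ∘ Tt` fixes `T1 (Ts Y)`, only `Y - T1 (Tt Y)` remains.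
    · have h3 : Y - 𝒢.unitTgt (𝒢.src g) Y = (Y - 𝒢.unitSrc (𝒢.src g) Y) -
          𝒢.unitTgt (𝒢.src g) (Y - 𝒢.unitSrc (𝒢.src g) Y) := by
        have h4 : 𝒢.unitTgt (𝒢.src g) (𝒢.unitSrc (𝒢.src g) Y) = 𝒢.unitSrc (𝒢.src g) Y := by
          have := 𝒢.tangent_mk_unitTgt (𝒢.src g) (𝒢.unitSrc (𝒢.src g) Y)
          rw [𝒢.tangent_mk_unitSrc, 𝒢.tangent_tgt_unit, ← 𝒢.tangent_mk_unitSrc] at this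
          exact (tangentBundle_mk_eq_iff.1 this).2
        rw [map_sub, h4]
        abel
      rw [h3]
      rfl
  exact congrArg (fun L : E →L[ℝ] ℝ => L Z) key

/-- Differentiating the involution `inv` at `g` and at `g⁻¹` gives both composites. -/
lemma inverse_mfderiv_inv (g : G) :
    ((mfderiv I I 𝒢.inv g).inverse : E →L[ℝ] E) = mfderiv I I 𝒢.inv (𝒢.inv g) := by
  have hinv : ∀ g (X : E), (mfderiv I I 𝒢.inv (𝒢.inv g) : E →L[ℝ] E)
      ((mfderiv I I 𝒢.inv g : E →L[ℝ] E) X) = X := fun g X =>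
    (tangentBundle_mk_eq_iff.1 (𝒢.tangent_inv_inv ⟨g, X⟩)).2
  have hinv' : ∀ X : E, (mfderiv I I 𝒢.inv g : E →L[ℝ] E)
      ((mfderiv I I 𝒢.inv (𝒢.inv g) : E →L[ℝ] E) X) = X := by
    have h1 := hinv (𝒢.inv g)
    have h2 : ∀ k, k = g → (mfderiv I I 𝒢.inv k : E →L[ℝ] E) = mfderiv I I 𝒢.inv g := by
      rintro _ rfl; rfl
    rwa [h2 _ (𝒢.inv_inv g)] at h1
  let L : E ≃L[ℝ] E := ContinuousLinearEquiv.equivOfInverse (mfderiv I I 𝒢.inv g : E →L[ℝ] E)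
    (mfderiv I I 𝒢.inv (𝒢.inv g) : E →L[ℝ] E) (hinv g) hinv'
  have hL : (mfderiv I I 𝒢.inv g : E →L[ℝ] E) = (L : E →L[ℝ] E) := rfl
  have h3 : (mfderiv I I 𝒢.inv (𝒢.inv g) : E →L[ℝ] E) = (L.symm : E →L[ℝ] E) := rfl
  rw [h3, ← ContinuousLinearMap.inverse_equiv L, ← hL]
  rfl

/-- Eliminates the inverse operator of the definition in favour of the inversion of `TG`. -/
lemma cInv_apply (g : G) (α : Cotangent I g) (Z : TangentSpace I (𝒢.inv g)) :
    𝒢.cInv g α Z = - covectorEval α (𝒢.tangentGroupoid.inv ⟨𝒢.inv g, Z⟩) := by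
  have h := 𝒢.inverse_mfderiv_inv g
  have h1 : 𝒢.cInv g α Z = - α ((mfderiv I I 𝒢.inv g).inverse Z) := rfl
  have h2 : ((mfderiv I I 𝒢.inv g).inverse Z : E) = (mfderiv I I 𝒢.inv (𝒢.inv g) : E →L[ℝ] E) Z :=
    congrArg (fun L : E →L[ℝ] E => L Z) h
  exact h1.trans (congrArg (fun z : E => - (α : E →L[ℝ] ℝ) z) h2)

lemma tangent_inv_mul_rev (X Y : TangentBundle I G)
    (h : 𝒢.tangentGroupoid.src X = 𝒢.tangentGroupoid.tgt Y) :
    𝒢.tangentGroupoid.inv (𝒢.tangentGroupoid.mul X Y) =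
      𝒢.tangentGroupoid.mul (𝒢.tangentGroupoid.inv Y) (𝒢.tangentGroupoid.inv X) := by
  set Z := 𝒢.tangentGroupoid.mul X Y with hZ
  set W := 𝒢.tangentGroupoid.mul (𝒢.tangentGroupoid.inv Y) (𝒢.tangentGroupoid.inv X) with hW
  have c : 𝒢.tangentGroupoid.src (𝒢.tangentGroupoid.inv Y) =
      𝒢.tangentGroupoid.tgt (𝒢.tangentGroupoid.inv X) := by
    rw [𝒢.tangent_src_inv, 𝒢.tangent_tgt_inv, h]
  have hWs : 𝒢.tangentGroupoid.src W = 𝒢.tangentGroupoid.tgt X := by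
    rw [hW, 𝒢.tangent_src_mul _ _ c, 𝒢.tangent_src_inv]
  have hWt : 𝒢.tangentGroupoid.tgt W = 𝒢.tangentGroupoid.src Y := by
    rw [hW, 𝒢.tangent_tgt_mul _ _ c, 𝒢.tangent_tgt_inv]
  have hZs : 𝒢.tangentGroupoid.src Z = 𝒢.tangentGroupoid.src Y := 𝒢.tangent_src_mul _ _ h
  have hZt : 𝒢.tangentGroupoid.tgt Z = 𝒢.tangentGroupoid.tgt X := 𝒢.tangent_tgt_mul _ _ h
  have hm : 𝒢.tangentGroupoid.mul Z W =
      𝒢.tangentGroupoid.unit (𝒢.tangentGroupoid.tgt X) := by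
    rw [hZ, 𝒢.tangent_mul_assoc _ _ _ h hWt.symm, hW,
      ← 𝒢.tangent_mul_assoc Y _ _ (by rw [𝒢.tangent_tgt_inv]) c, 𝒢.tangent_mul_inv, ← h,
      ← 𝒢.tangent_tgt_inv, 𝒢.tangent_unit_mul, 𝒢.tangent_mul_inv]
  have h1 := 𝒢.tangent_mul_assoc (𝒢.tangentGroupoid.inv Z) Z W (by rw [𝒢.tangent_src_inv])
    (by rw [hZs, hWt])
  rw [hm, 𝒢.tangent_inv_mul, hZs, ← hWt, 𝒢.tangent_unit_mul, ← hZt, ← 𝒢.tangent_src_inv,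
    𝒢.tangent_mul_unit] at h1
  exact h1.symm

/-- Inversion takes the left-invariant vector of `u` at `g⁻¹` to the right translate of `-u` at `g`.
The sign cancels the one in the definition of the inverse covector. -/
lemma gen_src_inv (v : 𝒢.GenTotal) :
    𝒢.genGroupoid.src (𝒢.genGroupoid.inv v) = 𝒢.genGroupoid.tgt v := by
  obtain ⟨g, X, α⟩ := v
  refine 𝒢.genBaseTotal_mk_eq_iff.2 ⟨𝒢.tangent_src_inv ⟨g, X⟩, fun u hu hu' => ?_⟩
  refine (𝒢.cSrc_apply _ _ u hu).trans (Eq.trans ?_ (𝒢.cTgt_apply g α u hu').symm)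
  refine (𝒢.cInv_apply g α _).trans ?_
  have hw : 𝒢.tangentGroupoid.tgt ⟨𝒢.unit (𝒢.src (𝒢.inv g)),
      
      tangentVec I (𝒢.unit (𝒢.src (𝒢.inv g))) u - 𝒢.unitTgt (𝒢.src (𝒢.inv g)) u⟩ = ⟨𝒢.src (𝒢.inv g), 0⟩ :=
    𝒢.tangent_tgt_sub_unitTgt (𝒢.src (𝒢.inv g)) u
  have hc := 𝒢.tangent_composable_left hw
  have h1 : (⟨𝒢.inv g, 𝒢.leftInvariant (𝒢.inv g) u⟩ : TangentBundle I G) = _ :=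
    𝒢.tangent_mk_leftInvariant (𝒢.inv g) u
  have h2 : 𝒢.tangentGroupoid.inv ⟨𝒢.inv g, 𝒢.leftInvariant (𝒢.inv g) u⟩ =
      𝒢.tangentGroupoid.mul ⟨𝒢.unit (𝒢.tgt g), -u⟩ ⟨g, 0⟩ := by
    refine (congrArg _ h1).trans ((𝒢.tangent_inv_mul_rev _ _ hc).trans ?_)
    refine congrArg₂ _ ((𝒢.tangent_inv_sub_unitTgt hu).trans ?_) ?_
    · exact tangentBundle_mk_eq_iff.2
        ⟨congrArg 𝒢.unit (𝒢.isLieGroupoid.src_inv g), rfl⟩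
    · rw [𝒢.tangent_inv_zero, 𝒢.inv_inv]
  refine (congrArg (fun W => - covectorEval α W) h2).trans ?_
  have h3 : 𝒢.tangentGroupoid.mul ⟨𝒢.unit (𝒢.tgt g), -u⟩ ⟨g, 0⟩ =
      ⟨g, 𝒢.rightTranslation g (-u : E)⟩ := (𝒢.tangent_mk_rightTranslation g (-u : E)).symm
  refine (congrArg (fun W => - covectorEval α W) h3).trans ?_
  have h4 : (𝒢.rightTranslation g (-u : E) : E) = - (𝒢.rightTranslation g u : E) :=
    (𝒢.rightTranslation g).map_neg u
  have h5 : covectorEval α (⟨g, 𝒢.rightTranslation g (-u : E)⟩ : TangentBundle I G) =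
      - α (𝒢.rightTranslation g u) :=
    (congrArg (fun z : E => (α : E →L[ℝ] ℝ) z) h4).trans ((α : E →L[ℝ] ℝ).map_neg _)
  exact (congrArg Neg.neg h5).trans (neg_neg _)

lemma gen_inv_inv (v : 𝒢.GenTotal) :
    𝒢.genGroupoid.inv (𝒢.genGroupoid.inv v) = v := by
  obtain ⟨g, X, α⟩ := v
  refine genTotal_mk_eq_iff.2 ⟨𝒢.tangent_inv_inv ⟨g, X⟩, fun Z => ?_⟩
  refine (𝒢.cInv_apply (𝒢.inv g) (𝒢.cInv g α) Z).trans ?_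
  have h1 := 𝒢.cInv_apply g α
    (mfderiv I I 𝒢.inv (𝒢.inv (𝒢.inv g)) (Z : TangentSpace I (𝒢.inv (𝒢.inv g))) : E)
  have hb : 𝒢.inv (𝒢.inv (𝒢.inv g)) = 𝒢.inv g := 𝒢.inv_inv _
  have h2 : (⟨𝒢.inv g, (mfderiv I I 𝒢.inv (𝒢.inv (𝒢.inv g))
      (Z : TangentSpace I (𝒢.inv (𝒢.inv g))) : E)⟩ : TangentBundle I G) =
      𝒢.tangentGroupoid.inv ⟨𝒢.inv (𝒢.inv g), Z⟩ :=
    tangentBundle_mk_eq_iff.2 ⟨hb.symm, rfl⟩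
  rw [h2, 𝒢.tangent_inv_inv] at h1
  refine (congrArg Neg.neg h1).trans ?_
  rw [neg_neg]
  rfl

lemma gen_tgt_inv (v : 𝒢.GenTotal) :
    𝒢.genGroupoid.tgt (𝒢.genGroupoid.inv v) = 𝒢.genGroupoid.src v := by
  rw [← 𝒢.gen_src_inv, 𝒢.gen_inv_inv]

/-- For `W = V • Y` over the unit and `V' = V⁻¹`, one has `V' • W = Y` and `V' • T1 (Tt W) = V'`.
Subtracting, the left translate of `W - T1 (Tt W)` is `Y - V'`, on which `α` takes the value
prescribed for the product of `α⁻¹` and `α`. -/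
lemma gen_inv_mul (v : 𝒢.GenTotal) :
    𝒢.genGroupoid.mul (𝒢.genGroupoid.inv v) v =
      𝒢.genGroupoid.unit (𝒢.genGroupoid.src v) := by
  obtain ⟨g, X, α⟩ := v
  have e := 𝒢.isLieGroupoid.src_inv g
  refine genTotal_mk_eq_iff.2 ⟨𝒢.tangent_inv_mul ⟨g, X⟩, fun Z => ?_⟩
  have key : 𝒢.cMul (𝒢.inv g) g (𝒢.cInv g α) α =
      (𝒢.cUnit (𝒢.src g) (𝒢.cSrc g α) : E →L[ℝ] ℝ) := by
    refine 𝒢.cMul_eq e fun V Y hVY => ?_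
    set x := 𝒢.src g
    set W : TangentSpace I (𝒢.unit x) := (𝒢.tMul (𝒢.inv g) g V Y : E) with hW
    have hWV : (⟨𝒢.unit x, W⟩ : TangentBundle I G) =
        𝒢.tangentGroupoid.mul ⟨𝒢.inv g, V⟩ ⟨g, Y⟩ :=
      tangentBundle_mk_eq_iff.2 ⟨(𝒢.isLieGroupoid.inv_mul g).symm, rfl⟩
    set V' : TangentSpace I g := (mfderiv I I 𝒢.inv (𝒢.inv g) V : E) with hV'
    have hVi : 𝒢.tangentGroupoid.inv ⟨𝒢.inv g, V⟩ = ⟨g, V'⟩ :=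
      tangentBundle_mk_eq_iff.2 ⟨𝒢.inv_inv g, rfl⟩
    rw [𝒢.cInv_apply, hVi]
    have h1 : 𝒢.cUnit x (𝒢.cSrc g α) W =
        α (𝒢.leftInvariant g (W - 𝒢.unitSrc x W)) := rfl
    refine h1.trans ?_
    have h2 : 𝒢.leftInvariant g (W - 𝒢.unitSrc x W) = Y - V' := by
      have h3 : (W - 𝒢.unitSrc x W) - 𝒢.unitTgt x (W - 𝒢.unitSrc x W) =
          W - 𝒢.unitTgt x W := by
        have h4 : 𝒢.unitTgt x (𝒢.unitSrc x W) = 𝒢.unitSrc x W := by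
          have := 𝒢.tangent_mk_unitTgt x (𝒢.unitSrc x W)
          rw [𝒢.tangent_mk_unitSrc, 𝒢.tangent_tgt_unit, ← 𝒢.tangent_mk_unitSrc] at this
          exact (tangentBundle_mk_eq_iff.1 this).2
        rw [map_sub, h4]
        abel
      have h5 : 𝒢.leftInvariant g (W - 𝒢.unitSrc x W) =
          𝒢.leftTranslation g (W - 𝒢.unitTgt x W) := congrArg (𝒢.leftTranslation g) h3
      have h6 : (𝒢.leftTranslation g (W - 𝒢.unitTgt x W) : E) =
          𝒢.tMul g (𝒢.unit x) 0 (W - 𝒢.unitTgt x W) := rfl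
      have h7 : 𝒢.tMul g (𝒢.unit x) 0 (W - 𝒢.unitTgt x W) =
          𝒢.tMul g (𝒢.unit x) V' W - 𝒢.tMul g (𝒢.unit x) V' (𝒢.unitTgt x W) := by
        rw [← 𝒢.tMul_sub, sub_self]
      have hWt : 𝒢.tangentGroupoid.tgt ⟨𝒢.unit x, W⟩ = 𝒢.tangentGroupoid.src ⟨g, V'⟩ := by
        rw [hWV, 𝒢.tangent_tgt_mul _ _ hVY, ← hVi, 𝒢.tangent_src_inv]
      have h8 : 𝒢.tangentGroupoid.mul ⟨g, V'⟩ ⟨𝒢.unit x, W⟩ = ⟨g, Y⟩ := by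
        rw [hWV, ← hVi, ← 𝒢.tangent_mul_assoc _ _ _ (by rw [𝒢.tangent_src_inv]) hVY,
          𝒢.tangent_inv_mul, hVY, 𝒢.tangent_unit_mul]
      have h9 : 𝒢.tangentGroupoid.mul ⟨g, V'⟩ ⟨𝒢.unit x, 𝒢.unitTgt x W⟩ = ⟨g, V'⟩ := by
        rw [𝒢.tangent_mk_unitTgt, hWt, 𝒢.tangent_mul_unit]
      exact (h5.trans (h6.trans h7)).trans (congrArg₂ (fun a b : E => a - b)
        (tangentBundle_mk_eq_iff.1 h8).2 (tangentBundle_mk_eq_iff.1 h9).2)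
    rw [h2, map_sub, covectorEval_mk, sub_eq_neg_add]
    rfl
  exact congrArg (fun L : E →L[ℝ] ℝ => L Z) key

lemma gen_mul_inv (v : 𝒢.GenTotal) :
    𝒢.genGroupoid.mul v (𝒢.genGroupoid.inv v) =
      𝒢.genGroupoid.unit (𝒢.genGroupoid.tgt v) := by
  have h := 𝒢.gen_inv_mul (𝒢.genGroupoid.inv v)
  rwa [𝒢.gen_inv_inv, 𝒢.gen_src_inv] at h

end LieGroupoid

/-! ### Smooth families of elements of vector bundles -/

section BundleFamilies

variable {EB HB EP HP F F' : Type*} [NormedAddCommGroup EB] [NormedSpace ℝ EB]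
  [TopologicalSpace HB] [NormedAddCommGroup EP] [NormedSpace ℝ EP] [TopologicalSpace HP]
  [NormedAddCommGroup F] [NormedSpace ℝ F] [NormedAddCommGroup F'] [NormedSpace ℝ F']
  {IB : ModelWithCorners ℝ EB HB} {J : ModelWithCorners ℝ EP HP}
  {B P : Type*} [TopologicalSpace B] [ChartedSpace HB B] [TopologicalSpace P] [ChartedSpace HP P]
  {V : B → Type*} [∀ x, AddCommGroup (V x)] [∀ x, Module ℝ (V x)]
  [TopologicalSpace (TotalSpace F V)] [∀ x, TopologicalSpace (V x)]
  [FiberBundle F V] [VectorBundle ℝ F V]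
  {V' : B → Type*} [∀ x, AddCommGroup (V' x)] [∀ x, Module ℝ (V' x)]
  [TopologicalSpace (TotalSpace F' V')] [∀ x, TopologicalSpace (V' x)]
  [FiberBundle F' V'] [VectorBundle ℝ F' V']

/-- In a basis of the finite-dimensional source, an operator is the finite sum of the coordinate
forms tensored with its values. -/
lemma contMDiffAt_clm_of_apply [FiniteDimensional ℝ F] {A : P → F →L[ℝ] F'} {p : P}
    (h : ∀ w, ContMDiffAt J 𝓘(ℝ, F') ∞ (fun q => A q w) p) :
    ContMDiffAt J 𝓘(ℝ, F →L[ℝ] F') ∞ A p := by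
  let b := Module.finBasis ℝ F
  let e : (F →L[ℝ] F') ≃ₗ[ℝ] (Fin (Module.finrank ℝ F) → F') :=
    LinearMap.toContinuousLinearMap.symm.trans (b.constr ℝ).symm
  have hA : A = fun q => ∑ i, ContinuousLinearMap.smulRight
      (LinearMap.toContinuousLinearMap (b.coord i)) (A q (b i)) := by
    funext q
    ext v
    rw [sum_apply]
    conv_lhs => rw [← b.sum_repr v, map_sum]
    refine Finset.sum_congr rfl fun i _ => ?_
    rw [map_smul]
    rfl
  rw [hA]
  refine ContMDiffAt.sum fun i _ => ?_
  exact (((ContinuousLinearMap.smulRightL ℝ F F')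
    (LinearMap.toContinuousLinearMap (b.coord i))).contDiff.contMDiff _).comp p (h (b i))

/-- A family of elements of the dual bundle is smooth if it is smooth on the frames given by the
preferred trivialization. -/
lemma contMDiffAt_dual_of_apply [FiniteDimensional ℝ F] {b : P → B} {p₀ : P}
    {A : ∀ p, V (b p) →L[ℝ] ℝ} (hb : ContMDiffAt J IB ∞ b p₀)
    (h : ∀ w, ContMDiffAt J 𝓘(ℝ, ℝ) ∞
      (fun p => A p ((trivializationAt F V (b p₀)).symm (b p) w)) p₀) :
    ContMDiffAt J (IB.prod 𝓘(ℝ, F →L[ℝ] ℝ)) ∞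
      (fun p => (⟨b p, A p⟩ : TotalSpace (F →L[ℝ] ℝ) (fun x => V x →L[ℝ] ℝ))) p₀ := by
  refine (contMDiffAt_hom_bundle _).2 ⟨hb, contMDiffAt_clm_of_apply fun w => ?_⟩
  refine (h w).congr_of_eventuallyEq ?_
  filter_upwards [hb.continuousAt.eventually_mem ((trivializationAt F V (b p₀)).open_baseSet.mem_nhds
    (mem_baseSet_trivializationAt F V (b p₀)))] with q hq
  simp [ContinuousLinearMap.inCoordinates, Trivialization.symmL_apply _ hq]

/-- The evaluation of a smooth family of covectors on a smooth family of vectors. -/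
lemma ContMDiffAt.dual_apply {b : P → B} {p₀ : P}
    {A : ∀ p, V (b p) →L[ℝ] ℝ} {v : ∀ p, V (b p)}
    (hA : ContMDiffAt J (IB.prod 𝓘(ℝ, F →L[ℝ] ℝ)) ∞
      (fun p => (⟨b p, A p⟩ : TotalSpace (F →L[ℝ] ℝ) (fun x => V x →L[ℝ] ℝ))) p₀)
    (hv : ContMDiffAt J (IB.prod 𝓘(ℝ, F)) ∞ (fun p => (⟨b p, v p⟩ : TotalSpace F V)) p₀) :
    ContMDiffAt J 𝓘(ℝ, ℝ) ∞ (fun p => A p (v p)) p₀ := by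
  have h := ContMDiffAt.clm_bundle_apply (F₁ := F) (F₂ := ℝ) (E₁ := V) (E₂ := fun _ : B => ℝ)
    (b := b) (v := v) (ϕ := A) hA hv
  exact (contMDiffAt_totalSpace.1 h).2

variable (F V) in
/-- The constant frames of a trivialization are smooth. -/
lemma contMDiffAt_trivialization_symm [ContMDiffVectorBundle ∞ F V IB]
    (e : Trivialization F (TotalSpace.proj (F := F) (E := V))) [MemTrivializationAtlas e]
    {b : P → B} {c : P → F} {p₀ : P} (hb : ContMDiffAt J IB ∞ b p₀) (hp : b p₀ ∈ e.baseSet)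
    (hc : ContMDiffAt J 𝓘(ℝ, F) ∞ c p₀) :
    ContMDiffAt J (IB.prod 𝓘(ℝ, F)) ∞
      (fun p => (⟨b p, e.symm (b p) (c p)⟩ : TotalSpace F V)) p₀ := by
  refine (e.contMDiffAt_iff (e.mem_source.2 hp)).2 ⟨hb, hc.congr_of_eventuallyEq ?_⟩
  filter_upwards [hb.continuousAt.eventually_mem (e.open_baseSet.mem_nhds hp)] with p h
  exact congrArg Prod.snd (e.apply_mk_symm h (c p))

lemma ContMDiffAt.bundle_add [ContMDiffVectorBundle ∞ F V IB] {b : P → B} {v w : ∀ p, V (b p)}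
    {p₀ : P} (hv : ContMDiffAt J (IB.prod 𝓘(ℝ, F)) ∞ (fun p => (⟨b p, v p⟩ : TotalSpace F V)) p₀)
    (hw : ContMDiffAt J (IB.prod 𝓘(ℝ, F)) ∞ (fun p => (⟨b p, w p⟩ : TotalSpace F V)) p₀) :
    ContMDiffAt J (IB.prod 𝓘(ℝ, F)) ∞ (fun p => (⟨b p, v p + w p⟩ : TotalSpace F V)) p₀ := by
  obtain ⟨hb, hv'⟩ := contMDiffAt_totalSpace.1 hv
  obtain ⟨-, hw'⟩ := contMDiffAt_totalSpace.1 hw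
  refine contMDiffAt_totalSpace.2 ⟨hb, (hv'.add hw').congr_of_eventuallyEq ?_⟩
  filter_upwards [hb.continuousAt.eventually_mem ((trivializationAt F V (b p₀)).open_baseSet.mem_nhds
    (mem_baseSet_trivializationAt F V (b p₀)))] with p h
  exact ((trivializationAt F V (b p₀)).linear ℝ h).1 _ _

lemma ContMDiffAt.bundle_smul [ContMDiffVectorBundle ∞ F V IB] {b : P → B} {v : ∀ p, V (b p)}
    {c : P → ℝ} {p₀ : P} (hc : ContMDiffAt J 𝓘(ℝ, ℝ) ∞ c p₀)
    (hv : ContMDiffAt J (IB.prod 𝓘(ℝ, F)) ∞ (fun p => (⟨b p, v p⟩ : TotalSpace F V)) p₀) :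
    ContMDiffAt J (IB.prod 𝓘(ℝ, F)) ∞ (fun p => (⟨b p, c p • v p⟩ : TotalSpace F V)) p₀ := by
  obtain ⟨hb, hv'⟩ := contMDiffAt_totalSpace.1 hv
  refine contMDiffAt_totalSpace.2 ⟨hb, (hc.smul hv').congr_of_eventuallyEq ?_⟩
  filter_upwards [hb.continuousAt.eventually_mem ((trivializationAt F V (b p₀)).open_baseSet.mem_nhds
    (mem_baseSet_trivializationAt F V (b p₀)))] with p h
  exact ((trivializationAt F V (b p₀)).linear ℝ h).2 _ _

lemma ContMDiffAt.bundle_sub [ContMDiffVectorBundle ∞ F V IB] {b : P → B} {v w : ∀ p, V (b p)}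
    {p₀ : P} (hv : ContMDiffAt J (IB.prod 𝓘(ℝ, F)) ∞ (fun p => (⟨b p, v p⟩ : TotalSpace F V)) p₀)
    (hw : ContMDiffAt J (IB.prod 𝓘(ℝ, F)) ∞ (fun p => (⟨b p, w p⟩ : TotalSpace F V)) p₀) :
    ContMDiffAt J (IB.prod 𝓘(ℝ, F)) ∞ (fun p => (⟨b p, v p - w p⟩ : TotalSpace F V)) p₀ := by
  have := hv.bundle_add ((contMDiffAt_const (c := (-1 : ℝ))).bundle_smul hw)
  simpa only [neg_smul, one_smul, ← sub_eq_add_neg] using this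

/-- Smoothness of families of elements of a direct sum of vector bundles. -/
lemma contMDiffAt_bundleProd_iff {b : P → B} {v : ∀ p, V (b p)} {w : ∀ p, V' (b p)} {p₀ : P} :
    ContMDiffAt J (IB.prod 𝓘(ℝ, F × F')) ∞
      (fun p => (⟨b p, (v p, w p)⟩ : TotalSpace (F × F') (V ×ᵇ V'))) p₀ ↔
    ContMDiffAt J (IB.prod 𝓘(ℝ, F)) ∞ (fun p => (⟨b p, v p⟩ : TotalSpace F V)) p₀ ∧
      ContMDiffAt J (IB.prod 𝓘(ℝ, F')) ∞ (fun p => (⟨b p, w p⟩ : TotalSpace F' V')) p₀ := by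
  rw [contMDiffAt_totalSpace, contMDiffAt_totalSpace, contMDiffAt_totalSpace]
  constructor
  · rintro ⟨h1, h2⟩
    exact ⟨⟨h1, (contMDiffAt_prod_module_iff _ |>.1 h2).1⟩,
      ⟨h1, (contMDiffAt_prod_module_iff _ |>.1 h2).2⟩⟩
  · rintro ⟨⟨h1, h2⟩, -, h3⟩
    exact ⟨h1, h2.prodMk_space h3⟩

end BundleFamilies

/-! ### Smooth families of tangent vectors -/

section TangentFamilies

variable {E H E' H' F K : Type*} [NormedAddCommGroup E] [NormedSpace ℝ E]
  [TopologicalSpace H] [NormedAddCommGroup E'] [NormedSpace ℝ E']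
  [TopologicalSpace H'] {I : ModelWithCorners ℝ E H} {I' : ModelWithCorners ℝ E' H'}
  {N B : Type*} [TopologicalSpace N] [ChartedSpace H N]
  [TopologicalSpace B] [ChartedSpace H' B]
  [NormedAddCommGroup F] [NormedSpace ℝ F] [TopologicalSpace K]
  {J : ModelWithCorners ℝ F K} {P : Type*} [TopologicalSpace P] [ChartedSpace K P]
  [IsManifold I ∞ N] [IsManifold I' ∞ B]

/-- Smoothness of `f` is required only at one base point, so that `f` may be a local extension of
the multiplication or a local section. -/
lemma ContMDiffAt.tangentMap_family {f : N → B} {v : P → TangentBundle I N} {p : P}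
    (hv : ContMDiffAt J I.tangent ∞ v p) (hf : ContMDiffAt I I' ∞ f (v p).1) :
    ContMDiffAt J I'.tangent ∞ (fun q => tangentMap I I' f (v q)) p := by
  have hb : ContMDiffAt J I ∞ (fun q => (v q).1) p := (contMDiffAt_totalSpace.1 hv).1
  have h1 := hf.mfderiv_const (m := ∞) (by simp)
  exact ContMDiffAt.clm_apply_of_inCoordinates (E₁ := TangentSpace I) (E₂ := TangentSpace I')
    (b₁ := fun q => (v q).1) (b₂ := fun q => f (v q).1) (v := fun q => (v q).2)
    (ϕ := fun q => mfderiv I I' f (v q).1) (h1.comp p hb) hv (hf.comp p hb)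

lemma contMDiffAt_tangent_prodMk {v : P → TangentBundle I N} {w : P → TangentBundle I' B} {p : P}
    (hv : ContMDiffAt J I.tangent ∞ v p) (hw : ContMDiffAt J I'.tangent ∞ w p) :
    ContMDiffAt J (I.prod I').tangent ∞
      (fun q => (⟨((v q).1, (w q).1), ((v q).2, (w q).2)⟩ : TangentBundle (I.prod I') (N × B))) p :=
  (contMDiff_equivTangentBundleProd_symm (I := I) (I' := I') (M := N) (M' := B) (n := ∞)
    (v p, w p)).comp p (hv.prodMk hw)

lemma contMDiffAt_tangent_zero {b : P → N} {p : P} (hb : ContMDiffAt J I ∞ b p) :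
    ContMDiffAt J I.tangent ∞ (fun q => (⟨b q, 0⟩ : TangentBundle I N)) p :=
  ((contMDiff_zeroSection ℝ (TangentSpace I : N → Type _)) (b p)).comp p hb

/-- The base of `Z` is allowed to equal `b` only by a proved equality, as happens for products such
as `1 • g`. -/
lemma contMDiffAt_covectorEval {b : P → N} {α : ∀ q, Cotangent I (b q)} {Z : P → TangentBundle I N}
    {p : P} (hα : ContMDiffAt J (I.prod 𝓘(ℝ, E →L[ℝ] ℝ)) ∞
      (fun q => (⟨b q, α q⟩ : TotalSpace (E →L[ℝ] ℝ) (fun x : N => TangentSpace I x →L[ℝ] ℝ))) p)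
    (hZ : ContMDiffAt J I.tangent ∞ Z p) (h : ∀ᶠ q in 𝓝 p, (Z q).1 = b q) :
    ContMDiffAt J 𝓘(ℝ, ℝ) ∞ (fun q => LieGroupoid.covectorEval (α q) (Z q)) p := by
  refine ContMDiffAt.dual_apply (V := fun x : N => TangentSpace I x) (F := E)
    (v := fun q => LieGroupoid.tangentVec I (b q) (Z q).2) hα (hZ.congr_of_eventuallyEq ?_)
  filter_upwards [h] with q hq
  exact tangentBundle_mk_eq_iff.2 ⟨hq.symm, rfl⟩

end TangentFamilies

/-! ### Smooth families in the tangent groupoid. -/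

namespace LieGroupoid

variable {E H E' H' : Type*} [NormedAddCommGroup E] [NormedSpace ℝ E]
  [TopologicalSpace H] [NormedAddCommGroup E'] [NormedSpace ℝ E']
  [TopologicalSpace H'] {I : ModelWithCorners ℝ E H} {I' : ModelWithCorners ℝ E' H'}
  {G M : Type*} [TopologicalSpace G] [ChartedSpace H G]
  [TopologicalSpace M] [ChartedSpace H' M]
  (𝒢 : LieGroupoid I G I' M)
  [FiniteDimensional ℝ E] [FiniteDimensional ℝ E'] [IsManifold I ∞ G] [IsManifold I' ∞ M]
  [I.Boundaryless] [I'.Boundaryless]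
  {F K P : Type*} [NormedAddCommGroup F] [NormedSpace ℝ F] [TopologicalSpace K]
  {J : ModelWithCorners ℝ F K} [TopologicalSpace P] [ChartedSpace K P]

/-- The product of the tangent groupoid is computed by any smooth extension of the
multiplication. -/
lemma tangent_mul_eq_tangentMap {m : G × G → G} {U : Set (G × G)} (hU : IsOpen U)
    (hm : ContMDiffOn (I.prod I) I ∞ m U)
    (hmU : EqOn m (fun p : G × G => 𝒢.mul p.1 p.2) (𝒢.composable ∩ U)) {X Y : TangentBundle I G}
    (h : 𝒢.tangentGroupoid.src X = 𝒢.tangentGroupoid.tgt Y) (hXY : (X.1, Y.1) ∈ U) :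
    𝒢.tangentGroupoid.mul X Y = tangentMap (I.prod I) I m ⟨(X.1, Y.1), (X.2, Y.2)⟩ := by
  obtain ⟨γ, δ, hγ, hδ, hc, rfl, rfl⟩ := 𝒢.exists_curves_composable X Y h
  have hγ' := hγ.mdifferentiableAt (by simp)
  have hδ' := hδ.mdifferentiableAt (by simp)
  have hXY : (γ 0, δ 0) ∈ U := hXY
  have hmd : MDifferentiableAt (I.prod I) I m (γ 0, δ 0) :=
    (hm.contMDiffAt (hU.mem_nhds hXY)).mdifferentiableAt (by simp)
  rw [← 𝒢.velocity_mul' hγ hδ hc]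
  have h1 := velocity_comp (γ := fun τ => (γ τ, δ τ)) hmd (hγ'.prodMk hδ')
  rw [velocity_prodMk hγ' hδ'] at h1
  refine (velocity_congr ?_).trans h1
  filter_upwards [hc, (hγ.continuousAt.prodMk hδ.continuousAt).eventually_mem (hU.mem_nhds hXY)]
    with τ h2 h3
  exact (hmU ⟨h2, h3⟩).symm

lemma contMDiffAt_tangent_mul {A B : P → TangentBundle I G} {p : P}
    (hA : ContMDiffAt J I.tangent ∞ A p) (hB : ContMDiffAt J I.tangent ∞ B p)
    (h : ∀ᶠ q in 𝓝 p, 𝒢.tangentGroupoid.src (A q) = 𝒢.tangentGroupoid.tgt (B q)) :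
    ContMDiffAt J I.tangent ∞ (fun q => 𝒢.tangentGroupoid.mul (A q) (B q)) p := by
  have hc : 𝒢.src (A p).1 = 𝒢.tgt (B p).1 := congrArg TotalSpace.proj h.self_of_nhds
  obtain ⟨U, m, hU, hpU, hm, hmU⟩ := 𝒢.isLieGroupoid.smooth_mul ((A p).1, (B p).1) hc
  have hAB := contMDiffAt_tangent_prodMk hA hB
  refine (hAB.tangentMap_family (f := m) (hm.contMDiffAt (hU.mem_nhds hpU))).congr_of_eventuallyEq ?_
  have hb := (contMDiffAt_totalSpace.1 hAB).1.continuousAt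
  filter_upwards [h, hb.eventually_mem (hU.mem_nhds hpU)] with q h1 h2
  exact 𝒢.tangent_mul_eq_tangentMap hU hm hmU h1 h2

lemma contMDiffAt_tangent_src {A : P → TangentBundle I G} {p : P}
    (hA : ContMDiffAt J I.tangent ∞ A p) :
    ContMDiffAt J I'.tangent ∞ (fun q => 𝒢.tangentGroupoid.src (A q)) p :=
  hA.tangentMap_family (𝒢.isLieGroupoid.smooth_src _)

lemma contMDiffAt_tangent_tgt {A : P → TangentBundle I G} {p : P}
    (hA : ContMDiffAt J I.tangent ∞ A p) :
    ContMDiffAt J I'.tangent ∞ (fun q => 𝒢.tangentGroupoid.tgt (A q)) p :=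
  hA.tangentMap_family (𝒢.isLieGroupoid.smooth_tgt _)

lemma contMDiffAt_tangent_inv {A : P → TangentBundle I G} {p : P}
    (hA : ContMDiffAt J I.tangent ∞ A p) :
    ContMDiffAt J I.tangent ∞ (fun q => 𝒢.tangentGroupoid.inv (A q)) p :=
  hA.tangentMap_family (𝒢.isLieGroupoid.smooth_inv _)

lemma contMDiffAt_tangent_unit {A : P → TangentBundle I' M} {p : P}
    (hA : ContMDiffAt J I'.tangent ∞ A p) :
    ContMDiffAt J I.tangent ∞ (fun q => 𝒢.tangentGroupoid.unit (A q)) p :=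
  hA.tangentMap_family (𝒢.isLieGroupoid.smooth_unit _)

/-! ### Smooth families of elements of the algebroid -/

/-- Links the coordinates used to build the algebroid bundle with the trivialization of `TG`. -/
lemma trivializationAt_tangent_unit {x₀ x : M} (hx : x ∈ 𝒢.chartDom x₀)
    (v : TangentSpace I (𝒢.unit x)) :
    (trivializationAt E (TangentSpace I : G → Type _) (𝒢.unit x₀) ⟨𝒢.unit x, v⟩).2 =
      𝒢.dchart x₀ x v := by
  have hx' : 𝒢.unit x ∈ (chartAt H (𝒢.unit x₀)).source := by simpa using hx.1
  have h := TangentBundle.continuousLinearMapAt_trivializationAt (𝕜 := ℝ) (I := I) hx'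
  refine Eq.trans ?_ (congrArg (fun L : E →L[ℝ] E => L v) h)
  exact (Trivialization.continuousLinearMapAt_apply_of_mem ℝ _ (by simpa using hx') v).symm

/-- Smoothness of families of elements of the algebroid. -/
lemma contMDiffAt_algebroid_iff {b : P → M} {u : ∀ q, 𝒢.Algebroid (b q)} {p : P} :
    ContMDiffAt J (I'.prod 𝓘(ℝ, AModel E E')) ∞
      (fun q => (⟨b q, u q⟩ : TotalSpace (AModel E E') 𝒢.Algebroid)) p ↔
    ContMDiffAt J I' ∞ b p ∧
      ContMDiffAt J I.tangent ∞ (fun q => (⟨𝒢.unit (b q), (u q).1⟩ : TangentBundle I G)) p := by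
  obtain ⟨hx, hi⟩ := (𝒢.exists_complement (b p)).choose_spec
  set ϖ := (𝒢.exists_complement (b p)).choose with hϖ
  have hev : ContinuousAt b p → ∀ᶠ q in 𝓝 p, b q ∈ 𝒢.trivDom (b p, ϖ) := fun hb =>
    hb.eventually_mem ((𝒢.isOpen_trivDom _).mem_nhds ⟨hx, hi⟩)
  constructor
  · intro h
    obtain ⟨hb, h2⟩ := contMDiffAt_totalSpace.1 h
    have h2 : ContMDiffAt J 𝓘(ℝ, AModel E E') ∞
      (fun q => ϖ (𝒢.dchart (b p) (b q) (u q).1)) p := h2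
    refine ⟨hb, contMDiffAt_totalSpace.2 ⟨(𝒢.isLieGroupoid.smooth_unit _).comp p hb, ?_⟩⟩
    have : CompleteSpace E := FiniteDimensional.complete ℝ E
    -- A vector of the algebroid is recovered from its coordinate `c` by applying the inverse of
    -- `(ds, ϖ)` to `(0, c)`, and this inverse depends smoothly on the point.
    have h1 : ContMDiffAt J 𝓘(ℝ, E' × AModel E E' →L[ℝ] E) ∞
        (fun q => (𝒢.frameMap (b p, ϖ) (b q)).inverse) p :=
      ((hi.contDiffAt_map_inverse (n := ∞)).contMDiffAt.comp _ (𝒢.contMDiffAt_frameMap hx)).comp p hb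
    have h3 : ContMDiffAt J 𝓘(ℝ, E' × AModel E E') ∞
        (fun q => ((0 : E'), ϖ (𝒢.dchart (b p) (b q) (u q).1))) p :=
      contMDiffAt_const.prodMk_space h2
    refine (h1.clm_apply h3).congr_of_eventuallyEq ?_
    filter_upwards [hev hb.continuousAt] with q hq
    refine (𝒢.trivializationAt_tangent_unit hq.1 _).trans ?_
    have hv : 𝒢.dsrc (b p) (b q) (𝒢.dchart (b p) (b q) (u q).1) = 0 :=
      (𝒢.mem_algebroid_iff hq.1 (u q).1).1 (u q).2
    have h4 : 𝒢.frameMap (b p, ϖ) (b q) (𝒢.dchart (b p) (b q) (u q).1) =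
        (0, ϖ (𝒢.dchart (b p) (b q) (u q).1)) := Prod.ext hv rfl
    rw [← h4, hq.2.inverse_apply_self]
  · rintro ⟨hb, h⟩
    refine contMDiffAt_totalSpace.2 ⟨hb, ?_⟩
    have h2 := (contMDiffAt_totalSpace.1 h).2
    refine (ϖ.contDiff.contMDiff.contMDiffAt.comp p h2).congr_of_eventuallyEq ?_
    filter_upwards [hev hb.continuousAt] with q hq
    exact congrArg ϖ (𝒢.trivializationAt_tangent_unit hq.1 _).symm

/-! ### Smoothness of the structure maps of `𝕋G` -/

lemma contMDiffAt_genTotal_iff {v : P → 𝒢.GenTotal} {p : P} :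
    ContMDiffAt J (I.prod 𝓘(ℝ, GenModel E)) ∞ v p ↔
      ContMDiffAt J I.tangent ∞ (fun q => (⟨(v q).1, (v q).2.1⟩ : TangentBundle I G)) p ∧
      ContMDiffAt J (I.prod 𝓘(ℝ, E →L[ℝ] ℝ)) ∞
        (fun q => (⟨(v q).1, (v q).2.2⟩ :
          TotalSpace (E →L[ℝ] ℝ) (fun x : G => TangentSpace I x →L[ℝ] ℝ))) p :=
  contMDiffAt_bundleProd_iff (V := fun x : G => TangentSpace I x)
    (V' := fun x : G => TangentSpace I x →L[ℝ] ℝ) (b := fun q => (v q).1)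
    (v := fun q => (v q).2.1) (w := fun q => (v q).2.2)

lemma contMDiffAt_genBaseTotal_iff {v : P → 𝒢.GenBaseTotal} {p : P} :
    ContMDiffAt J (I'.prod 𝓘(ℝ, BaseModel E E')) ∞ v p ↔
      ContMDiffAt J I'.tangent ∞ (fun q => (⟨(v q).1, (v q).2.1⟩ : TangentBundle I' M)) p ∧
      ContMDiffAt J (I'.prod 𝓘(ℝ, AModel E E' →L[ℝ] ℝ)) ∞
        (fun q => (⟨(v q).1, (v q).2.2⟩ :
          TotalSpace (AModel E E' →L[ℝ] ℝ) (fun x : M => 𝒢.Algebroid x →L[ℝ] ℝ))) p :=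
  contMDiffAt_bundleProd_iff (V := fun x : M => TangentSpace I' x)
    (V' := fun x : M => 𝒢.Algebroid x →L[ℝ] ℝ) (b := fun q => (v q).1)
    (v := fun q => (v q).2.1) (w := fun q => (v q).2.2)

/-- On a local frame of the algebroid the target covector is `α (u • 0_g)`, the evaluation of a
smooth family on a product of smooth families. -/
lemma contMDiffAt_gen_tgt {v : P → 𝒢.GenTotal} {p : P}
    (hv : ContMDiffAt J (I.prod 𝓘(ℝ, GenModel E)) ∞ v p) :
    ContMDiffAt J (I'.prod 𝓘(ℝ, BaseModel E E')) ∞ (fun q => 𝒢.genGroupoid.tgt (v q)) p := by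
  obtain ⟨h1, h2⟩ := 𝒢.contMDiffAt_genTotal_iff.1 hv
  have hb : ContMDiffAt J I ∞ (fun q => (v q).1) p := (contMDiffAt_totalSpace.1 hv).1
  have hbt : ContMDiffAt J I' ∞ (fun q => 𝒢.tgt (v q).1) p :=
    (𝒢.isLieGroupoid.smooth_tgt _).comp p hb
  refine 𝒢.contMDiffAt_genBaseTotal_iff.2 ⟨𝒢.contMDiffAt_tangent_tgt h1, ?_⟩
  refine contMDiffAt_dual_of_apply (V := 𝒢.Algebroid) (F := AModel E E')
    (A := fun q => 𝒢.cTgt (v q).1 (v q).2.2) hbt fun w => ?_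
  have h3 := contMDiffAt_trivialization_symm (IB := I') (AModel E E') 𝒢.Algebroid
    (trivializationAt (AModel E E') 𝒢.Algebroid (𝒢.tgt (v p).1)) hbt
    (mem_baseSet_trivializationAt _ _ _) (contMDiffAt_const (c := w))
  have h4 := (𝒢.contMDiffAt_algebroid_iff.1 h3).2
  have h5 := 𝒢.contMDiffAt_tangent_mul h4 (contMDiffAt_tangent_zero hb)
    (.of_forall fun q => 𝒢.tangent_composable_right (LinearMap.mem_ker.1 (Subtype.property _)))
  refine (contMDiffAt_covectorEval h2 h5 (.of_forall fun q => ?_)).congr_of_eventuallyEq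
    (.of_forall fun q => rfl)
  exact 𝒢.isLieGroupoid.unit_mul _

/-- On a frame vector `Z` the unit covector is `ξ (Z - T1 (Ts Z))`, and this argument is a smooth
family in the algebroid. -/
lemma contMDiffAt_gen_unit {v : P → 𝒢.GenBaseTotal} {p : P}
    (hv : ContMDiffAt J (I'.prod 𝓘(ℝ, BaseModel E E')) ∞ v p) :
    ContMDiffAt J (I.prod 𝓘(ℝ, GenModel E)) ∞ (fun q => 𝒢.genGroupoid.unit (v q)) p := by
  obtain ⟨h1, h2⟩ := 𝒢.contMDiffAt_genBaseTotal_iff.1 hv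
  have hb : ContMDiffAt J I' ∞ (fun q => (v q).1) p := (contMDiffAt_totalSpace.1 hv).1
  have hbu : ContMDiffAt J I ∞ (fun q => 𝒢.unit (v q).1) p :=
    (𝒢.isLieGroupoid.smooth_unit _).comp p hb
  refine 𝒢.contMDiffAt_genTotal_iff.2 ⟨𝒢.contMDiffAt_tangent_unit h1, ?_⟩
  refine contMDiffAt_dual_of_apply (V := fun x : G => TangentSpace I x) (F := E)
    (A := fun q => 𝒢.cUnit (v q).1 (v q).2.2) hbu fun w => ?_
  have h3 := contMDiffAt_trivialization_symm (IB := I) E (fun x : G => TangentSpace I x)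
    (trivializationAt E (fun x : G => TangentSpace I x) (𝒢.unit (v p).1)) hbu
    (mem_baseSet_trivializationAt _ _ _) (contMDiffAt_const (c := w))
  have h4 := 𝒢.contMDiffAt_tangent_unit (𝒢.contMDiffAt_tangent_src h3)
  have h5 := h3.bundle_sub (V := fun x : G => TangentSpace I x) (w := fun q => 𝒢.unitSrc (v q).1
    ((trivializationAt E (fun x : G => TangentSpace I x) (𝒢.unit (v p).1)).symm (𝒢.unit (v q).1) w))
    (h4.congr_of_eventuallyEq (.of_forall fun q => 𝒢.tangent_mk_unitSrc _ _))
  exact ContMDiffAt.dual_apply (V := 𝒢.Algebroid) (F := AModel E E') (b := fun q => (v q).1)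
    (v := fun q => 𝒢.algebroidProj (v q).1 ((trivializationAt E
      (fun x : G => TangentSpace I x) (𝒢.unit (v p).1)).symm (𝒢.unit (v q).1) w)) h2
    (𝒢.contMDiffAt_algebroid_iff.2 ⟨hb, h5⟩)

/-- On a frame vector `Z` the inverse covector is `-α (Z⁻¹)`. -/
lemma contMDiffAt_gen_inv {v : P → 𝒢.GenTotal} {p : P}
    (hv : ContMDiffAt J (I.prod 𝓘(ℝ, GenModel E)) ∞ v p) :
    ContMDiffAt J (I.prod 𝓘(ℝ, GenModel E)) ∞ (fun q => 𝒢.genGroupoid.inv (v q)) p := by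
  obtain ⟨h1, h2⟩ := 𝒢.contMDiffAt_genTotal_iff.1 hv
  have hb : ContMDiffAt J I ∞ (fun q => (v q).1) p := (contMDiffAt_totalSpace.1 hv).1
  have hbi : ContMDiffAt J I ∞ (fun q => 𝒢.inv (v q).1) p :=
    (𝒢.isLieGroupoid.smooth_inv _).comp p hb
  refine 𝒢.contMDiffAt_genTotal_iff.2 ⟨𝒢.contMDiffAt_tangent_inv h1, ?_⟩
  refine contMDiffAt_dual_of_apply (V := fun x : G => TangentSpace I x) (F := E)
    (A := fun q => 𝒢.cInv (v q).1 (v q).2.2) hbi fun w => ?_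
  have h3 := contMDiffAt_trivialization_symm (IB := I) E (fun x : G => TangentSpace I x)
    (trivializationAt E (fun x : G => TangentSpace I x) (𝒢.inv (v p).1)) hbi
    (mem_baseSet_trivializationAt _ _ _) (contMDiffAt_const (c := w))
  have h4 := contMDiffAt_covectorEval h2 (𝒢.contMDiffAt_tangent_inv h3)
    (.of_forall fun q => 𝒢.inv_inv _)
  exact h4.neg.congr_of_eventuallyEq (.of_forall fun q => 𝒢.cInv_apply _ _ _)

/-- The source is the target of the inverse, so left translations need no separate treatment. -/
lemma contMDiffAt_gen_src {v : P → 𝒢.GenTotal} {p : P}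
    (hv : ContMDiffAt J (I.prod 𝓘(ℝ, GenModel E)) ∞ v p) :
    ContMDiffAt J (I'.prod 𝓘(ℝ, BaseModel E E')) ∞ (fun q => 𝒢.genGroupoid.src (v q)) p :=
  (𝒢.contMDiffAt_gen_tgt (𝒢.contMDiffAt_gen_inv hv)).congr_of_eventuallyEq
    (.of_forall fun _ => (𝒢.gen_tgt_inv _).symm)

/-- Smooth lifts along the source map: vectors over `h` with prescribed image under `Ts`. -/
lemma exists_tangent_src_lift {h : P → G} {w : P → TangentBundle I' M} {p : P}
    (hh : ContMDiffAt J I ∞ h p) (hw : ContMDiffAt J I'.tangent ∞ w p)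
    (hwh : ∀ᶠ q in 𝓝 p, (w q).1 = 𝒢.src (h q)) :
    ∃ Y : P → TangentBundle I G, ContMDiffAt J I.tangent ∞ Y p ∧
      ∀ᶠ q in 𝓝 p, (Y q).1 = h q ∧ 𝒢.tangentGroupoid.src (Y q) = w q := by
  obtain ⟨σ, hσ⟩ := exists_sections_of_submersion (f := 𝒢.src) (x₀ := h p) isOpen_univ (mem_univ _)
    𝒢.isLieGroupoid.smooth_src.contMDiffOn (𝒢.isLieGroupoid.submersion_src _)
  have hwp : (w p).1 = 𝒢.src (h p) := hwh.self_of_nhds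
  rw [← hwp] at hσ
  have hA := contMDiffAt_tangent_prodMk hw (contMDiffAt_tangent_zero hh)
  -- The lift is `Tσ (w, 0_h)`, with `σ` a family of local sections of the source map. Its base
  -- point is `σ (s(h), h) = h`.
  refine ⟨_, hA.tangentMap_family (f := σ) hσ.self_of_nhds.1, ?_⟩
  have hb := (contMDiffAt_totalSpace.1 hA).1.continuousAt
  filter_upwards [hwh, hb.eventually hσ.eventually_nhds] with q h1 h2
  have h3 := h2.self_of_nhds
  have h2' : ∀ᶠ r : M × G in 𝓝 ((w q).1, h q), 𝒢.src (σ r) = r.1 := h2.mono fun r hr => hr.2.1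
  refine ⟨h3.2.2 h1, ?_⟩
  have hs : MDifferentiableAt (I'.prod I) I σ ((w q).1, h q) := h3.1.mdifferentiableAt (by simp)
  refine (tangentMap_comp_at (p := (⟨((w q).1, h q), ((w q).2, 0)⟩ :
    TangentBundle (I'.prod I) (M × G))) (𝒢.mdifferentiableAt_src _) hs).symm.trans ?_
  -- Near the point `s ∘ σ` is the first projection, so `Ts` of the lift is `w`.
  have h4 : mfderiv (I'.prod I) I' (𝒢.src ∘ σ) ((w q).1, h q) =
      ContinuousLinearMap.fst ℝ E' E :=
    (Filter.EventuallyEq.mfderiv_eq h2').trans mfderiv_fst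
  refine tangentBundle_mk_eq_iff.2 ⟨h2'.self_of_nhds, ?_⟩
  exact congrArg (fun L : E' × E →L[ℝ] E' => L ((w q).2, 0)) h4

/-- Since the product covector is chosen pointwise, its smoothness must come from the defining
equation: a smooth family `Z` of vectors at the product is factored smoothly as `X • Y`, and the
value on `Z` is `α X + β Y`. -/
lemma contMDiffAt_gen_mul {v w : P → 𝒢.GenTotal} {p : P}
    (hv : ContMDiffAt J (I.prod 𝓘(ℝ, GenModel E)) ∞ v p)
    (hw : ContMDiffAt J (I.prod 𝓘(ℝ, GenModel E)) ∞ w p)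
    (hvw : ∀ᶠ q in 𝓝 p, 𝒢.genGroupoid.src (v q) = 𝒢.genGroupoid.tgt (w q)) :
    ContMDiffAt J (I.prod 𝓘(ℝ, GenModel E)) ∞ (fun q => 𝒢.genGroupoid.mul (v q) (w q)) p := by
  obtain ⟨hv1, hv2⟩ := 𝒢.contMDiffAt_genTotal_iff.1 hv
  obtain ⟨hw1, hw2⟩ := 𝒢.contMDiffAt_genTotal_iff.1 hw
  have hbv : ContMDiffAt J I ∞ (fun q => (v q).1) p := (contMDiffAt_totalSpace.1 hv).1
  have hbw : ContMDiffAt J I ∞ (fun q => (w q).1) p := (contMDiffAt_totalSpace.1 hw).1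
  have hc : ∀ᶠ q in 𝓝 p, 𝒢.GenComposable (v q).1 (w q).1 (v q).2 (w q).2 := hvw
  have hsrc : ∀ᶠ q in 𝓝 p, 𝒢.src (v q).1 = 𝒢.tgt (w q).1 :=
    hc.mono fun q h => GenComposable.src_eq 𝒢 h
  refine 𝒢.contMDiffAt_genTotal_iff.2 ⟨𝒢.contMDiffAt_tangent_mul hv1 hw1
    (hc.mono fun q h => (𝒢.genComposable_iff.1 h).1), ?_⟩
  have hbm := 𝒢.contMDiffAt_mul hbv hbw hsrc
  refine contMDiffAt_dual_of_apply (V := fun x : G => TangentSpace I x) (F := E)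
    (A := fun q => 𝒢.cMul (v q).1 (w q).1 (v q).2.2 (w q).2.2) hbm fun u => ?_
  have hZ := contMDiffAt_trivialization_symm (IB := I) E (fun x : G => TangentSpace I x)
    (trivializationAt E (fun x : G => TangentSpace I x) (𝒢.mul (v p).1 (w p).1)) hbm
    (mem_baseSet_trivializationAt _ _ _) (contMDiffAt_const (c := u))
  set Z : P → TangentBundle I G := fun q => ⟨𝒢.mul (v q).1 (w q).1,
    (trivializationAt E (fun x : G => TangentSpace I x)
      (𝒢.mul (v p).1 (w p).1)).symm (𝒢.mul (v q).1 (w q).1) u⟩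
  have hZ : ContMDiffAt J I.tangent ∞ Z p := hZ
  obtain ⟨Y, hY, hYs⟩ := 𝒢.exists_tangent_src_lift hbw (𝒢.contMDiffAt_tangent_src hZ)
    (hsrc.mono fun q h => 𝒢.isLieGroupoid.src_mul _ _ h)
  -- With `Y` a smooth lift of `Ts Z`, the other factor is `X = Z • Y⁻¹`.
  have hX := 𝒢.contMDiffAt_tangent_mul hZ (𝒢.contMDiffAt_tangent_inv hY)
    (hYs.mono fun q h => h.2.symm.trans (𝒢.tangent_tgt_inv _).symm)
  have hX1 : ∀ᶠ q in 𝓝 p,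
      (𝒢.tangentGroupoid.mul (Z q) (𝒢.tangentGroupoid.inv (Y q))).1 = (v q).1 := by
    filter_upwards [hYs, hsrc] with q h1 h2
    change 𝒢.mul (𝒢.mul (v q).1 (w q).1) (𝒢.inv (Y q).1) = _
    rw [h1.1, 𝒢.isLieGroupoid.mul_assoc _ _ _ h2 (𝒢.isLieGroupoid.tgt_inv _).symm,
      𝒢.isLieGroupoid.mul_inv, ← h2, 𝒢.isLieGroupoid.mul_unit]
  refine ((contMDiffAt_covectorEval hv2 hX hX1).add (contMDiffAt_covectorEval hw2 hY
    (hYs.mono fun q h => h.1))).congr_of_eventuallyEq ?_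
  filter_upwards [hX1, hYs, hc] with q h1 h2 h3
  have h4 := IsCotangentProduct.eval 𝒢 (𝒢.isCotangentProduct_cMul h3) h1 h2.1
    ((𝒢.tangent_src_mul _ _ (h2.2.symm.trans (𝒢.tangent_tgt_inv _).symm)).trans
      (𝒢.tangent_src_inv _))
  rw [𝒢.tangent_mul_inv_mul _ _ h2.2.symm] at h4
  exact h4

end LieGroupoid

/-! ### Fibrewise linear submersions -/

section FibrewiseLinear

variable {E H E' H' F F' : Type*} [NormedAddCommGroup E] [NormedSpace ℝ E]
  [TopologicalSpace H] [NormedAddCommGroup E'] [NormedSpace ℝ E']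
  [TopologicalSpace H'] {I : ModelWithCorners ℝ E H} {I' : ModelWithCorners ℝ E' H'}
  {N B : Type*} [TopologicalSpace N] [ChartedSpace H N]
  [TopologicalSpace B] [ChartedSpace H' B]
  [NormedAddCommGroup F] [NormedSpace ℝ F] [NormedAddCommGroup F'] [NormedSpace ℝ F']
  [IsManifold I ∞ N] [IsManifold I' ∞ B] [I.Boundaryless] [I'.Boundaryless]
  {V : N → Type*} [∀ x, AddCommGroup (V x)] [∀ x, Module ℝ (V x)]
  [TopologicalSpace (TotalSpace F V)] [∀ x, TopologicalSpace (V x)]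
  [FiberBundle F V] [VectorBundle ℝ F V] [ContMDiffVectorBundle ∞ F V I]
  {V' : B → Type*} [∀ x, AddCommGroup (V' x)] [∀ x, Module ℝ (V' x)]
  [TopologicalSpace (TotalSpace F' V')] [∀ x, TopologicalSpace (V' x)]
  [FiberBundle F' V'] [VectorBundle ℝ F' V'] [ContMDiffVectorBundle ∞ F' V' I']

lemma contMDiffAt_line {x : N} (v u : V x) :
    ContMDiffAt 𝓘(ℝ, ℝ) (I.prod 𝓘(ℝ, F)) ∞
      (fun τ : ℝ => (⟨x, v + τ • u⟩ : TotalSpace F V)) 0 :=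
  ContMDiffAt.bundle_add contMDiffAt_const (ContMDiffAt.bundle_smul (b := fun _ => x)
    (v := fun _ => u) contMDiffAt_id contMDiffAt_const)

/-- Vertical tangent vectors of a vector bundle are the velocities of affine lines in the fibre. -/
lemma exists_velocity_line {y : TotalSpace F V} (W : TangentSpace (I.prod 𝓘(ℝ, F)) y)
    (hW : mfderiv (I.prod 𝓘(ℝ, F)) I (TotalSpace.proj : TotalSpace F V → N) y W = 0) :
    ∃ u : V y.1, velocity (I.prod 𝓘(ℝ, F)) (fun τ : ℝ => (⟨y.1, y.2 + τ • u⟩ : TotalSpace F V)) =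
      ⟨y, W⟩ := by
  obtain ⟨δ, hδ, hδW⟩ := exists_velocity_eq (I := I.prod 𝓘(ℝ, F)) (⟨y, W⟩ :
    TangentBundle (I.prod 𝓘(ℝ, F)) (TotalSpace F V))
  have h0 : δ 0 = y := congrArg TotalSpace.proj hδW
  set e := trivializationAt F V y.1
  have hy : y ∈ e.source := e.mem_source.2 (mem_baseSet_trivializationAt F V y.1)
  have hyb : y.1 ∈ e.baseSet := mem_baseSet_trivializationAt F V y.1
  have hδb : ContMDiffAt 𝓘(ℝ, ℝ) I ∞ (fun τ => (δ τ).1) 0 := (contMDiffAt_totalSpace.1 hδ).1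
  have hδc : ContMDiffAt 𝓘(ℝ, ℝ) 𝓘(ℝ, F) ∞ (fun τ => (e (δ τ)).2) 0 :=
    ((e.contMDiffAt_iff (h0 ▸ hy)).1 hδ).2
  have hpr : velocity I (fun τ => (δ τ).1) = ⟨y.1, 0⟩ := by
    refine (velocity_comp (f := (TotalSpace.proj : TotalSpace F V → N)) ?_
      (hδ.mdifferentiableAt (by simp))).trans ?_
    · exact (contMDiff_proj V (n := ∞) _).mdifferentiableAt (by simp)
    · rw [hδW]
      exact tangentBundle_mk_eq_iff.2 ⟨rfl, hW⟩
  obtain ⟨c, hc⟩ : ∃ c : F, velocity 𝓘(ℝ, F) (fun τ => (e (δ τ)).2) = ⟨(e y).2, c⟩ :=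
    ⟨(velocity 𝓘(ℝ, F) (fun τ => (e (δ τ)).2)).2, tangentBundle_mk_eq_iff.2
      ⟨congrArg (fun z => (e z).2) h0, rfl⟩⟩
  have hline : ContMDiffAt 𝓘(ℝ, ℝ) 𝓘(ℝ, F) ∞ (fun τ : ℝ => (e y).2 + τ • c) 0 :=
    (contDiff_const.add (contDiff_id.smul contDiff_const)).contMDiff _
  have hvl : velocity 𝓘(ℝ, F) (fun τ : ℝ => (e y).2 + τ • c) = ⟨(e y).2, c⟩ := by
    have hd : HasDerivAt (fun τ : ℝ => (e y).2 + τ • c) c 0 := by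
      simpa using ((hasDerivAt_id (0 : ℝ)).smul_const c).const_add (e y).2
    refine tangentBundle_mk_eq_iff.2 ⟨by simp, ?_⟩
    have := hd.hasFDerivAt.hasMFDerivAt.mfderiv
    exact (congrArg (fun L : ℝ →L[ℝ] F => L 1) this).trans (by simp)
  -- Work in the trivialization: a curve with zero base velocity and fibre velocity `c` has the same
  -- velocity in `N × F` as the line of direction `c` over the fixed base point.
  let Ψ : N × F → TotalSpace F V := fun p => ⟨p.1, e.symm p.1 p.2⟩
  have hΨ : ContMDiffAt (I.prod 𝓘(ℝ, F)) (I.prod 𝓘(ℝ, F)) ∞ Ψ (y.1, (e y).2) :=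
    contMDiffAt_trivialization_symm F V e contMDiffAt_fst hyb contMDiffAt_snd
  have hΨd := hΨ.mdifferentiableAt (by simp)
  have hΨe : ∀ z ∈ e.source, Ψ (z.1, (e z).2) = z := by
    intro z hz
    exact congrArg _ (e.symm_apply_apply_mk (e.mem_source.1 hz) z.2)
  refine ⟨e.symm y.1 c, ?_⟩
  have h1 : velocity (I.prod 𝓘(ℝ, F)) (fun τ => Ψ ((δ τ).1, (e (δ τ)).2)) = ⟨y, W⟩ := by
    rw [← hδW]
    refine velocity_congr ?_
    filter_upwards [hδ.continuousAt.eventually_mem (e.open_source.mem_nhds (h0 ▸ hy))] with τ hτ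
    exact hΨe _ hτ
  have h2 : velocity (I.prod 𝓘(ℝ, F)) (fun τ : ℝ => Ψ (y.1, (e y).2 + τ • c)) = ⟨y, W⟩ := by
    rw [← h1]
    have e1 := velocity_comp (γ := fun τ => ((δ τ).1, (e (δ τ)).2)) (f := Ψ) (I := I.prod 𝓘(ℝ, F))
      (I' := I.prod 𝓘(ℝ, F)) (by simpa only [h0] using hΨd)
      ((hδb.mdifferentiableAt (by simp)).prodMk (hδc.mdifferentiableAt (by simp)))
    have e2 := velocity_comp (γ := fun τ : ℝ => (y.1, (e y).2 + τ • c)) (f := Ψ)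
      (I := I.prod 𝓘(ℝ, F)) (I' := I.prod 𝓘(ℝ, F)) (by simpa using hΨd)
      (mdifferentiableAt_const.prodMk (hline.mdifferentiableAt (by simp)))
    rw [velocity_prodMk (hδb.mdifferentiableAt (by simp)) (hδc.mdifferentiableAt (by simp))] at e1
    rw [velocity_prodMk (γ := fun _ => y.1) mdifferentiableAt_const
      (hline.mdifferentiableAt (by simp))] at e2
    refine e2.trans (Eq.trans ?_ e1.symm)
    rw [hpr, hc, hvl, velocity_const]
    refine congrArg (tangentMap (I.prod 𝓘(ℝ, F)) (I.prod 𝓘(ℝ, F)) Ψ)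
      (tangentBundle_mk_eq_iff.2 ⟨?_, rfl⟩)
    simp [h0]
  rw [← h2]
  congr 1
  funext τ
  refine congrArg (TotalSpace.mk y.1) ?_
  -- Linearity of the trivialization on the fibre turns the line in `F` into the line in `V y.1`.
  have hl := fun z : F => e.symmL_apply (R := ℝ) hyb z
  rw [← hl, ← hl, map_add, map_smul, hl, hl]
  congr 1
  exact (e.symm_apply_apply_mk hyb y.2).symm

/-- A smooth fibrewise linear surjection over a submersion is a submersion. -/
theorem surjective_mfderiv_of_fibrewise {f : N → B} {Φ : ∀ x, V x →ₗ[ℝ] V' (f x)}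
    (hf : ContMDiff I I' ∞ f)
    (hΦ : ContMDiff (I.prod 𝓘(ℝ, F)) (I'.prod 𝓘(ℝ, F')) ∞
      (fun v : TotalSpace F V => (⟨f v.1, Φ v.1 v.2⟩ : TotalSpace F' V')))
    (v : TotalSpace F V) (hs : Function.Surjective (mfderiv I I' f v.1))
    (hv : Function.Surjective (Φ v.1)) :
    Function.Surjective (mfderiv (I.prod 𝓘(ℝ, F)) (I'.prod 𝓘(ℝ, F'))
      (fun v : TotalSpace F V => (⟨f v.1, Φ v.1 v.2⟩ : TotalSpace F' V')) v) := by
  set Ψ := fun v : TotalSpace F V => (⟨f v.1, Φ v.1 v.2⟩ : TotalSpace F' V')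
  intro W
  have hπ : ∀ z, MDifferentiableAt (I.prod 𝓘(ℝ, F)) I (TotalSpace.proj : TotalSpace F V → N) z :=
    fun z => (contMDiff_proj V (n := ∞) _).mdifferentiableAt (by simp)
  have hπ' : ∀ z, MDifferentiableAt (I'.prod 𝓘(ℝ, F')) I'
    (TotalSpace.proj : TotalSpace F' V' → B) z :=
    fun z => (contMDiff_proj V' (n := ∞) _).mdifferentiableAt (by simp)
  have hΨ : ∀ z, MDifferentiableAt (I.prod 𝓘(ℝ, F)) (I'.prod 𝓘(ℝ, F')) Ψ z :=
    fun z => (hΦ z).mdifferentiableAt (by simp)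
  -- The base component of `W` is lifted first, by a curve with constant coordinates in the
  -- trivialization.
  obtain ⟨Z, hZ⟩ := hs (mfderiv (I'.prod 𝓘(ℝ, F')) I' (TotalSpace.proj : TotalSpace F' V' → B)
    (Ψ v) W)
  obtain ⟨γ, hγ, hγZ⟩ := exists_velocity_eq (I := I) (⟨v.1, Z⟩ : TangentBundle I N)
  have h0 : γ 0 = v.1 := congrArg TotalSpace.proj hγZ
  set e := trivializationAt F V v.1
  have hvb : v.1 ∈ e.baseSet := mem_baseSet_trivializationAt F V v.1
  have hγ' : ContMDiffAt 𝓘(ℝ, ℝ) (I.prod 𝓘(ℝ, F)) ∞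
      (fun τ => (⟨γ τ, e.symm (γ τ) (e v).2⟩ : TotalSpace F V)) 0 :=
    contMDiffAt_trivialization_symm F V e hγ (h0 ▸ hvb) contMDiffAt_const
  obtain ⟨Z', hZ'⟩ : ∃ Z' : TangentSpace (I.prod 𝓘(ℝ, F)) v, velocity (I.prod 𝓘(ℝ, F))
      (fun τ => (⟨γ τ, e.symm (γ τ) (e v).2⟩ : TotalSpace F V)) = ⟨v, Z'⟩ :=
    ⟨(velocity (I.prod 𝓘(ℝ, F)) (fun τ => (⟨γ τ, e.symm (γ τ) (e v).2⟩ : TotalSpace F V))).2,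
      tangentBundle_mk_eq_iff.2 ⟨by
        change (⟨γ 0, e.symm (γ 0) (e v).2⟩ : TotalSpace F V) = v
        rw [h0]
        exact congrArg _ (e.symm_apply_apply_mk hvb v.2), rfl⟩⟩
  have hZZ' : (mfderiv (I.prod 𝓘(ℝ, F)) I (TotalSpace.proj : TotalSpace F V → N) v Z' : E) = Z := by
    have h1 := velocity_comp (f := (TotalSpace.proj : TotalSpace F V → N)) (hπ _)
      (hγ'.mdifferentiableAt (by simp))
    rw [hZ'] at h1
    exact (tangentBundle_mk_eq_iff.1 (h1.symm.trans hγZ)).2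
  -- What remains is vertical, hence the velocity of a line in the fibre, and lifts because `Φ` is
  -- linear and onto on that fibre.
  set W' : TangentSpace (I'.prod 𝓘(ℝ, F')) (Ψ v) :=
    W - mfderiv (I.prod 𝓘(ℝ, F)) (I'.prod 𝓘(ℝ, F')) Ψ v Z' with hWdef
  have hW' : mfderiv (I'.prod 𝓘(ℝ, F')) I' (TotalSpace.proj : TotalSpace F' V' → B) (Ψ v) W' =
      0 := by
    have h1 := mfderiv_comp v (hπ' (Ψ v)) (hΨ v)
    have h2 := mfderiv_comp v ((hf v.1).mdifferentiableAt (by simp)) (hπ v)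
    have h3 : (TotalSpace.proj : TotalSpace F' V' → B) ∘ Ψ = f ∘ TotalSpace.proj := rfl
    rw [h3, h2] at h1
    have h4 := congrArg (fun L : E × F →L[ℝ] E' => L Z') h1
    rw [hWdef, map_sub, ← hZ, sub_eq_zero]
    refine Eq.trans ?_ h4
    exact congrArg (mfderiv I I' f v.1) hZZ'.symm
  obtain ⟨u', hu'⟩ := exists_velocity_line (I := I') W' hW'
  obtain ⟨u, hu⟩ := hv u'
  have hl := (contMDiffAt_line (I := I) (F := F) v.2 u).mdifferentiableAt (by simp)
  have h5 := velocity_comp (f := Ψ) (hΨ _) hl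
  have h6 : (fun τ : ℝ => Ψ ⟨v.1, v.2 + τ • u⟩) = fun τ : ℝ => ⟨(Ψ v).1, (Ψ v).2 + τ • u'⟩ := by
    funext τ
    simp only [Ψ, map_add, map_smul, hu]
  rw [h6, hu'] at h5
  have h7 : (fun τ : ℝ => (⟨v.1, v.2 + τ • u⟩ : TotalSpace F V)) 0 = v := by
    simp
  obtain ⟨Z₂, hZ₂⟩ : ∃ Z₂ : TangentSpace (I.prod 𝓘(ℝ, F)) v, velocity (I.prod 𝓘(ℝ, F))
      (fun τ : ℝ => (⟨v.1, v.2 + τ • u⟩ : TotalSpace F V)) = ⟨v, Z₂⟩ :=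
    ⟨(velocity (I.prod 𝓘(ℝ, F)) (fun τ : ℝ => (⟨v.1, v.2 + τ • u⟩ : TotalSpace F V))).2,
      tangentBundle_mk_eq_iff.2 ⟨h7, rfl⟩⟩
  rw [hZ₂] at h5
  have h8 : mfderiv (I.prod 𝓘(ℝ, F)) (I'.prod 𝓘(ℝ, F')) Ψ v Z₂ = W' :=
    (tangentBundle_mk_eq_iff.1 h5).2.symm
  exact ⟨Z' + Z₂, by rw [map_add, h8, hWdef]; abel⟩

end FibrewiseLinear

/-! ### The Lie groupoid structure of `𝕋G`, its pairing and its anchor. -/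

namespace LieGroupoid

variable {E H E' H' : Type*} [NormedAddCommGroup E] [NormedSpace ℝ E]
  [TopologicalSpace H] [NormedAddCommGroup E'] [NormedSpace ℝ E']
  [TopologicalSpace H'] {I : ModelWithCorners ℝ E H} {I' : ModelWithCorners ℝ E' H'}
  {G M : Type*} [TopologicalSpace G] [ChartedSpace H G]
  [TopologicalSpace M] [ChartedSpace H' M]
  (𝒢 : LieGroupoid I G I' M)
  [FiniteDimensional ℝ E] [FiniteDimensional ℝ E'] [IsManifold I ∞ G] [IsManifold I' ∞ M]
  [I.Boundaryless] [I'.Boundaryless]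

/-- Multiplying `u • 0_g` on the right by the inverse of `0_g` gives `u` back. -/
lemma rightTranslation_injective {g : G} {u : TangentSpace I (𝒢.unit (𝒢.tgt g))}
    (hu : mfderiv I I' 𝒢.src (𝒢.unit (𝒢.tgt g)) u = 0) (h : 𝒢.rightTranslation g u = 0) :
    u = 0 := by
  obtain hc := 𝒢.tangent_composable_right hu
  have h1 := 𝒢.tangent_mk_rightTranslation g u
  have h2 : 𝒢.tangentGroupoid.mul ⟨𝒢.unit (𝒢.tgt g), u⟩ ⟨g, 0⟩ = ⟨g, 0⟩ := by rw [← h1, h]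
  have h3 := 𝒢.tangent_mul_assoc _ _ (𝒢.tangentGroupoid.inv ⟨g, 0⟩) hc
    (𝒢.tangent_tgt_inv _).symm
  rw [h2, 𝒢.tangent_mul_inv, ← hc, 𝒢.tangent_mul_unit, 𝒢.tangent_src_algebroid hu,
    𝒢.tangent_unit_zero] at h3
  exact (tangentBundle_mk_eq_iff.1 h3).2.symm

/-- Right translation is injective on the algebroid fibre, so a functional on that fibre extends
along it by a linear left inverse. -/
lemma cTgt_surjective (g : G) : Function.Surjective (𝒢.cTgt g) := by
  intro ξ
  let R : 𝒢.Algebroid (𝒢.tgt g) →ₗ[ℝ] E :=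
    (𝒢.rightTranslation g ∘L Submodule.subtypeL _ : 𝒢.Algebroid (𝒢.tgt g) →L[ℝ] E).toLinearMap
  have hR : LinearMap.ker R = ⊥ := by
    rw [LinearMap.ker_eq_bot']
    rintro ⟨u, hu⟩ h
    exact Subtype.ext (𝒢.rightTranslation_injective (LinearMap.mem_ker.1 hu) h)
  obtain ⟨S, hS⟩ := LinearMap.exists_leftInverse_of_injective R hR
  refine ⟨show E →L[ℝ] ℝ from LinearMap.toContinuousLinearMap (ξ.toLinearMap ∘ₗ S : E →ₗ[ℝ] ℝ), ?_⟩
  ext u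
  exact congrArg ξ (congrArg (fun L => L u) hS)

lemma genTgt_surjective (g : G) : Function.Surjective (𝒢.genTgt g) := by
  rintro ⟨v, ξ⟩
  obtain ⟨X, hX⟩ := 𝒢.isLieGroupoid.submersion_tgt g v
  obtain ⟨α, hα⟩ := 𝒢.cTgt_surjective g ξ
  exact ⟨(X, α), Prod.ext hX hα⟩

/-- `𝕋G ⇉ TM ⊕ A*G` is a Lie groupoid. -/
theorem isLieGroupoid_genGroupoid :
    IsLieGroupoid (I.prod 𝓘(ℝ, GenModel E)) (I'.prod 𝓘(ℝ, BaseModel E E')) 𝒢.genGroupoid := by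
  have htgt : ContMDiff (I.prod 𝓘(ℝ, GenModel E)) (I'.prod 𝓘(ℝ, BaseModel E E')) ∞
      𝒢.genGroupoid.tgt := fun v => 𝒢.contMDiffAt_gen_tgt contMDiffAt_id
  have hinv : ContMDiff (I.prod 𝓘(ℝ, GenModel E)) (I.prod 𝓘(ℝ, GenModel E)) ∞
      𝒢.genGroupoid.inv := fun v => 𝒢.contMDiffAt_gen_inv contMDiffAt_id
  have hsrc : ContMDiff (I.prod 𝓘(ℝ, GenModel E)) (I'.prod 𝓘(ℝ, BaseModel E E')) ∞
      𝒢.genGroupoid.src := fun v => 𝒢.contMDiffAt_gen_src contMDiffAt_id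
  have hsub : ∀ v, Function.Surjective
      (mfderiv (I.prod 𝓘(ℝ, GenModel E)) (I'.prod 𝓘(ℝ, BaseModel E E')) 𝒢.genGroupoid.tgt v) :=
    fun v => surjective_mfderiv_of_fibrewise (V := (GenTangent I : G → Type _)) (V' := 𝒢.GenBase)
      (Φ := 𝒢.genTgt) 𝒢.isLieGroupoid.smooth_tgt htgt v (𝒢.isLieGroupoid.submersion_tgt _)
      (𝒢.genTgt_surjective _)
  refine ⟨𝒢.gen_src_unit, 𝒢.gen_tgt_unit, 𝒢.gen_src_mul, 𝒢.gen_tgt_mul, 𝒢.gen_mul_assoc,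
    𝒢.gen_unit_mul, 𝒢.gen_mul_unit, 𝒢.gen_src_inv, 𝒢.gen_tgt_inv, 𝒢.gen_inv_mul, 𝒢.gen_mul_inv,
    hsrc, htgt, fun v => 𝒢.contMDiffAt_gen_unit contMDiffAt_id, hinv, ?_, ?_, hsub⟩
  · rintro ⟨v, w⟩ hvw
    have hvw : 𝒢.genGroupoid.src v = 𝒢.genGroupoid.tgt w := hvw
    -- The smooth extension of the product corrects the second factor by a local section of the
    -- target until the pair is composable. Pairs that are already composable are left unchanged.
    obtain ⟨σ, hσ⟩ := exists_sections_of_submersion (x₀ := w) isOpen_univ (mem_univ _)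
      htgt.contMDiffOn (hsub w)
    obtain ⟨S, hS, hSo, hSw⟩ := eventually_nhds_iff.1 hσ
    have hθ : ContMDiff ((I.prod 𝓘(ℝ, GenModel E)).prod (I.prod 𝓘(ℝ, GenModel E)))
        ((I'.prod 𝓘(ℝ, BaseModel E E')).prod (I.prod 𝓘(ℝ, GenModel E))) ∞
        (fun q : 𝒢.GenTotal × 𝒢.GenTotal => (𝒢.genGroupoid.src q.1, q.2)) :=
      (hsrc.comp contMDiff_fst).prodMk contMDiff_snd
    refine ⟨_, fun q => 𝒢.genGroupoid.mul q.1 (σ (𝒢.genGroupoid.src q.1, q.2)),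
      hSo.preimage hθ.continuous, ?_, fun q hq => ?_, ?_⟩
    · change (𝒢.genGroupoid.src v, w) ∈ S
      rw [hvw]
      exact hSw
    · refine (𝒢.contMDiffAt_gen_mul contMDiffAt_fst ((hS _ hq).1.comp q (hθ q))
        ?_).contMDiffWithinAt
      filter_upwards [(hSo.preimage hθ.continuous).mem_nhds hq] with r hr
      exact (hS _ hr).2.1.symm
    · rintro ⟨v', w'⟩ ⟨h1, h2⟩
      exact congrArg (𝒢.genGroupoid.mul v') ((hS _ h2).2.2 h1)
  · intro v
    have h1 : 𝒢.genGroupoid.src = 𝒢.genGroupoid.tgt ∘ 𝒢.genGroupoid.inv :=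
      funext fun v => (𝒢.gen_tgt_inv v).symm
    have hd : ∀ v, MDifferentiableAt (I.prod 𝓘(ℝ, GenModel E)) (I.prod 𝓘(ℝ, GenModel E))
      𝒢.genGroupoid.inv v := fun v => (hinv v).mdifferentiableAt (by simp)
    -- Inversion is an involution, so its derivative is onto; the source is the target after
    -- inversion.
    have h2 : Function.Surjective (mfderiv (I.prod 𝓘(ℝ, GenModel E)) (I.prod 𝓘(ℝ, GenModel E))
        𝒢.genGroupoid.inv v) := by
      intro W
      have h3 := tangentMap_comp_at (I := I.prod 𝓘(ℝ, GenModel E)) (I' := I.prod 𝓘(ℝ, GenModel E))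
        (I'' := I.prod 𝓘(ℝ, GenModel E)) (f := 𝒢.genGroupoid.inv) (g := 𝒢.genGroupoid.inv)
        ⟨𝒢.genGroupoid.inv v, W⟩ (hd _) (hd _)
      rw [show 𝒢.genGroupoid.inv ∘ 𝒢.genGroupoid.inv = id from funext 𝒢.gen_inv_inv,
        tangentMap_id] at h3
      -- The preimage found by the chain rule lies over the double inverse of `v`; a generalized
      -- point `v'` lets it be moved to `v`.
      have h4 : ∀ v', v' = v → ∀ Y : TangentSpace (I.prod 𝓘(ℝ, GenModel E)) v',
          (⟨𝒢.genGroupoid.inv v, W⟩ : TangentBundle (I.prod 𝓘(ℝ, GenModel E)) 𝒢.GenTotal) =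
            tangentMap (I.prod 𝓘(ℝ, GenModel E)) (I.prod 𝓘(ℝ, GenModel E)) 𝒢.genGroupoid.inv
              ⟨v', Y⟩ → ∃ a, mfderiv (I.prod 𝓘(ℝ, GenModel E)) (I.prod 𝓘(ℝ, GenModel E))
                𝒢.genGroupoid.inv v a = W := by
        rintro _ rfl Y hY
        exact ⟨Y, (tangentBundle_mk_eq_iff.1 hY).2.symm⟩
      exact h4 _ (𝒢.gen_inv_inv v) _ h3
    rw [h1, mfderiv_comp v ((htgt _).mdifferentiableAt (by simp)) (hd v)]
    exact (hsub _).comp h2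

/-! ### The pairing and the anchor -/

/-- Vectors tangent to the units are fixed by `T1 ∘ Ts` and project to zero in the algebroid. Hence
the pairing vanishes on units. -/
lemma cUnit_unit {x : M} (ξ : 𝒢.DualAlgebroid x) (v : TangentSpace I' x) :
    𝒢.cUnit x ξ (mfderiv I' I 𝒢.unit x v) = 0 := by
  have h : mfderiv I' I 𝒢.unit x v - 𝒢.unitSrc x (mfderiv I' I 𝒢.unit x v) = 0 := by
    rw [sub_eq_zero]
    have h1 := 𝒢.tangent_mk_unitSrc x (mfderiv I' I 𝒢.unit x v)
    have h2 : (⟨𝒢.unit x, mfderiv I' I 𝒢.unit x v⟩ : TangentBundle I G) =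
      𝒢.tangentGroupoid.unit ⟨x, v⟩ := rfl
    rw [h2, 𝒢.tangent_src_unit, ← h2] at h1
    exact ((tangentBundle_mk_eq_iff.1 h1).2).symm
  rw [𝒢.cUnit_apply ξ (map_zero _) h]
  exact map_zero ξ

lemma genPairing_apply (v : 𝒢.GenSumTotal) :
    𝒢.genPairing v = v.2.1.2 v.2.2.1 + v.2.2.2 v.2.1.1 := rfl

/-- The pairing of `𝕋G` is a morphism of Lie groupoids to `ℝ`. -/
theorem isLieGroupoidHom_genPairing :
    IsLieGroupoidHom (I.prod 𝓘(ℝ, GenModel E × GenModel E))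
        (I'.prod 𝓘(ℝ, BaseModel E E' × BaseModel E E')) 𝓘(ℝ, ℝ)
        𝓘(ℝ, PUnit.{1}) 𝒢.genSumGroupoid realGroupoid 𝒢.genPairing (fun _ => PUnit.unit) where
  smooth v := by
    obtain ⟨h1, h2⟩ := (contMDiffAt_bundleProd_iff (V := (GenTangent I : G → Type _))
      (V' := (GenTangent I : G → Type _)) (IB := I) (b := fun q : 𝒢.GenSumTotal => q.1)
      (v := fun q => q.2.1) (w := fun q => q.2.2)).1 (contMDiffAt_id (x := v))
    obtain ⟨h3, h4⟩ := 𝒢.contMDiffAt_genTotal_iff.1 h1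
    obtain ⟨h5, h6⟩ := 𝒢.contMDiffAt_genTotal_iff.1 h2
    exact (ContMDiffAt.dual_apply (V := fun x : G => TangentSpace I x) (F := E) h4 h5).add
      (ContMDiffAt.dual_apply (V := fun x : G => TangentSpace I x) (F := E) h6 h3)
  smooth_base := contMDiff_const
  map_src _ := rfl
  map_tgt _ := rfl
  map_unit ξ := by
    refine (𝒢.genPairing_apply _).trans ?_
    change 𝒢.cUnit ξ.1 ξ.2.1.2 (mfderiv I' I 𝒢.unit ξ.1 ξ.2.2.1) +
      𝒢.cUnit ξ.1 ξ.2.2.2 (mfderiv I' I 𝒢.unit ξ.1 ξ.2.1.1) = 0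
    rw [cUnit_unit, cUnit_unit, add_zero]
  map_mul v w h := by
    have hc : 𝒢.src v.1 = 𝒢.tgt w.1 := congrArg TotalSpace.proj h
    have hinj := TotalSpace.mk.inj h
    have hc1 : 𝒢.GenComposable v.1 w.1 v.2.1 w.2.1 := by
      have := congrArg (fun ξ : 𝒢.GenBaseSumTotal => (⟨ξ.1, ξ.2.1⟩ : 𝒢.GenBaseTotal)) h
      exact this
    have hc2 : 𝒢.GenComposable v.1 w.1 v.2.2 w.2.2 := by
      have := congrArg (fun ξ : 𝒢.GenBaseSumTotal => (⟨ξ.1, ξ.2.2⟩ : 𝒢.GenBaseTotal)) h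
      exact this
    -- The covectors of each pair are evaluated on the tangent vectors of the other; the two
    -- defining equations add up to the claim.
    have e1 := 𝒢.isCotangentProduct_cMul hc1 _ _ (𝒢.genComposable_iff.1 hc2).1
    have e2 := 𝒢.isCotangentProduct_cMul hc2 _ _ (𝒢.genComposable_iff.1 hc1).1
    refine (𝒢.genPairing_apply _).trans ?_
    change 𝒢.cMul v.1 w.1 v.2.1.2 w.2.1.2 (𝒢.tMul v.1 w.1 v.2.2.1 w.2.2.1) +
      𝒢.cMul v.1 w.1 v.2.2.2 w.2.2.2 (𝒢.tMul v.1 w.1 v.2.1.1 w.2.1.1) =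
      (v.2.1.2 v.2.2.1 + v.2.2.2 v.2.1.1) + (w.2.1.2 w.2.2.1 + w.2.2.2 w.2.1.1)
    rw [e1, e2]
    ring

lemma mem_tangentTo_composable {g h : G} {X : TangentSpace I g} {Y : TangentSpace I h}
    (hXY : 𝒢.tangentGroupoid.src ⟨g, X⟩ = 𝒢.tangentGroupoid.tgt ⟨h, Y⟩) :
    ((X, Y) : TangentSpace (I.prod I) (g, h)) ∈ tangentTo (I.prod I) 𝒢.composable (g, h) := by
  obtain ⟨γ, δ, hγ, hδ, hc, h1, h2⟩ := 𝒢.exists_curves_composable _ _ hXY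
  refine ⟨fun τ => (γ τ, δ τ), hγ.prodMk hδ, hc, ?_⟩
  refine (velocity_prodMk (hγ.mdifferentiableAt (by simp)) (hδ.mdifferentiableAt (by simp))).trans ?_
  have e1 := tangentBundle_mk_eq_iff.1 h1
  have e2 := tangentBundle_mk_eq_iff.1 h2
  exact tangentBundle_mk_eq_iff.2 ⟨Prod.ext e1.1 e2.1, Prod.ext e1.2 e2.2⟩

end LieGroupoid

/-! ### The Courant bracket on a vector space -/

section Flat

lemma two_le_infty : (2 : ℕ∞ω) ≤ ∞ := by
  norm_cast

variable {E : Type*} [NormedAddCommGroup E] [NormedSpace ℝ E]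

/-- The Courant bracket of sections of the trivial bundle `E × E*` over `E`. -/
def flatBracket (a b : E → GenModel E) (y : E) : GenModel E :=
  ((fderiv ℝ b y (a y).1).1 - (fderiv ℝ a y (b y).1).1,
    (fderiv ℝ b y (a y).1).2 + (b y).2 ∘L (ContinuousLinearMap.fst ℝ E (E →L[ℝ] ℝ) ∘L fderiv ℝ a y)
      - (fderiv ℝ a y (b y).1).2
      + (ContinuousLinearMap.snd ℝ E (E →L[ℝ] ℝ) ∘L fderiv ℝ a y).flip (b y).1)

/-- The canonical pairing on `E × E*`. -/
def flatPair (v w : GenModel E) : ℝ := v.2 w.1 + w.2 v.1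

/-- Of the four terms, the first two are `L_X β` and the last two are `-i_Y dα`. -/
lemma flatBracket_snd_apply (a b : E → GenModel E) (y w : E) :
    (flatBracket a b y).2 w = (fderiv ℝ b y (a y).1).2 w + (b y).2 (fderiv ℝ a y w).1
      - (fderiv ℝ a y (b y).1).2 w + (fderiv ℝ a y w).2 (b y).1 := rfl

lemma flatBracket_congr {a a' b b' : E → GenModel E} {y : E} (ha : a =ᶠ[𝓝 y] a')
    (hb : b =ᶠ[𝓝 y] b') : flatBracket a b y = flatBracket a' b' y := by
  simp only [flatBracket, ha.fderiv_eq, hb.fderiv_eq, ha.self_of_nhds, hb.self_of_nhds]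

lemma ContDiffAt.flatBracket [FiniteDimensional ℝ E] {a b : E → GenModel E} {y : E} (ha : ContDiffAt ℝ ∞ a y)
    (hb : ContDiffAt ℝ ∞ b y) : ContDiffAt ℝ ∞ (flatBracket a b) y := by
  have ha' : ContDiffAt ℝ ∞ (fderiv ℝ a) y := ha.fderiv_right (by simp)
  have hb' : ContDiffAt ℝ ∞ (fderiv ℝ b) y := hb.fderiv_right (by simp)
  have h1 : ContDiffAt ℝ ∞ (fun y => fderiv ℝ b y (a y).1) y := hb'.clm_apply ha.fst
  have h2 : ContDiffAt ℝ ∞ (fun y => fderiv ℝ a y (b y).1) y := ha'.clm_apply hb.fst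
  have h3 : ContDiffAt ℝ ∞ (fun y => (ContinuousLinearMap.snd ℝ E (E →L[ℝ] ℝ) ∘L
      fderiv ℝ a y).flip (b y).1) y := by
    refine (contMDiffAt_clm_of_apply fun w => ?_).contDiffAt
    exact ((ha'.clm_apply contDiffAt_const).snd.clm_apply hb.fst).contMDiffAt
  exact (h1.fst.sub h2.fst).prodMk
    (((h1.snd.add (hb.snd.clm_comp (contDiffAt_const.clm_comp ha'))).sub h2.snd).add h3)

lemma fderiv_fst_apply {a : E → GenModel E} {y : E} (ha : DifferentiableAt ℝ a y) (u : E) :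
    fderiv ℝ (fun y => (a y).1) y u = (fderiv ℝ a y u).1 := by
  rw [ha.hasFDerivAt.fst.fderiv]; rfl

lemma fderiv_snd_apply {a : E → GenModel E} {y : E} (ha : DifferentiableAt ℝ a y) (u w : E) :
    fderiv ℝ (fun y => (a y).2 w) y u = (fderiv ℝ a y u).2 w := by
  rw [(ha.hasFDerivAt.snd.clm_apply (hasFDerivAt_const w y)).fderiv]; simp

lemma fderiv_flatPair {a b : E → GenModel E} {y : E} (ha : DifferentiableAt ℝ a y)
    (hb : DifferentiableAt ℝ b y) (u : E) :
    fderiv ℝ (fun y => flatPair (a y) (b y)) y u =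
      flatPair (fderiv ℝ a y u) (b y) + flatPair (a y) (fderiv ℝ b y u) := by
  have h := (ha.hasFDerivAt.snd.clm_apply hb.hasFDerivAt.fst).add
    (hb.hasFDerivAt.snd.clm_apply ha.hasFDerivAt.fst)
  have h' : HasFDerivAt (fun y => flatPair (a y) (b y)) _ y := h
  rw [h'.fderiv]
  simp [flatPair]
  ring

lemma flatBracket_add_left {a b c : E → GenModel E} {y : E} (ha : DifferentiableAt ℝ a y)
    (hb : DifferentiableAt ℝ b y) :
    flatBracket (fun y => a y + b y) c y = flatBracket a c y + flatBracket b c y := by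
  have h : fderiv ℝ (fun y => a y + b y) y = fderiv ℝ a y + fderiv ℝ b y := fderiv_add ha hb
  refine Prod.ext ?_ (ContinuousLinearMap.ext fun w => ?_)
  · simp only [flatBracket, h, Prod.fst_add, map_add, add_apply]
    abel
  · simp only [Prod.snd_add, add_apply, flatBracket_snd_apply, h, Prod.fst_add, map_add]
    ring

lemma flatBracket_smul_left {a b : E → GenModel E} {y : E} (r : ℝ) (ha : DifferentiableAt ℝ a y) :
    flatBracket (fun y => r • a y) b y = r • flatBracket a b y := by
  have h : fderiv ℝ (fun y => r • a y) y = r • fderiv ℝ a y := fderiv_const_smul ha r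
  refine Prod.ext ?_ (ContinuousLinearMap.ext fun w => ?_)
  · simp only [flatBracket, h, Prod.smul_fst, map_smul, smul_apply, smul_sub]
  · simp only [Prod.smul_snd, smul_apply, flatBracket_snd_apply, h, Prod.smul_fst, map_smul,
      smul_eq_mul]
    ring

lemma flatBracket_add_right {a b c : E → GenModel E} {y : E} (hb : DifferentiableAt ℝ b y)
    (hc : DifferentiableAt ℝ c y) :
    flatBracket a (fun y => b y + c y) y = flatBracket a b y + flatBracket a c y := by
  have h : fderiv ℝ (fun y => b y + c y) y = fderiv ℝ b y + fderiv ℝ c y := fderiv_add hb hc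
  refine Prod.ext ?_ (ContinuousLinearMap.ext fun w => ?_)
  · simp only [flatBracket, h, Prod.fst_add, map_add, add_apply]
    abel
  · simp only [Prod.snd_add, add_apply, flatBracket_snd_apply, h, Prod.fst_add, map_add]
    ring

lemma flatBracket_leibniz {f : E → ℝ} {a b : E → GenModel E} {y : E}
    (hf : DifferentiableAt ℝ f y) (hb : DifferentiableAt ℝ b y) :
    flatBracket a (fun y => f y • b y) y =
      f y • flatBracket a b y + fderiv ℝ f y (a y).1 • b y := by
  have h : fderiv ℝ (fun y => f y • b y) y = f y • fderiv ℝ b y + (fderiv ℝ f y).smulRight (b y) :=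
    (hf.hasFDerivAt.smul hb.hasFDerivAt).fderiv
  refine Prod.ext ?_ (ContinuousLinearMap.ext fun w => ?_)
  · simp only [flatBracket, h, Prod.fst_add, Prod.smul_fst, map_smul, add_apply, smul_apply,
      ContinuousLinearMap.smulRight_apply, smul_sub]
    abel
  · simp only [Prod.snd_add, add_apply, flatBracket_snd_apply, h, Prod.smul_fst, map_smul,
      Prod.smul_snd, smul_apply, ContinuousLinearMap.smulRight_apply, smul_eq_mul]
    ring

lemma flatBracket_symm_part (a b : E → GenModel E) {y : E} (ha : DifferentiableAt ℝ a y)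
    (hb : DifferentiableAt ℝ b y) (v : GenModel E) :
    flatPair (flatBracket a b y + flatBracket b a y) v =
      fderiv ℝ (fun y => flatPair (a y) (b y)) y v.1 := by
  rw [fderiv_flatPair ha hb]
  simp only [flatPair, Prod.snd_add, add_apply, flatBracket_snd_apply, Prod.fst_add, map_add]
  simp only [flatBracket, map_sub]
  ring

lemma flatBracket_invariance (a b c : E → GenModel E) {y : E}
    (hb : DifferentiableAt ℝ b y) (hc : DifferentiableAt ℝ c y) :
    fderiv ℝ (fun y => flatPair (b y) (c y)) y (a y).1 =
      flatPair (flatBracket a b y) (c y) + flatPair (b y) (flatBracket a c y) := by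
  rw [fderiv_flatPair hb hc]
  simp only [flatPair, flatBracket_snd_apply]
  simp only [flatBracket, map_sub]
  ring

/-- Displays the second derivatives, as needed for the nested brackets in the Jacobi identity. -/
lemma fderiv_flatBracket_fst [FiniteDimensional ℝ E] {a b : E → GenModel E} {y : E} (ha : ContDiffAt ℝ ∞ a y)
    (hb : ContDiffAt ℝ ∞ b y) (u : E) :
    (fderiv ℝ (flatBracket a b) y u).1 =
      (fderiv ℝ (fderiv ℝ b) y u (a y).1).1 + (fderiv ℝ b y (fderiv ℝ a y u).1).1
      - (fderiv ℝ (fderiv ℝ a) y u (b y).1).1 - (fderiv ℝ a y (fderiv ℝ b y u).1).1 := by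
  have ha' : ContDiffAt ℝ ∞ (fderiv ℝ a) y := ha.fderiv_right (by simp)
  have hb' : ContDiffAt ℝ ∞ (fderiv ℝ b) y := hb.fderiv_right (by simp)
  have da := (ha.differentiableAt (by simp)).hasFDerivAt
  have db := (hb.differentiableAt (by simp)).hasFDerivAt
  have da' := (ha'.differentiableAt (by simp)).hasFDerivAt
  have db' := (hb'.differentiableAt (by simp)).hasFDerivAt
  rw [← fderiv_fst_apply ((ha.flatBracket hb).differentiableAt (by simp))]
  have h : HasFDerivAt (fun y => (flatBracket a b y).1) _ y :=
    (db'.clm_apply da.fst).fst.sub (da'.clm_apply db.fst).fst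
  rw [h.fderiv]
  simp
  abel

lemma fderiv_flatBracket_snd [FiniteDimensional ℝ E] {a b : E → GenModel E} {y : E} (ha : ContDiffAt ℝ ∞ a y)
    (hb : ContDiffAt ℝ ∞ b y) (u w : E) :
    (fderiv ℝ (flatBracket a b) y u).2 w =
      (fderiv ℝ (fderiv ℝ b) y u (a y).1).2 w + (fderiv ℝ b y (fderiv ℝ a y u).1).2 w
      + (fderiv ℝ b y u).2 (fderiv ℝ a y w).1 + (b y).2 (fderiv ℝ (fderiv ℝ a) y u w).1
      - (fderiv ℝ (fderiv ℝ a) y u (b y).1).2 w - (fderiv ℝ a y (fderiv ℝ b y u).1).2 w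
      + (fderiv ℝ (fderiv ℝ a) y u w).2 (b y).1 + (fderiv ℝ a y w).2 (fderiv ℝ b y u).1 := by
  have ha' : ContDiffAt ℝ ∞ (fderiv ℝ a) y := ha.fderiv_right (by simp)
  have hb' : ContDiffAt ℝ ∞ (fderiv ℝ b) y := hb.fderiv_right (by simp)
  have da := (ha.differentiableAt (by simp)).hasFDerivAt
  have db := (hb.differentiableAt (by simp)).hasFDerivAt
  have da' := (ha'.differentiableAt (by simp)).hasFDerivAt
  have db' := (hb'.differentiableAt (by simp)).hasFDerivAt
  rw [← fderiv_snd_apply ((ha.flatBracket hb).differentiableAt (by simp))]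
  have cw := hasFDerivAt_const w y (𝕜 := ℝ)
  have h : HasFDerivAt (fun y => (flatBracket a b y).2 w) _ y :=
    ((((db'.clm_apply da.fst).snd.clm_apply cw).add
      (db.snd.clm_apply (da'.clm_apply cw).fst)).sub
      ((da'.clm_apply db.fst).snd.clm_apply cw)).add ((da'.clm_apply cw).snd.clm_apply db.fst)
  rw [h.fderiv]
  simp
  ring

/-- After expansion, the terms containing only first derivatives cancel algebraically, and those
with second derivatives cancel by the symmetry of the latter. -/
lemma flatBracket_jacobi [FiniteDimensional ℝ E] {a b c : E → GenModel E} {y : E} (ha : ContDiffAt ℝ ∞ a y)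
    (hb : ContDiffAt ℝ ∞ b y) (hc : ContDiffAt ℝ ∞ c y) :
    flatBracket a (flatBracket b c) y =
      flatBracket (flatBracket a b) c y + flatBracket b (flatBracket a c) y := by
  have sa : ∀ u v, fderiv ℝ (fderiv ℝ a) y u v = fderiv ℝ (fderiv ℝ a) y v u := fun u v =>
    (ha.isSymmSndFDerivAt (by simpa using two_le_infty)).eq u v
  have sb : ∀ u v, fderiv ℝ (fderiv ℝ b) y u v = fderiv ℝ (fderiv ℝ b) y v u := fun u v =>
    (hb.isSymmSndFDerivAt (by simpa using two_le_infty)).eq u v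
  have sc : ∀ u v, fderiv ℝ (fderiv ℝ c) y u v = fderiv ℝ (fderiv ℝ c) y v u := fun u v =>
    (hc.isSymmSndFDerivAt (by simpa using two_le_infty)).eq u v
  have f1 : ∀ (a b : E → GenModel E), (flatBracket a b y).1 =
    (fderiv ℝ b y (a y).1).1 - (fderiv ℝ a y (b y).1).1 := fun _ _ => rfl
  refine Prod.ext ?_ (ContinuousLinearMap.ext fun w => ?_)
  · simp only [Prod.fst_add, f1, fderiv_flatBracket_fst hb hc,
      fderiv_flatBracket_fst ha hb, fderiv_flatBracket_fst ha hc]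
    simp only [map_sub, Prod.fst_sub]
    rw [sc (a y).1 (b y).1, sb (a y).1 (c y).1, sa (c y).1 (b y).1]
    abel
  · simp only [Prod.snd_add, add_apply, flatBracket_snd_apply, fderiv_flatBracket_snd hb hc,
      fderiv_flatBracket_snd ha hb, fderiv_flatBracket_snd ha hc, fderiv_flatBracket_fst ha hb, f1]
    simp only [map_sub, map_add, Prod.snd_sub, sub_apply]
    rw [sc (a y).1 (b y).1, sb (a y).1 (c y).1, sa (c y).1 (b y).1, sb (a y).1 w, sa (b y).1 w,
      sa (c y).1 w]
    ring

/-- The exterior derivative of 1-forms commutes with pullbacks. -/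
lemma fderiv_pullback_symm {E₁ : Type*} [NormedAddCommGroup E₁] [NormedSpace ℝ E₁]
    {θ : E → E →L[ℝ] ℝ} {g : E₁ → E} {y : E₁} (hθ : DifferentiableAt ℝ θ (g y))
    (hg : ContDiffAt ℝ ∞ g y) (u v : E₁) :
    fderiv ℝ (fun z => θ (g z) ∘L fderiv ℝ g z) y u v -
      fderiv ℝ (fun z => θ (g z) ∘L fderiv ℝ g z) y v u =
    fderiv ℝ θ (g y) (fderiv ℝ g y u) (fderiv ℝ g y v) -
      fderiv ℝ θ (g y) (fderiv ℝ g y v) (fderiv ℝ g y u) := by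
  have hg' : ContDiffAt ℝ ∞ (fderiv ℝ g) y := hg.fderiv_right (by simp)
  have d1 := hθ.hasFDerivAt.comp y (hg.differentiableAt (by simp)).hasFDerivAt
  have d2 := (hg'.differentiableAt (by simp)).hasFDerivAt
  have h : HasFDerivAt (fun z => θ (g z) ∘L fderiv ℝ g z) _ y := d1.clm_comp d2
  -- The second derivative of `g` enters symmetrically and drops out of the antisymmetrized
  -- expression.
  have hs := (hg.isSymmSndFDerivAt (by simpa using two_le_infty)).eq u v
  rw [h.fderiv]
  simp [hs]

end Flat

/-! ### The Courant bracket in charts -/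

section CourantChart

variable {E H : Type*} [NormedAddCommGroup E] [NormedSpace ℝ E] [FiniteDimensional ℝ E]
  [TopologicalSpace H] {I : ModelWithCorners ℝ E H} [I.Boundaryless]
  {N : Type*} [TopologicalSpace N] [ChartedSpace H N] [IsManifold I ∞ N]

lemma contMDiffAt_extChartAt_symm_boundaryless {x₀ : N} {y : E}
    (hy : y ∈ (extChartAt I x₀).target) :
    ContMDiffAt 𝓘(ℝ, E) I ∞ (extChartAt I x₀).symm y :=
  (contMDiffOn_extChartAt_symm (n := ∞) x₀).contMDiffAt ((isOpen_extChartAt_target _).mem_nhds hy)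

lemma mfderiv_extChartAt_comp_symm {x₀ : N} {y : E} (hy : y ∈ (extChartAt I x₀).target) (w : E) :
    mfderiv I 𝓘(ℝ, E) (extChartAt I x₀) ((extChartAt I x₀).symm y)
      (mfderiv 𝓘(ℝ, E) I (extChartAt I x₀).symm y w) = w := by
  have hs := (contMDiffAt_extChartAt_symm_boundaryless hy).mdifferentiableAt (by simp)
  have hc := mdifferentiableAt_extChartAt (I := I) (x := x₀)
    (y := (extChartAt I x₀).symm y) (by simpa using (extChartAt I x₀).map_target hy)
  have h1 := mfderiv_comp y hc hs
  have h2 : (extChartAt I x₀) ∘ (extChartAt I x₀).symm =ᶠ[𝓝 y] id := by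
    filter_upwards [(isOpen_extChartAt_target _).mem_nhds hy] with z hz
    exact (extChartAt I x₀).right_inv hz
  rw [h2.mfderiv_eq, mfderiv_id] at h1
  exact (congrArg (fun L : E →L[ℝ] E => L w) h1).symm

lemma mfderiv_symm_comp_extChartAt {x₀ : N} {y : E} (hy : y ∈ (extChartAt I x₀).target)
    (v : TangentSpace I ((extChartAt I x₀).symm y)) :
    (mfderiv 𝓘(ℝ, E) I (extChartAt I x₀).symm y
      (mfderiv I 𝓘(ℝ, E) (extChartAt I x₀) ((extChartAt I x₀).symm y) v) : E) = v := by
  have hi := (mfderiv_extChartAt_bijective (I := I) (x₀ := x₀)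
    ((extChartAt I x₀).map_target hy)).1
  exact hi (mfderiv_extChartAt_comp_symm hy _)

variable (I) in
/-- A section of `𝕋N` read in the chart at `x₀`. -/
def genInChart (a : ∀ x : N, GenTangent I x) (x₀ : N) (y : E) : GenModel E :=
  (mfderiv I 𝓘(ℝ, E) (extChartAt I x₀) ((extChartAt I x₀).symm y) (a ((extChartAt I x₀).symm y)).1,
    oneFormInChart I (fun z => (a z).2) x₀ y)

lemma oneFormInChart_apply (α : ∀ x : N, Cotangent I x) (x₀ : N) (y w : E) :
    oneFormInChart I α x₀ y w =
      α ((extChartAt I x₀).symm y) (mfderiv 𝓘(ℝ, E) I (extChartAt I x₀).symm y w) := by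
  unfold oneFormInChart
  rw [I.range_eq_univ, mfderivWithin_univ]
  rfl

/-- The chart expression is the coordinate in the preferred bundle trivialization, so smoothness of
a section can be tested on it. -/
lemma trivializationAt_genTangent {x₀ : N} {y : E} (hy : y ∈ (extChartAt I x₀).target)
    (a : ∀ x : N, GenTangent I x) :
    (trivializationAt (GenModel E) (GenTangent I : N → Type _) x₀
      ⟨(extChartAt I x₀).symm y, a ((extChartAt I x₀).symm y)⟩).2 = genInChart I a x₀ y := by
  have hx : (extChartAt I x₀).symm y ∈ (chartAt H x₀).source := by
    simpa using (extChartAt I x₀).map_target hy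
  have h1 := TangentBundle.continuousLinearMapAt_trivializationAt (𝕜 := ℝ) (I := I) hx
  have h2 := TangentBundle.symmL_trivializationAt (𝕜 := ℝ) (I := I) hx
  rw [(extChartAt I x₀).right_inv hy] at h2
  refine Prod.ext ?_ ?_
  · refine Eq.trans ?_ (congrArg (fun L : E →L[ℝ] E =>
      L (a ((extChartAt I x₀).symm y)).1) h1)
    exact (Trivialization.continuousLinearMapAt_apply_of_mem ℝ _ (by simpa using hx) _).symm
  · refine ContinuousLinearMap.ext fun w => ?_
    change (trivializationAt (E →L[ℝ] ℝ) (fun x : N => TangentSpace I x →L[ℝ] ℝ) x₀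
      ⟨(extChartAt I x₀).symm y, (a ((extChartAt I x₀).symm y)).2⟩).2 w = _
    rw [hom_trivializationAt_apply]
    simp only [ContinuousLinearMap.inCoordinates, ContinuousLinearMap.comp_apply, genInChart,
      oneFormInChart]
    rw [h2]
    simp
    rfl

/-- Smoothness of sections of `𝕋N` can be tested in charts. -/
lemma contMDiffAt_genSection_iff {a : ∀ x : N, GenTangent I x} {x₀ : N} {y : E}
    (hy : y ∈ (extChartAt I x₀).target) :
    ContMDiffAt I (I.prod 𝓘(ℝ, GenModel E)) ∞
      (fun x => (⟨x, a x⟩ : TotalSpace (GenModel E) (GenTangent I : N → Type _)))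
        ((extChartAt I x₀).symm y) ↔ ContDiffAt ℝ ∞ (genInChart I a x₀) y := by
  have hx : (extChartAt I x₀).symm y ∈ (extChartAt I x₀).source := (extChartAt I x₀).map_target hy
  have hx' : (extChartAt I x₀).symm y ∈ (chartAt H x₀).source := by simpa using hx
  have hT := (isOpen_extChartAt_target (I := I) x₀).mem_nhds hy
  have hev : (fun z => (trivializationAt (GenModel E) (GenTangent I : N → Type _) x₀
      ⟨(extChartAt I x₀).symm z, a ((extChartAt I x₀).symm z)⟩).2) =ᶠ[𝓝 y] genInChart I a x₀ := by
    filter_upwards [hT] with z hz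
    exact trivializationAt_genTangent hz a
  rw [(trivializationAt (GenModel E) (GenTangent I : N → Type _) x₀).contMDiffAt_iff
    (by rw [Trivialization.mem_source]; simpa using hx')]
  constructor
  · rintro ⟨-, h⟩
    exact ((h.comp y (contMDiffAt_extChartAt_symm_boundaryless hy)).congr_of_eventuallyEq
      hev.symm).contDiffAt
  · intro h
    refine ⟨contMDiffAt_id, ?_⟩
    have h1 := (h.congr_of_eventuallyEq hev).contMDiffAt
    have h2 : ContMDiffAt I 𝓘(ℝ, E) ∞ (extChartAt I x₀) ((extChartAt I x₀).symm y) :=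
      contMDiffAt_extChartAt' (by simpa using hx)
    refine (ContMDiffAt.comp_of_eq h1 h2 ((extChartAt I x₀).right_inv hy)).congr_of_eventuallyEq ?_
    filter_upwards [(isOpen_extChartAt_source (I := I) x₀).mem_nhds hx] with z hz
    exact congrArg (fun x => (trivializationAt (GenModel E) (GenTangent I : N → Type _) x₀
      ⟨x, a x⟩).2) ((extChartAt I x₀).left_inv hz).symm

lemma genInChart_injOn {a b : ∀ x : N, GenTangent I x} {x₀ : N} {y : E}
    (hy : y ∈ (extChartAt I x₀).target) (h : genInChart I a x₀ y = genInChart I b x₀ y) :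
    a ((extChartAt I x₀).symm y) = b ((extChartAt I x₀).symm y) := by
  refine Prod.ext ((mfderiv_extChartAt_bijective (I := I) (x₀ := x₀)
    ((extChartAt I x₀).map_target hy)).1 (congrArg Prod.fst h)) ?_
  refine ContinuousLinearMap.ext fun v => ?_
  have h2 := congrArg (fun L : E →L[ℝ] ℝ => L (mfderiv I 𝓘(ℝ, E) (extChartAt I x₀)
    ((extChartAt I x₀).symm y) v)) (congrArg Prod.snd h)
  have h3 := mfderiv_symm_comp_extChartAt hy v
  have h4 : ∀ α : Cotangent I ((extChartAt I x₀).symm y),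
      α (mfderiv 𝓘(ℝ, E) I (extChartAt I x₀).symm y (mfderiv I 𝓘(ℝ, E) (extChartAt I x₀)
        ((extChartAt I x₀).symm y) v)) = α v := fun α => congrArg α h3
  have h5 := (oneFormInChart_apply (fun z => (a z).2) x₀ y _).symm.trans
    (h2.trans (oneFormInChart_apply (fun z => (b z).2) x₀ y _))
  exact (h4 _).symm.trans (h5.trans (h4 _))

/-- Sections of `𝕋N` that agree in all charts are equal. -/
lemma genSection_ext {a b : ∀ x : N, GenTangent I x}
    (h : ∀ x₀, ∀ y ∈ (extChartAt I x₀).target, genInChart I a x₀ y = genInChart I b x₀ y) :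
    a = b := by
  funext x
  have h1 := genInChart_injOn (mem_extChartAt_target x) (h x _ (mem_extChartAt_target x))
  rwa [extChartAt_to_inv] at h1

lemma flatPair_genInChart {a b : ∀ x : N, GenTangent I x} {x₀ : N} {y : E}
    (hy : y ∈ (extChartAt I x₀).target) :
    flatPair (genInChart I a x₀ y) (genInChart I b x₀ y) =
      canonicalPairing I ((extChartAt I x₀).symm y) (a ((extChartAt I x₀).symm y))
        (b ((extChartAt I x₀).symm y)) := by
  have h : ∀ (α : Cotangent I ((extChartAt I x₀).symm y)) v,
      α (mfderiv 𝓘(ℝ, E) I (extChartAt I x₀).symm y (mfderiv I 𝓘(ℝ, E) (extChartAt I x₀)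
        ((extChartAt I x₀).symm y) v)) = α v :=
    fun α v => congrArg α (mfderiv_symm_comp_extChartAt hy v)
  exact congrArg₂ (· + ·) ((oneFormInChart_apply (fun z => (a z).2) x₀ y _).trans (h _ _))
    ((oneFormInChart_apply (fun z => (b z).2) x₀ y _).trans (h _ _))

lemma dFun_genInChart {f : N → ℝ} {x₀ : N} {y : E} (hy : y ∈ (extChartAt I x₀).target)
    (hf : MDifferentiableAt I 𝓘(ℝ, ℝ) f ((extChartAt I x₀).symm y)) (w : E) :
    dFun I f ((extChartAt I x₀).symm y) (mfderiv 𝓘(ℝ, E) I (extChartAt I x₀).symm y w) =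
      fderiv ℝ (fun z => f ((extChartAt I x₀).symm z)) y w := by
  have hs := (contMDiffAt_extChartAt_symm_boundaryless hy).mdifferentiableAt (by simp)
  have h1 := mfderiv_comp y hf hs
  rw [mfderiv_eq_fderiv] at h1
  exact (congrArg (fun L : E →L[ℝ] ℝ => L w) h1).symm

/-- The exterior derivative of a 1-form, computed on a pullback. -/
lemma dOneForm_pullback {α : ∀ x : N, Cotangent I x} {g : E → N} {y : E}
    (hα : DifferentiableAt ℝ (oneFormInChart I α (g y)) (extChartAt I (g y) (g y)))
    (hg : ContMDiffAt 𝓘(ℝ, E) I ∞ g y) (hg' : ∀ᶠ z in 𝓝 y, MDifferentiableAt 𝓘(ℝ, E) I g z)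
    {θ : E → E →L[ℝ] ℝ} (hθ : ∀ᶠ z in 𝓝 y, ∀ w, θ z w = α (g z) (mfderiv 𝓘(ℝ, E) I g z w))
    (u v : E) :
    dOneForm I α (g y) (mfderiv 𝓘(ℝ, E) I g y u) (mfderiv 𝓘(ℝ, E) I g y v) =
      fderiv ℝ θ y u v - fderiv ℝ θ y v u := by
  set φ := extChartAt I (g y) with hφ
  set k : E → E := fun z => φ (g z) with hk
  have hφd : ∀ x ∈ φ.source, MDifferentiableAt I 𝓘(ℝ, E) φ x := fun x hx =>
    mdifferentiableAt_extChartAt (by simpa [hφ] using hx)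
  have hks : ContDiffAt ℝ ∞ k y :=
    ((contMDiffAt_extChartAt (n := ∞)).comp y hg).contDiffAt
  have hsrc : ∀ᶠ z in 𝓝 y, g z ∈ φ.source :=
    hg.continuousAt.eventually_mem ((isOpen_extChartAt_source (I := I) (g y)).mem_nhds
      (mem_extChartAt_source _))
  have hkd : ∀ᶠ z in 𝓝 y, ∀ w, fderiv ℝ k z w =
      mfderiv I 𝓘(ℝ, E) φ (g z) (mfderiv 𝓘(ℝ, E) I g z w) := by
    filter_upwards [hg', hsrc] with z h1 h2 w
    have h3 := mfderiv_comp z (hφd _ h2) h1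
    rw [mfderiv_eq_fderiv] at h3
    exact congrArg (fun L : E →L[ℝ] E => L w) h3
  -- The exterior derivative at `g y` is defined in the preferred chart there. In that chart `θ` is
  -- the flat pullback of the form along `k = φ ∘ g`, and flat exterior derivatives commute with
  -- pullbacks.
  have hθ' : θ =ᶠ[𝓝 y] fun z => oneFormInChart I α (g y) (k z) ∘L fderiv ℝ k z := by
    filter_upwards [hθ, hkd, hsrc] with z h1 h2 h3
    refine ContinuousLinearMap.ext fun w => ?_
    rw [h1, ContinuousLinearMap.comp_apply, oneFormInChart_apply, h2]
    have hl : φ.symm (k z) = g z := φ.left_inv h3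
    have h4 := mfderiv_symm_comp_extChartAt (I := I) (x₀ := g y) (y := k z) (φ.map_source h3)
    have h5 : ∀ x, φ.symm (k z) = x → ∀ v : E, (mfderiv 𝓘(ℝ, E) I φ.symm (k z)
        (show E from mfderiv I 𝓘(ℝ, E) φ x v) : E) = v := by
      rintro x rfl v
      exact h4 v
    have h6 : ∀ x, x = g z → ∀ v v' : E, v = v' →
      (show E →L[ℝ] ℝ from α (g z)) v = (show E →L[ℝ] ℝ from α x) v' := by
      rintro x rfl v v' rfl; rfl
    exact h6 _ hl _ _ (h5 _ hl _).symm
  have hkd0 := hkd.self_of_nhds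
  have hα' : DifferentiableAt ℝ (oneFormInChart I α (g y)) (k y) := hα
  rw [hθ'.fderiv_eq, fderiv_pullback_symm hα' hks u v, hkd0 u, hkd0 v]
  unfold dOneForm
  rw [I.range_eq_univ, fderivWithin_univ]
  rfl

lemma genInChart_snd_differentiableAt {a : ∀ x : N, GenTangent I x}
    (ha : ContMDiff I (I.prod 𝓘(ℝ, GenModel E)) ∞
      (fun x => (⟨x, a x⟩ : TotalSpace (GenModel E) (GenTangent I : N → Type _)))) (x : N) :
    DifferentiableAt ℝ (oneFormInChart I (fun z => (a z).2) x) (extChartAt I x x) := by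
  have h := (contMDiffAt_genSection_iff (mem_extChartAt_target (I := I) x)).1
    (ha ((extChartAt I x).symm (extChartAt I x x)))
  exact (h.differentiableAt (by simp)).snd

lemma contMDiff_genSection_fst {a : ∀ x : N, GenTangent I x} {x : N}
    (ha : ContMDiffAt I (I.prod 𝓘(ℝ, GenModel E)) ∞
      (fun x => (⟨x, a x⟩ : TotalSpace (GenModel E) (GenTangent I : N → Type _))) x) :
    ContMDiffAt I I.tangent ∞ (fun x => (⟨x, (a x).1⟩ : TangentBundle I N)) x :=
  ((contMDiffAt_bundleProd_iff (V := fun x : N => TangentSpace I x)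
    (V' := fun x : N => TangentSpace I x →L[ℝ] ℝ) (b := fun q => q)
    (v := fun q => (a q).1) (w := fun q => (a q).2)).1 ha).1

lemma contMDiffAt_pairing {a b : ∀ x : N, GenTangent I x} {x : N}
    (ha : ContMDiffAt I (I.prod 𝓘(ℝ, GenModel E)) ∞
      (fun x => (⟨x, a x⟩ : TotalSpace (GenModel E) (GenTangent I : N → Type _))) x)
    (hb : ContMDiffAt I (I.prod 𝓘(ℝ, GenModel E)) ∞
      (fun x => (⟨x, b x⟩ : TotalSpace (GenModel E) (GenTangent I : N → Type _))) x) :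
    ContMDiffAt I 𝓘(ℝ, ℝ) ∞ (fun x => canonicalPairing I x (a x) (b x)) x := by
  obtain ⟨a1, a2⟩ := (contMDiffAt_bundleProd_iff (V := fun x : N => TangentSpace I x)
    (V' := fun x : N => TangentSpace I x →L[ℝ] ℝ) (b := fun q => q)
    (v := fun q => (a q).1) (w := fun q => (a q).2)).1 ha
  obtain ⟨b1, b2⟩ := (contMDiffAt_bundleProd_iff (V := fun x : N => TangentSpace I x)
    (V' := fun x : N => TangentSpace I x →L[ℝ] ℝ) (b := fun q => q)
    (v := fun q => (b q).1) (w := fun q => (b q).2)).1 hb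
  exact (ContMDiffAt.dual_apply (V := fun x : N => TangentSpace I x) (F := E) a2 b1).add
    (ContMDiffAt.dual_apply (V := fun x : N => TangentSpace I x) (F := E) b2 a1)

lemma mlieBracket_modelSpace (V W : ∀ x : E, TangentSpace 𝓘(ℝ, E) x) (y : E) :
    (VectorField.mlieBracket 𝓘(ℝ, E) V W y : E) =
      fderiv ℝ (fun z => (show E from W z)) y (V y) -
        fderiv ℝ (fun z => (show E from V z)) y (W y) := by
  rw [← VectorField.mlieBracketWithin_univ, VectorField.mlieBracketWithin_eq_lieBracketWithin]
  exact congrFun (VectorField.lieBracketWithin_univ (𝕜 := ℝ) (V := fun z => (show E from V z))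
    (W := fun z => (show E from W z))) y

/-- The Courant bracket in a chart. -/
theorem genInChart_courantBracket {a b : ∀ x : N, GenTangent I x}
    (ha : ContMDiff I (I.prod 𝓘(ℝ, GenModel E)) ∞
      (fun x => (⟨x, a x⟩ : TotalSpace (GenModel E) (GenTangent I : N → Type _))))
    (hb : ContMDiff I (I.prod 𝓘(ℝ, GenModel E)) ∞
      (fun x => (⟨x, b x⟩ : TotalSpace (GenModel E) (GenTangent I : N → Type _))))
    {x₀ : N} {y : E} (hy : y ∈ (extChartAt I x₀).target) :
    genInChart I (courantBracket I a b) x₀ y =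
      flatBracket (genInChart I a x₀) (genInChart I b x₀) y := by
  set φ := extChartAt I x₀ with hφ
  have hT := (isOpen_extChartAt_target (I := I) x₀).mem_nhds hy
  have hψ : ∀ z ∈ φ.target, ContMDiffAt 𝓘(ℝ, E) I ∞ φ.symm z := fun z hz =>
    contMDiffAt_extChartAt_symm_boundaryless hz
  have ha' := (contMDiffAt_genSection_iff hy).1 (ha _)
  have hb' := (contMDiffAt_genSection_iff hy).1 (hb _)
  have da := ha'.differentiableAt (by simp)
  have db := hb'.differentiableAt (by simp)
  -- The derivatives of the chart and of its inverse are mutually inverse, so the pullback of vector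
  -- fields along `φ.symm` is the first component of `genInChart`.
  have hinv : ∀ z ∈ φ.target, ∀ v : TangentSpace I (φ.symm z),
      (mfderiv 𝓘(ℝ, E) I φ.symm z).inverse v = mfderiv I 𝓘(ℝ, E) φ (φ.symm z) v := by
    intro z hz v
    have h1 : (mfderiv 𝓘(ℝ, E) I φ.symm z).IsInvertible := by
      refine ⟨ContinuousLinearEquiv.equivOfInverse (mfderiv 𝓘(ℝ, E) I φ.symm z)
        (mfderiv I 𝓘(ℝ, E) φ (φ.symm z)) (fun w => mfderiv_extChartAt_comp_symm hz w)
        (fun w => mfderiv_symm_comp_extChartAt hz w), ?_⟩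
      rfl
    have h2 := h1.injective
    refine h2 ?_
    rw [h1.self_apply_inverse]
    exact (mfderiv_symm_comp_extChartAt hz v).symm
  have hpull : ∀ c : ∀ x : N, GenTangent I x,
      VectorField.mpullback 𝓘(ℝ, E) I φ.symm (fun x => (c x).1) =ᶠ[𝓝 y]
        fun z => (genInChart I c x₀ z).1 := by
    intro c
    filter_upwards [hT] with z hz
    exact hinv z hz _
  refine Prod.ext ?_ (ContinuousLinearMap.ext fun w => ?_)
  · have : IsManifold I (minSmoothness ℝ 2) N := by
      simpa using IsManifold.of_le (I := I) (M := N) two_le_infty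
    have h1 := VectorField.mpullback_mlieBracket (I := 𝓘(ℝ, E)) (I' := I) (f := φ.symm) (x₀ := y)
      (n := ∞) (V := fun x => (a x).1) (W := fun x => (b x).1)
      ((contMDiff_genSection_fst (ha _)).mdifferentiableAt (by simp))
      ((contMDiff_genSection_fst (hb _)).mdifferentiableAt (by simp)) (hψ y hy)
      (by simpa using two_le_infty)
    have h2 : (genInChart I (courantBracket I a b) x₀ y).1 =
        VectorField.mpullback 𝓘(ℝ, E) I φ.symm
          (VectorField.mlieBracket I (fun x => (a x).1) (fun x => (b x).1)) y :=
      (hinv y hy _).symm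
    rw [h2, h1, (hpull a).mlieBracket_vectorField_eq (hpull b)]
    refine (mlieBracket_modelSpace _ _ y).trans ?_
    exact congrArg₂ (· - ·) (fderiv_fst_apply db _) (fderiv_fst_apply da _)
  · have hX : ∀ c : ∀ x : N, GenTangent I x,
        (mfderiv 𝓘(ℝ, E) I φ.symm y (genInChart I c x₀ y).1 : E) = (c (φ.symm y)).1 := fun c =>
      mfderiv_symm_comp_extChartAt hy _
    have hd : ∀ᶠ z in 𝓝 y, MDifferentiableAt 𝓘(ℝ, E) I φ.symm z := by
      filter_upwards [hT] with z hz
      exact (hψ z hz).mdifferentiableAt (by simp)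
    -- Each value of `dOneForm` uses the chart of its own point; pulling back along `φ.symm` brings
    -- all of them to the fixed chart `φ`.
    have hD : ∀ {c : ∀ x : N, GenTangent I x}, ContMDiff I (I.prod 𝓘(ℝ, GenModel E)) ∞
        (fun x => (⟨x, c x⟩ : TotalSpace (GenModel E) (GenTangent I : N → Type _))) →
        ∀ u v : E, dOneForm I (fun z => (c z).2) (φ.symm y) (mfderiv 𝓘(ℝ, E) I φ.symm y u)
          (mfderiv 𝓘(ℝ, E) I φ.symm y v) =
          (fderiv ℝ (genInChart I c x₀) y u).2 v - (fderiv ℝ (genInChart I c x₀) y v).2 u := by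
      intro c hc u v
      have dc := ((contMDiffAt_genSection_iff hy).1 (hc _)).differentiableAt (by simp)
      rw [dOneForm_pullback (genInChart_snd_differentiableAt hc _) (hψ y hy) hd
        (θ := fun z => (genInChart I c x₀ z).2)
        (.of_forall fun z w => oneFormInChart_apply _ _ _ _), dc.hasFDerivAt.snd.fderiv]
      rfl
    have hF : dFun I (fun z => (b z).2 (a z).1) (φ.symm y) (mfderiv 𝓘(ℝ, E) I φ.symm y w) =
        (fderiv ℝ (genInChart I b x₀) y w).2 (genInChart I a x₀ y).1 +
          (genInChart I b x₀ y).2 (fderiv ℝ (genInChart I a x₀) y w).1 := by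
      obtain ⟨b1, b2⟩ := (contMDiffAt_bundleProd_iff (V := fun x : N => TangentSpace I x)
        (V' := fun x : N => TangentSpace I x →L[ℝ] ℝ) (b := fun q => q)
        (v := fun q => (b q).1) (w := fun q => (b q).2)).1 (hb (φ.symm y))
      have hm := ContMDiffAt.dual_apply (V := fun x : N => TangentSpace I x) (F := E) b2
        (contMDiff_genSection_fst (ha (φ.symm y)))
      rw [dFun_genInChart hy (hm.mdifferentiableAt (by simp))]
      have he : (fun z => (b (φ.symm z)).2 (a (φ.symm z)).1) =ᶠ[𝓝 y]
          fun z => (genInChart I b x₀ z).2 (genInChart I a x₀ z).1 := by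
        filter_upwards [hT] with z hz
        refine Eq.trans ?_ (oneFormInChart_apply _ _ _ _).symm
        exact congrArg (b (φ.symm z)).2 (mfderiv_symm_comp_extChartAt hz _).symm
      rw [he.fderiv_eq, (db.hasFDerivAt.snd.clm_apply da.hasFDerivAt.fst).fderiv]
      simp
      ring
    have h3 : (genInChart I (courantBracket I a b) x₀ y).2 w =
        (dOneForm I (fun z => (b z).2) (φ.symm y) (a (φ.symm y)).1
          (mfderiv 𝓘(ℝ, E) I φ.symm y w) +
        dFun I (fun z => (b z).2 (a z).1) (φ.symm y) (mfderiv 𝓘(ℝ, E) I φ.symm y w)) -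
        dOneForm I (fun z => (a z).2) (φ.symm y) (b (φ.symm y)).1
          (mfderiv 𝓘(ℝ, E) I φ.symm y w) := oneFormInChart_apply _ _ _ _
    have h4 : ∀ c : ∀ x : N, GenTangent I x, dOneForm I (fun z => (b z).2) (φ.symm y)
      (c (φ.symm y)).1 = dOneForm I (fun z => (b z).2) (φ.symm y)
        (mfderiv 𝓘(ℝ, E) I φ.symm y (genInChart I c x₀ y).1) := fun c =>
      congrArg _ (hX c).symm
    have h5 : ∀ c : ∀ x : N, GenTangent I x, dOneForm I (fun z => (a z).2) (φ.symm y)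
      (c (φ.symm y)).1 = dOneForm I (fun z => (a z).2) (φ.symm y)
        (mfderiv 𝓘(ℝ, E) I φ.symm y (genInChart I c x₀ y).1) := fun c =>
      congrArg _ (hX c).symm
    rw [h3, h4, h5, hD hb, hD ha, hF, flatBracket_snd_apply]
    ring

end CourantChart

/-! ### The Courant algebroid `𝕋N` -/

section StandardCourant

variable {E H : Type*} [NormedAddCommGroup E] [NormedSpace ℝ E] [FiniteDimensional ℝ E]
  [TopologicalSpace H] {I : ModelWithCorners ℝ E H} [I.Boundaryless]
  {N : Type*} [TopologicalSpace N] [ChartedSpace H N] [IsManifold I ∞ N]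

lemma isSmooth_standardCourant_iff {a : ∀ x : N, GenTangent I x} :
    (standardCourant I N).IsSmooth a ↔ ContMDiff I (I.prod 𝓘(ℝ, GenModel E)) ∞
      (fun x => (⟨x, a x⟩ : TotalSpace (GenModel E) (GenTangent I : N → Type _))) :=
  contMDiffOn_univ

lemma contDiffAt_genInChart {a : ∀ x : N, GenTangent I x} (ha : (standardCourant I N).IsSmooth a)
    {x₀ : N} {y : E} (hy : y ∈ (extChartAt I x₀).target) :
    ContDiffAt ℝ ∞ (genInChart I a x₀) y :=
  (contMDiffAt_genSection_iff hy).1 (isSmooth_standardCourant_iff.1 ha _)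

lemma isSmooth_of_genInChart {a : ∀ x : N, GenTangent I x}
    (h : ∀ x₀, ∀ y ∈ (extChartAt I x₀).target, ContDiffAt ℝ ∞ (genInChart I a x₀) y) :
    (standardCourant I N).IsSmooth a := by
  refine isSmooth_standardCourant_iff.2 fun x => ?_
  have h1 := (contMDiffAt_genSection_iff (mem_extChartAt_target (I := I) x)).2
    (h x _ (mem_extChartAt_target x))
  rwa [extChartAt_to_inv] at h1

/-- Equality on a neighbourhood is what nested brackets require, since the outer bracket
differentiates the inner one. -/
lemma eventuallyEq_bracket_genInChart {a b : ∀ x : N, GenTangent I x}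
    (ha : (standardCourant I N).IsSmooth a) (hb : (standardCourant I N).IsSmooth b)
    {x₀ : N} {y : E} (hy : y ∈ (extChartAt I x₀).target) :
    genInChart I (courantBracket I a b) x₀ =ᶠ[𝓝 y]
      flatBracket (genInChart I a x₀) (genInChart I b x₀) := by
  filter_upwards [(isOpen_extChartAt_target (I := I) x₀).mem_nhds hy] with z hz
  exact genInChart_courantBracket (isSmooth_standardCourant_iff.1 ha)
    (isSmooth_standardCourant_iff.1 hb) hz

lemma isSmooth_courantBracket {a b : ∀ x : N, GenTangent I x}
    (ha : (standardCourant I N).IsSmooth a) (hb : (standardCourant I N).IsSmooth b) :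
    (standardCourant I N).IsSmooth (courantBracket I a b) :=
  isSmooth_of_genInChart fun _ _ hy =>
    ((contDiffAt_genInChart ha hy).flatBracket (contDiffAt_genInChart hb hy)).congr_of_eventuallyEq
      (eventuallyEq_bracket_genInChart ha hb hy)

lemma genInChart_add (a b : ∀ x : N, GenTangent I x) (x₀ : N) :
    genInChart I (a + b) x₀ = fun y => genInChart I a x₀ y + genInChart I b x₀ y := by
  funext y
  refine Prod.ext (map_add _ _ _) (ContinuousLinearMap.ext fun w => ?_)
  refine (oneFormInChart_apply _ _ _ _).trans ?_
  exact congrArg₂ (· + ·) (oneFormInChart_apply (fun z => (a z).2) _ _ _).symm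
    (oneFormInChart_apply (fun z => (b z).2) _ _ _).symm

lemma genInChart_fun_smul (f : N → ℝ) (a : ∀ x : N, GenTangent I x) (x₀ : N) :
    genInChart I (fun z => f z • a z) x₀ =
      fun y => f ((extChartAt I x₀).symm y) • genInChart I a x₀ y := by
  funext y
  refine Prod.ext (map_smul _ _ _) (ContinuousLinearMap.ext fun w => ?_)
  refine (oneFormInChart_apply _ _ _ _).trans ?_
  exact congrArg (f ((extChartAt I x₀).symm y) • ·)
    (oneFormInChart_apply (fun z => (a z).2) _ _ _).symm

lemma isSmooth_add {a b : ∀ x : N, GenTangent I x}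
    (ha : (standardCourant I N).IsSmooth a) (hb : (standardCourant I N).IsSmooth b) :
    (standardCourant I N).IsSmooth (a + b) :=
  isSmooth_of_genInChart fun x₀ y hy => by
    rw [genInChart_add]
    exact (contDiffAt_genInChart ha hy).add (contDiffAt_genInChart hb hy)

lemma isSmooth_fun_smul {f : N → ℝ} {a : ∀ x : N, GenTangent I x}
    (hf : ContMDiff I 𝓘(ℝ, ℝ) ∞ f) (ha : (standardCourant I N).IsSmooth a) :
    (standardCourant I N).IsSmooth (fun z => f z • a z) :=
  isSmooth_of_genInChart fun x₀ y hy => by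
    rw [genInChart_fun_smul]
    exact ((hf _).comp y (contMDiffAt_extChartAt_symm_boundaryless hy)).contDiffAt.smul
      (contDiffAt_genInChart ha hy)

lemma smooth_pair {a b : ∀ x : N, GenTangent I x}
    (ha : (standardCourant I N).IsSmooth a) (hb : (standardCourant I N).IsSmooth b) :
    ContMDiff I 𝓘(ℝ, ℝ) ∞ ((standardCourant I N).pair a b) := fun x =>
  contMDiffAt_pairing (isSmooth_standardCourant_iff.1 ha x) (isSmooth_standardCourant_iff.1 hb x)

/-- A vector at one point is the value of a possibly discontinuous section, zero elsewhere. This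
suffices for identities in which only that value enters, and lets them be read in charts. -/
lemma exists_genInChart_eq (x : N) (v : GenTangent I x) :
    ∃ w : ∀ z : N, GenTangent I z, w x = v := by
  classical
  exact ⟨fun z => if h : z = x then h ▸ v else 0, by simp⟩

/-- The differential of a pairing along an anchor, in a chart. -/
lemma dFun_pair_genInChart {a b c : ∀ x : N, GenTangent I x}
    (ha : (standardCourant I N).IsSmooth a) (hb : (standardCourant I N).IsSmooth b)
    {x₀ : N} {y : E} (hy : y ∈ (extChartAt I x₀).target) :
    dFun I ((standardCourant I N).pair a b) ((extChartAt I x₀).symm y)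
        (c ((extChartAt I x₀).symm y)).1 =
      fderiv ℝ (fun y => flatPair (genInChart I a x₀ y) (genInChart I b x₀ y)) y
        (genInChart I c x₀ y).1 := by
  have h1 := dFun_genInChart hy ((smooth_pair ha hb _).mdifferentiableAt (by simp))
    (genInChart I c x₀ y).1
  have h2 : (fun z => (standardCourant I N).pair a b ((extChartAt I x₀).symm z)) =ᶠ[𝓝 y]
      fun y => flatPair (genInChart I a x₀ y) (genInChart I b x₀ y) := by
    filter_upwards [(isOpen_extChartAt_target (I := I) x₀).mem_nhds hy] with z hz
    exact (flatPair_genInChart hz).symm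
  rw [h2.fderiv_eq] at h1
  rw [← h1]
  exact congrArg _ (mfderiv_symm_comp_extChartAt hy _).symm

variable (I N) in
/-- `𝕋N` is a Courant algebroid. -/
theorem isCourantAlgebroid_standardCourant : (standardCourant I N).IsCourantAlgebroid where
  pairing_symm x v w := add_comm _ _
  pairing_nondegenerate x v h := by
    refine Prod.ext ?_ (ContinuousLinearMap.ext fun u => ?_)
    -- Pure covectors detect the vector part, and pure vectors detect the covector part.
    · refine SeparatingDual.eq_zero_of_forall_dual_eq_zero (R := ℝ) (V := E) fun f => ?_
      have := h (0, f)
      change v.2 0 + f v.1 = 0 at this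
      rwa [map_zero, zero_add] at this
    · have := h (u, 0)
      change v.2 u + 0 = 0 at this
      simpa using this
  smooth_pairing a b ha hb := smooth_pair ha hb
  smooth_anchor a ha x := contMDiff_genSection_fst (isSmooth_standardCourant_iff.1 ha x)
  smooth_bracket a b ha hb := isSmooth_courantBracket ha hb
  bracket_add_left a b c ha hb hc := genSection_ext fun x₀ y hy => by
    refine (eventuallyEq_bracket_genInChart (isSmooth_add ha hb) hc hy).self_of_nhds.trans ?_
    rw [genInChart_add, genInChart_add, flatBracket_add_left ((contDiffAt_genInChart ha hy).differentiableAt (by simp))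
      ((contDiffAt_genInChart hb hy).differentiableAt (by simp)),
      ← (eventuallyEq_bracket_genInChart ha hc hy).self_of_nhds,
      ← (eventuallyEq_bracket_genInChart hb hc hy).self_of_nhds]
    rfl
  bracket_smul_left r a b ha hb := genSection_ext fun x₀ y hy => by
    have h := isSmooth_fun_smul (contMDiff_const (c := r)) ha
    refine (eventuallyEq_bracket_genInChart h hb hy).self_of_nhds.trans ?_
    rw [genInChart_fun_smul (fun _ => r),
      flatBracket_smul_left r ((contDiffAt_genInChart ha hy).differentiableAt (by simp)),
      ← (eventuallyEq_bracket_genInChart ha hb hy).self_of_nhds]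
    exact (congrFun (genInChart_fun_smul (fun _ => r) _ x₀) y).symm
  bracket_add_right a b c ha hb hc := genSection_ext fun x₀ y hy => by
    refine (eventuallyEq_bracket_genInChart ha (isSmooth_add hb hc) hy).self_of_nhds.trans ?_
    rw [genInChart_add, genInChart_add, flatBracket_add_right
      ((contDiffAt_genInChart hb hy).differentiableAt (by simp))
      ((contDiffAt_genInChart hc hy).differentiableAt (by simp)),
      ← (eventuallyEq_bracket_genInChart ha hb hy).self_of_nhds,
      ← (eventuallyEq_bracket_genInChart ha hc hy).self_of_nhds]
    rfl
  leibniz f a b hf ha hb := by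
    -- The pointwise identity is stated as an equality of sections, so that it can be verified in
    -- charts.
    refine congrFun (f := courantBracket I a (fun y => f y • b y))
      (g := (fun x => f x • courantBracket I a b x) + fun x => dFun I f x (a x).1 • b x)
      (genSection_ext fun x₀ y hy => ?_)
    have hfd : ContDiffAt ℝ ∞ (fun z => f ((extChartAt I x₀).symm z)) y :=
      ((hf _).comp y (contMDiffAt_extChartAt_symm_boundaryless hy)).contDiffAt
    rw [(eventuallyEq_bracket_genInChart ha (isSmooth_fun_smul hf hb) hy).self_of_nhds,
      genInChart_fun_smul, flatBracket_leibniz (hfd.differentiableAt (by simp))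
      ((contDiffAt_genInChart hb hy).differentiableAt (by simp)), genInChart_add,
      genInChart_fun_smul, genInChart_fun_smul (fun x => dFun I f x (a x).1)]
    beta_reduce
    rw [(eventuallyEq_bracket_genInChart ha hb hy).self_of_nhds,
      ← dFun_genInChart hy ((hf _).mdifferentiableAt (by simp))]
    refine congrArg (fun r : ℝ => _ + r • genInChart I b x₀ y) ?_
    exact congrArg _ (mfderiv_symm_comp_extChartAt hy _)
  jacobi a b c ha hb hc := genSection_ext fun x₀ y hy => by
    have hab := isSmooth_courantBracket ha hb
    have hbc := isSmooth_courantBracket hb hc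
    have hac := isSmooth_courantBracket ha hc
    rw [genInChart_add]
    refine (eventuallyEq_bracket_genInChart ha hbc hy).self_of_nhds.trans ?_
    refine Eq.trans ?_ (congrArg₂ (· + ·) (eventuallyEq_bracket_genInChart hab hc hy).self_of_nhds
      (eventuallyEq_bracket_genInChart hb hac hy).self_of_nhds).symm
    -- The inner brackets are replaced by their chart expressions on a whole neighbourhood of `y`.
    rw [flatBracket_congr .rfl (eventuallyEq_bracket_genInChart hb hc hy),
      flatBracket_congr (eventuallyEq_bracket_genInChart ha hb hy) .rfl,
      flatBracket_congr .rfl (eventuallyEq_bracket_genInChart ha hc hy)]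
    exact flatBracket_jacobi (contDiffAt_genInChart ha hy) (contDiffAt_genInChart hb hy)
      (contDiffAt_genInChart hc hy)
  anchor_bracket a b ha hb x := rfl
  invariance a b c ha hb hc x := by
    have key : ∀ x₀, ∀ y ∈ (extChartAt I x₀).target,
        dFun I ((standardCourant I N).pair b c) ((extChartAt I x₀).symm y)
          (a ((extChartAt I x₀).symm y)).1 =
        (standardCourant I N).pair (courantBracket I a b) c ((extChartAt I x₀).symm y) +
          (standardCourant I N).pair b (courantBracket I a c) ((extChartAt I x₀).symm y) := by
      intro x₀ y hy
      rw [dFun_pair_genInChart hb hc hy, flatBracket_invariance _ _ _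
        ((contDiffAt_genInChart hb hy).differentiableAt (by simp))
        ((contDiffAt_genInChart hc hy).differentiableAt (by simp)),
        ← (eventuallyEq_bracket_genInChart ha hb hy).self_of_nhds,
        ← (eventuallyEq_bracket_genInChart ha hc hy).self_of_nhds, flatPair_genInChart hy,
        flatPair_genInChart hy]
      rfl
    have h := key x _ (mem_extChartAt_target x)
    rwa [extChartAt_to_inv] at h
  symmetric_part a b ha hb x v := by
    obtain ⟨w, rfl⟩ := exists_genInChart_eq x v
    have key : ∀ x₀, ∀ y ∈ (extChartAt I x₀).target,
        canonicalPairing I ((extChartAt I x₀).symm y)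
          ((courantBracket I a b + courantBracket I b a) ((extChartAt I x₀).symm y))
          (w ((extChartAt I x₀).symm y)) =
        dFun I ((standardCourant I N).pair a b) ((extChartAt I x₀).symm y)
          (w ((extChartAt I x₀).symm y)).1 := by
      intro x₀ y hy
      rw [← flatPair_genInChart hy, genInChart_add]
      beta_reduce
      rw [(eventuallyEq_bracket_genInChart ha hb hy).self_of_nhds,
        (eventuallyEq_bracket_genInChart hb ha hy).self_of_nhds,
        flatBracket_symm_part _ _ ((contDiffAt_genInChart ha hy).differentiableAt (by simp))
        ((contDiffAt_genInChart hb hy).differentiableAt (by simp)), dFun_pair_genInChart ha hb hy]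
    have h := key x _ (mem_extChartAt_target x)
    rwa [extChartAt_to_inv] at h

end StandardCourant

/-! ### Frames of kernels of surjective linear maps -/

section KernelFrames

variable {E F : Type*} [NormedAddCommGroup E] [NormedSpace ℝ E] [FiniteDimensional ℝ E]
  [NormedAddCommGroup F] [NormedSpace ℝ F] [FiniteDimensional ℝ F]

/-- If the derivative of `f` is surjective at `y₀`, its kernels near `y₀` are the images of a smooth
family of injective linear maps. -/
lemma exists_kernel_frame {f : E → F} {y₀ : E} {U : Set E} (hU : IsOpen U) (hy₀ : y₀ ∈ U)
    (hf : ContDiffOn ℝ ∞ f U) (hs : Function.Surjective (fderiv ℝ f y₀)) :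
    ∃ (r : ℕ) (Ξ : E → F × (Fin r → ℝ) →L[ℝ] E) (ϖ : E →L[ℝ] Fin r → ℝ),
      ∀ᶠ y in 𝓝 y₀, ContDiffAt ℝ ∞ Ξ y ∧
        (∀ v, Ξ y (fderiv ℝ f y v, ϖ v) = v) ∧
        (∀ p, fderiv ℝ f y (Ξ y p) = p.1 ∧ ϖ (Ξ y p) = p.2) := by
  obtain ⟨ϖ, hϖ⟩ := LieGroupoid.exists_prod_isInvertible (fderiv ℝ f y₀) hs
  have : CompleteSpace E := FiniteDimensional.complete ℝ E
  -- `Ξ y` is the inverse of `(Df_y, ϖ)`, with `ϖ` a complement fixed at `y₀`; restricted to `0 ×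
  -- ℝ^r` it parametrizes the kernel of `Df_y`.
  refine ⟨_, fun y => ((fderiv ℝ f y).prod ϖ).inverse, ϖ, ?_⟩
  have hsm : ∀ y ∈ U, ContDiffAt ℝ ∞ (fun y => (fderiv ℝ f y).prod ϖ) y := by
    intro y hy
    have h1 : ContDiffAt ℝ ∞ (fderiv ℝ f) y :=
      (hf.contDiffAt (hU.mem_nhds hy)).fderiv_right (by simp)
    exact ((ContinuousLinearMap.prodL ℝ (E := E) (F := F) (𝕜 := ℝ)
      (G := LieGroupoid.AModel E F)).contDiff.contDiffAt).comp y (h1.prodMk contDiffAt_const)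
  have hinv : ∀ᶠ y in 𝓝 y₀, ((fderiv ℝ f y).prod ϖ).IsInvertible :=
    (hsm y₀ hy₀).continuousAt.eventually_mem
      (ContinuousLinearEquiv.isOpen (𝕜 := ℝ) (E := E) (F := F × _) |>.mem_nhds hϖ)
  filter_upwards [hinv, hU.mem_nhds hy₀] with y h1 h2
  have h3 : ContDiffAt ℝ ∞ ContinuousLinearMap.inverse ((fderiv ℝ f y).prod ϖ) :=
    h1.contDiffAt_map_inverse
  refine ⟨ContDiffAt.comp y (g := ContinuousLinearMap.inverse) h3 (hsm y h2), fun v => ?_,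
    fun p => ?_⟩
  · exact h1.inverse_apply_self v
  · have := h1.self_apply_inverse p
    exact ⟨congrArg Prod.fst this, congrArg Prod.snd this⟩

end KernelFrames

/-! ### The Courant bracket and zero sets of submersions -/

section FlatDirac

variable {E : Type*} [NormedAddCommGroup E] [NormedSpace ℝ E] [FiniteDimensional ℝ E] {k : ℕ}

/-- The bracket of vector fields tangent to a zero set is tangent to it. -/
lemma fderiv_lieBracket_eq_zero {f : E → Fin k → ℝ} {y₀ : E} {Q : Set E}
    (hf : ContDiffAt ℝ ∞ f y₀)
    (hV : ∀ u : E → ℝ, DifferentiableAt ℝ u y₀ → (∀ᶠ y in 𝓝 y₀, y ∈ Q → u y = 0) →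
      ∀ w, fderiv ℝ f y₀ w = 0 → fderiv ℝ u y₀ w = 0) (hy₀ : y₀ ∈ Q)
    {X Y : E → E} (hX : DifferentiableAt ℝ X y₀) (hY : DifferentiableAt ℝ Y y₀)
    (hXQ : ∀ᶠ y in 𝓝 y₀, y ∈ Q → fderiv ℝ f y (X y) = 0)
    (hYQ : ∀ᶠ y in 𝓝 y₀, y ∈ Q → fderiv ℝ f y (Y y) = 0) :
    fderiv ℝ f y₀ (fderiv ℝ Y y₀ (X y₀) - fderiv ℝ X y₀ (Y y₀)) = 0 := by
  have hf' : ContDiffAt ℝ ∞ (fderiv ℝ f) y₀ := hf.fderiv_right (by simp)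
  have df' := (hf'.differentiableAt (by simp)).hasFDerivAt
  -- Differentiating `Df (Y) = 0` along `X`, which is tangent to `Q`, gives `D²f (X, Y) + Df (DY X)
  -- = 0`. Exchanging `X` and `Y` and subtracting removes the symmetric term.
  have key : ∀ {X Y : E → E}, DifferentiableAt ℝ Y y₀ →
      (∀ᶠ y in 𝓝 y₀, y ∈ Q → fderiv ℝ f y (X y) = 0) →
      (∀ᶠ y in 𝓝 y₀, y ∈ Q → fderiv ℝ f y (Y y) = 0) →
      fderiv ℝ (fderiv ℝ f) y₀ (X y₀) (Y y₀) + fderiv ℝ f y₀ (fderiv ℝ Y y₀ (X y₀)) = 0 := by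
    intro X Y hY hXQ hYQ
    funext i
    have h1 := df'.clm_apply hY.hasFDerivAt
    have h2 := (hasFDerivAt_pi'.1 h1) i
    have h3 := hV (fun y => fderiv ℝ f y (Y y) i) h2.differentiableAt
      (hYQ.mono fun y hy hq => congrFun (hy hq) i) _ (hXQ.self_of_nhds hy₀)
    rw [h2.fderiv] at h3
    simp only [ContinuousLinearMap.comp_apply, add_apply, ContinuousLinearMap.flip_apply,
      ContinuousLinearMap.proj_apply] at h3
    simpa [add_comm] using h3
  have e1 := key hY hXQ hYQ
  have e2 := key hX hYQ hXQ
  have hs := (hf.isSymmSndFDerivAt (by simpa using two_le_infty)).eq (X y₀) (Y y₀)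
  rw [map_sub, eq_neg_of_add_eq_zero_right e1, eq_neg_of_add_eq_zero_right e2, hs, sub_self]

/-- Sections of `TQ ⊕ Ann TQ` are closed under the Courant bracket. -/
lemma flatBracket_mem {f : E → Fin k → ℝ} {y₀ : E} {Q U : Set E} (hU : IsOpen U) (hyU : y₀ ∈ U)
    (hf : ContDiffOn ℝ ∞ f U) (hs : Function.Surjective (fderiv ℝ f y₀))
    (hV : ∀ u : E → ℝ, DifferentiableAt ℝ u y₀ → (∀ᶠ y in 𝓝 y₀, y ∈ Q → u y = 0) →
      ∀ w, fderiv ℝ f y₀ w = 0 → fderiv ℝ u y₀ w = 0) (hy₀ : y₀ ∈ Q)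
    {a b : E → GenModel E} (ha : ContDiffAt ℝ ∞ a y₀) (hb : ContDiffAt ℝ ∞ b y₀)
    (haQ : ∀ᶠ y in 𝓝 y₀, y ∈ Q → fderiv ℝ f y (a y).1 = 0 ∧
      ∀ w, fderiv ℝ f y w = 0 → (a y).2 w = 0)
    (hbQ : ∀ᶠ y in 𝓝 y₀, y ∈ Q → fderiv ℝ f y (b y).1 = 0 ∧
      ∀ w, fderiv ℝ f y w = 0 → (b y).2 w = 0) :
    fderiv ℝ f y₀ (flatBracket a b y₀).1 = 0 ∧
      ∀ w, fderiv ℝ f y₀ w = 0 → (flatBracket a b y₀).2 w = 0 := by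
  have hf₀ := hf.contDiffAt (hU.mem_nhds hyU)
  have da := ha.differentiableAt (by simp)
  have db := hb.differentiableAt (by simp)
  have hXa := haQ.mono fun y h hq => (h hq).1
  have hXb := hbQ.mono fun y h hq => (h hq).1
  refine ⟨?_, fun w hw => ?_⟩
  · have := fderiv_lieBracket_eq_zero hf₀ hV hy₀ da.fst db.fst hXa hXb
    rwa [fderiv_fst_apply da, fderiv_fst_apply db] at this
  · obtain ⟨r, Ξ, ϖ, hΞ⟩ := exists_kernel_frame hU hyU hf hs
    -- `W` extends `w` to a smooth field in the kernels of `Df`, with the same complementary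
    -- coordinate throughout.
    set W : E → E := fun y => Ξ y (0, ϖ w) with hWdef
    have hW0 : W y₀ = w := by
      have := hΞ.self_of_nhds.2.1 w
      rwa [hw] at this
    have hWd : DifferentiableAt ℝ W y₀ :=
      (hΞ.self_of_nhds.1.clm_apply contDiffAt_const).differentiableAt (by simp)
    have hWQ : ∀ᶠ y in 𝓝 y₀, y ∈ Q → fderiv ℝ f y (W y) = 0 :=
      hΞ.mono fun y h _ => (h.2.2 _).1
    -- The function `⟨c.2, Z⟩` vanishes on `Q`, so its derivative along tangent vectors of `Q`
    -- vanishes.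
    have hpair : ∀ {c : E → GenModel E} {Z : E → E}, DifferentiableAt ℝ c y₀ →
        DifferentiableAt ℝ Z y₀ →
        (∀ᶠ y in 𝓝 y₀, y ∈ Q → ∀ w, fderiv ℝ f y w = 0 → (c y).2 w = 0) →
        (∀ᶠ y in 𝓝 y₀, y ∈ Q → fderiv ℝ f y (Z y) = 0) → ∀ v, fderiv ℝ f y₀ v = 0 →
        (fderiv ℝ c y₀ v).2 (Z y₀) + (c y₀).2 (fderiv ℝ Z y₀ v) = 0 := by
      intro c Z hc hZ hcQ hZQ v hv
      have h1 := hc.hasFDerivAt.snd.clm_apply hZ.hasFDerivAt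
      have h2 := hV _ h1.differentiableAt
        ((hcQ.and hZQ).mono fun y hy hq => hy.1 hq _ (hy.2 hq)) v hv
      rw [h1.fderiv] at h2
      simp only [ContinuousLinearMap.comp_apply, add_apply, ContinuousLinearMap.flip_apply] at h2
      rw [add_comm]
      exact h2
    have hca := haQ.mono fun y h hq => (h hq).2
    have hcb := hbQ.mono fun y h hq => (h hq).2
    have fa := hXa.self_of_nhds hy₀
    have fb := hXb.self_of_nhds hy₀
    have e1 := hpair db hWd hcb hWQ _ fa
    have e3 := hpair da hWd hca hWQ _ fb
    have e4 := hpair da db.fst hca hXb _ hw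
    have e5 := hcb.self_of_nhds hy₀ _ (fderiv_lieBracket_eq_zero hf₀ hV hy₀ da.fst hWd hXa hWQ)
    have e6 := hca.self_of_nhds hy₀ _ (fderiv_lieBracket_eq_zero hf₀ hV hy₀ db.fst hWd hXb hWQ)
    rw [hW0, map_sub, fderiv_fst_apply da] at e5
    rw [hW0, map_sub, fderiv_fst_apply db] at e6
    rw [hW0] at e1 e3
    rw [fderiv_fst_apply db] at e4
    rw [flatBracket_snd_apply]
    -- The covector parts of `a` and `b` also annihilate the brackets of the other's vector part
    -- with `W`. Combined with the differentiated pairings, this cancels all derivatives of `W`.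
    linarith

end FlatDirac

/-! ### Tangent spaces of embedded submanifolds -/

section Embedded

variable {E H : Type*} [NormedAddCommGroup E] [NormedSpace ℝ E] [FiniteDimensional ℝ E]
  [TopologicalSpace H] {I : ModelWithCorners ℝ E H} [I.Boundaryless]
  {N : Type*} [TopologicalSpace N] [ChartedSpace H N] [IsManifold I ∞ N]

/-- A curve in `Q` is killed by `f`, so its velocity lies in the kernel. Conversely a curve with
velocity in the kernel is pushed into `Q` by `σ (0, ·)`, with `σ` a family of local sections of `f`.
The conclusion holds at all points of `Q` near `q`, because the sections do. -/
lemma mem_tangentTo_iff_eventually {Q U : Set N} {q : N} {k : ℕ} {f : N → Fin k → ℝ}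
    (hU : IsOpen U) (hqU : q ∈ U) (hf : ContMDiffOn I 𝓘(ℝ, Fin k → ℝ) ∞ f U)
    (hs : Function.Surjective (mfderiv I 𝓘(ℝ, Fin k → ℝ) f q)) (hfQ : ∀ p ∈ U, p ∈ Q ↔ f p = 0)
    (hq : q ∈ Q) :
    ∀ᶠ p in 𝓝 q, p ∈ Q → ∀ v : TangentSpace I p,
      v ∈ tangentTo I Q p ↔ mfderiv I 𝓘(ℝ, Fin k → ℝ) f p v = 0 := by
  obtain ⟨σ, hσ⟩ := exists_sections_of_submersion hU hqU hf hs
  have hcont : ContinuousAt (fun p : N => (f q, p)) q := by fun_prop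
  filter_upwards [hU.mem_nhds hqU, hcont.eventually hσ.eventually_nhds] with p hpU hσp hp v
  have hp0 := (hfQ p hpU).1 hp
  rw [(hfQ q hqU).1 hq] at hσp
  have hfd : MDifferentiableAt I 𝓘(ℝ, Fin k → ℝ) f p :=
    (hf.contMDiffAt (hU.mem_nhds hpU)).mdifferentiableAt (by simp)
  constructor
  · rintro ⟨γ, hγ, hγQ, hγv⟩
    have hγv : velocity I γ = ⟨p, v⟩ := hγv
    have h0 : γ 0 = p := congrArg TotalSpace.proj hγv
    have h1 := velocity_comp (f := f) (γ := γ) (I := I) (I' := 𝓘(ℝ, Fin k → ℝ)) (h0 ▸ hfd)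
      (hγ.mdifferentiableAt (by simp))
    have h2 : (fun τ => f (γ τ)) =ᶠ[𝓝 0] fun _ => 0 := by
      filter_upwards [hγQ, hγ.continuousAt.eventually_mem (hU.mem_nhds (h0 ▸ hpU))] with τ h3 h4
      exact (hfQ _ h4).1 h3
    rw [velocity_congr h2, velocity_const, hγv] at h1
    exact (tangentBundle_mk_eq_iff.1 h1).2.symm
  · intro hv
    obtain ⟨γ, hγ, hγv⟩ := exists_velocity_eq (I := I) (⟨p, v⟩ : TangentBundle I N)
    have h0 : γ 0 = p := congrArg TotalSpace.proj hγv
    have hγd := hγ.mdifferentiableAt (by simp)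
    have hσ0 := hσp.self_of_nhds
    have hσd : MDifferentiableAt (𝓘(ℝ, Fin k → ℝ).prod I) I σ (0, p) :=
      hσ0.1.mdifferentiableAt (by simp)
    have hcurve : ContMDiffAt 𝓘(ℝ, ℝ) (𝓘(ℝ, Fin k → ℝ).prod I) ∞
        (fun τ => ((0 : Fin k → ℝ), γ τ)) 0 := contMDiffAt_const.prodMk hγ
    have hc : ContMDiffAt 𝓘(ℝ, ℝ) I ∞ (fun τ => σ (0, γ τ)) 0 :=
      ContMDiffAt.comp (0 : ℝ) (g := σ) (by simpa only [h0] using hσ0.1) hcurve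
    have hc0 : σ (0, γ 0) = p := by rw [h0]; exact hσ0.2.2 hp0.symm
    refine ⟨fun τ => σ (0, γ τ), hc, ?_, ?_⟩
    · have hσp' : ∀ᶠ r in 𝓝 ((0 : Fin k → ℝ), γ 0), f (σ r) = r.1 := by
        rw [h0]
        exact hσp.mono fun r hr => hr.2.1
      filter_upwards [hc.continuousAt.eventually_mem (hU.mem_nhds (by rw [hc0]; exact hpU)),
        hcurve.continuousAt.eventually hσp'] with τ h3 h4
      exact (hfQ _ h3).2 h4
    -- Pushing into `Q` keeps the velocity: `σ (f γ, γ) = γ`, and `(f γ, γ)` has the same velocity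
    -- as `(0, γ)` because `df v = 0`.
    · have hfγ : MDifferentiableAt 𝓘(ℝ, ℝ) 𝓘(ℝ, Fin k → ℝ) (fun τ => f (γ τ)) 0 :=
        MDifferentiableAt.comp (0 : ℝ) (g := f) (by simpa only [h0] using hfd) hγd
      have e1 := velocity_comp (f := σ) (γ := fun τ => (f (γ τ), γ τ))
        (I := 𝓘(ℝ, Fin k → ℝ).prod I) (I' := I) (by simpa only [h0, hp0] using hσd)
        (hfγ.prodMk hγd)
      have e2 := velocity_comp (f := σ) (γ := fun τ => ((0 : Fin k → ℝ), γ τ))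
        (I := 𝓘(ℝ, Fin k → ℝ).prod I) (I' := I) (by simpa only [h0] using hσd)
        (mdifferentiableAt_const.prodMk hγd)
      have hfv : velocity 𝓘(ℝ, Fin k → ℝ) (fun τ => f (γ τ)) = ⟨0, 0⟩ := by
        rw [velocity_comp (f := f) (by simpa only [h0] using hfd) hγd, hγv]
        exact tangentBundle_mk_eq_iff.2 ⟨hp0, hv⟩
      rw [velocity_prodMk hfγ hγd, hfv] at e1
      rw [velocity_prodMk (γ := fun _ => (0 : Fin k → ℝ)) mdifferentiableAt_const hγd,
        velocity_const] at e2
      have e3 : (fun τ => σ (f (γ τ), γ τ)) =ᶠ[𝓝 0] γ := by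
        have hpr := (hfγ.continuousAt.prodMk hγ.continuousAt)
        have h4 : ∀ᶠ r in 𝓝 (f (γ 0), γ 0), r.1 = f r.2 → σ r = r.2 := by
          rw [h0, hp0]
          exact hσp.mono fun r hr => hr.2.2
        filter_upwards [hpr.eventually h4] with τ h5
        exact h5 rfl
      rw [velocity_congr e3, hγv] at e1
      refine e2.trans (Eq.trans ?_ e1.symm)
      refine congrArg _ (tangentBundle_mk_eq_iff.2 ⟨?_, ?_⟩)
      · exact Prod.ext (by simp [h0, hp0]) rfl
      · exact Prod.ext rfl (tangentBundle_mk_eq_iff.1 hγv).2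

/-- The derivative of a function that vanishes on `Q` vanishes along `TQ`. -/
lemma mfderiv_eq_zero_of_mem_tangentTo {Q : Set N} {q : N} {u : N → ℝ}
    (hu : MDifferentiableAt I 𝓘(ℝ, ℝ) u q) (huQ : ∀ᶠ p in 𝓝 q, p ∈ Q → u p = 0)
    {v : TangentSpace I q} (hv : v ∈ tangentTo I Q q) : mfderiv I 𝓘(ℝ, ℝ) u q v = 0 := by
  obtain ⟨γ, hγ, hγQ, hγv⟩ := hv
  have hγv : velocity I γ = ⟨q, v⟩ := hγv
  have h0 : γ 0 = q := congrArg TotalSpace.proj hγv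
  have h1 := velocity_comp (f := u) (γ := γ) (I := I) (I' := 𝓘(ℝ, ℝ)) (h0 ▸ hu)
    (hγ.mdifferentiableAt (by simp))
  have h2 : (fun τ => u (γ τ)) =ᶠ[𝓝 0] fun _ => 0 := by
    filter_upwards [hγQ, hγ.continuousAt.eventually (h0 ▸ huQ)] with τ h3 h4
    exact h4 h3
  rw [velocity_congr h2, velocity_const, hγv] at h1
  exact (tangentBundle_mk_eq_iff.1 h1).2.symm

end Embedded

/-! ### The Dirac structure `TQ ⊕ Ann TQ` of an embedded submanifold -/

section FlatFrame

variable {E : Type*} [NormedAddCommGroup E] [NormedSpace ℝ E] [FiniteDimensional ℝ E] {k : ℕ}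

/-- The subspace `ker D ⊕ Ann (ker D)`. -/
def kerAnn {F : Type*} [NormedAddCommGroup F] [NormedSpace ℝ F] (D : E →L[ℝ] F) :
    Submodule ℝ (GenModel E) where
  carrier := {v | D v.1 = 0 ∧ ∀ w, D w = 0 → v.2 w = 0}
  add_mem' := by
    rintro a b ⟨h1, h2⟩ ⟨h3, h4⟩
    exact ⟨by simp [h1, h3], fun w hw => by simp [h2 w hw, h4 w hw]⟩
  zero_mem' := ⟨map_zero _, fun _ _ => rfl⟩
  smul_mem' := by
    rintro c a ⟨h1, h2⟩
    exact ⟨by simp [h1], fun w hw => by simp [h2 w hw]⟩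

/-- A frame of `ker D ⊕ Ann (ker D)`, from a splitting of `D`. -/
lemma kerAnn_frame {r : ℕ} {D : E →L[ℝ] Fin k → ℝ} {Ξ : (Fin k → ℝ) × (Fin r → ℝ) →L[ℝ] E}
    {ϖ : E →L[ℝ] Fin r → ℝ} (h1 : ∀ v, Ξ (D v, ϖ v) = v)
    (h2 : ∀ p, D (Ξ p) = p.1 ∧ ϖ (Ξ p) = p.2) {e : Fin r ⊕ Fin k → GenModel E}
    (he : e = Sum.elim (fun i => (Ξ (0, Pi.single i 1), 0))
      (fun j => (0, ContinuousLinearMap.proj j ∘L D))) :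
    LinearIndependent ℝ e ∧ kerAnn D = Submodule.span ℝ (range e) := by
  have hsum : ∀ c : Fin r ⊕ Fin k → ℝ, ∑ i, c i • e i =
      (Ξ (0, fun i => c (.inl i)), ∑ j, c (.inr j) • (ContinuousLinearMap.proj j ∘L D)) := by
    intro c
    have h3 : Ξ (0, fun i => c (.inl i)) = ∑ i, c (.inl i) • Ξ (0, Pi.single i 1) := by
      rw [← Finset.sum_congr rfl fun i _ => map_smul Ξ (c (.inl i)) _, ← map_sum]
      congr 1
      refine Prod.ext ?_ ?_
      · simp [Prod.fst_sum]
      · funext l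
        simp [Prod.snd_sum, Finset.sum_apply, Pi.single_apply]
    rw [Fintype.sum_sum_type, he, h3]
    refine Prod.ext ?_ ?_
    · simp [Prod.fst_sum]
    · simp [Prod.snd_sum]
  have hev : ∀ (d : Fin k → ℝ) u, (∑ j, d j • (ContinuousLinearMap.proj (R := ℝ)
      (φ := fun _ : Fin k => ℝ) j ∘L D)) u = ∑ j, d j * D u j := by
    intro d u
    simp [sum_apply]
  constructor
  · rw [Fintype.linearIndependent_iff]
    intro c hc
    rw [hsum] at hc
    obtain ⟨h3, h4⟩ := Prod.ext_iff.1 hc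
    have h5 := (h2 (0, fun i => c (.inl i))).2
    rw [show Ξ (0, fun i => c (.inl i)) = 0 from h3, map_zero] at h5
    rintro (i | j)
    · exact (congrFun h5 i).symm
    · have h6 := congrArg (fun L : E →L[ℝ] ℝ => L (Ξ (Pi.single j 1, 0))) h4
      have h7 := (hev (fun j => c (.inr j)) (Ξ (Pi.single j 1, 0))).symm.trans h6
      rw [(h2 (Pi.single j 1, 0)).1] at h7
      simpa [Pi.single_apply] using h7
  · ext v
    rw [Submodule.mem_span_range_iff_exists_fun]
    constructor
    · rintro ⟨h3, h4⟩
      -- Coefficients: the complementary coordinate of the vector part, and the values of the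
      -- covector part on the chosen lifts of the standard basis of the target of `D`.
      refine ⟨Sum.elim (ϖ v.1) (fun j => v.2 (Ξ (Pi.single j 1, 0))), ?_⟩
      rw [hsum]
      refine Prod.ext ?_ (ContinuousLinearMap.ext fun u => ?_)
      · have := h1 v.1
        rwa [h3] at this
      · refine (hev _ u).trans ?_
        -- A covector that kills `ker D` takes the same value on `u` as on the lift `Ξ (D u, 0)` of
        -- `D u`.
        have h5 := h4 (u - Ξ (D u, 0)) (by rw [map_sub, (h2 _).1, sub_self])
        rw [map_sub, sub_eq_zero] at h5
        have h6 : (D u, (0 : Fin r → ℝ)) = ∑ j, D u j • (Pi.single j 1, (0 : Fin r → ℝ)) := by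
          refine Prod.ext ?_ ?_
          · funext l
            simp [Prod.fst_sum, Finset.sum_apply, Pi.single_apply]
          · simp [Prod.snd_sum]
        rw [h5, h6, map_sum, map_sum]
        exact Finset.sum_congr rfl fun j _ => by
          rw [map_smul, map_smul, smul_eq_mul, mul_comm]; rfl
    · rintro ⟨c, rfl⟩
      rw [hsum]
      refine ⟨(h2 _).1, fun w hw => ?_⟩
      refine (hev _ w).trans ?_
      simp [hw]

end FlatFrame

/-! ### `TQ ⊕ Ann TQ` in charts. -/

section TangentDirac

variable {E H : Type*} [NormedAddCommGroup E] [NormedSpace ℝ E] [FiniteDimensional ℝ E]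
  [TopologicalSpace H] {I : ModelWithCorners ℝ E H} [I.Boundaryless]
  {N : Type*} [TopologicalSpace N] [ChartedSpace H N] [IsManifold I ∞ N]

variable (I) in
/-- The fibres of `TQ ⊕ Ann TQ`. -/
def tangentDirac (Q : Set N) (p : N) : Set (GenTangent I p) :=
  {v | v.1 ∈ tangentTo I Q p ∧ ∀ w ∈ tangentTo I Q p, v.2 w = 0}

lemma fderiv_comp_extChartAt_symm {F : Type*} [NormedAddCommGroup F] [NormedSpace ℝ F] {f : N → F}
    {x₀ : N} {y : E} (hy : y ∈ (extChartAt I x₀).target)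
    (hf : MDifferentiableAt I 𝓘(ℝ, F) f ((extChartAt I x₀).symm y)) (w : E) :
    fderiv ℝ (fun z => f ((extChartAt I x₀).symm z)) y w =
      mfderiv I 𝓘(ℝ, F) f ((extChartAt I x₀).symm y)
        (mfderiv 𝓘(ℝ, E) I (extChartAt I x₀).symm y w) := by
  have hs := (contMDiffAt_extChartAt_symm_boundaryless hy).mdifferentiableAt (by simp)
  have h1 := mfderiv_comp y hf hs
  rw [mfderiv_eq_fderiv] at h1
  exact congrArg (fun L : E →L[ℝ] F => L w) h1

/-- In a chart `TQ` is the kernel of the derivative of a local equation, so membership becomes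
linear algebra in `E × E*`. -/
lemma genInChart_mem_kerAnn_iff {a : ∀ x : N, GenTangent I x} {x₀ : N} {y : E} {Q : Set N}
    {k : ℕ} {f : N → Fin k → ℝ} (hy : y ∈ (extChartAt I x₀).target)
    (hf : MDifferentiableAt I 𝓘(ℝ, Fin k → ℝ) f ((extChartAt I x₀).symm y))
    (hfQ : ∀ v, v ∈ tangentTo I Q ((extChartAt I x₀).symm y) ↔
      mfderiv I 𝓘(ℝ, Fin k → ℝ) f ((extChartAt I x₀).symm y) v = 0) :
    genInChart I a x₀ y ∈ kerAnn (fderiv ℝ (fun z => f ((extChartAt I x₀).symm z)) y) ↔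
      a ((extChartAt I x₀).symm y) ∈ tangentDirac I Q ((extChartAt I x₀).symm y) := by
  have hfd := fderiv_comp_extChartAt_symm hy hf
  have h1 : fderiv ℝ (fun z => f ((extChartAt I x₀).symm z)) y (genInChart I a x₀ y).1 =
      mfderiv I 𝓘(ℝ, Fin k → ℝ) f ((extChartAt I x₀).symm y) (a ((extChartAt I x₀).symm y)).1 :=
    (hfd _).trans (congrArg _ (mfderiv_symm_comp_extChartAt hy _))
  refine and_congr ?_ ⟨fun h w hw => ?_, fun h w hw => ?_⟩
  · rw [hfQ]
    exact Eq.congr_left h1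
  · have h2 := mfderiv_symm_comp_extChartAt hy w
    have h3 := h (mfderiv I 𝓘(ℝ, E) (extChartAt I x₀) ((extChartAt I x₀).symm y) w)
      ((hfd _).trans ((congrArg _ h2).trans ((hfQ w).1 hw)))
    refine Eq.trans ?_ ((oneFormInChart_apply (fun z => (a z).2) x₀ y _).symm.trans h3)
    exact congrArg (a ((extChartAt I x₀).symm y)).2 h2.symm
  · exact (oneFormInChart_apply (fun z => (a z).2) x₀ y _).trans
      (h _ ((hfQ _).2 ((hfd w).symm.trans hw)))

/-- The trivialization of `𝕋N` maps `TQ ⊕ Ann TQ` to `ker ⊕ Ann ker`. -/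
lemma trivializationAt_mem_kerAnn_iff {x₀ p : N} {Q : Set N} {k : ℕ} {f : N → Fin k → ℝ}
    (hp : p ∈ (extChartAt I x₀).source) (hf : MDifferentiableAt I 𝓘(ℝ, Fin k → ℝ) f p)
    (hfQ : ∀ v, v ∈ tangentTo I Q p ↔ mfderiv I 𝓘(ℝ, Fin k → ℝ) f p v = 0) (v : GenTangent I p) :
    (trivializationAt (GenModel E) (GenTangent I : N → Type _) x₀ ⟨p, v⟩).2 ∈
        kerAnn (fderiv ℝ (fun z => f ((extChartAt I x₀).symm z)) (extChartAt I x₀ p)) ↔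
      v ∈ tangentDirac I Q p := by
  obtain ⟨a, rfl⟩ := exists_genInChart_eq p v
  obtain ⟨y, hy, rfl⟩ : ∃ y ∈ (extChartAt I x₀).target, (extChartAt I x₀).symm y = p :=
    ⟨_, (extChartAt I x₀).map_source hp, (extChartAt I x₀).left_inv hp⟩
  rw [trivializationAt_genTangent hy, (extChartAt I x₀).right_inv hy]
  exact genInChart_mem_kerAnn_iff hy hf hfQ

end TangentDirac

/-! ### `TQ ⊕ Ann TQ` is Lagrangian, closed under the bracket, and locally framed. -/

section StandardDirac

variable {E H : Type*} [NormedAddCommGroup E] [NormedSpace ℝ E] [FiniteDimensional ℝ E]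
  [TopologicalSpace H] {I : ModelWithCorners ℝ E H} [I.Boundaryless]
  {N : Type*} [TopologicalSpace N] [ChartedSpace H N] [IsManifold I ∞ N]

/-- Isotropy is immediate. Conversely, pairing with `(0, df_j)` shows that the vector part is
tangent to `Q`, and pairing with `(u, 0)` for `u` tangent shows that the covector part annihilates
`TQ`. -/
lemma tangentDirac_lagrangian {Q : Set N} (hQ : IsEmbeddedSubmanifold I Q) {q : N} (hq : q ∈ Q)
    (v : GenTangent I q) :
    v ∈ tangentDirac I Q q ↔ ∀ w ∈ tangentDirac I Q q, canonicalPairing I q v w = 0 := by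
  obtain ⟨k, U, f, hU, hqU, hf, hs, hfQ⟩ := hQ q hq
  have hT := (mem_tangentTo_iff_eventually hU hqU hf hs hfQ hq).self_of_nhds hq
  constructor
  · rintro ⟨h1, h2⟩ w ⟨h3, h4⟩
    change v.2 w.1 + w.2 v.1 = 0
    rw [h2 _ h3, h4 _ h1, add_zero]
  · intro h
    refine ⟨(hT _).2 ?_, fun u hu => ?_⟩
    · funext j
      have h1 := h (0, ContinuousLinearMap.proj (R := ℝ) (φ := fun _ : Fin k => ℝ) j ∘L
          (mfderiv I 𝓘(ℝ, Fin k → ℝ) f q : E →L[ℝ] Fin k → ℝ))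
        ⟨(hT _).2 (map_zero _), fun w hw => congrFun ((hT w).1 hw) j⟩
      change v.2 0 + _ = 0 at h1
      rw [map_zero, zero_add] at h1
      exact h1
    · have h1 := h (u, 0) ⟨hu, fun _ _ => rfl⟩
      change v.2 u + 0 = 0 at h1
      rwa [add_zero] at h1

/-- In a chart this is `flatBracket_mem`. Its condition on functions vanishing on `Q` holds because
tangent vectors of `Q` are velocities of curves in `Q`. -/
lemma courantBracket_mem_tangentDirac {Q : Set N} (hQ : IsEmbeddedSubmanifold I Q)
    {a b : ∀ x : N, GenTangent I x} (ha : (standardCourant I N).IsSmooth a)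
    (hb : (standardCourant I N).IsSmooth b) (haQ : ∀ q ∈ Q, a q ∈ tangentDirac I Q q)
    (hbQ : ∀ q ∈ Q, b q ∈ tangentDirac I Q q) {q : N} (hq : q ∈ Q) :
    courantBracket I a b q ∈ tangentDirac I Q q := by
  obtain ⟨k, U, f, hU, hqU, hf, hs, hfQ⟩ := hQ q hq
  have hT := mem_tangentTo_iff_eventually hU hqU hf hs hfQ hq
  obtain ⟨x₀, y₀, hy₀, rfl⟩ : ∃ x₀ y, y ∈ (extChartAt I x₀).target ∧
      (extChartAt I x₀).symm y = q := ⟨q, _, mem_extChartAt_target q, extChartAt_to_inv q⟩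
  have hcont := (contMDiffAt_extChartAt_symm_boundaryless hy₀).continuousAt
  have hW : IsOpen ((extChartAt I x₀).target ∩ (extChartAt I x₀).symm ⁻¹' U) :=
    (contMDiffOn_extChartAt_symm (I := I) (n := ∞) x₀).continuousOn.isOpen_inter_preimage
      (isOpen_extChartAt_target x₀) hU
  have hfs : ContDiffOn ℝ ∞ (fun z => f ((extChartAt I x₀).symm z))
      ((extChartAt I x₀).target ∩ (extChartAt I x₀).symm ⁻¹' U) :=
    (hf.comp ((contMDiffOn_extChartAt_symm (I := I) (n := ∞) x₀).mono inter_subset_left)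
      fun z hz => hz.2).contDiffOn
  have hfm : ∀ p ∈ U, MDifferentiableAt I 𝓘(ℝ, Fin k → ℝ) f p := fun p hp =>
    (hf.contMDiffAt (hU.mem_nhds hp)).mdifferentiableAt (by simp)
  have hTy : ∀ᶠ y in 𝓝 y₀, y ∈ (extChartAt I x₀).target ∧ (extChartAt I x₀).symm y ∈ U ∧
      ((extChartAt I x₀).symm y ∈ Q → ∀ v, v ∈ tangentTo I Q ((extChartAt I x₀).symm y) ↔
        mfderiv I 𝓘(ℝ, Fin k → ℝ) f ((extChartAt I x₀).symm y) v = 0) := by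
    filter_upwards [hW.mem_nhds ⟨hy₀, hqU⟩, hcont.eventually hT] with y h1 h2
    exact ⟨h1.1, h1.2, h2⟩
  have key : ∀ c : ∀ x : N, GenTangent I x, (∀ q ∈ Q, c q ∈ tangentDirac I Q q) →
      ∀ᶠ y in 𝓝 y₀, y ∈ (extChartAt I x₀).symm ⁻¹' Q → genInChart I c x₀ y ∈
        kerAnn (fderiv ℝ (fun z => f ((extChartAt I x₀).symm z)) y) := by
    intro c hc
    filter_upwards [hTy] with y h1 h2
    exact (genInChart_mem_kerAnn_iff h1.1 (hfm _ h1.2.1) (h1.2.2 h2)).2 (hc _ h2)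
  have hT0 := hTy.self_of_nhds.2.2 hq
  refine (genInChart_mem_kerAnn_iff hy₀ (hfm _ hqU) hT0).1 ?_
  rw [genInChart_courantBracket (isSmooth_standardCourant_iff.1 ha)
    (isSmooth_standardCourant_iff.1 hb) hy₀]
  refine flatBracket_mem (Q := (extChartAt I x₀).symm ⁻¹' Q) hW ⟨hy₀, hqU⟩ hfs ?_ ?_ hq
    (contDiffAt_genInChart ha hy₀) (contDiffAt_genInChart hb hy₀) (key a haQ) (key b hbQ)
  · intro w
    obtain ⟨v, hv⟩ := hs w
    exact ⟨_, (fderiv_comp_extChartAt_symm hy₀ (hfm _ hqU) _).trans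
      ((congrArg _ (mfderiv_symm_comp_extChartAt hy₀ v)).trans hv)⟩
  · intro u hu huQ w hw
    have hsrc := (extChartAt I x₀).map_target hy₀
    have hr := (extChartAt I x₀).right_inv hy₀
    have hφ : MDifferentiableAt I 𝓘(ℝ, E) (extChartAt I x₀) ((extChartAt I x₀).symm y₀) :=
      mdifferentiableAt_extChartAt (by simpa using hsrc)
    have hu' : MDifferentiableAt 𝓘(ℝ, E) 𝓘(ℝ, ℝ) u
        (extChartAt I x₀ ((extChartAt I x₀).symm y₀)) := by
      rw [hr]
      exact hu.mdifferentiableAt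
    have hm : MDifferentiableAt I 𝓘(ℝ, ℝ) (fun p => u (extChartAt I x₀ p))
        ((extChartAt I x₀).symm y₀) := hu'.comp _ hφ
    have h0 := mfderiv_eq_zero_of_mem_tangentTo (Q := Q) hm (by
      have h1 := hφ.continuousAt
      unfold ContinuousAt at h1
      rw [hr] at h1
      filter_upwards [h1.eventually huQ, (isOpen_extChartAt_source (I := I) x₀).mem_nhds hsrc]
        with p h2 h3 h4
      exact h2 (show (extChartAt I x₀).symm (extChartAt I x₀ p) ∈ Q by
        rwa [(extChartAt I x₀).left_inv h3]))
      ((hT0 _).2 ((fderiv_comp_extChartAt_symm hy₀ (hfm _ hqU) w).symm.trans hw))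
    rw [← fderiv_comp_extChartAt_symm hy₀ hm w] at h0
    refine Eq.trans ?_ h0
    refine congrArg (fun L : E →L[ℝ] ℝ => L w) (Filter.EventuallyEq.fderiv_eq ?_)
    filter_upwards [(isOpen_extChartAt_target (I := I) x₀).mem_nhds hy₀] with z hz
    rw [(extChartAt I x₀).right_inv hz]

/-- The frame of `ker Df ⊕ Ann (ker Df)` is smooth on a full neighbourhood, also off `Q`, and is
carried back by the trivialization; on `Q` it spans the required fibre. -/
lemma exists_frame_tangentDirac {Q : Set N} (hQ : IsEmbeddedSubmanifold I Q) {q : N} (hq : q ∈ Q) :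
    ∃ (U : Set N) (r : ℕ) (e : Fin r → ∀ x : N, GenTangent I x), IsOpen U ∧ q ∈ U ∧
      (∀ i, IsSmoothGenSection I (e i) U) ∧ ∀ p ∈ U ∩ Q, LinearIndependent ℝ (fun i => e i p) ∧
        tangentDirac I Q p =
          (Submodule.span ℝ (range fun i => e i p) : Set (GenTangent I p)) := by
  obtain ⟨k, U, f, hU, hqU, hf, hs, hfQ⟩ := hQ q hq
  have hT := mem_tangentTo_iff_eventually hU hqU hf hs hfQ hq
  set φ := extChartAt I q with hφ
  have hy₀ := mem_extChartAt_target (I := I) q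
  have hW : IsOpen (φ.target ∩ φ.symm ⁻¹' U) :=
    (contMDiffOn_extChartAt_symm (I := I) (n := ∞) q).continuousOn.isOpen_inter_preimage
      (isOpen_extChartAt_target q) hU
  have hfs : ContDiffOn ℝ ∞ (fun z => f (φ.symm z)) (φ.target ∩ φ.symm ⁻¹' U) :=
    (hf.comp ((contMDiffOn_extChartAt_symm (I := I) (n := ∞) q).mono inter_subset_left)
      fun z hz => hz.2).contDiffOn
  have hfm : ∀ p ∈ U, MDifferentiableAt I 𝓘(ℝ, Fin k → ℝ) f p := fun p hp =>
    (hf.contMDiffAt (hU.mem_nhds hp)).mdifferentiableAt (by simp)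
  have hq0 : φ.symm (φ q) = q := extChartAt_to_inv q
  have hqW : φ q ∈ φ.target ∩ φ.symm ⁻¹' U := ⟨hy₀, by rw [mem_preimage, hq0]; exact hqU⟩
  have hsf : Function.Surjective (fderiv ℝ (fun z => f (φ.symm z)) (φ q)) := by
    intro w
    obtain ⟨v, hv⟩ : ∃ v, mfderiv I 𝓘(ℝ, Fin k → ℝ) f (φ.symm (φ q)) v = w := by
      rw [hq0]
      exact hs w
    exact ⟨_, (fderiv_comp_extChartAt_symm hy₀ (hfm _ hqW.2) _).trans
      ((congrArg _ (mfderiv_symm_comp_extChartAt hy₀ v)).trans hv)⟩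
  obtain ⟨r, Ξ, ϖ, hΞ⟩ := exists_kernel_frame hW hqW hfs hsf
  have hφc : ContinuousAt φ q := continuousAt_extChartAt q
  obtain ⟨W, hW1, hWo, hqW'⟩ := mem_nhds_iff.1 (((hφc.eventually hΞ).and hT).and
    ((isOpen_extChartAt_source (I := I) q).inter hU |>.mem_nhds
      ⟨mem_extChartAt_source (I := I) q, hqU⟩))
  set T := trivializationAt (GenModel E) (GenTangent I : N → Type _) q with hTr
  have hbase : ∀ p ∈ φ.source, p ∈ T.baseSet := fun p hp => by
    have : p ∈ (chartAt H q).source := by simpa [hφ] using hp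
    simpa [hTr] using this
  -- First the `r` kernel vectors, then the `k` component differentials of `f`; `finSumFinEquiv`
  -- turns the two blocks into a single index.
  set e₀ : E → Fin r ⊕ Fin k → GenModel E := fun y => Sum.elim (fun i => (Ξ y (0, Pi.single i 1), 0))
      (fun j => (0, ContinuousLinearMap.proj j ∘L fderiv ℝ (fun z => f (φ.symm z)) y)) with he₀
  refine ⟨W, r + k, fun i p => T.symm p (e₀ (φ p) (finSumFinEquiv.symm i)), hWo, hqW',
    fun i p hp => ?_, fun p hp => ?_⟩
  · obtain ⟨⟨h1, h2⟩, h3⟩ := hW1 hp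
    refine ContMDiffAt.contMDiffWithinAt ?_
    have hφp : ContMDiffAt I 𝓘(ℝ, E) ∞ φ p := contMDiffAt_extChartAt' (by simpa [hφ] using h3.1)
    have he : ContDiffAt ℝ ∞ (fun y => e₀ y (finSumFinEquiv.symm i)) (φ p) := by
      rcases finSumFinEquiv.symm i with i | j
      · exact (h1.1.clm_apply contDiffAt_const).prodMk contDiffAt_const
      · refine contDiffAt_const.prodMk (contDiffAt_const.clm_comp ?_)
        exact (hfs.contDiffAt (hW.mem_nhds ⟨φ.map_source h3.1, by
          rw [mem_preimage, φ.left_inv h3.1]; exact h3.2⟩)).fderiv_right (by simp)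
    exact contMDiffAt_trivialization_symm (GenModel E) (GenTangent I : N → Type _) T contMDiffAt_id
      (hbase p h3.1) (he.contMDiffAt.comp p hφp)
  · obtain ⟨⟨h1, h2⟩, h3⟩ := hW1 hp.1
    obtain ⟨h4, h5⟩ := kerAnn_frame h1.2.1 h1.2.2 (e := e₀ (φ p)) rfl
    let L := T.continuousLinearEquivAt ℝ p (hbase p h3.1)
    have hL : ∀ w, L.symm w = T.symm p w := fun _ => rfl
    have hr : (fun i => T.symm p (e₀ (φ p) (finSumFinEquiv.symm i))) =
        (L.symm.toLinearEquiv.toLinearMap ∘ e₀ (φ p)) ∘ finSumFinEquiv.symm :=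
      funext fun i => (hL _).symm
    beta_reduce
    rw [hr]
    constructor
    · exact (h4.map' _ (LinearEquiv.ker _)).comp _ finSumFinEquiv.symm.injective
    · rw [finSumFinEquiv.symm.surjective.range_comp, range_comp, ← Submodule.map_span, ← h5]
      ext v
      rw [← trivializationAt_mem_kerAnn_iff (x₀ := q) h3.1 (hfm _ h3.2) (h2 hp.2) v]
      constructor
      · intro hv
        exact ⟨_, hv, L.symm_apply_apply v⟩
      · rintro ⟨w, hw, rfl⟩
        have : L (L.symm w) = w := L.apply_symm_apply w
        rwa [← this] at hw

end StandardDirac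

/-! ### The Courant algebroid `𝕋N × 𝕋N × 𝕋N` with the signs `+ - -` -/

section Triple

variable {E H : Type*} [NormedAddCommGroup E] [NormedSpace ℝ E]
  [FiniteDimensional ℝ E] [TopologicalSpace H] {I : ModelWithCorners ℝ E H}
  {N : Type*} [TopologicalSpace N] [ChartedSpace H N] [IsManifold I ∞ N]

lemma contMDiffAt_genTangent_iff {EP HP P : Type*} [NormedAddCommGroup EP] [NormedSpace ℝ EP]
    [TopologicalSpace HP] {J : ModelWithCorners ℝ EP HP} [TopologicalSpace P] [ChartedSpace HP P]
    {b : P → N} {a : ∀ q, GenTangent I (b q)} {p : P} :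
    ContMDiffAt J (I.prod 𝓘(ℝ, GenModel E)) ∞
      (fun q => (⟨b q, a q⟩ : TotalSpace (GenModel E) (GenTangent I : N → Type _))) p ↔
    ContMDiffAt J I.tangent ∞ (fun q => (⟨b q, (a q).1⟩ : TangentBundle I N)) p ∧
      ContMDiffAt J (I.prod 𝓘(ℝ, E →L[ℝ] ℝ)) ∞ (fun q => (⟨b q, (a q).2⟩ :
        TotalSpace (E →L[ℝ] ℝ) (fun x : N => TangentSpace I x →L[ℝ] ℝ))) p :=
  contMDiffAt_bundleProd_iff (V := fun x : N => TangentSpace I x)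
    (V' := fun x : N => TangentSpace I x →L[ℝ] ℝ) (b := b)
    (v := fun q => (a q).1) (w := fun q => (a q).2)

lemma tripleEquiv_snd_apply (p : N × (N × N)) (v : TripleGen I p) (u : E × (E × E)) :
    (show E × (E × E) →L[ℝ] ℝ from (tripleEquiv I p v).2) u =
      v.1.2 u.1 - v.2.1.2 u.2.1 - v.2.2.2 u.2.2 := rfl

/-- The sign put on the covectors of the last two factors is what turns the pairing with signs `+ -
-` into the canonical one. -/
lemma canonicalPairing_tripleEquiv (p : N × (N × N)) (v w : TripleGen I p) :
    canonicalPairing (I.prod (I.prod I)) p (tripleEquiv I p v) (tripleEquiv I p w) =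
      (tripleCourant I N).pairing p v w := by
  change (v.1.2 w.1.1 - v.2.1.2 w.2.1.1 - v.2.2.2 w.2.2.1) +
    (w.1.2 v.1.1 - w.2.1.2 v.2.1.1 - w.2.2.2 v.2.2.1) =
    (v.1.2 w.1.1 + w.1.2 v.1.1) - (v.2.1.2 w.2.1.1 + w.2.1.2 v.2.1.1)
      - (v.2.2.2 w.2.2.1 + w.2.2.2 v.2.2.1)
  ring

/-- Smoothness of sections of `𝕋N × (𝕋N × 𝕋N)`, read in `𝕋(N × N × N)`. -/
lemma contMDiffAt_tripleEquiv_iff {a : ∀ p : N × (N × N), TripleGen I p} {p : N × (N × N)} :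
    ContMDiffAt (I.prod (I.prod I)) ((I.prod (I.prod I)).prod 𝓘(ℝ, GenModel (E × (E × E)))) ∞
      (fun q => (⟨q, tripleEquiv I q (a q)⟩ : TotalSpace (GenModel (E × (E × E)))
        (GenTangent (I.prod (I.prod I)) : N × (N × N) → Type _))) p ↔
    ContMDiffAt (I.prod (I.prod I)) (I.prod 𝓘(ℝ, GenModel E)) ∞
      (fun p => (⟨p.1, (a p).1⟩ : TotalSpace (GenModel E) (GenTangent I : N → Type _))) p ∧
    ContMDiffAt (I.prod (I.prod I)) (I.prod 𝓘(ℝ, GenModel E)) ∞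
      (fun p => (⟨p.2.1, (a p).2.1⟩ : TotalSpace (GenModel E) (GenTangent I : N → Type _))) p ∧
    ContMDiffAt (I.prod (I.prod I)) (I.prod 𝓘(ℝ, GenModel E)) ∞
      (fun p => (⟨p.2.2, (a p).2.2⟩ : TotalSpace (GenModel E) (GenTangent I : N → Type _))) p := by
  have s0 : ContMDiffAt (I.prod (I.prod I)) I ∞ (fun q : N × (N × N) => q.1) p := contMDiffAt_fst
  have s1 : ContMDiffAt (I.prod (I.prod I)) I ∞ (fun q : N × (N × N) => q.2.1) p :=
    contMDiffAt_snd.fst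
  have s2 : ContMDiffAt (I.prod (I.prod I)) I ∞ (fun q : N × (N × N) => q.2.2) p :=
    contMDiffAt_snd.snd
  have z0 := contMDiffAt_tangent_zero s0
  have z1 := contMDiffAt_tangent_zero s1
  have z2 := contMDiffAt_tangent_zero s2
  have comps : ∀ {Z : ∀ q : N × (N × N), TangentSpace (I.prod (I.prod I)) q},
      ContMDiffAt (I.prod (I.prod I)) (I.prod (I.prod I)).tangent ∞
        (fun q => (⟨q, Z q⟩ : TangentBundle (I.prod (I.prod I)) (N × (N × N)))) p →
      ContMDiffAt (I.prod (I.prod I)) I.tangent ∞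
        (fun q => (⟨q.1, (Z q).1⟩ : TangentBundle I N)) p ∧
      ContMDiffAt (I.prod (I.prod I)) I.tangent ∞
        (fun q => (⟨q.2.1, (Z q).2.1⟩ : TangentBundle I N)) p ∧
      ContMDiffAt (I.prod (I.prod I)) I.tangent ∞
        (fun q => (⟨q.2.2, (Z q).2.2⟩ : TangentBundle I N)) p := by
    intro Z hZ
    have h0 := hZ.tangentMap_family (f := Prod.fst) contMDiffAt_fst
    have h' := hZ.tangentMap_family (f := Prod.snd) contMDiffAt_snd
    have h1 := h'.tangentMap_family (f := Prod.fst) contMDiffAt_fst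
    have h2 := h'.tangentMap_family (f := Prod.snd) contMDiffAt_snd
    simp only [tangentMap_prodFst, tangentMap_prodSnd] at h0 h1 h2
    exact ⟨h0, h1, h2⟩
  constructor
  · intro h
    obtain ⟨hX, hθ⟩ := contMDiffAt_genTangent_iff.1 h
    obtain ⟨x0, x1, x2⟩ := comps hX
    -- Each covector component is recovered, up to sign, by evaluating on vectors whose other two
    -- components are zero.
    have ev : ∀ {Z : ∀ q : N × (N × N), TangentSpace (I.prod (I.prod I)) q},
        ContMDiffAt (I.prod (I.prod I)) (I.prod (I.prod I)).tangent ∞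
          (fun q => (⟨q, Z q⟩ : TangentBundle (I.prod (I.prod I)) (N × (N × N)))) p →
        ContMDiffAt (I.prod (I.prod I)) 𝓘(ℝ, ℝ) ∞ (fun q => (tripleEquiv I q (a q)).2 (Z q)) p :=
      fun hZ => ContMDiffAt.dual_apply (V := fun x : N × (N × N) => TangentSpace _ x)
        (F := E × (E × E)) hθ hZ
    have tr : ∀ {b : N × (N × N) → N} (w : E), ContMDiffAt (I.prod (I.prod I)) I ∞ b p →
        ContMDiffAt (I.prod (I.prod I)) I.tangent ∞ (fun q => (⟨b q, (trivializationAt E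
          (fun x : N => TangentSpace I x) (b p)).symm (b q) w⟩ : TangentBundle I N)) p :=
      fun {b} w hb => contMDiffAt_trivialization_symm E (fun x : N => TangentSpace I x) _ hb
        (mem_baseSet_trivializationAt E (fun x : N => TangentSpace I x) (b p)) contMDiffAt_const
    refine ⟨contMDiffAt_genTangent_iff.2 ⟨x0, ?_⟩, contMDiffAt_genTangent_iff.2 ⟨x1, ?_⟩,
      contMDiffAt_genTangent_iff.2 ⟨x2, ?_⟩⟩
    · refine contMDiffAt_dual_of_apply (V := fun x : N => TangentSpace I x) s0 fun w => ?_
      refine (ev (contMDiffAt_tangent_prodMk (tr w s0)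
        (contMDiffAt_tangent_prodMk z1 z2))).congr_of_eventuallyEq (.of_forall fun q => ?_)
      refine Eq.trans ?_ (tripleEquiv_snd_apply q (a q) _).symm
      refine Eq.trans ?_ (congrArg₂ (fun x y => _ - x - y) (map_zero (a q).2.1.2)
        (map_zero (a q).2.2.2)).symm
      rw [sub_zero, sub_zero]
    · refine contMDiffAt_dual_of_apply (V := fun x : N => TangentSpace I x) s1 fun w => ?_
      refine (ev (contMDiffAt_tangent_prodMk z0
        (contMDiffAt_tangent_prodMk (tr w s1) z2))).neg.congr_of_eventuallyEq
          (.of_forall fun q => ?_)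
      refine Eq.trans ?_ (congrArg Neg.neg (tripleEquiv_snd_apply q (a q) _).symm)
      refine Eq.trans ?_ (congrArg₂ (fun x y => -(x - _ - y)) (map_zero (a q).1.2)
        (map_zero (a q).2.2.2)).symm
      rw [sub_zero, zero_sub, neg_neg]
    · refine contMDiffAt_dual_of_apply (V := fun x : N => TangentSpace I x) s2 fun w => ?_
      refine (ev (contMDiffAt_tangent_prodMk z0
        (contMDiffAt_tangent_prodMk z1 (tr w s2)))).neg.congr_of_eventuallyEq
          (.of_forall fun q => ?_)
      refine Eq.trans ?_ (congrArg Neg.neg (tripleEquiv_snd_apply q (a q) _).symm)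
      refine Eq.trans ?_ (congrArg₂ (fun x y => -(x - y - _)) (map_zero (a q).1.2)
        (map_zero (a q).2.1.2)).symm
      rw [sub_zero, zero_sub, neg_neg]
  · rintro ⟨h0, h1, h2⟩
    obtain ⟨x0, α0⟩ := contMDiffAt_genTangent_iff.1 h0
    obtain ⟨x1, α1⟩ := contMDiffAt_genTangent_iff.1 h1
    obtain ⟨x2, α2⟩ := contMDiffAt_genTangent_iff.1 h2
    refine contMDiffAt_genTangent_iff.2 ⟨contMDiffAt_tangent_prodMk x0
      (contMDiffAt_tangent_prodMk x1 x2), ?_⟩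
    refine contMDiffAt_dual_of_apply (V := fun x : N × (N × N) => TangentSpace _ x)
      contMDiffAt_id fun w => ?_
    obtain ⟨c0, c1, c2⟩ := comps (contMDiffAt_trivialization_symm (E × (E × E))
      (fun x : N × (N × N) => TangentSpace (I.prod (I.prod I)) x) _ contMDiffAt_id
      (mem_baseSet_trivializationAt (E × (E × E))
        (fun x : N × (N × N) => TangentSpace (I.prod (I.prod I)) x) p)
      (contMDiffAt_const (c := w)))
    exact ((ContMDiffAt.dual_apply (V := fun x : N => TangentSpace I x) (F := E) α0 c0).sub
      (ContMDiffAt.dual_apply (V := fun x : N => TangentSpace I x) (F := E) α1 c1)).sub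
      (ContMDiffAt.dual_apply (V := fun x : N => TangentSpace I x) (F := E) α2 c2)

lemma isSmoothOn_tripleCourant_iff {a : ∀ p : N × (N × N), TripleGen I p} {U : Set (N × (N × N))}
    (hU : IsOpen U) : (tripleCourant I N).IsSmoothOn a U ↔
      IsSmoothGenSection (I.prod (I.prod I)) (fun q => tripleEquiv I q (a q)) U := by
  constructor
  · rintro ⟨h0, h1, h2⟩ p hp
    have hU' := hU.mem_nhds hp
    exact (contMDiffAt_tripleEquiv_iff.2 ⟨h0.contMDiffAt hU', h1.contMDiffAt hU',
      h2.contMDiffAt hU'⟩).contMDiffWithinAt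
  · intro h
    have h' := fun p (hp : p ∈ U) => contMDiffAt_tripleEquiv_iff.1 (h.contMDiffAt (hU.mem_nhds hp))
    exact ⟨fun p hp => (h' p hp).1.contMDiffWithinAt, fun p hp => (h' p hp).2.1.contMDiffWithinAt,
      fun p hp => (h' p hp).2.2.contMDiffWithinAt⟩

/-- Dirac structures in `𝕋N × (𝕋N × 𝕋N)` from embedded submanifolds of `N × N × N`. -/
theorem isDiracStructureOn_tripleCourant [I.Boundaryless] {Q : Set (N × (N × N))}
    {K : ∀ p, Set (TripleGen I p)} (hQ : IsEmbeddedSubmanifold (I.prod (I.prod I)) Q)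
    (hK : ∀ p ∈ Q, ∀ c, c ∈ K p ↔ tripleEquiv I p c ∈ tangentDirac (I.prod (I.prod I)) Q p) :
    (tripleCourant I N).IsDiracStructureOn Q K where
  support := hQ
  subbundle q hq := by
    obtain ⟨U, r, e, hU, hqU, he, hspan⟩ := exists_frame_tangentDirac hQ hq
    refine ⟨U, r, fun i p => (tripleEquiv I p).symm (e i p), hU, hqU, fun i => ?_, fun p hp => ?_⟩
    · rw [isSmoothOn_tripleCourant_iff hU]
      simpa only [LinearEquiv.apply_symm_apply] using he i
    · obtain ⟨h1, h2⟩ := hspan p hp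
      refine ⟨h1.map' (tripleEquiv I p).symm.toLinearMap (LinearEquiv.ker _), ?_⟩
      have h3 : (range fun i => (tripleEquiv I p).symm (e i p)) =
          (tripleEquiv I p).symm.toLinearMap '' range (fun i => e i p) :=
        (range_comp _ _)
      rw [h3, ← Submodule.map_span]
      ext c
      rw [hK p hp.2, h2]
      constructor
      · intro h
        exact ⟨_, h, LinearEquiv.symm_apply_apply _ _⟩
      · rintro ⟨w, hw, rfl⟩
        simpa using hw
  lagrangian q hq v := by
    rw [hK q hq, tangentDirac_lagrangian hQ hq]
    constructor
    · intro h w hw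
      rw [← canonicalPairing_tripleEquiv]
      exact h _ ((hK q hq w).1 hw)
    · intro h w hw
      obtain ⟨w, rfl⟩ := (tripleEquiv I q).surjective w
      rw [canonicalPairing_tripleEquiv]
      exact h _ ((hK q hq w).2 hw)
  anchor_mem q hq v hv := ((hK q hq v).1 hv).1
  bracket_mem a b ha hb haQ hbQ q hq := by
    rw [hK q hq]
    have h := courantBracket_mem_tangentDirac hQ ((isSmoothOn_tripleCourant_iff isOpen_univ).1 ha)
      ((isSmoothOn_tripleCourant_iff isOpen_univ).1 hb) (fun p hp => (hK p hp _).1 (haQ p hp))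
      (fun p hp => (hK p hp _).1 (hbQ p hp)) hq
    have h' : tripleEquiv I q ((tripleCourant I N).bracket a b q) = _ :=
      (tripleEquiv I q).apply_symm_apply _
    rwa [h']

end Triple

/-! ### The graph of the multiplication -/

section EmbeddedCriterion

variable {E H E' F : Type*} [NormedAddCommGroup E] [NormedSpace ℝ E] [TopologicalSpace H]
  [NormedAddCommGroup E'] [NormedSpace ℝ E']
  {I : ModelWithCorners ℝ E H} {N : Type*} [TopologicalSpace N] [ChartedSpace H N]
  [NormedAddCommGroup F] [NormedSpace ℝ F]

/-- Coordinates on `F` provide the target `ℝ^k` demanded by the definition of an embedded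
submanifold. -/
lemma exists_embedding_chart [FiniteDimensional ℝ F] {Q U : Set N} {q : N} {f : N → F}
    (hU : IsOpen U) (hq : q ∈ U) (hf : ContMDiffOn I 𝓘(ℝ, F) ∞ f U)
    (hs : Function.Surjective (mfderiv I 𝓘(ℝ, F) f q)) (hfQ : ∀ p ∈ U, p ∈ Q ↔ f p = 0) :
    ∃ (k : ℕ) (U : Set N) (f : N → (Fin k → ℝ)), IsOpen U ∧ q ∈ U ∧
      ContMDiffOn I 𝓘(ℝ, Fin k → ℝ) ∞ f U ∧
      Function.Surjective (mfderiv I 𝓘(ℝ, Fin k → ℝ) f q) ∧ ∀ p ∈ U, p ∈ Q ↔ f p = 0 := by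
  let L : F ≃L[ℝ] (Fin (Module.finrank ℝ F) → ℝ) := (Module.finBasis ℝ F).equivFunL
  refine ⟨_, U, fun p => L (f p), hU, hq, L.contDiff.contMDiff.comp_contMDiffOn hf, ?_,
    fun p hp => (hfQ p hp).trans L.map_eq_zero_iff.symm⟩
  have h1 : HasMFDerivAt I 𝓘(ℝ, F) f q (mfderiv I 𝓘(ℝ, F) f q) :=
    ((hf.contMDiffAt (hU.mem_nhds hq)).mdifferentiableAt (by simp)).hasMFDerivAt
  have h2 := HasMFDerivAt.comp q (g := L)
    (L.toContinuousLinearMap.hasFDerivAt (x := f q)).hasMFDerivAt h1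
  intro w
  obtain ⟨v, hv⟩ := hs (L.symm w)
  refine ⟨v, ?_⟩
  rw [show (fun p => L (f p)) = L ∘ f from rfl, h2.mfderiv]
  exact (congrArg L hv).trans (L.apply_symm_apply w)

lemma HasMFDerivAt.prodMk_modelSpace {f : N → E'} {g : N → F} {x : N}
    {df : TangentSpace I x →L[ℝ] E'} {dg : TangentSpace I x →L[ℝ] F}
    (hf : HasMFDerivAt I 𝓘(ℝ, E') f x df) (hg : HasMFDerivAt I 𝓘(ℝ, F) g x dg) :
    HasMFDerivAt I 𝓘(ℝ, E' × F) (fun y => (f y, g y)) x (df.prod dg) :=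
  ⟨hf.1.prodMk hg.1, hf.2.prodMk hg.2⟩

/-- The derivative is triangular: the middle variable reaches the first component through `A`, and
the first variable then corrects the second component through `C`. -/
lemma surjective_mfderiv_graph {A B : N → E'} {C : N → F} {D : N × N → F}
    {p : N × (N × N)}
    (hA : MDifferentiableAt I 𝓘(ℝ, E') A p.2.1) (hB : MDifferentiableAt I 𝓘(ℝ, E') B p.2.2)
    (hC : MDifferentiableAt I 𝓘(ℝ, F) C p.1) (hD : MDifferentiableAt (I.prod I) 𝓘(ℝ, F) D p.2)
    (sA : Function.Surjective (mfderiv I 𝓘(ℝ, E') A p.2.1))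
    (sC : Function.Surjective (mfderiv I 𝓘(ℝ, F) C p.1)) :
    Function.Surjective (mfderiv (I.prod (I.prod I)) 𝓘(ℝ, E' × F)
      (fun p : N × (N × N) => (A p.2.1 - B p.2.2, C p.1 - D p.2)) p) := by
  have f1 : HasMFDerivAt (I.prod (I.prod I)) I (fun p : N × (N × N) => p.1) p
      (ContinuousLinearMap.fst ℝ E (E × E)) := hasMFDerivAt_fst p
  have f2 : HasMFDerivAt (I.prod (I.prod I)) (I.prod I) (fun p : N × (N × N) => p.2) p
      (ContinuousLinearMap.snd ℝ E (E × E)) := hasMFDerivAt_snd p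
  have f3 : HasMFDerivAt (I.prod (I.prod I)) I (fun p : N × (N × N) => p.2.1) p
      ((ContinuousLinearMap.fst ℝ E E).comp (ContinuousLinearMap.snd ℝ E (E × E))) :=
    HasMFDerivAt.comp p (g := Prod.fst) (hasMFDerivAt_fst p.2) f2
  have f4 : HasMFDerivAt (I.prod (I.prod I)) I (fun p : N × (N × N) => p.2.2) p
      ((ContinuousLinearMap.snd ℝ E E).comp (ContinuousLinearMap.snd ℝ E (E × E))) :=
    HasMFDerivAt.comp p (g := Prod.snd) (hasMFDerivAt_snd p.2) f2
  have h12 : HasMFDerivAt (I.prod (I.prod I)) 𝓘(ℝ, E') (fun p => A p.2.1 - B p.2.2) p _ :=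
    (HasMFDerivAt.comp p (g := A) hA.hasMFDerivAt f3).sub
      (HasMFDerivAt.comp p (g := B) hB.hasMFDerivAt f4)
  have h34 : HasMFDerivAt (I.prod (I.prod I)) 𝓘(ℝ, F) (fun p => C p.1 - D p.2) p _ :=
    (HasMFDerivAt.comp p (g := C) hC.hasMFDerivAt f1).sub
      (HasMFDerivAt.comp p (g := D) hD.hasMFDerivAt f2)
  have h := h12.prodMk_modelSpace h34
  rintro ⟨w', w⟩
  obtain ⟨v, hv⟩ := sA w'
  -- The contribution of `v` through `D`, which the choice of `u` has to compensate.
  let z : F := mfderiv (I.prod I) 𝓘(ℝ, F) D p.2 ((v, 0) : E × E)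
  obtain ⟨u, hu⟩ := sC (w + z : F)
  refine ⟨((u, (v, 0)) : E × (E × E)), ?_⟩
  refine (congrArg (fun L : E × (E × E) →L[ℝ] E' × F => L (u, (v, 0))) h.mfderiv).trans ?_
  refine Prod.ext ?_ ?_
  · have h0 : (mfderiv I 𝓘(ℝ, E') B p.2.2 (0 : TangentSpace I p.2.2) : E') = 0 := map_zero _
    exact (congrArg₂ (fun x y : E' => x - y) hv h0).trans (sub_zero w')
  · change (show F from mfderiv I 𝓘(ℝ, F) C p.1 u) - z = w
    exact (congrArg (fun x : F => x - z) hu).trans (add_sub_cancel_right w z)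

end EmbeddedCriterion

namespace LieGroupoid

variable {E H E' H' : Type*} [NormedAddCommGroup E] [NormedSpace ℝ E]
  [TopologicalSpace H] [NormedAddCommGroup E'] [NormedSpace ℝ E']
  [TopologicalSpace H'] {I : ModelWithCorners ℝ E H} {I' : ModelWithCorners ℝ E' H'}
  {G M : Type*} [TopologicalSpace G] [ChartedSpace H G]
  [TopologicalSpace M] [ChartedSpace H' M]
  (𝒢 : LieGroupoid I G I' M)
  [FiniteDimensional ℝ E] [FiniteDimensional ℝ E'] [IsManifold I ∞ G] [IsManifold I' ∞ M]
  [I.Boundaryless] [I'.Boundaryless]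

/-- In charts the local equations are `s(g) = t(h)` and `k = m(g, h)`, with `m` a smooth extension
of the product. They are independent because `s` is a submersion and `k` occurs linearly. -/
lemma isEmbeddedSubmanifold_graphMul :
    IsEmbeddedSubmanifold (I.prod (I.prod I)) 𝒢.graphMul := by
  rintro ⟨k₀, g₀, h₀⟩ hp₀
  obtain ⟨hgh, hk⟩ : 𝒢.src g₀ = 𝒢.tgt h₀ ∧ k₀ = 𝒢.mul g₀ h₀ := hp₀
  obtain ⟨U, m, hU, hpU, hm, hmU⟩ := 𝒢.isLieGroupoid.smooth_mul (g₀, h₀) hgh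
  have hm₀ : m (g₀, h₀) = k₀ := (hmU ⟨hgh, hpU⟩).trans hk.symm
  set φ := extChartAt I' (𝒢.src g₀) with hφ
  set χ := extChartAt I k₀ with hχ
  have cs := 𝒢.isLieGroupoid.smooth_src.continuous
  have ct := 𝒢.isLieGroupoid.smooth_tgt.continuous
  have oφ : IsOpen φ.source := isOpen_extChartAt_source _
  have oχ : IsOpen χ.source := isOpen_extChartAt_source _
  have cφ : ∀ x ∈ φ.source, ContMDiffAt I' 𝓘(ℝ, E') ∞ φ x := fun x hx =>
    contMDiffAt_extChartAt' (by simpa [hφ] using hx)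
  have cχ : ∀ x ∈ χ.source, ContMDiffAt I 𝓘(ℝ, E) ∞ χ x := fun x hx =>
    contMDiffAt_extChartAt' (by simpa [hχ] using hx)
  have hs0 : 𝒢.src g₀ ∈ φ.source := mem_extChartAt_source _
  have ht0 : 𝒢.tgt h₀ ∈ φ.source := hgh ▸ hs0
  have hk0 : k₀ ∈ χ.source := mem_extChartAt_source _
  have hm0 : m (g₀, h₀) ∈ χ.source := by rwa [hm₀]
  set W : Set (G × (G × G)) := (fun p => p.1) ⁻¹' χ.source ∩
    ((fun p => 𝒢.src p.2.1) ⁻¹' φ.source ∩ (fun p => 𝒢.tgt p.2.2) ⁻¹' φ.source) ∩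
    (fun p => p.2) ⁻¹' (U ∩ m ⁻¹' χ.source) with hW
  have oW : IsOpen W := ((oχ.preimage continuous_fst).inter
    ((oφ.preimage (cs.comp (continuous_fst.comp continuous_snd))).inter
      (oφ.preimage (ct.comp (continuous_snd.comp continuous_snd))))).inter
    ((hm.continuousOn.isOpen_inter_preimage hU oχ).preimage continuous_snd)
  have hA : ∀ g, 𝒢.src g ∈ φ.source → ContMDiffAt I 𝓘(ℝ, E') ∞ (fun g => φ (𝒢.src g)) g :=
    fun g hg => (cφ _ hg).comp g (𝒢.isLieGroupoid.smooth_src g)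
  have hB : ∀ g, 𝒢.tgt g ∈ φ.source → ContMDiffAt I 𝓘(ℝ, E') ∞ (fun g => φ (𝒢.tgt g)) g :=
    fun g hg => (cφ _ hg).comp g (𝒢.isLieGroupoid.smooth_tgt g)
  have hD : ∀ p ∈ U, m p ∈ χ.source → ContMDiffAt (I.prod I) 𝓘(ℝ, E) ∞ (fun p => χ (m p)) p :=
    fun p hp hp' => (cχ _ hp').comp p (hm.contMDiffAt (hU.mem_nhds hp))
  refine exists_embedding_chart (F := E' × E) (f := fun p : G × (G × G) =>
    (φ (𝒢.src p.2.1) - φ (𝒢.tgt p.2.2), χ p.1 - χ (m p.2))) oW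
    ⟨⟨hk0, hs0, ht0⟩, hpU, hm0⟩ ?_ ?_ ?_
  · rintro ⟨k, g, h⟩ ⟨⟨h1, h2, h3⟩, h4, h5⟩
    refine ContMDiffAt.contMDiffWithinAt (ContMDiffAt.prodMk_space ?_ ?_)
    · exact (ContMDiffAt.comp (k, g, h) (g := fun g => φ (𝒢.src g)) (hA g h2)
        contMDiffAt_snd.fst).sub (ContMDiffAt.comp (k, g, h) (g := fun g => φ (𝒢.tgt g)) (hB h h3)
        contMDiffAt_snd.snd)
    · exact (ContMDiffAt.comp (k, g, h) (g := χ) (cχ k h1) contMDiffAt_fst).sub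
        (ContMDiffAt.comp (k, g, h) (g := fun p => χ (m p)) (hD (g, h) h4 h5) contMDiffAt_snd)
  · refine surjective_mfderiv_graph (A := fun g => φ (𝒢.src g)) (B := fun g => φ (𝒢.tgt g))
      (C := χ) (D := fun p => χ (m p)) ((hA g₀ hs0).mdifferentiableAt (by simp))
      ((hB h₀ ht0).mdifferentiableAt (by simp)) ((cχ k₀ hk0).mdifferentiableAt (by simp))
      ((hD (g₀, h₀) hpU hm0).mdifferentiableAt (by simp)) ?_
      (mfderiv_extChartAt_bijective hk0).2
    have h1 := mfderiv_comp g₀ (g := φ) (f := 𝒢.src) ((cφ _ hs0).mdifferentiableAt (by simp))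
      (𝒢.mdifferentiableAt_src g₀)
    change Function.Surjective (mfderiv I 𝓘(ℝ, E') (φ ∘ 𝒢.src) g₀)
    rw [h1]
    exact (mfderiv_extChartAt_bijective hs0).2.comp (𝒢.isLieGroupoid.submersion_src g₀)
  · rintro ⟨k, g, h⟩ ⟨⟨h1, h2, h3⟩, h4, h5⟩
    change 𝒢.src g = 𝒢.tgt h ∧ k = 𝒢.mul g h ↔ _
    rw [Prod.mk_eq_zero, sub_eq_zero, sub_eq_zero, φ.injOn.eq_iff h2 h3, χ.injOn.eq_iff h1 h5]
    -- The extension `m` has to agree with the product only where `s(g) = t(h)` already holds.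
    refine and_congr_right fun h6 => ?_
    rw [hmU (⟨h6, h4⟩ : (g, h) ∈ 𝒢.composable ∩ U)]

/-- The tangent spaces of the graph of the multiplication. -/
lemma mem_tangentTo_graphMul_iff {g h : G}
    {Z : TangentSpace I (𝒢.mul g h)} {X : TangentSpace I g} {Y : TangentSpace I h} :
    ((Z, (X, Y)) : TangentSpace (I.prod (I.prod I)) (𝒢.mul g h, (g, h))) ∈
        tangentTo (I.prod (I.prod I)) 𝒢.graphMul (𝒢.mul g h, (g, h)) ↔
      𝒢.tangentGroupoid.src ⟨g, X⟩ = 𝒢.tangentGroupoid.tgt ⟨h, Y⟩ ∧ Z = 𝒢.tMul g h X Y := by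
  constructor
  · rintro ⟨γ, hγ, hγQ, hγv⟩
    have hγv : velocity (I.prod (I.prod I)) γ = ⟨(𝒢.mul g h, (g, h)), (Z, (X, Y))⟩ := hγv
    have c0 : ContMDiffAt 𝓘(ℝ, ℝ) I ∞ (fun τ => (γ τ).1) 0 := contMDiffAt_fst.comp 0 hγ
    have c' : ContMDiffAt 𝓘(ℝ, ℝ) (I.prod I) ∞ (fun τ => (γ τ).2) 0 := contMDiffAt_snd.comp 0 hγ
    have c1 : ContMDiffAt 𝓘(ℝ, ℝ) I ∞ (fun τ => (γ τ).2.1) 0 := contMDiffAt_fst.comp 0 c'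
    have c2 : ContMDiffAt 𝓘(ℝ, ℝ) I ∞ (fun τ => (γ τ).2.2) 0 := contMDiffAt_snd.comp 0 c'
    have v0 : velocity I (fun τ => (γ τ).1) = ⟨𝒢.mul g h, Z⟩ := by
      rw [velocity_comp (f := Prod.fst) mdifferentiableAt_fst (hγ.mdifferentiableAt (by simp)), hγv,
        tangentMap_prodFst]
    have v' : velocity (I.prod I) (fun τ => (γ τ).2) = ⟨(g, h), (X, Y)⟩ := by
      rw [velocity_comp (f := Prod.snd) mdifferentiableAt_snd (hγ.mdifferentiableAt (by simp)), hγv,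
        tangentMap_prodSnd]
    have v1 : velocity I (fun τ => (γ τ).2.1) = ⟨g, X⟩ := by
      rw [velocity_comp (f := Prod.fst) (γ := fun τ => (γ τ).2) mdifferentiableAt_fst
        (c'.mdifferentiableAt (by simp)), v', tangentMap_prodFst]
    have v2 : velocity I (fun τ => (γ τ).2.2) = ⟨h, Y⟩ := by
      rw [velocity_comp (f := Prod.snd) (γ := fun τ => (γ τ).2) mdifferentiableAt_snd
        (c'.mdifferentiableAt (by simp)), v', tangentMap_prodSnd]
    have hc : ∀ᶠ τ in 𝓝 0, 𝒢.src (γ τ).2.1 = 𝒢.tgt (γ τ).2.2 := hγQ.mono fun τ h => h.1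
    have h1 := 𝒢.velocity_mul' c1 c2 hc
    have h2 : (fun τ => 𝒢.mul (γ τ).2.1 (γ τ).2.2) =ᶠ[𝓝 0] fun τ => (γ τ).1 :=
      hγQ.mono fun τ h => h.2.symm
    rw [velocity_congr h2, v0, v1, v2] at h1
    refine ⟨?_, (tangentBundle_mk_eq_iff.1 h1).2⟩
    rw [← v1, ← v2, ← 𝒢.velocity_src c1, ← 𝒢.velocity_tgt c2]
    exact velocity_congr hc
  · rintro ⟨hXY, rfl⟩
    obtain ⟨γ, δ, hγ, hδ, hc, h1, h2⟩ := 𝒢.exists_curves_composable _ _ hXY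
    refine ⟨fun τ => (𝒢.mul (γ τ) (δ τ), (γ τ, δ τ)),
      (𝒢.contMDiffAt_mul hγ hδ hc).prodMk (hγ.prodMk hδ), hc.mono fun τ h => ⟨h, rfl⟩, ?_⟩
    have h3 := 𝒢.velocity_mul' hγ hδ hc
    rw [h1, h2] at h3
    have dγ := hγ.mdifferentiableAt (by simp)
    have dδ := hδ.mdifferentiableAt (by simp)
    refine (velocity_prodMk ((𝒢.contMDiffAt_mul hγ hδ hc).mdifferentiableAt (by simp))
      (dγ.prodMk dδ)).trans ?_
    rw [velocity_prodMk dγ dδ]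
    have e1 := tangentBundle_mk_eq_iff.1 h1
    have e2 := tangentBundle_mk_eq_iff.1 h2
    have e3 := tangentBundle_mk_eq_iff.1 h3
    exact tangentBundle_mk_eq_iff.2 ⟨Prod.ext e3.1 (Prod.ext e1.1 e2.1),
      Prod.ext e3.2 (Prod.ext e1.2 e2.2)⟩

/-- Tangent vectors of the graph are the `(X • Y, X, Y)`, and with the signs of `tripleEquiv`
annihilating them all is the defining equation of the covector product. Composability of the
covectors is then automatic, by `exists_isCotangentProduct_iff`. -/
lemma mem_graphGenMul_iff {p : G × (G × G)} (hp : p ∈ 𝒢.graphMul) (c : TripleGen I p) :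
    c ∈ 𝒢.graphGenMul p ↔
      tripleEquiv I p c ∈ tangentDirac (I.prod (I.prod I)) 𝒢.graphMul p := by
  obtain ⟨k, g, h⟩ := p
  obtain ⟨hgh, rfl⟩ : 𝒢.src g = 𝒢.tgt h ∧ k = 𝒢.mul g h := hp
  obtain ⟨⟨Z, γ⟩, ⟨X, α⟩, ⟨Y, β⟩⟩ := c
  have h1 : tripleEquiv I (𝒢.mul g h, (g, h)) ((Z, γ), ((X, α), (Y, β))) ∈
      tangentDirac (I.prod (I.prod I)) 𝒢.graphMul (𝒢.mul g h, (g, h)) ↔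
      (𝒢.tangentGroupoid.src ⟨g, X⟩ = 𝒢.tangentGroupoid.tgt ⟨h, Y⟩ ∧ Z = 𝒢.tMul g h X Y) ∧
        𝒢.IsCotangentProduct g h α β γ := by
    refine and_congr 𝒢.mem_tangentTo_graphMul_iff ⟨fun H X' Y' hXY => ?_, ?_⟩
    · have h2 := H ((𝒢.tMul g h X' Y', (X', Y')) : E × (E × E))
        (𝒢.mem_tangentTo_graphMul_iff.2 ⟨hXY, rfl⟩)
      have h3 : γ (𝒢.tMul g h X' Y') - α X' - β Y' = 0 := h2
      linarith
    · rintro H ⟨Z', X', Y'⟩ hw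
      obtain ⟨h2, rfl⟩ := 𝒢.mem_tangentTo_graphMul_iff.1 hw
      have h3 := H X' Y' h2
      change γ (𝒢.tMul g h X' Y') - α X' - β Y' = 0
      linarith
  rw [h1]
  constructor
  · rintro ⟨h2, h3⟩
    have h4 : ((Z, γ) : GenTangent I (𝒢.mul g h)) = 𝒢.genMul g h (X, α) (Y, β) :=
      eq_of_heq (TotalSpace.mk.inj h3).2
    have h5 : γ = 𝒢.cMul g h α β := congrArg Prod.snd h4
    refine ⟨⟨(𝒢.genComposable_iff.1 h2).1, congrArg Prod.fst h4⟩, ?_⟩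
    rw [h5]
    exact 𝒢.isCotangentProduct_cMul h2
  · rintro ⟨⟨h2, h3⟩, h4⟩
    refine ⟨𝒢.genComposable_iff.2 ⟨h2, (𝒢.exists_isCotangentProduct_iff hgh α β).1 ⟨γ, h4⟩⟩, ?_⟩
    have h5 : ((Z, γ) : GenTangent I (𝒢.mul g h)) = 𝒢.genMul g h (X, α) (Y, β) :=
      Prod.ext h3 (𝒢.cMul_eq hgh h4).symm
    exact congrArg (TotalSpace.mk (𝒢.mul g h)) h5

/-- The graph of the multiplication of `𝕋G` is a Dirac structure with support on the graph of the
multiplication of `G`. -/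
theorem isDiracStructureOn_graphGenMul :
    (tripleCourant I G).IsDiracStructureOn 𝒢.graphMul 𝒢.graphGenMul :=
  isDiracStructureOn_tripleCourant 𝒢.isEmbeddedSubmanifold_graphMul
    fun _ hp c => 𝒢.mem_graphGenMul_iff hp c

end LieGroupoid

/-! ### The Courant bracket of sections pulled back from the factors -/

section FlatTriple

variable (E : Type*) [NormedAddCommGroup E] [NormedSpace ℝ E]

/-- The model of `tripleEquiv`. -/
def flatTriple : GenModel E × (GenModel E × GenModel E) →L[ℝ] GenModel (E × (E × E)) :=
  let p₀ := ContinuousLinearMap.fst ℝ (GenModel E) (GenModel E × GenModel E)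
  let p' := ContinuousLinearMap.snd ℝ (GenModel E) (GenModel E × GenModel E)
  let p₁ := ContinuousLinearMap.fst ℝ (GenModel E) (GenModel E) ∘L p'
  let p₂ := ContinuousLinearMap.snd ℝ (GenModel E) (GenModel E) ∘L p'
  let v := ContinuousLinearMap.fst ℝ E (E →L[ℝ] ℝ)
  let c := ContinuousLinearMap.snd ℝ E (E →L[ℝ] ℝ)
  ((v ∘L p₀).prod ((v ∘L p₁).prod (v ∘L p₂))).prod
    (ContinuousLinearMap.precomp ℝ (ContinuousLinearMap.fst ℝ E (E × E)) ∘L c ∘L p₀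
      - ContinuousLinearMap.precomp ℝ
        ((ContinuousLinearMap.fst ℝ E E).comp (ContinuousLinearMap.snd ℝ E (E × E))) ∘L c ∘L p₁
      - ContinuousLinearMap.precomp ℝ
        ((ContinuousLinearMap.snd ℝ E E).comp (ContinuousLinearMap.snd ℝ E (E × E))) ∘L c ∘L p₂)

variable {E}

lemma flatTriple_fst (v : GenModel E × (GenModel E × GenModel E)) :
    (flatTriple E v).1 = (v.1.1, (v.2.1.1, v.2.2.1)) := rfl

lemma flatTriple_snd_apply (v : GenModel E × (GenModel E × GenModel E)) (u : E × (E × E)) :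
    (flatTriple E v).2 u = v.1.2 u.1 - v.2.1.2 u.2.1 - v.2.2.2 u.2.2 := rfl

lemma fderiv_flatTriple {a₀ a₁ a₂ : E → GenModel E} {y : E × (E × E)}
    (h₀ : DifferentiableAt ℝ a₀ y.1) (h₁ : DifferentiableAt ℝ a₁ y.2.1)
    (h₂ : DifferentiableAt ℝ a₂ y.2.2) (u : E × (E × E)) :
    fderiv ℝ (fun z : E × (E × E) => flatTriple E (a₀ z.1, (a₁ z.2.1, a₂ z.2.2))) y u =
      flatTriple E (fderiv ℝ a₀ y.1 u.1, (fderiv ℝ a₁ y.2.1 u.2.1, fderiv ℝ a₂ y.2.2 u.2.2)) := by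
  have s : HasFDerivAt (fun z : E × (E × E) => z.2) (ContinuousLinearMap.snd ℝ E (E × E)) y :=
    hasFDerivAt_snd
  have h := (h₀.hasFDerivAt.comp y hasFDerivAt_fst).prodMk
    ((HasFDerivAt.comp y (g := a₁) h₁.hasFDerivAt s.fst).prodMk
      (HasFDerivAt.comp y (g := a₂) h₂.hasFDerivAt s.snd))
  have h' := (flatTriple E).hasFDerivAt.comp y h
  exact congrArg (fun L : E × (E × E) →L[ℝ] GenModel (E × (E × E)) => L u) h'.fderiv

/-- `flatTriple` is linear and each component depends on its own variable, so no cross terms arise;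
the signs survive since each term of the covector part contains exactly one covector. -/
lemma flatBracket_flatTriple {a₀ a₁ a₂ b₀ b₁ b₂ : E → GenModel E} {y : E × (E × E)}
    (ha₀ : DifferentiableAt ℝ a₀ y.1) (ha₁ : DifferentiableAt ℝ a₁ y.2.1)
    (ha₂ : DifferentiableAt ℝ a₂ y.2.2) (hb₀ : DifferentiableAt ℝ b₀ y.1)
    (hb₁ : DifferentiableAt ℝ b₁ y.2.1) (hb₂ : DifferentiableAt ℝ b₂ y.2.2) :
    flatBracket (fun z => flatTriple E (a₀ z.1, (a₁ z.2.1, a₂ z.2.2)))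
        (fun z => flatTriple E (b₀ z.1, (b₁ z.2.1, b₂ z.2.2))) y =
      flatTriple E (flatBracket a₀ b₀ y.1, (flatBracket a₁ b₁ y.2.1, flatBracket a₂ b₂ y.2.2)) := by
  have da := fderiv_flatTriple ha₀ ha₁ ha₂
  have db := fderiv_flatTriple hb₀ hb₁ hb₂
  refine Prod.ext ?_ (ContinuousLinearMap.ext fun w => ?_)
  · exact congrArg₂ (fun u v : GenModel (E × (E × E)) => u.1 - v.1) (db _) (da _)
  · rw [flatBracket_snd_apply, da, db, da]
    simp only [flatTriple_snd_apply, flatTriple_fst, flatBracket_snd_apply]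
    ring

end FlatTriple

section TripleBracket

variable {E H : Type*} [NormedAddCommGroup E] [NormedSpace ℝ E] [FiniteDimensional ℝ E]
  [TopologicalSpace H] {I : ModelWithCorners ℝ E H} [I.Boundaryless]
  {N : Type*} [TopologicalSpace N] [ChartedSpace H N] [IsManifold I ∞ N]

variable (I) in
/-- The section of `𝕋(N × N × N)` defined by three sections of `𝕋N`. -/
def tripleSection (a₀ a₁ a₂ : ∀ x : N, GenTangent I x) (p : N × (N × N)) :
    GenTangent (I.prod (I.prod I)) p :=
  tripleEquiv I p (a₀ p.1, (a₁ p.2.1, a₂ p.2.2))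

lemma mem_extChartAt_triple_target_iff {p₀ : N × (N × N)} {y : E × (E × E)} :
    y ∈ (extChartAt (I.prod (I.prod I)) p₀).target ↔ y.1 ∈ (extChartAt I p₀.1).target ∧
      y.2.1 ∈ (extChartAt I p₀.2.1).target ∧ y.2.2 ∈ (extChartAt I p₀.2.2).target := by
  rw [extChartAt_prod, extChartAt_prod]
  rfl

lemma mfderiv_extChartAt_triple_symm {p₀ : N × (N × N)} {y : E × (E × E)}
    (hy : y ∈ (extChartAt (I.prod (I.prod I)) p₀).target) (w : E × (E × E)) :
    (mfderiv 𝓘(ℝ, E × (E × E)) (I.prod (I.prod I)) (extChartAt (I.prod (I.prod I)) p₀).symm y w :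
      E × (E × E)) =
      (mfderiv 𝓘(ℝ, E) I (extChartAt I p₀.1).symm y.1 w.1,
        (mfderiv 𝓘(ℝ, E) I (extChartAt I p₀.2.1).symm y.2.1 w.2.1,
          mfderiv 𝓘(ℝ, E) I (extChartAt I p₀.2.2).symm y.2.2 w.2.2)) := by
  obtain ⟨h0, h1, h2⟩ := mem_extChartAt_triple_target_iff.1 hy
  have d : ∀ {x₀ : N} {z : E}, z ∈ (extChartAt I x₀).target →
      HasMFDerivAt 𝓘(ℝ, E) I (extChartAt I x₀).symm z
        (mfderiv 𝓘(ℝ, E) I (extChartAt I x₀).symm z) := fun hz =>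
    ((contMDiffAt_extChartAt_symm_boundaryless hz).mdifferentiableAt (by simp)).hasMFDerivAt
  have s : HasFDerivAt (fun z : E × (E × E) => z.2) (ContinuousLinearMap.snd ℝ E (E × E)) y :=
    hasFDerivAt_snd
  have s0 : HasFDerivAt (fun z : E × (E × E) => z.1) (ContinuousLinearMap.fst ℝ E (E × E)) y :=
    hasFDerivAt_fst
  have h : HasMFDerivAt 𝓘(ℝ, E × (E × E)) (I.prod (I.prod I))
      (extChartAt (I.prod (I.prod I)) p₀).symm y _ :=
    (HasMFDerivAt.comp y (g := (extChartAt I p₀.1).symm) (d h0) s0.hasMFDerivAt).prodMk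
    ((HasMFDerivAt.comp y (g := (extChartAt I p₀.2.1).symm) (d h1) s.fst.hasMFDerivAt).prodMk
      (HasMFDerivAt.comp y (g := (extChartAt I p₀.2.2).symm) (d h2) s.snd.hasMFDerivAt))
  exact congrArg (fun L : E × (E × E) →L[ℝ] E × (E × E) => L w) h.mfderiv

/-- A triple of sections in a product chart. -/
lemma genInChart_tripleSection (a₀ a₁ a₂ : ∀ x : N, GenTangent I x) {p₀ : N × (N × N)}
    {y : E × (E × E)} (hy : y ∈ (extChartAt (I.prod (I.prod I)) p₀).target) :
    genInChart (I.prod (I.prod I)) (tripleSection I a₀ a₁ a₂) p₀ y =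
      flatTriple E (genInChart I a₀ p₀.1 y.1,
        (genInChart I a₁ p₀.2.1 y.2.1, genInChart I a₂ p₀.2.2 y.2.2)) := by
  obtain ⟨h0, h1, h2⟩ := mem_extChartAt_triple_target_iff.1 hy
  have hd := mfderiv_extChartAt_triple_symm hy
  -- The vector parts are compared after the derivative of the inverse chart, which is known to be a
  -- product.
  have hinj : Function.Injective (mfderiv 𝓘(ℝ, E × (E × E)) (I.prod (I.prod I))
      (extChartAt (I.prod (I.prod I)) p₀).symm y) :=
    Function.LeftInverse.injective (g := mfderiv (I.prod (I.prod I)) 𝓘(ℝ, E × (E × E))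
      (extChartAt (I.prod (I.prod I)) p₀) ((extChartAt (I.prod (I.prod I)) p₀).symm y))
      (fun w => mfderiv_extChartAt_comp_symm hy w)
  refine Prod.ext (hinj ?_) (ContinuousLinearMap.ext fun w => ?_)
  · refine (mfderiv_symm_comp_extChartAt hy _).trans ?_
    refine Eq.trans ?_ (hd _).symm
    exact (Prod.ext (mfderiv_symm_comp_extChartAt h0 _) (Prod.ext
      (mfderiv_symm_comp_extChartAt h1 _) (mfderiv_symm_comp_extChartAt h2 _))).symm
  · refine (oneFormInChart_apply _ _ _ _).trans ?_
    refine (congrArg (fun u : E × (E × E) => (show E × (E × E) →L[ℝ] ℝ from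
      (tripleSection I a₀ a₁ a₂ ((extChartAt (I.prod (I.prod I)) p₀).symm y)).2) u) (hd w)).trans ?_
    rw [flatTriple_snd_apply]
    exact congrArg₂ (· - ·) (congrArg₂ (· - ·)
      (oneFormInChart_apply (fun z => (a₀ z).2) p₀.1 y.1 w.1).symm
      (oneFormInChart_apply (fun z => (a₁ z).2) p₀.2.1 y.2.1 w.2.1).symm)
      (oneFormInChart_apply (fun z => (a₂ z).2) p₀.2.2 y.2.2 w.2.2).symm

lemma isSmooth_tripleSection {a₀ a₁ a₂ : ∀ x : N, GenTangent I x}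
    (h₀ : (standardCourant I N).IsSmooth a₀) (h₁ : (standardCourant I N).IsSmooth a₁)
    (h₂ : (standardCourant I N).IsSmooth a₂) :
    (tripleCourant I N).IsSmooth fun p => (a₀ p.1, (a₁ p.2.1, a₂ p.2.2)) := by
  have s1 (p : N × (N × N)) : ContMDiffAt (I.prod (I.prod I)) I ∞
    (fun q : N × (N × N) => q.2.1) p := contMDiffAt_snd.fst
  have s2 (p : N × (N × N)) : ContMDiffAt (I.prod (I.prod I)) I ∞
    (fun q : N × (N × N) => q.2.2) p := contMDiffAt_snd.snd
  refine ⟨fun p _ => ?_, fun p _ => ?_, fun p _ => ?_⟩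
  · exact ((isSmooth_standardCourant_iff.1 h₀ p.1).comp p contMDiffAt_fst).contMDiffWithinAt
  · exact ((isSmooth_standardCourant_iff.1 h₁ p.2.1).comp p (s1 p)).contMDiffWithinAt
  · exact ((isSmooth_standardCourant_iff.1 h₂ p.2.2).comp p (s2 p)).contMDiffWithinAt

/-- The Courant bracket of triples of sections is componentwise. -/
theorem courantBracket_tripleSection {a₀ a₁ a₂ b₀ b₁ b₂ : ∀ x : N, GenTangent I x}
    (ha₀ : (standardCourant I N).IsSmooth a₀) (ha₁ : (standardCourant I N).IsSmooth a₁)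
    (ha₂ : (standardCourant I N).IsSmooth a₂) (hb₀ : (standardCourant I N).IsSmooth b₀)
    (hb₁ : (standardCourant I N).IsSmooth b₁) (hb₂ : (standardCourant I N).IsSmooth b₂) :
    courantBracket (I.prod (I.prod I)) (tripleSection I a₀ a₁ a₂) (tripleSection I b₀ b₁ b₂) =
      tripleSection I (courantBracket I a₀ b₀) (courantBracket I a₁ b₁)
        (courantBracket I a₂ b₂) := by
  have ha := contMDiffOn_univ.1 ((isSmoothOn_tripleCourant_iff isOpen_univ).1
    (isSmooth_tripleSection ha₀ ha₁ ha₂))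
  have hb := contMDiffOn_univ.1 ((isSmoothOn_tripleCourant_iff isOpen_univ).1
    (isSmooth_tripleSection hb₀ hb₁ hb₂))
  refine genSection_ext fun p₀ y hy => ?_
  have hev : ∀ c₀ c₁ c₂ : ∀ x : N, GenTangent I x,
      genInChart (I.prod (I.prod I)) (tripleSection I c₀ c₁ c₂) p₀ =ᶠ[𝓝 y]
        fun y => flatTriple E (genInChart I c₀ p₀.1 y.1,
          (genInChart I c₁ p₀.2.1 y.2.1, genInChart I c₂ p₀.2.2 y.2.2)) := by
    intro c₀ c₁ c₂
    filter_upwards [(isOpen_extChartAt_target (I := I.prod (I.prod I)) p₀).mem_nhds hy] with z hz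
    exact genInChart_tripleSection c₀ c₁ c₂ hz
  obtain ⟨h0, h1, h2⟩ := mem_extChartAt_triple_target_iff.1 hy
  have d : ∀ {c : ∀ x : N, GenTangent I x} {x₀ : N} {z : E}, (standardCourant I N).IsSmooth c →
      z ∈ (extChartAt I x₀).target → DifferentiableAt ℝ (genInChart I c x₀) z :=
    fun hc hz => (contDiffAt_genInChart hc hz).differentiableAt (by simp)
  refine (genInChart_courantBracket ha hb hy).trans ?_
  refine (flatBracket_congr (hev a₀ a₁ a₂) (hev b₀ b₁ b₂)).trans ?_
  rw [flatBracket_flatTriple (d ha₀ h0) (d ha₁ h1) (d ha₂ h2) (d hb₀ h0) (d hb₁ h1) (d hb₂ h2),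
    genInChart_tripleSection _ _ _ hy,
    genInChart_courantBracket (isSmooth_standardCourant_iff.1 ha₀)
      (isSmooth_standardCourant_iff.1 hb₀) h0,
    genInChart_courantBracket (isSmooth_standardCourant_iff.1 ha₁)
      (isSmooth_standardCourant_iff.1 hb₁) h1,
    genInChart_courantBracket (isSmooth_standardCourant_iff.1 ha₂)
      (isSmooth_standardCourant_iff.1 hb₂) h2]

end TripleBracket

/-! ### The bracket of related sections. -/

namespace LieGroupoid

variable {E H E' H' : Type*} [NormedAddCommGroup E] [NormedSpace ℝ E]
  [TopologicalSpace H] [NormedAddCommGroup E'] [NormedSpace ℝ E']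
  [TopologicalSpace H'] {I : ModelWithCorners ℝ E H} {I' : ModelWithCorners ℝ E' H'}
  {G M : Type*} [TopologicalSpace G] [ChartedSpace H G]
  [TopologicalSpace M] [ChartedSpace H' M]
  (𝒢 : LieGroupoid I G I' M)
  [FiniteDimensional ℝ E] [FiniteDimensional ℝ E'] [IsManifold I ∞ G] [IsManifold I' ∞ M]
  [I.Boundaryless] [I'.Boundaryless]

/-- Being related by the multiplication means that the section of the triple product built from `a`,
`a₁`, `a₂` takes values in the graph along `Q`. -/
lemma mem_graphGenMul_section_iff {a a₁ a₂ : ∀ g : G, GenTangent I g} :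
    (∀ p ∈ 𝒢.graphMul, (a p.1, (a₁ p.2.1, a₂ p.2.2)) ∈ 𝒢.graphGenMul p) ↔
      ∀ g h, 𝒢.src g = 𝒢.tgt h →
        𝒢.GenComposable g h (a₁ g) (a₂ h) ∧ 𝒢.genMul g h (a₁ g) (a₂ h) = a (𝒢.mul g h) := by
  constructor
  · intro H g h hgh
    obtain ⟨h1, h2⟩ := H (𝒢.mul g h, (g, h)) ⟨hgh, rfl⟩
    exact ⟨h1, (eq_of_heq (TotalSpace.mk.inj h2).2).symm⟩
  · rintro H ⟨k, g, h⟩ ⟨hgh, hk⟩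
    obtain rfl : k = 𝒢.mul g h := hk
    obtain ⟨h1, h2⟩ := H g h hgh
    exact ⟨h1, congrArg (TotalSpace.mk (𝒢.mul g h)) h2.symm⟩

/-- The Courant brackets of related sections are related. -/
theorem courantBracket_related {a b a₁ a₂ b₁ b₂ : ∀ g : G, GenTangent I g}
    (ha : (standardCourant I G).IsSmooth a) (hb : (standardCourant I G).IsSmooth b)
    (ha₁ : (standardCourant I G).IsSmooth a₁) (ha₂ : (standardCourant I G).IsSmooth a₂)
    (hb₁ : (standardCourant I G).IsSmooth b₁) (hb₂ : (standardCourant I G).IsSmooth b₂)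
    (hA : ∀ g h, 𝒢.src g = 𝒢.tgt h →
      𝒢.GenComposable g h (a₁ g) (a₂ h) ∧ 𝒢.genMul g h (a₁ g) (a₂ h) = a (𝒢.mul g h))
    (hB : ∀ g h, 𝒢.src g = 𝒢.tgt h →
      𝒢.GenComposable g h (b₁ g) (b₂ h) ∧ 𝒢.genMul g h (b₁ g) (b₂ h) = b (𝒢.mul g h)) :
    ∀ g h, 𝒢.src g = 𝒢.tgt h →
      𝒢.GenComposable g h (courantBracket I a₁ b₁ g) (courantBracket I a₂ b₂ h) ∧
        𝒢.genMul g h (courantBracket I a₁ b₁ g) (courantBracket I a₂ b₂ h) =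
          courantBracket I a b (𝒢.mul g h) := by
  refine 𝒢.mem_graphGenMul_section_iff.1 fun p hp => ?_
  -- Closure of the graph under the bracket, for sections pulled back from the factors, where the
  -- bracket is componentwise.
  have h := 𝒢.isDiracStructureOn_graphGenMul.bracket_mem _ _
    (isSmooth_tripleSection ha ha₁ ha₂) (isSmooth_tripleSection hb hb₁ hb₂)
    (𝒢.mem_graphGenMul_section_iff.2 hA) (𝒢.mem_graphGenMul_section_iff.2 hB) p hp
  have h' := congrFun (courantBracket_tripleSection ha ha₁ ha₂ hb hb₁ hb₂) p
  have h'' : (tripleCourant I G).bracket (fun p => (a p.1, (a₁ p.2.1, a₂ p.2.2)))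
      (fun p => (b p.1, (b₁ p.2.1, b₂ p.2.2))) p = (courantBracket I a b p.1,
        (courantBracket I a₁ b₁ p.2.1, courantBracket I a₂ b₂ p.2.2)) :=
    (congrArg (tripleEquiv I p).symm h').trans ((tripleEquiv I p).symm_apply_apply _)
  rwa [h''] at h

end LieGroupoid

end

theorem mainTheorem3 {E H E' H' G M : Type*} [NormedAddCommGroup E] [NormedSpace ℝ E]
    [FiniteDimensional ℝ E] [TopologicalSpace H] [NormedAddCommGroup E'] [NormedSpace ℝ E']
    [FiniteDimensional ℝ E'] [TopologicalSpace H'] {I : ModelWithCorners ℝ E H}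
    {I' : ModelWithCorners ℝ E' H'} [I.Boundaryless] [I'.Boundaryless]
    [TopologicalSpace G] [ChartedSpace H G] [IsManifold I ∞ G]
    [TopologicalSpace M] [ChartedSpace H' M] [IsManifold I' ∞ M] (𝒢 : LieGroupoid I G I' M) :
    -- `𝕋G ⇉ TM ⊕ A*G` is a Lie groupoid
    IsLieGroupoid (I.prod 𝓘(ℝ, GenModel E)) (I'.prod 𝓘(ℝ, LieGroupoid.BaseModel E E'))
        𝒢.genGroupoid ∧
      -- whose multiplication is linear over `G_(2)`, as for a `VB`-groupoid
      (∀ (g h : G) (a a' : GenTangent I g) (b b' : GenTangent I h) (r : ℝ),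
        𝒢.GenComposable g h a b → 𝒢.GenComposable g h a' b' →
          𝒢.genMul g h (a + r • a') (b + r • b') = 𝒢.genMul g h a b + r • 𝒢.genMul g h a' b') ∧
      -- and given on covectors by `(α ∘ β) (X • Y) = α X + β Y`
      (∀ (g h : G) (a : GenTangent I g) (b : GenTangent I h), 𝒢.GenComposable g h a b →
        𝒢.IsCotangentProduct g h a.2 b.2 (𝒢.genMul g h a b).2) ∧
      -- `𝕋G → G` is a Courant algebroid
      (standardCourant I G).IsCourantAlgebroid ∧
      -- the pairing `𝕋G ⊕ 𝕋G → ℝ` is a morphism of Lie groupoids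
      IsLieGroupoidHom (I.prod 𝓘(ℝ, GenModel E × GenModel E))
        (I'.prod 𝓘(ℝ, LieGroupoid.BaseModel E E' × LieGroupoid.BaseModel E E')) 𝓘(ℝ, ℝ)
        𝓘(ℝ, PUnit.{1}) 𝒢.genSumGroupoid realGroupoid 𝒢.genPairing (fun _ => PUnit.unit) ∧
      -- the multiplication of `𝕋G` is compatible with the anchors
      (∀ (g h : G) (a : GenTangent I g) (b : GenTangent I h), 𝒢.GenComposable g h a b →
        (((standardCourant I G).anchor g a, (standardCourant I G).anchor h b) :
            TangentSpace (I.prod I) (g, h)) ∈ tangentTo (I.prod I) 𝒢.composable (g, h) ∧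
          (standardCourant I G).anchor (𝒢.mul g h) (𝒢.genMul g h a b) =
            mfderivWithin (I.prod I) I (fun p : G × G => 𝒢.mul p.1 p.2) 𝒢.composable (g, h)
              ((standardCourant I G).anchor g a, (standardCourant I G).anchor h b)) ∧
      -- and with the Courant brackets of `m`-related sections
      (∀ a b a₁ a₂ b₁ b₂ : ∀ g : G, GenTangent I g,
        (standardCourant I G).IsSmooth a → (standardCourant I G).IsSmooth b →
        (standardCourant I G).IsSmooth a₁ → (standardCourant I G).IsSmooth a₂ →
        (standardCourant I G).IsSmooth b₁ → (standardCourant I G).IsSmooth b₂ →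
        (∀ g h, 𝒢.src g = 𝒢.tgt h →
          𝒢.GenComposable g h (a₁ g) (a₂ h) ∧ 𝒢.genMul g h (a₁ g) (a₂ h) = a (𝒢.mul g h)) →
        (∀ g h, 𝒢.src g = 𝒢.tgt h →
          𝒢.GenComposable g h (b₁ g) (b₂ h) ∧ 𝒢.genMul g h (b₁ g) (b₂ h) = b (𝒢.mul g h)) →
        ∀ g h, 𝒢.src g = 𝒢.tgt h →
          𝒢.GenComposable g h (courantBracket I a₁ b₁ g) (courantBracket I a₂ b₂ h) ∧
            𝒢.genMul g h (courantBracket I a₁ b₁ g) (courantBracket I a₂ b₂ h) =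
              courantBracket I a b (𝒢.mul g h)) ∧
      -- `graph(m_𝕋)` is a Dirac structure supported on `graph(m_G)`
      (tripleCourant I G).IsDiracStructureOn 𝒢.graphMul 𝒢.graphGenMul := by
  refine ⟨𝒢.isLieGroupoid_genGroupoid, 𝒢.genMul_smul_add,
    fun g h a b hab => 𝒢.isCotangentProduct_cMul hab, ?_, 𝒢.isLieGroupoidHom_genPairing,
    -- The tangent component of the product is `Tm` by definition, so compatibility with the anchor
    -- is definitional.
    fun g h a b hab => ⟨𝒢.mem_tangentTo_composable (𝒢.genComposable_iff.1 hab).1, rfl⟩, ?_, ?_⟩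
  · exact isCourantAlgebroid_standardCourant I G
  · exact fun a b a₁ a₂ b₁ b₂ ha hb ha₁ ha₂ hb₁ hb₂ hA hB =>
      𝒢.courantBracket_related ha hb ha₁ ha₂ hb₁ hb₂ hA hB
  · exact 𝒢.isDiracStructureOn_graphGenMul
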